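/- **Setting.** Put $I=\{t:\tfrac14\le|t|\le4\}$, $V_\delta=(-\delta,\delta)\setminus\{0\}$, and let $N\ge4$. Let $\gamma:\mathbb R\to\mathbb R$ be *smooth and non-flat near the origin*, meaning the following. * For some $\delta>0$, $\gamma\in C^N(V_\delta)$ and $\gamma'\neq0$ on $V_\delta$; moreover $\sup_{\alpha>0}\#\{j\ge0:\ |2^{-j}\gamma'(2^{-j})|\in[\alpha,2\alpha]\}<\infty$. * There are $Q\in C^N(I)$ and positive $a_j\to0$ such that for all sufficiently large $j$ and all $t\in I$ $$\frac{\gamma(2^{-j}t)}{2^{-j}\gamma'(2^{-j})}=Q(t)+Q_j(t),\qquad \|Q_j\|_{C^N(I)}\le a_j .$$ * With $J=Q'(I)$, there are $r\in C^{N-1}(J)$ and positive $a_j\to0$ such that for all sufficiently large $j$ and all $s\in J$ (with $s\,\gamma'(2^{-j})$ in the domain of $(\gamma')^{-1}$) $$\frac{(\gamma')^{-1}(s\,\gamma'(2^{-j}))}{(\gamma')^{-1}(\gamma'(2^{-j}))}=r(s)+r_j(s),\qquad \|r_j\|_{C^{N-1}(J)}\le a_j .$$ Here $(\gamma')^{-1}$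 is the inverse of $\gamma'$ on some $V_\delta$; where $\gamma'$ takes a value on both sides of $0$, the preimage in $(0,\delta)$ is taken. * For some $c>0$: $|Q''|>c$ on $I$, $|r'|>c$ on $J$, and $|s_1r'(s_1)-s_2r'(s_2)|>c\,|s_1-s_2|$ for all distinct $s_1,s_2\in J$. Assume also $\gamma'(t)\to0$ as $t\to0$, $t\ne0$. Let $D\supseteq J$ be a compact set on which $r$ is defined and on which the third condition holds with $D$ in place of $J$ (for example $D=J$). Put $R(s)=\int_1^s r(u)\,du$ for $s\in D$, with $r$ extended by $0$ off $D$. Let $\phi\in C_c^\infty(\mathbb R)$ satisfy $\operatorname{supp}\phi\subset\{\tfrac1{10}<|x|<10\}$ and $u/q\in D$ for all $u\in\operatorname{supp}\phi$, $q\in[1,2]$ (so that $R$ is defined wherever it is used below). For integers $j,m\ge1$ and $2^m\le p_0\le2^{m+1}$ set $$\phi_k(\xi)=\phi(2^{-k}\xi),\qquad \phi_{j,p_0}(\eta)=\phi\Big(\frac{\gamma'(2^{-j})\,\eta}{2^j}-p_0\Big),\qquad \psi_{m,p_0,j}(\xi)=2^{-m/2}e^{-ip_0R\left(\frac{\xi}{2^jp_0}\right)}\phi\Big(\frac{\xi}{2^{m+j}}\Big).$$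 With $\check F(x)=\frac1{2\pi}\int F(\xi)e^{i\xi x}\,d\xi$ (and the convention that a term is $0$ if $\gamma'(2^{-j})$ is zero or undefined, which is possible for finitely many $j$ only), define $$\Lambda_{j,m}(f,g,h)=\sum_{p_0=2^m}^{2^{m+1}}\int_{\mathbb R}(f*\check\phi_{m+j}*\check\psi_{m,p_0,j})(x)\,(g*\check\phi_{j,p_0})(x)\,(h*\check\phi_{j,p_0})(x)\,dx,\qquad \Lambda_m^+(f,g,h)=\sum_{j\ge1}\Lambda_{j,m}(f,g,h).$$ **Proposition.** Let $2\le p<\infty$ and $\frac1p+\frac1{p'}=1$. There is a constant $C$, depending only on $p$ and on the fixed data $\gamma,\phi,D$ (not on $m,f,g,h$), such that for every integer $m\ge1$ and all complex-valued $f\in L^p(\mathbb R)$, $g\in L^\infty(\mathbb R)$, $h\in L^{p'}(\mathbb R)$, the integrals defining $\Lambda_{j,m}(f,g,h)$ converge absolutely, the series $\sum_{j\ge1}\Lambda_{j,m}(f,g,h)$ converges absolutely, and $$|\Lambda_m^+(f,g,h)|\le C\,m^{\frac2{p'}-1}\,\|f\|_p\,\|g\|_\infty\,\|h\|_{p'}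 .$$ -/

import Mathlib

open Set Filter Topology MeasureTheory

namespace CurvedBHT

noncomputable section

/-- `F` is of class `C^k` on `S` and all its derivatives of order at most `k` are bounded by `b`
there, that is, `‖F‖_{C^k(S)} ≤ b`. -/
def CNormLE (k : ℕ) (F : ℝ → ℝ) (S : Set ℝ) (b : ℝ) : Prop :=
  ContDiffOn ℝ k F S ∧ ∀ i ≤ k, ∀ t ∈ S, |iteratedDerivWithin i F S t| ≤ b

/-- The set `I = {t : 1/4 ≤ |t| ≤ 4}`. -/
def bandI : Set ℝ := {t | 1 / 4 ≤ |t| ∧ |t| ≤ 4}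

/-- The set `J = Q'(I)`. -/
def imageJ (Q : ℝ → ℝ) : Set ℝ := derivWithin Q bandI '' bandI

/-- The punctured neighbourhood `V_δ = (-δ, δ) \ {0}`. -/
def punctured (δ : ℝ) : Set ℝ := Ioo (-δ) δ \ {0}

/-- `ι` is the inverse of `γ'`, restricted to `V_δ`: it inverts `γ'` on `(0, δ)`, and it inverts
`γ'` at those points of `(-δ, 0)` whose value is not already taken on `(0, δ)`. (If `γ'` is
injective on `V_δ`, this is its inverse on `γ'(V_δ)`; if both sides have common values, as for
`γ(t) = t^3`, this is the branch with `ι(γ'(2^{-j})) = 2^{-j}`.) -/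
def IsInverseDeriv (γ ι : ℝ → ℝ) (δ : ℝ) : Prop :=
  (∀ t ∈ Ioo 0 δ, ι (deriv γ t) = t) ∧
  ∀ t ∈ Ioo (-δ) 0, deriv γ t ∉ deriv γ '' Ioo 0 δ → ι (deriv γ t) = t

/-- The asymptotic behaviour of the inverse of `γ'` on the set `D`:
`(γ')⁻¹(s γ'(2^{-j})) / (γ')⁻¹(γ'(2^{-j})) = r(s) + r_j(s)` for `s ∈ D`, where `r` is of class
`C^{N-1}` on `D` and `‖r_j‖_{C^{N-1}(D)} ≤ a_j → 0`. -/
def DualAsymptotics (N : ℕ) (γ : ℝ → ℝ) (D : Set ℝ) (r : ℝ → ℝ) : Prop :=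
  ContDiffOn ℝ (N - 1 : ℕ) r D ∧
  ∃ δ > 0, ∃ ι : ℝ → ℝ, IsInverseDeriv γ ι δ ∧
    ∃ a : ℕ → ℝ, (∀ j, 0 < a j) ∧ Tendsto a atTop (𝓝 0) ∧
      ∀ᶠ j : ℕ in atTop,
        (∀ s ∈ D, s * deriv γ ((2 : ℝ)⁻¹ ^ j) ∈ deriv γ '' punctured δ) ∧
        CNormLE (N - 1)
          (fun s => ι (s * deriv γ ((2 : ℝ)⁻¹ ^ j)) / ι (deriv γ ((2 : ℝ)⁻¹ ^ j)) - r s) D (a j)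

/-- `γ` is smooth and non-flat near the origin, with order of smoothness `N`, with main term `Q`
in the expansion of `γ` and main term `r` in the expansion of the inverse of `γ'`. -/
structure NonFlatNearZero (N : ℕ) (γ Q r : ℝ → ℝ) : Prop where
  /-- Smoothness and absence of critical points. -/
  smooth : ∃ δ > 0, ContDiffOn ℝ N γ (punctured δ) ∧ ∀ t ∈ punctured δ, deriv γ t ≠ 0
  /-- Variation. -/
  variation : ∃ n : ℕ, ∀ α : ℝ, 0 < α →
    {j : ℕ | |(2 : ℝ)⁻¹ ^ j * deriv γ ((2 : ℝ)⁻¹ ^ j)| ∈ Icc α (2 * α)}.encard ≤ n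
  smooth_main : ContDiffOn ℝ N Q bandI
  /-- `γ(2^{-j} t) / (2^{-j} γ'(2^{-j})) = Q(t) + Q_j(t)` with `‖Q_j‖_{C^N(I)} ≤ a_j → 0`. -/
  asymptotic : ∃ a : ℕ → ℝ, (∀ j, 0 < a j) ∧ Tendsto a atTop (𝓝 0) ∧
    ∀ᶠ j : ℕ in atTop,
      CNormLE N
        (fun t => γ ((2 : ℝ)⁻¹ ^ j * t) / ((2 : ℝ)⁻¹ ^ j * deriv γ ((2 : ℝ)⁻¹ ^ j)) - Q t)
        bandI (a j)
  dual : DualAsymptotics N γ (imageJ Q) r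
  /-- Non-flatness. -/
  nonflat : ∃ c > 0,
    (∀ t ∈ bandI, c < |iteratedDerivWithin 2 Q bandI t|) ∧
    (∀ s ∈ imageJ Q, c < |derivWithin r (imageJ Q) s|) ∧
    ∀ s₁ ∈ imageJ Q, ∀ s₂ ∈ imageJ Q, s₁ ≠ s₂ →
      c < |s₁ * derivWithin r (imageJ Q) s₁ - s₂ * derivWithin r (imageJ Q) s₂| / |s₁ - s₂|

/-- `R(s) = ∫_1^s r(u) du`, where `r` is extended by zero outside its domain `D`. -/
def dualPhase (D : Set ℝ) (r : ℝ → ℝ) (s : ℝ) : ℝ := ∫ u in (1 : ℝ)..s, D.indicator r u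

/-- The inverse Fourier transform `F^∨(x) = (2π)⁻¹ ∫ F(ξ) e^{i ξ x} dξ`. -/
def invFT (F : ℝ → ℂ) (x : ℝ) : ℂ :=
  (2 * Real.pi : ℂ)⁻¹ * ∫ ξ : ℝ, F ξ * Complex.exp (Complex.I * ξ * x)

/-- Convolution of complex-valued functions on the line. -/
def conv (f k : ℝ → ℂ) : ℝ → ℂ :=
  MeasureTheory.convolution f k (ContinuousLinearMap.mul ℂ ℂ) volume

/-- `φ_k(ξ) = φ(ξ / 2^k)`. -/
def phiScale (φ : ℝ → ℂ) (k : ℕ) (ξ : ℝ) : ℂ := φ (ξ / 2 ^ k)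

/-- `φ_{j,p₀}(η) = φ(γ'(2^{-j}) η / 2^j - p₀)`. -/
def phiLoc (γ : ℝ → ℝ) (φ : ℝ → ℂ) (j p₀ : ℕ) (η : ℝ) : ℂ :=
  φ (deriv γ ((2 : ℝ)⁻¹ ^ j) * η / 2 ^ j - p₀)

/-- `ψ_{m,p₀,j}(ξ) = 2^{-m/2} e^{-i p₀ R(ξ / (2^j p₀))} φ(ξ / 2^{m+j})`. -/
def psi (R : ℝ → ℝ) (φ : ℝ → ℂ) (m p₀ j : ℕ) (ξ : ℝ) : ℂ :=
  (((2 : ℝ) ^ (-(m : ℝ) / 2) : ℝ) : ℂ) *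
    Complex.exp (-Complex.I * (p₀ * R (ξ / (2 ^ j * p₀)) : ℝ)) * φ (ξ / 2 ^ (m + j))

/-- `(f * φ_{m+j}^∨ * ψ_{m,p₀,j}^∨)(x) (g * φ_{j,p₀}^∨)(x) (h * φ_{j,p₀}^∨)(x)`. -/
def integrand (γ R : ℝ → ℝ) (φ : ℝ → ℂ) (j m p₀ : ℕ) (f g h : ℝ → ℂ) (x : ℝ) : ℂ :=
  conv (conv f (invFT (phiScale φ (m + j)))) (invFT (psi R φ m p₀ j)) x *
    conv g (invFT (phiLoc γ φ j p₀)) x * conv h (invFT (phiLoc γ φ j p₀)) x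

/-- The trilinear form `Λ_{j,m}`. -/
def lambdaPiece (γ R : ℝ → ℝ) (φ : ℝ → ℂ) (j m : ℕ) (f g h : ℝ → ℂ) : ℂ :=
  ∑ p₀ ∈ Finset.Icc (2 ^ m) (2 ^ (m + 1)), ∫ x : ℝ, integrand γ R φ j m p₀ f g h x

/-- The trilinear form `Λ_m^+ = ∑_{j ≥ 1} Λ_{j,m}`. -/
def lambdaPlus (γ R : ℝ → ℝ) (φ : ℝ → ℂ) (m : ℕ) (f g h : ℝ → ℂ) : ℂ :=
  ∑' j : ℕ+, lambdaPiece γ R φ j m f g h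

end

end CurvedBHT

/-!
Since `p' ≤ 2`, the factor `m ^ (2 / p' - 1)` is at least one, and the estimate holds without it.

*The curve.* Nonflatness makes the slopes `γ'(2^{-j})` eventually decrease geometrically
(`NonFlatNearZero.exists_slope_le`). Hence the numbers `σ_j = γ'(2^{-j}) / 2^j`, which fix the
frequency scales of `g` and `h`, are lacunary and summably small compared with `2^{-j}`. The phase
`R` has a derivative `r` that is three times differentiable, with `r' ≠ 0`, on the relevant compact
set (`exists_isPhase`); the bound from below for `r'` comes from `r` being a limit of rescaled
inverses of the Lipschitz function `γ'`.

*Large `m`.* Two integrations by parts show that the symbols `ψ_{m,p₀,0}`, `2^m ≤ p₀ ≤ 2^{m+1}`, and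
the integer translates of `φ` have Gram matrices that decay quadratically. Bessel's inequality then
bounds the sums over `p₀` of the squares of the convolutions of `f` and of `g`, at each point, by an
average of `|f_j|²`, respectively by `‖g‖_∞²`. If `32 ≤ 2^m`, the symbols acting on `h` live in
annuli, so that only the part of `h` in a lacunary annulus matters. The square functions of `f` in
`L^p` and of `h` in `L^{p'}` complete the estimate (`exists_lintegral_trilinear_le`), uniformly in
`m`.

*Small `m`.* There are finitely many pairs `(m, p₀)` left, and constants may depend on them, but
the symbols acting on `g` and `h` need not vanish at the origin. As `σ_j` is small compared with
`2^{-j}`, the operator on `g` can be moved past `f` to `h` with a summable commutator. The result is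
a square function term plus a paraproduct. The paraproduct is summed by parts: the partial sums of
the operators on `f` are bounded multipliers, and the differences of the low-pass operators on `h`
see only the frequencies of `g` between consecutive scales, which form a Carleson measure
(`exists_sum_enorm_separated_le`, `exists_enorm_sum_lowpass_le`,
`exists_lintegral_sum_sq_band_rpow_le`).

The tools are proved here as well: the maximal theorem, the Calderón–Zygmund theorem for multipliers
that satisfy Hörmander's condition, and, through Khinchine's inequality, square functions of
lacunary families.
-/

namespace CurvedBHT

open scoped ENNReal NNReal FourierTransform ComplexConjugate Real
open ENNReal (ofReal ofReal_ne_top mul_top toReal_ofReal tsum_le_tsum ofReal_mul ofReal_ofNat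
  ofReal_div_of_pos ofReal_le_ofReal ofReal_toReal rpow_one rpow_mul rpow_add_of_nonneg
  mul_rpow_of_nonneg ofReal_rpow_of_pos ofReal_one add_lt_top mul_lt_top ofReal_lt_top coe_lt_top
  rpow_le_rpow rpow_ne_top_of_nonneg rpow_natCast rpow_lt_top_of_nonneg coe_ne_top ofReal_pow
  lintegral_mul_le_Lp_mul_Lq rpow_ofNat ofReal_add mul_ne_top ofReal_sum_of_nonneg coe_le_coe
  coe_toNNReal coe_mul ofNNReal_toNNReal coe_add)
open Finset (mem_insert_self aemeasurable_fun_sum sum_congr mul_sum sum_add_distrib sum_le_sum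
  sum_mul sum_nonneg sum_div sum_le_card_nsmul single_le_sum mem_filter sum_coe_sort
  sum_range_add)
open Complex (exp I real_smul norm_real ofRealCLM norm_I exp_add continuous_conj mul_conj
  normSq_nonneg conj_conj conj_ofReal)
open Real (volume_Ioo norm_eq_abs pi_pos norm_of_nonneg)

/-! ### The Hardy–Littlewood maximal function on the line -/

/-- The uncentred maximal function: the supremum of the averages of `F` over the bounded open
intervals that contain `x`. -/
noncomputable def maxFn (F : ℝ → ℝ≥0∞) (x : ℝ) : ℝ≥0∞ :=
  ⨆ (a : ℝ) (b : ℝ) (_ : x ∈ Ioo a b), (∫⁻ y in Ioo a b, F y) / ofReal (b - a)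

lemma average_le_maxFn (F : ℝ → ℝ≥0∞) {a b x : ℝ} (hx : x ∈ Ioo a b) :
    (∫⁻ y in Ioo a b, F y) / ofReal (b - a) ≤ maxFn F x :=
  le_iSup_of_le a (le_iSup_of_le b (le_iSup_of_le hx le_rfl))

lemma lintegral_Ioo_le_maxFn (F : ℝ → ℝ≥0∞) {a b x : ℝ} (hx : x ∈ Ioo a b) :
    (∫⁻ y in Ioo a b, F y) ≤ ofReal (b - a) * maxFn F x := by
  have hab : 0 < b - a := by linarith [hx.1, hx.2]
  have := average_le_maxFn F hx
  rwa [ENNReal.div_le_iff (by simpa using hab) ofReal_ne_top, mul_comm] at this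

lemma maxFn_mono {F G : ℝ → ℝ≥0∞} (h : ∀ x, F x ≤ G x) (x : ℝ) : maxFn F x ≤ maxFn G x := by
  unfold maxFn
  gcongr with a b hx y
  exact h y

lemma lt_maxFn_iff {F : ℝ → ℝ≥0∞} {x : ℝ} {l : ℝ≥0∞} : l < maxFn F x ↔
    ∃ a b : ℝ, x ∈ Ioo a b ∧ l < (∫⁻ y in Ioo a b, F y) / ofReal (b - a) := by
  simp only [maxFn, lt_iSup_iff, exists_prop]

lemma isOpen_lt_maxFn (F : ℝ → ℝ≥0∞) (l : ℝ≥0∞) : IsOpen {x | l < maxFn F x} := by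
  rw [isOpen_iff_mem_nhds]
  intro x hx
  obtain ⟨a, b, hab, h⟩ := lt_maxFn_iff.1 hx
  filter_upwards [isOpen_Ioo.mem_nhds hab] with y hy
  exact lt_maxFn_iff.2 ⟨a, b, hy, h⟩

@[fun_prop]
lemma measurable_maxFn (F : ℝ → ℝ≥0∞) : Measurable (maxFn F) :=
  measurable_of_Ioi fun l => (isOpen_lt_maxFn F l).measurableSet

/-- The weak type `(1, 1)` inequality, by Vitali's covering lemma. -/
lemma volume_lt_maxFn_le (F : ℝ → ℝ≥0∞) {l : ℝ≥0∞} (hl : l ≠ 0) (hl' : l ≠ ∞) :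
    volume {x | l < maxFn F x} ≤ 4 * (∫⁻ y, F y) / l := by
  by_cases hF : ∫⁻ y, F y = ∞
  · rw [hF, mul_top (by norm_num), ENNReal.top_div_of_ne_top hl']
    exact le_top
  set t : Set (ℝ × ℝ) := {p | p.1 < p.2 ∧
    l < (∫⁻ y in Ioo p.1 p.2, F y) / ofReal (p.2 - p.1)} with ht
  have hlen : ∀ p ∈ t, ofReal (p.2 - p.1) ≤ (∫⁻ y in Ioo p.1 p.2, F y) / l := by
    rintro p ⟨hp, h⟩
    rw [ENNReal.le_div_iff_mul_le (Or.inl hl) (Or.inl hl'), mul_comm]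
    rw [ENNReal.lt_div_iff_mul_lt (Or.inl (by simpa using hp)) (Or.inl ofReal_ne_top)] at h
    exact h.le
  set R : ℝ := ((∫⁻ y, F y) / l).toReal
  have hfin : (∫⁻ y, F y) / l ≠ ∞ := ENNReal.div_ne_top hF hl
  have hR : ∀ p ∈ t, (p.2 - p.1) / 2 ≤ R := by
    intro p hp
    have h1 : ofReal (p.2 - p.1) ≤ (∫⁻ y, F y) / l :=
      (hlen p hp).trans (by gcongr; exact Measure.restrict_le_self)
    have h2 := ENNReal.toReal_mono hfin h1
    rw [toReal_ofReal (by linarith [hp.1])] at h2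
    have := hp.1
    change _ ≤ R at h2
    linarith
  obtain ⟨u, hut, hdisj, hcov⟩ := Vitali.exists_disjoint_subfamily_covering_enlargement_closedBall
    t (fun p => (p.1 + p.2) / 2) (fun p => (p.2 - p.1) / 2) R hR 4 (by norm_num)
  have hball : ∀ p : ℝ × ℝ, Metric.closedBall ((p.1 + p.2) / 2) ((p.2 - p.1) / 2)
      = Icc p.1 p.2 := by
    intro p
    rw [Real.closedBall_eq_Icc]
    congr 1 <;> ring
  have hdisj' : u.PairwiseDisjoint fun p => Ioo p.1 p.2 := by
    intro p hp q hq hpq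
    have := hdisj hp hq hpq
    simp only [Function.onFun, hball] at this ⊢
    exact this.mono Ioo_subset_Icc_self Ioo_subset_Icc_self
  have hcount : u.Countable := hdisj'.countable_of_isOpen (fun p _ => isOpen_Ioo)
    (fun p hp => nonempty_Ioo.2 (hut hp).1)
  have hsub : {x | l < maxFn F x} ⊆
      ⋃ p ∈ u, Metric.closedBall ((p.1 + p.2) / 2) (4 * ((p.2 - p.1) / 2)) := by
    intro x hx
    obtain ⟨a, b, hab, h⟩ := lt_maxFn_iff.1 hx
    obtain ⟨p, hp, hsub⟩ := hcov (a, b) ⟨hab.1.trans hab.2, h⟩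
    refine mem_biUnion hp (hsub ?_)
    rw [hball]
    exact Ioo_subset_Icc_self hab
  calc volume {x | l < maxFn F x}
      ≤ volume (⋃ p ∈ u, Metric.closedBall ((p.1 + p.2) / 2) (4 * ((p.2 - p.1) / 2))) :=
        measure_mono hsub
    _ ≤ ∑' p : u, volume (Metric.closedBall ((p.1.1 + p.1.2) / 2) (4 * ((p.1.2 - p.1.1) / 2))) :=
        measure_biUnion_le _ hcount _
    _ ≤ ∑' p : u, 4 * (∫⁻ y in Ioo p.1.1 p.1.2, F y) / l := by
        refine tsum_le_tsum fun p => ?_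
        rw [Real.volume_closedBall, show 2 * (4 * ((p.1.2 - p.1.1) / 2)) = 4 * (p.1.2 - p.1.1) by
          ring, ofReal_mul (by norm_num), mul_div_assoc]
        have := hlen p.1 (hut p.2)
        simp only [ofReal_ofNat]
        gcongr
    _ = 4 * (∫⁻ y in ⋃ p ∈ u, Ioo p.1 p.2, F y) / l := by
        rw [lintegral_biUnion hcount (fun p _ => measurableSet_Ioo) hdisj']
        simp only [div_eq_mul_inv]
        rw [ENNReal.tsum_mul_right, ENNReal.tsum_mul_left]
    _ ≤ 4 * (∫⁻ y, F y) / l := by gcongr; exact Measure.restrict_le_self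

lemma maxFn_const_le (c : ℝ≥0∞) (x : ℝ) : maxFn (fun _ => c) x ≤ c := by
  refine iSup_le fun a => iSup_le fun b => iSup_le fun h => ?_
  simp only [lintegral_const, MeasurableSet.univ, Measure.restrict_apply, univ_inter,
    volume_Ioo]
  rw [ENNReal.mul_div_cancel_right (by simpa using h.1.trans h.2) ofReal_ne_top]

lemma maxFn_add_le {F G : ℝ → ℝ≥0∞} (hF : Measurable F) (x : ℝ) :
    maxFn (fun y => F y + G y) x ≤ maxFn F x + maxFn G x := by
  refine iSup_le fun a => iSup_le fun b => iSup_le fun h => ?_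
  rw [lintegral_add_left hF, ENNReal.add_div]
  exact add_le_add (average_le_maxFn F h) (average_le_maxFn G h)

/-- Only the part of `F` above height `l` contributes to the set where `maxFn F` exceeds `2 l`. -/
lemma volume_lt_maxFn_le_truncated {F : ℝ → ℝ≥0∞} (hF : Measurable F) {l : ℝ≥0∞} (hl : l ≠ 0)
    (hl' : l ≠ ∞) :
    volume {x | 2 * l < maxFn F x} ≤ 4 * (∫⁻ y, {y | l < F y}.indicator F y) / l := by
  refine (measure_mono fun x hx => ?_).trans
    (volume_lt_maxFn_le ({y | l < F y}.indicator F) hl hl')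
  simp only [mem_ofPred_eq] at hx ⊢
  have hm : Measurable ({y | l < F y}.indicator F) :=
    hF.indicator (measurableSet_lt measurable_const hF)
  have h1 : maxFn F x ≤ maxFn ({y | l < F y}.indicator F) x + l := by
    refine (maxFn_mono (G := fun y => {y | l < F y}.indicator F y + l) (fun y => ?_) x).trans
      ((maxFn_add_le hm x).trans (by gcongr; exact maxFn_const_le l x))
    by_cases h : l < F y
    · rw [indicator_of_mem (by exact h)]; exact le_self_add
    · rw [indicator_of_notMem (by exact h), zero_add]; exact not_lt.1 h
  have h2 := hx.trans_le h1
  rw [two_mul] at h2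
  exact (ENNReal.add_lt_add_iff_right hl').1 h2

/-- The layer cake formula. -/
lemma lintegral_rpow_eq_lintegral_meas_lt {μ : Measure ℝ} {G : ℝ → ℝ≥0∞} (hG : AEMeasurable G μ)
    {q : ℝ} (hq : 0 < q) : ∫⁻ x, G x ^ q ∂μ = ofReal q * ∫⁻ t in Ioi (0 : ℝ),
      μ {x | ofReal t < G x} * ofReal (t ^ (q - 1)) := by
  by_cases h : μ {x | G x = ∞} = 0
  · have h' : ∀ᵐ x ∂μ, G x ≠ ∞ := by simpa [ae_iff] using h
    rw [lintegral_congr_ae (h'.mono fun x hx => by rw [← ofReal_toReal hx,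
      ENNReal.ofReal_rpow_of_nonneg ENNReal.toReal_nonneg hq.le]),
      lintegral_rpow_eq_lintegral_meas_lt_mul μ (ae_of_all _ fun _ => ENNReal.toReal_nonneg)
        hG.ennreal_toReal hq]
    refine congrArg _ (setLIntegral_congr_fun measurableSet_Ioi fun t ht => congrArg (· * _) ?_)
    exact measure_congr (h'.mono fun x hx =>
      propext (ENNReal.ofReal_lt_iff_lt_toReal (le_of_lt ht) hx).symm)
  · rw [lintegral_eq_top_of_measure_eq_top_ne_zero (hG.pow_const q) (by simpa [hq, hq.not_gt])]
    have h1 : ∫⁻ t in Ioi (0 : ℝ), ofReal (t ^ (q - 1)) = ∞ := by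
      by_contra h1
      refine not_integrableOn_Ioi_rpow (q - 1) ((lintegral_ofReal_ne_top_iff_integrable
        (by fun_prop) ?_).1 h1)
      filter_upwards [ae_restrict_mem measurableSet_Ioi] with t ht
      exact Real.rpow_nonneg (le_of_lt ht) _
    refine (top_le_iff.1 ?_).symm
    calc ∞ = ofReal q * ∫⁻ t in Ioi (0 : ℝ), μ {x | G x = ∞} * ofReal (t ^ (q - 1)) := by
          rw [lintegral_const_mul _ (by fun_prop), h1, ENNReal.mul_top h, mul_top (by simpa)]
      _ ≤ _ := by gcongr with t x; exact fun hx => by simp [hx]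

/-- The maximal theorem on `L^q`, `1 < q`. -/
lemma exists_lintegral_maxFn_rpow_le {q : ℝ} (hq : 1 < q) :
    ∃ C : ℝ≥0, ∀ F : ℝ → ℝ≥0∞, Measurable F →
      ∫⁻ x, maxFn F x ^ q ≤ C * ∫⁻ x, F x ^ q := by
  refine ⟨(ofReal q * (8 * ((ofReal (q - 1))⁻¹ * 2 ^ (q - 1)))).toNNReal, fun F hF => ?_⟩
  have hq0 : 0 < q := by linarith
  have hq1 : 0 < q - 1 := by linarith
  rw [lintegral_rpow_eq_lintegral_meas_lt (measurable_maxFn F).aemeasurable hq0]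
  set μ := volume.withDensity F
  calc ofReal q * ∫⁻ t in Ioi (0 : ℝ), volume {x | ofReal t < maxFn F x} * ofReal (t ^ (q - 1))
      ≤ ofReal q * ∫⁻ t in Ioi (0 : ℝ),
          8 * (μ {x | ofReal t < 2 * F x} * ofReal (t ^ (q - 1 - 1))) := by
        gcongr ofReal q * ?_
        refine setLIntegral_mono' measurableSet_Ioi fun t (ht : 0 < t) => ?_
        have h2 : ofReal t = 2 * ofReal (t / 2) := by
          rw [← ofReal_ofNat 2, ← ofReal_mul (by norm_num)]; congr 1; ring
        have hl : ofReal (t / 2) ≠ 0 := by simpa using ht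
        have h4 : {x | ofReal t < 2 * F x} = {x | ofReal (t / 2) < F x} := by
          ext x
          rw [mem_ofPred_eq, h2, ENNReal.mul_lt_mul_iff_right (by norm_num) (by norm_num)]; rfl
        have hms := measurableSet_lt (measurable_const (a := ofReal (t / 2))) hF
        have hw := volume_lt_maxFn_le_truncated hF hl ofReal_ne_top
        rw [← h2, lintegral_indicator hms, ← withDensity_apply F hms] at hw
        rw [h4]
        refine (mul_le_mul_left hw _).trans (le_of_eq ?_)
        have h3 : ofReal (t ^ (q - 1)) = 2 * ofReal (t / 2) * ofReal (t ^ (q - 1 - 1)) := by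
          rw [← h2, ← ofReal_mul ht.le, Real.rpow_sub_one ht.ne' (q - 1)]
          congr 1
          field_simp
        rw [h3, show 2 * ofReal (t / 2) * ofReal (t ^ (q - 1 - 1)) =
          ofReal (t / 2) * (2 * ofReal (t ^ (q - 1 - 1))) by ring, ← mul_assoc,
          ENNReal.div_mul_cancel hl ofReal_ne_top]
        change 4 * μ _ * _ = _
        ring
    _ = _ := by
        have h := lintegral_rpow_eq_lintegral_meas_lt (μ := μ) (hF.const_mul 2).aemeasurable hq1
        have h5 : ∀ y, (F * fun y => (2 * F y) ^ (q - 1)) y = 2 ^ (q - 1) * F y ^ q := fun y => by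
          rw [← add_sub_cancel 1 q, rpow_add_of_nonneg _ _ one_pos.le hq1.le, rpow_one,
            add_sub_cancel_left, Pi.mul_apply, mul_rpow_of_nonneg _ _ hq1.le]
          ring
        rw [lintegral_withDensity_eq_lintegral_mul _ hF (by fun_prop), lintegral_congr h5,
          lintegral_const_mul _ (by fun_prop)] at h
        rw [coe_toNNReal (by finiteness [sub_pos.2 hq]), lintegral_const_mul' _ _ (by norm_num),
          mul_assoc, mul_assoc, mul_assoc, h, ENNReal.inv_mul_cancel_left (by simpa) (by simp)]

/-- Averages against the Cauchy kernel `t / (t ^ 2 + u ^ 2)`. -/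
noncomputable def cauchyAvg (t : ℝ) (F : ℝ → ℝ≥0∞) (x : ℝ) : ℝ≥0∞ :=
  ∫⁻ y, ofReal (t / (t ^ 2 + (x - y) ^ 2)) * F y

lemma cauchyAvg_le_maxFn {t : ℝ} (ht : 0 < t) {F : ℝ → ℝ≥0∞} (hF : Measurable F) (x : ℝ) :
    cauchyAvg t F x ≤ 16 * maxFn F x := by
  -- dyadic decomposition of the kernel
  have hker : ∀ y, ofReal (t / (t ^ 2 + (x - y) ^ 2)) ≤
      ∑' n : ℕ, ofReal (4 * (1 / 4) ^ n / t) *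
        (Ioo (x - 2 ^ n * t) (x + 2 ^ n * t)).indicator 1 y := by
    intro y
    set u := |x - y| with hu
    have hex : ∃ n : ℕ, u < 2 ^ n * t := by
      obtain ⟨n, hn⟩ := pow_unbounded_of_one_lt (u / t) (one_lt_two)
      exact ⟨n, by rwa [div_lt_iff₀ ht] at hn⟩
    classical
    set n := Nat.find hex
    have hn : u < 2 ^ n * t := Nat.find_spec hex
    refine le_trans ?_ (ENNReal.le_tsum n)
    have hmem : y ∈ Ioo (x - 2 ^ n * t) (x + 2 ^ n * t) := by
      have := abs_lt.1 hn
      constructor <;> linarith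
    rw [indicator_of_mem hmem, Pi.one_apply, mul_one]
    refine ofReal_le_ofReal ?_
    rw [← sq_abs (x - y), ← hu]
    have hu0 : 0 ≤ u := abs_nonneg _
    rcases Nat.eq_zero_or_pos n with h0 | h0
    · rw [h0, pow_zero, mul_one, div_le_div_iff₀ (by positivity) ht]
      nlinarith [sq_nonneg u, sq_nonneg t]
    · have h1 : 2 ^ (n - 1) * t ≤ u := not_lt.1 (Nat.find_min hex (Nat.sub_lt h0 one_pos))
      obtain ⟨k, hk⟩ : ∃ k, n = k + 1 := ⟨n - 1, by omega⟩
      rw [hk] at h1 ⊢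
      rw [Nat.add_sub_cancel] at h1
      have h2 : (2 ^ k * t) ^ 2 ≤ u ^ 2 := pow_le_pow_left₀ (by positivity) h1 2
      rw [pow_succ ((1 : ℝ) / 4) k, div_le_div_iff₀ (by positivity) ht]
      have h4 : ((1 : ℝ) / 4) ^ k * (2 ^ k) ^ 2 = 1 := by
        rw [← pow_mul, mul_comm k 2, pow_mul, ← mul_pow]; norm_num
      have h5 : (0 : ℝ) ≤ (1 / 4) ^ k := by positivity
      have h6 : ((1 : ℝ) / 4) ^ k * (2 ^ k * t) ^ 2 = t ^ 2 := by
        rw [mul_pow, ← mul_assoc, h4, one_mul]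
      have h7 := mul_le_mul_of_nonneg_left h2 h5
      have h8 := mul_nonneg h5 (sq_nonneg t)
      rw [h6] at h7
      linarith
  calc cauchyAvg t F x
      ≤ ∫⁻ y, ∑' n : ℕ, ofReal (4 * (1 / 4) ^ n / t) *
        (Ioo (x - 2 ^ n * t) (x + 2 ^ n * t)).indicator F y := by
        refine lintegral_mono fun y => (mul_le_mul_left (hker y) _).trans (le_of_eq ?_)
        rw [← ENNReal.tsum_mul_right]
        congr 1; ext n
        by_cases h : y ∈ Ioo (x - 2 ^ n * t) (x + 2 ^ n * t) <;> simp [h]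
    _ = ∑' n : ℕ, ofReal (4 * (1 / 4) ^ n / t) *
        ∫⁻ y in Ioo (x - 2 ^ n * t) (x + 2 ^ n * t), F y := by
        rw [lintegral_tsum fun n => ((hF.indicator measurableSet_Ioo).const_mul _).aemeasurable]
        congr 1; ext n
        rw [lintegral_const_mul' _ _ ofReal_ne_top, lintegral_indicator measurableSet_Ioo]
    _ ≤ ∑' n : ℕ, ofReal (8 * (1 / 2) ^ n) * maxFn F x := by
        refine tsum_le_tsum fun n => ?_
        have hx : x ∈ Ioo (x - 2 ^ n * t) (x + 2 ^ n * t) := by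
          have : 0 < 2 ^ n * t := by positivity
          constructor <;> linarith
        refine (mul_le_mul_right (lintegral_Ioo_le_maxFn F hx) _).trans (le_of_eq ?_)
        rw [← mul_assoc, ← ofReal_mul (by positivity)]
        congr 2
        rw [show ((1 : ℝ) / 4) ^ n = (1 / 2) ^ n * (1 / 2) ^ n by rw [← mul_pow]; norm_num]
        have : ((1 : ℝ) / 2) ^ n * 2 ^ n = 1 := by rw [← mul_pow]; norm_num
        field_simp
        linear_combination (8 : ℝ) * t * this
    _ = 16 * maxFn F x := by
        rw [ENNReal.tsum_mul_right, ← ENNReal.ofReal_tsum_of_nonneg (fun n => by positivity)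
          (summable_geometric_two.mul_left 8), tsum_mul_left, tsum_geometric_two]
        norm_num

lemma ae_enorm_le_maxFn {E : Type*} [NormedAddCommGroup E] {f : ℝ → E}
    (hf : LocallyIntegrable f volume) : ∀ᵐ x, ‖f x‖ₑ ≤ maxFn (fun y => ‖f y‖ₑ) x := by
  filter_upwards [IsUnifLocDoublingMeasure.ae_tendsto_average volume
    (f := fun x => ‖f x‖) (fun x => (hf x).norm) 1] with x hx
  have h := hx (l := 𝓝[>] (0 : ℝ)) (fun _ => x) id tendsto_id (by
    filter_upwards [self_mem_nhdsWithin] with d hd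
    have : (0 : ℝ) < d := hd
    simpa using this.le)
  have h' := (ENNReal.continuous_ofReal.tendsto _).comp h
  rw [ofReal_norm] at h'
  refine le_of_tendsto h' ?_
  filter_upwards [self_mem_nhdsWithin] with d hd
  have hd0 : (0 : ℝ) < d := hd
  simp only [Function.comp, id]
  rw [setAverage_eq, smul_eq_mul, ofReal_mul (by positivity),
    ofReal_integral_norm_eq_lintegral_enorm, Real.closedBall_eq_Icc]
  · rw [setLIntegral_congr Ioo_ae_eq_Icc.symm]
    refine le_trans (le_of_eq ?_) (average_le_maxFn _ (a := x - d) (b := x + d)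
      ⟨by linarith, by linarith⟩)
    rw [ENNReal.div_eq_inv_mul, Measure.real, Real.volume_Icc, toReal_ofReal (by linarith),
      ENNReal.ofReal_inv_of_pos (by linarith)]
  · exact hf.integrableOn_isCompact (isCompact_closedBall _ _)

/-! ### The Calderón–Zygmund decomposition -/

/-- The left end point of the component of `x` in the open set `U`. -/
noncomputable def leftEnd (U : Set ℝ) (x : ℝ) : ℝ := sSup (Iic x ∩ Uᶜ)

/-- The right end point of the component of `x` in the open set `U`. -/
noncomputable def rightEnd (U : Set ℝ) (x : ℝ) : ℝ := sInf (Ici x ∩ Uᶜ)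

/-- The components of an open set `U` of finite measure, each given by its end points. -/
def components (U : Set ℝ) : Set (ℝ × ℝ) :=
  {p | p.1 < p.2 ∧ Ioo p.1 p.2 ⊆ U ∧ p.1 ∉ U ∧ p.2 ∉ U}

section components

variable {U : Set ℝ}

lemma nonempty_Iic_inter_compl (hU : volume U ≠ ∞) (x : ℝ) : (Iic x ∩ Uᶜ).Nonempty := by
  by_contra h
  rw [not_nonempty_iff_eq_empty, ← disjoint_iff_inter_eq_empty, disjoint_compl_right_iff] at h
  exact hU (top_le_iff.1 (Real.volume_Iic (a := x) ▸ measure_mono h))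

lemma nonempty_Ici_inter_compl (hU : volume U ≠ ∞) (x : ℝ) : (Ici x ∩ Uᶜ).Nonempty := by
  by_contra h
  rw [not_nonempty_iff_eq_empty, ← disjoint_iff_inter_eq_empty, disjoint_compl_right_iff] at h
  exact hU (top_le_iff.1 (Real.volume_Ici (a := x) ▸ measure_mono h))

lemma monotone_leftEnd (hU : volume U ≠ ∞) : Monotone (leftEnd U) := fun x _ hxy =>
  csSup_le_csSup ⟨_, fun _ h => h.1⟩ (nonempty_Iic_inter_compl hU x)
    (inter_subset_inter_left _ (Iic_subset_Iic.2 hxy))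

lemma monotone_rightEnd (hU : volume U ≠ ∞) : Monotone (rightEnd U) := fun _ y hxy =>
  csInf_le_csInf ⟨_, fun _ h => h.1⟩ (nonempty_Ici_inter_compl hU y)
    (inter_subset_inter_left _ (Ici_subset_Ici.2 hxy))

lemma ends_mem_components (ho : IsOpen U) (hU : volume U ≠ ∞) {x : ℝ} (hx : x ∈ U) :
    (leftEnd U x, rightEnd U x) ∈ components U ∧ x ∈ Ioo (leftEnd U x) (rightEnd U x) := by
  have hl : leftEnd U x ∈ Iic x ∩ Uᶜ :=
    (isClosed_Iic.inter ho.isClosed_compl).csSup_mem (nonempty_Iic_inter_compl hU x)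
      ⟨x, fun _ h => h.1⟩
  have hr : rightEnd U x ∈ Ici x ∩ Uᶜ :=
    (isClosed_Ici.inter ho.isClosed_compl).csInf_mem (nonempty_Ici_inter_compl hU x)
      ⟨x, fun _ h => h.1⟩
  have hlx : leftEnd U x < x := lt_of_le_of_ne hl.1 fun h => hl.2 (by rwa [h])
  have hrx : x < rightEnd U x := lt_of_le_of_ne hr.1 fun h => hr.2 (by rwa [← h])
  refine ⟨⟨hlx.trans hrx, fun y hy => ?_, hl.2, hr.2⟩, hlx, hrx⟩
  by_contra hyU
  rcases le_total y x with h | h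
  · exact absurd hy.1 (not_lt.2 (le_csSup ⟨x, fun _ h => h.1⟩ ⟨h, hyU⟩))
  · exact absurd hy.2 (not_lt.2 (csInf_le ⟨x, fun _ h => h.1⟩ ⟨h, hyU⟩))

lemma eq_of_mem_components {p p' : ℝ × ℝ} (hp : p ∈ components U) (hp' : p' ∈ components U)
    {z : ℝ} (hz : z ∈ Ioo p.1 p.2) (hz' : z ∈ Ioo p'.1 p'.2) : p = p' := by
  refine Prod.ext (le_antisymm ?_ ?_) (le_antisymm ?_ ?_) <;> by_contra! h
  · exact hp.2.2.1 (hp'.2.1 ⟨h, hz.1.trans hz'.2⟩)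
  · exact hp'.2.2.1 (hp.2.1 ⟨h, hz'.1.trans hz.2⟩)
  · exact hp'.2.2.2 (hp.2.1 ⟨hz.1.trans hz'.2, h⟩)
  · exact hp.2.2.2 (hp'.2.1 ⟨hz'.1.trans hz.2, h⟩)

lemma ends_eq (ho : IsOpen U) (hU : volume U ≠ ∞) {p : ℝ × ℝ} (hp : p ∈ components U) {x : ℝ}
    (hx : x ∈ Ioo p.1 p.2) : leftEnd U x = p.1 ∧ rightEnd U x = p.2 := by
  have h := ends_mem_components ho hU (hp.2.1 hx)
  have := eq_of_mem_components h.1 hp h.2 hx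
  exact ⟨congrArg Prod.fst this, congrArg Prod.snd this⟩

lemma pairwise_disjoint_components :
    Pairwise (Function.onFun Disjoint fun p : components U => Ioo p.1.1 p.1.2) := by
  intro p p' hne
  rw [Function.onFun, Set.disjoint_left]
  intro z hz hz'
  exact hne (Subtype.ext (eq_of_mem_components p.2 p'.2 hz hz'))

instance countable_components : Countable (components U) :=
  pairwise_disjoint_components.countable_of_isOpen_disjoint (fun _ => isOpen_Ioo)
    fun p => nonempty_Ioo.2 p.2.1

lemma iUnion_components (ho : IsOpen U) (hU : volume U ≠ ∞) :
    ⋃ p : components U, Ioo p.1.1 p.1.2 = U := by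
  refine subset_antisymm (iUnion_subset fun p => p.2.2.1) fun x hx => ?_
  have h := ends_mem_components ho hU hx
  exact mem_iUnion.2 ⟨⟨_, h.1⟩, h.2⟩

end components

/-- On a component of `{l < maxFn F}` the average of `F` is at most `l`, because the end points lie
outside that set. -/
lemma lintegral_component_le {F : ℝ → ℝ≥0∞} {l : ℝ≥0∞} {p : ℝ × ℝ}
    (hp : p ∈ components {x | l < maxFn F x}) :
    ∫⁻ y in Ioo p.1 p.2, F y ≤ ofReal (p.2 - p.1) * l := by
  have h1 : maxFn F p.1 ≤ l := not_lt.1 hp.2.2.1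
  have hlim : Tendsto (fun e : ℝ => ofReal (p.2 - p.1 + e) * l) (𝓝[>] 0)
      (𝓝 (ofReal (p.2 - p.1) * l)) := by
    refine ENNReal.Tendsto.mul_const ?_ (Or.inl (by simpa using hp.1))
    refine (ENNReal.continuous_ofReal.tendsto _).comp ?_
    have : Tendsto (fun e : ℝ => p.2 - p.1 + e) (𝓝 0) (𝓝 (p.2 - p.1 + 0)) :=
      tendsto_const_nhds.add tendsto_id
    rw [add_zero] at this
    exact this.mono_left nhdsWithin_le_nhds
  refine ge_of_tendsto hlim ?_
  filter_upwards [self_mem_nhdsWithin] with e he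
  have he0 : (0 : ℝ) < e := he
  calc ∫⁻ y in Ioo p.1 p.2, F y ≤ ∫⁻ y in Ioo (p.1 - e) p.2, F y :=
        lintegral_mono_set (Ioo_subset_Ioo_left (by linarith))
    _ ≤ ofReal (p.2 - (p.1 - e)) * maxFn F p.1 :=
        lintegral_Ioo_le_maxFn F ⟨by linarith, hp.1⟩
    _ ≤ _ := by
        rw [show p.2 - (p.1 - e) = p.2 - p.1 + e by ring]
        gcongr

lemma lintegral_lt_maxFn_le {F : ℝ → ℝ≥0∞} {l : ℝ≥0∞}
    (hU : volume {x | l < maxFn F x} ≠ ∞) :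
    ∫⁻ y in {x | l < maxFn F x}, F y ≤ l * volume {x | l < maxFn F x} := by
  have ho := isOpen_lt_maxFn F l
  set U := {x | l < maxFn F x} with hUdef
  calc ∫⁻ y in U, F y = ∑' p : components U, ∫⁻ y in Ioo p.1.1 p.1.2, F y := by
        conv_lhs => rw [← iUnion_components ho hU]
        rw [lintegral_iUnion (fun _ => measurableSet_Ioo) pairwise_disjoint_components]
    _ ≤ ∑' p : components U, l * volume (Ioo p.1.1 p.1.2) := by
        refine tsum_le_tsum fun p => (lintegral_component_le p.2).trans (le_of_eq ?_)
        rw [volume_Ioo, mul_comm]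
    _ = l * volume U := by
        rw [ENNReal.tsum_mul_left,
          ← measure_iUnion pairwise_disjoint_components (fun _ => measurableSet_Ioo),
          iUnion_components ho hU]

section good

variable {E : Type*} [NormedAddCommGroup E] [NormedSpace ℂ E]

open Classical in
/-- The good part of the Calderón–Zygmund decomposition of `f` with exceptional set `U`: the
function `f` outside `U`, and its average over the component inside `U`. -/
noncomputable def goodPart (U : Set ℝ) (f : ℝ → E) (x : ℝ) : E :=
  if x ∈ U then ⨍ y in Ioo (leftEnd U x) (rightEnd U x), f y else f x

lemma goodPart_of_mem {U : Set ℝ} (ho : IsOpen U) (hU : volume U ≠ ∞) (f : ℝ → E) {p : ℝ × ℝ}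
    (hp : p ∈ components U) {x : ℝ} (hx : x ∈ Ioo p.1 p.2) :
    goodPart U f x = ⨍ y in Ioo p.1 p.2, f y := by
  rw [goodPart, if_pos (hp.2.1 hx), (ends_eq ho hU hp hx).1, (ends_eq ho hU hp hx).2]

lemma goodPart_of_notMem {U : Set ℝ} (f : ℝ → E) {x : ℝ} (hx : x ∉ U) : goodPart U f x = f x :=
  if_neg hx

lemma aestronglyMeasurable_goodPart {U : Set ℝ} (ho : IsOpen U) (hU : volume U ≠ ∞) {f : ℝ → E}
    (hf : AEStronglyMeasurable f) : AEStronglyMeasurable (goodPart U f) := by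
  have h1 : AEStronglyMeasurable (goodPart U f) (volume.restrict U) := by
    have : AEStronglyMeasurable (goodPart U f)
        (volume.restrict (⋃ p : components U, Ioo p.1.1 p.1.2)) := by
      rw [aestronglyMeasurable_iUnion_iff]
      intro p
      refine (aestronglyMeasurable_const (b := ⨍ y in Ioo p.1.1 p.1.2, f y)).congr ?_
      filter_upwards [ae_restrict_mem measurableSet_Ioo] with x hx
      rw [goodPart_of_mem ho hU f p.2 hx]
    rwa [iUnion_components ho hU] at this
  have h2 : AEStronglyMeasurable (goodPart U f) (volume.restrict Uᶜ) := by
    refine hf.restrict.congr ?_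
    filter_upwards [ae_restrict_mem ho.measurableSet.compl] with x hx
    rw [goodPart_of_notMem f hx]
  have := aestronglyMeasurable_union_iff.2 ⟨h1, h2⟩
  rwa [union_compl_self, Measure.restrict_univ] at this

lemma enorm_goodPart_le {f : ℝ → E} {l : ℝ≥0∞}
    (hU : volume {x | l < maxFn (fun y => ‖f y‖ₑ) x} ≠ ∞) {x : ℝ}
    (hx : l < maxFn (fun y => ‖f y‖ₑ) x) :
    ‖goodPart {x | l < maxFn (fun y => ‖f y‖ₑ) x} f x‖ₑ ≤ l := by
  have ho := isOpen_lt_maxFn (fun y => ‖f y‖ₑ) l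
  set U := {x | l < maxFn (fun y => ‖f y‖ₑ) x} with hUdef
  obtain ⟨hp, hxp⟩ := ends_mem_components ho hU (show x ∈ U from hx)
  rw [goodPart_of_mem ho hU f hp hxp]
  have hlt : 0 < rightEnd U x - leftEnd U x := sub_pos.2 hp.1
  rw [setAverage_eq, Measure.real, volume_Ioo, toReal_ofReal hlt.le]
  rw [enorm_smul, enorm_inv hlt.ne', Real.enorm_eq_ofReal hlt.le, ← ENNReal.div_eq_inv_mul]
  refine ENNReal.div_le_of_le_mul ?_
  rw [mul_comm]
  exact (enorm_integral_le_lintegral_enorm _).trans (lintegral_component_le hp)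

end good

lemma lintegral_inv_one_add_sq_lt_top (x : ℝ) :
    ∫⁻ y : ℝ, ofReal (1 / (1 + (x - y) ^ 2)) < ∞ := by
  have h : Integrable fun y : ℝ => 1 / (1 + (x - y) ^ 2) := by
    have := (integrable_inv_one_add_sq).comp_sub_left x
    simpa [one_div] using this
  exact h.lintegral_lt_top

/-- A function in `L^q`, `1 ≤ q`, is integrable against a bounded kernel with quadratic decay. -/
lemma lintegral_enorm_mul_inv_one_add_sq_lt_top {E : Type*} [NormedAddCommGroup E] {f : ℝ → E}
    {q : ℝ} (hq : 1 ≤ q) (hf : ∫⁻ y, ‖f y‖ₑ ^ q < ∞) (x : ℝ) :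
    ∫⁻ y, ofReal (1 / (1 + (x - y) ^ 2)) * ‖f y‖ₑ < ∞ := by
  refine lt_of_le_of_lt (b := ∫⁻ y, (ofReal (1 / (1 + (x - y) ^ 2)) + ‖f y‖ₑ ^ q)) ?_ ?_
  · refine lintegral_mono fun y => ?_
    have h1 : ofReal (1 / (1 + (x - y) ^ 2)) ≤ 1 := by
      rw [← ofReal_one]
      refine ofReal_le_ofReal ?_
      rw [div_le_one (by positivity)]
      nlinarith [sq_nonneg (x - y)]
    rcases le_total ‖f y‖ₑ 1 with h | h
    · exact (mul_le_mul_right h _).trans (by rw [mul_one]; exact le_self_add)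
    · refine (mul_le_mul_left h1 _).trans ?_
      rw [one_mul]
      refine le_trans ?_ le_add_self
      conv_lhs => rw [← rpow_one ‖f y‖ₑ]
      exact ENNReal.rpow_le_rpow_of_exponent_le h hq
  · rw [lintegral_add_left (by fun_prop)]
    exact ENNReal.add_lt_top.2 ⟨lintegral_inv_one_add_sq_lt_top x, hf⟩

/-! ### Fourier analysis of twice differentiable compactly supported symbols -/

/-- A symbol: a compactly supported function of class `C²` on the frequency line. -/
def IsSymbol (a : ℝ → ℂ) : Prop := ContDiff ℝ 2 a ∧ HasCompactSupport a

namespace IsSymbol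

variable {a b : ℝ → ℂ}

lemma continuous (ha : IsSymbol a) : Continuous a := ha.1.continuous

lemma integrable (ha : IsSymbol a) : Integrable a := ha.continuous.integrable_of_hasCompactSupport ha.2

lemma mul (ha : IsSymbol a) (hb : IsSymbol b) : IsSymbol fun x => a x * b x :=
  ⟨ha.1.mul hb.1, ha.2.mul_right⟩

lemma mul_contDiff (ha : IsSymbol a) (hb : ContDiff ℝ 2 b) : IsSymbol fun x => b x * a x :=
  ⟨hb.mul ha.1, ha.2.mul_left⟩

lemma const_mul (ha : IsSymbol a) (c : ℂ) : IsSymbol fun x => c * a x :=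
  ha.mul_contDiff contDiff_const

lemma add (ha : IsSymbol a) (hb : IsSymbol b) : IsSymbol fun x => a x + b x :=
  ⟨ha.1.add hb.1, ha.2.add hb.2⟩

lemma sub (ha : IsSymbol a) (hb : IsSymbol b) : IsSymbol fun x => a x - b x := by
  simpa [sub_eq_add_neg] using ha.add (hb.const_mul (-1))

lemma comp_mul (ha : IsSymbol a) {s : ℝ} (hs : s ≠ 0) : IsSymbol fun x => a (s * x) :=
  ⟨ha.1.comp (contDiff_const.mul contDiff_id),
    ha.2.comp_homeomorph (Homeomorph.mulLeft₀ s hs)⟩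

lemma comp_sub (ha : IsSymbol a) (c : ℝ) : IsSymbol fun x => a (x - c) :=
  ⟨ha.1.comp (contDiff_id.sub contDiff_const), ha.2.comp_homeomorph (Homeomorph.subRight c)⟩

lemma star (ha : IsSymbol a) : IsSymbol fun x => conj (a x) :=
  ⟨Complex.conjCLE.contDiff.comp ha.1, ha.2.comp_left (g := conj) (map_zero _)⟩

lemma sum {ι : Type*} (s : Finset ι) {a : ι → ℝ → ℂ} (ha : ∀ i ∈ s, IsSymbol (a i)) :
    IsSymbol fun x => ∑ i ∈ s, a i x := by
  classical
  induction s using Finset.induction_on with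
  | empty =>
    simp only [Finset.sum_empty]
    exact ⟨contDiff_const, HasCompactSupport.zero⟩
  | insert i s hi ih =>
    simp only [Finset.sum_insert hi]
    exact (ha i (mem_insert_self i s)).add
      (ih fun j hj => ha j (Finset.mem_insert_of_mem hj))

end IsSymbol

lemma invFT_eq_fourierInv (a : ℝ → ℂ) (x : ℝ) :
    invFT a x = 𝓕⁻ (fun η => a (2 * π * η)) x := by
  rw [invFT, Real.fourierInv_eq']
  have h := Measure.integral_comp_mul_left (fun ξ : ℝ => a ξ * exp (I * ξ * x))
    (2 * π)
  rw [abs_of_pos (by positivity)] at h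
  have h2 : ∫ v : ℝ, exp (↑(2 * π * inner ℝ v x) * I) •
      a (2 * π * v) = ∫ v : ℝ, a (2 * π * v) *
        exp (I * (2 * π * v : ℝ) * x) := by
    congr 1; ext v
    rw [smul_eq_mul, mul_comm]
    congr 2
    simp only [RCLike.inner_apply, conj_trivial]
    push_cast; ring
  rw [h2, h, real_smul]
  push_cast
  rfl

lemma norm_exp_I_mul (ξ x : ℝ) : ‖exp (I * ξ * x)‖ = 1 := by
  rw [show I * ξ * x = ((ξ * x : ℝ) : ℂ) * I by push_cast; ring,
    Complex.norm_exp_ofReal_mul_I]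

lemma integrable_mul_exp {a : ℝ → ℂ} (ha : Integrable a) (x : ℝ) :
    Integrable fun ξ : ℝ => a ξ * exp (I * ξ * x) :=
  ha.mul_bdd (c := 1) (by fun_prop) (ae_of_all _ fun ξ => (norm_exp_I_mul ξ x).le)

lemma norm_invFT_le (a : ℝ → ℂ) (x : ℝ) : ‖invFT a x‖ ≤ ∫ ξ, ‖a ξ‖ := by
  rw [invFT, norm_mul]
  have h1 : ‖(2 * π : ℂ)⁻¹‖ ≤ 1 := by
    rw [norm_inv]
    refine inv_le_one_of_one_le₀ ?_
    rw [norm_mul, norm_real, norm_eq_abs, abs_of_pos pi_pos]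
    simp only [Complex.norm_ofNat]
    linarith [Real.pi_gt_three]
  calc ‖(2 * π : ℂ)⁻¹‖ * ‖∫ ξ : ℝ, a ξ * exp (I * ξ * x)‖
      ≤ 1 * ∫ ξ, ‖a ξ‖ := by
        gcongr
        refine (norm_integral_le_integral_norm _).trans (le_of_eq ?_)
        simp only [norm_mul, norm_exp_I_mul, mul_one]
    _ = _ := one_mul _

lemma continuous_invFT {a : ℝ → ℂ} (ha : Integrable a) : Continuous (invFT a) := by
  refine continuous_const.mul (continuous_of_dominated (bound := fun ξ => ‖a ξ‖)
    (fun x => (integrable_mul_exp ha x).1) (fun x => Eventually.of_forall fun ξ => ?_) ha.norm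
    (ae_of_all _ fun ξ => by fun_prop))
  rw [norm_mul, norm_exp_I_mul, mul_one]

/-- Differentiating the symbol multiplies the kernel by `-i x`. -/
lemma invFT_of_hasDerivAt {a a' : ℝ → ℂ} (ha : Integrable a) (ha' : Integrable a')
    (h : ∀ ξ, HasDerivAt a (a' ξ) ξ) (x : ℝ) : invFT a' x = -(I * x) * invFT a x := by
  have hd : ∀ ξ : ℝ, HasDerivAt (fun ξ : ℝ => a ξ * exp (I * ξ * x))
      (a' ξ * exp (I * ξ * x) +
        a ξ * (exp (I * ξ * x) * (I * x))) ξ := by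
    intro ξ
    refine (h ξ).mul (HasDerivAt.cexp ?_)
    have h1 := ((Complex.ofRealCLM.hasDerivAt (x := ξ)).const_mul I).mul_const (x : ℂ)
    simpa using h1
  have h1 := integrable_mul_exp ha' x
  have h2 : Integrable fun ξ : ℝ => a ξ * (exp (I * ξ * x) * (I * x)) := by
    simpa only [mul_assoc] using (integrable_mul_exp ha x).mul_const (I * x)
  have h0 := integral_eq_zero_of_hasDerivAt_of_integrable hd (h1.add h2) (integrable_mul_exp ha x)
  rw [integral_add h1 h2] at h0
  have h3 : ∫ ξ : ℝ, a ξ * (exp (I * ξ * x) * (I * x)) =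
      (∫ ξ : ℝ, a ξ * exp (I * ξ * x)) * (I * x) := by
    rw [← integral_mul_const]; simp only [mul_assoc]
  rw [h3] at h0
  rw [invFT, invFT, eq_neg_of_add_eq_zero_left h0]
  ring

/-- A kernel `k` with `|k|, |k'| ≤ D / (1 + x²)`. -/
structure IsBump (D : ℝ) (k : ℝ → ℂ) : Prop where
  differentiable : Differentiable ℝ k
  norm_le : ∀ x, ‖k x‖ ≤ D / (1 + x ^ 2)
  norm_deriv_le : ∀ x, ‖deriv k x‖ ≤ D / (1 + x ^ 2)

lemma IsBump.nonneg {D : ℝ} {k : ℝ → ℂ} (h : IsBump D k) : 0 ≤ D := by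
  have := (norm_nonneg _).trans (h.norm_le 0); simpa using this

lemma IsSymbol.hasDerivAt_invFT {a : ℝ → ℂ} (ha : IsSymbol a) (x : ℝ) :
    HasDerivAt (invFT a) (invFT (fun ξ => I * ξ * a ξ) x) x := by
  have hs : IsSymbol fun ξ : ℝ => I * ξ * a ξ :=
    ha.mul_contDiff (contDiff_const.mul Complex.ofRealCLM.contDiff)
  refine HasDerivAt.const_mul _ ?_
  refine (hasDerivAt_integral_of_dominated_loc_of_deriv_le (Metric.ball_mem_nhds x one_pos)
    (bound := fun ξ => ‖I * ξ * a ξ‖)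
    (F' := fun (x ξ : ℝ) => I * ξ * a ξ * exp (I * ξ * x))
    (Eventually.of_forall fun y => (integrable_mul_exp ha.integrable y).1)
    (integrable_mul_exp ha.integrable x) (integrable_mul_exp hs.integrable x).1
    (ae_of_all _ fun ξ y _ => ?_) hs.integrable.norm
    (ae_of_all _ fun ξ y _ => ?_)).2
  · rw [norm_mul _ (exp _), norm_exp_I_mul, mul_one]
  · have h1 : HasDerivAt (fun y : ℝ => I * ξ * (y : ℂ)) (I * ξ) y := by
      simpa using (Complex.ofRealCLM.hasDerivAt (x := y)).const_mul (I * ξ)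
    have h2 := (h1.cexp).const_mul (a ξ)
    rwa [show a ξ * (exp (I * ξ * y) * (I * ξ)) =
      I * ξ * a ξ * exp (I * ξ * y) by ring] at h2

lemma IsSymbol.exists_norm_invFT_le {a : ℝ → ℂ} (ha : IsSymbol a) :
    ∃ D, ∀ x, ‖invFT a x‖ ≤ D / (1 + x ^ 2) := by
  have h1 : ContDiff ℝ 1 (deriv a) := by
    have := (contDiff_succ_iff_deriv (n := 1)).1 (by rw [one_add_one_eq_two]; exact ha.1)
    exact this.2.2
  have hc1 : HasCompactSupport (deriv a) := ha.2.deriv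
  have hi1 : Integrable (deriv a) := h1.continuous.integrable_of_hasCompactSupport hc1
  have hi2 : Integrable (deriv (deriv a)) :=
    (h1.continuous_deriv le_rfl).integrable_of_hasCompactSupport hc1.deriv
  have hd : ∀ x, HasDerivAt a (deriv a x) x := fun x =>
    (ha.1.differentiable (by norm_num) x).hasDerivAt
  have hd1 : ∀ x, HasDerivAt (deriv a) (deriv (deriv a) x) x := fun x =>
    (h1.differentiable (by norm_num) x).hasDerivAt
  refine ⟨(∫ ξ, ‖a ξ‖) + ∫ ξ, ‖deriv (deriv a) ξ‖, fun x => ?_⟩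
  rw [le_div_iff₀ (by positivity), mul_add, mul_one]
  refine add_le_add (norm_invFT_le a x) (le_trans (le_of_eq ?_) (norm_invFT_le _ x))
  rw [invFT_of_hasDerivAt hi1 hi2 hd1, invFT_of_hasDerivAt ha.integrable hi1 hd]
  simp only [norm_mul, norm_neg, norm_I, one_mul, norm_real, norm_eq_abs]
  rw [← sq_abs x]; ring

lemma IsSymbol.exists_isBump {a : ℝ → ℂ} (ha : IsSymbol a) : ∃ D, IsBump D (invFT a) := by
  obtain ⟨D₁, h₁⟩ := ha.exists_norm_invFT_le
  obtain ⟨D₂, h₂⟩ := (ha.mul_contDiff (b := fun ξ : ℝ => I * ξ)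
    (contDiff_const.mul Complex.ofRealCLM.contDiff)).exists_norm_invFT_le
  refine ⟨max D₁ D₂, fun x => (ha.hasDerivAt_invFT x).differentiableAt, fun x => ?_, fun x => ?_⟩
  · exact (h₁ x).trans (by gcongr; exact le_max_left _ _)
  · rw [(ha.hasDerivAt_invFT x).deriv]
    exact (h₂ x).trans (by gcongr; exact le_max_right _ _)

lemma integrable_of_norm_le {k : ℝ → ℂ} (hk : Continuous k) {D : ℝ}
    (hD : ∀ x, ‖k x‖ ≤ D / (1 + x ^ 2)) : Integrable k := by
  refine Integrable.mono' (integrable_inv_one_add_sq.const_mul D) hk.aestronglyMeasurable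
    (ae_of_all _ fun x => ?_)
  simpa [div_eq_mul_inv] using hD x

lemma IsSymbol.integrable_invFT {a : ℝ → ℂ} (ha : IsSymbol a) : Integrable (invFT a) := by
  obtain ⟨D, hD⟩ := ha.exists_norm_invFT_le
  exact integrable_of_norm_le (continuous_invFT ha.integrable) hD

/-- Fourier inversion. -/
lemma IsSymbol.integral_invFT_mul_exp {a : ℝ → ℂ} (ha : IsSymbol a) (ξ : ℝ) :
    ∫ x : ℝ, invFT a x * exp (-(I * ξ * x)) = a ξ := by
  have hpi : (2 * π) ≠ 0 := by positivity
  have hb : IsSymbol fun η => a (2 * π * η) := ha.comp_mul hpi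
  have hinv : invFT a = 𝓕⁻ fun η => a (2 * π * η) := funext (invFT_eq_fourierInv a)
  have hi : Integrable (𝓕 fun η => a (2 * π * η)) := by
    have h1 : Integrable (𝓕⁻ fun η => a (2 * π * η)) := hinv ▸ ha.integrable_invFT
    have h2 := h1.comp_neg
    refine h2.congr (ae_of_all _ fun x => ?_)
    simp only [Real.fourierInv_eq_fourier_neg, neg_neg]
  have h := Continuous.fourier_fourierInv_eq hb.continuous hb.integrable hi
  have h2 := congrFun h (ξ / (2 * π))
  rw [← hinv, Real.fourier_real_eq_integral_exp_smul] at h2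
  simp only [mul_div_cancel₀ _ hpi] at h2
  rw [← h2]
  congr 1; ext x
  rw [smul_eq_mul, mul_comm]
  congr 2
  have : (π : ℂ) ≠ 0 := by exact_mod_cast Real.pi_ne_zero
  push_cast
  field_simp

lemma invFT_comp_mul (a : ℝ → ℂ) {s : ℝ} (hs : s ≠ 0) (x : ℝ) :
    invFT (fun η => a (s * η)) x = ((|s|⁻¹ : ℝ) : ℂ) * invFT a (x / s) := by
  rw [invFT, invFT]
  have h := Measure.integral_comp_mul_left
    (fun ξ : ℝ => a ξ * exp (I * ξ * (x / s : ℝ))) s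
  have h2 : ∫ v : ℝ, a (s * v) * exp (I * v * x) =
      ∫ v : ℝ, a (s * v) * exp (I * (s * v : ℝ) * (x / s : ℝ)) := by
    congr 1; ext v; congr 2
    have : (s : ℂ) ≠ 0 := by exact_mod_cast hs
    push_cast; field_simp
  rw [h2, h, real_smul, abs_inv]
  ring

lemma invFT_comp_sub (a : ℝ → ℂ) (c x : ℝ) :
    invFT (fun η => a (η - c)) x = exp (I * c * x) * invFT a x := by
  rw [invFT, invFT, ← integral_add_right_eq_self (μ := volume)
    (fun ξ : ℝ => a (ξ - c) * exp (I * ξ * x)) c]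
  have : ∀ ξ : ℝ, a (ξ + c - c) * exp (I * (ξ + c : ℝ) * x) =
      exp (I * c * x) * (a ξ * exp (I * ξ * x)) := by
    intro ξ
    rw [add_sub_cancel_right, mul_left_comm, ← exp_add]
    congr 2; push_cast; ring
  simp_rw [this]
  rw [integral_const_mul]; ring

lemma invFT_neg (a : ℝ → ℂ) (x : ℝ) : invFT (fun η => a (-η)) x = invFT a (-x) := by
  have h := invFT_comp_mul a (s := -1) (by norm_num) x
  simpa [div_neg] using h

lemma conj_invFT (a : ℝ → ℂ) (x : ℝ) :
    conj (invFT a x) = invFT (fun ξ => conj (a ξ)) (-x) := by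
  rw [invFT, invFT, map_mul, ← integral_conj]
  congr 1
  · simp [Complex.conj_ofNat]
  · congr 1; ext ξ
    rw [map_mul, ← Complex.exp_conj]
    congr 2
    simp

/-- Plancherel's identity for the kernels of two symbols. -/
lemma IsSymbol.integral_invFT_mul_conj {a : ℝ → ℂ} (ha : IsSymbol a) {b : ℝ → ℂ}
    (hb : Integrable b) : ∫ x, invFT a x * conj (invFT b x) =
      (2 * π : ℂ)⁻¹ * ∫ ξ, a ξ * conj (b ξ) := by
  have h1 : ∀ x : ℝ, invFT a x * conj (invFT b x) = (2 * π : ℂ)⁻¹ *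
      ∫ ξ : ℝ, invFT a x * (conj (b ξ) * exp (-(I * ξ * x))) := by
    intro x
    have h : invFT (fun ξ => conj (b ξ)) (-x) = (2 * π : ℂ)⁻¹ *
        ∫ ξ : ℝ, conj (b ξ) * exp (-(I * ξ * x)) := by
      simp only [invFT, Complex.ofReal_neg, mul_neg]
    rw [conj_invFT, h, integral_const_mul]
    ring
  simp_rw [h1]
  rw [integral_const_mul, integral_integral_swap]
  · congr 2; ext ξ
    have h2 : ∀ x : ℝ, invFT a x * (conj (b ξ) *
        exp (-(I * ξ * x))) = conj (b ξ) *
        (invFT a x * exp (-(I * ξ * x))) := fun x => by ring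
    simp_rw [h2]
    rw [integral_const_mul, ha.integral_invFT_mul_exp, mul_comm]
  · have hbc : Integrable fun ξ => conj (b ξ) :=
      hb.mono (Complex.continuous_conj.comp_aestronglyMeasurable hb.1)
        (ae_of_all _ fun ξ => by simp)
    have h3 : Integrable (fun z : ℝ × ℝ => invFT a z.1 * conj (b z.2))
        (volume.prod volume) :=
      ha.integrable_invFT.mul_prod hbc
    have h4 := h3.mul_bdd (c := 1) (g := fun z : ℝ × ℝ => exp (-(I * z.2 * z.1)))
      (by fun_prop) (ae_of_all _ fun z => by
        have := norm_exp_I_mul z.2 (-z.1)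
        push_cast at this
        rw [mul_neg] at this
        exact this.le)
    refine h4.congr (ae_of_all _ fun z => ?_)
    simp only [Function.uncurry]; ring

/-! ### Convolution with kernels of quadratic decay -/

lemma maxFn_congr_ae {F G : ℝ → ℝ≥0∞} (h : F =ᵐ[volume] G) : maxFn F = maxFn G := by
  ext x
  simp only [maxFn, lintegral_congr_ae (ae_restrict_of_ae h)]

lemma cauchyAvg_congr_ae {F G : ℝ → ℝ≥0∞} (h : F =ᵐ[volume] G) (t : ℝ) :
    cauchyAvg t F = cauchyAvg t G := by
  ext x
  exact lintegral_congr_ae (h.mono fun y hy => by simp only [hy])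

lemma cauchyAvg_le_maxFn₀ {t : ℝ} (ht : 0 < t) {F : ℝ → ℝ≥0∞} (hF : AEMeasurable F)
    (x : ℝ) : cauchyAvg t F x ≤ 16 * maxFn F x := by
  rw [maxFn_congr_ae hF.ae_eq_mk, cauchyAvg_congr_ae hF.ae_eq_mk]
  exact cauchyAvg_le_maxFn ht hF.measurable_mk x

/-- A constant in the maximal theorem on `L^q`. -/
noncomputable def maxConst (q : ℝ) : ℝ≥0 :=
  if hq : 1 < q then (exists_lintegral_maxFn_rpow_le hq).choose else 0

lemma lintegral_maxFn_rpow_le {q : ℝ} (hq : 1 < q) {F : ℝ → ℝ≥0∞} (hF : AEMeasurable F) :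
    ∫⁻ x, maxFn F x ^ q ≤ maxConst q * ∫⁻ x, F x ^ q := by
  have h : ∫⁻ x, F x ^ q = ∫⁻ x, hF.mk F x ^ q :=
    lintegral_congr_ae (hF.ae_eq_mk.mono fun x hx => by simp only [hx])
  rw [maxFn_congr_ae hF.ae_eq_mk, h, maxConst, dif_pos hq]
  exact (exists_lintegral_maxFn_rpow_le hq).choose_spec _ hF.measurable_mk

lemma measurable_cauchyKernel (t : ℝ) :
    Measurable fun z : ℝ × ℝ => ofReal (t / (t ^ 2 + (z.1 - z.2) ^ 2)) := by fun_prop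

lemma measurable_cauchyAvg {F : ℝ → ℝ≥0∞} (hF : AEMeasurable F) (t : ℝ) :
    Measurable (cauchyAvg t F) := by
  rw [cauchyAvg_congr_ae hF.ae_eq_mk]
  exact Measurable.lintegral_prod_right' (f := fun z : ℝ × ℝ =>
    ofReal (t / (t ^ 2 + (z.1 - z.2) ^ 2)) * hF.mk F z.2)
    ((measurable_cauchyKernel t).mul (hF.measurable_mk.comp measurable_snd))

/-- The averages are symmetric. -/
lemma lintegral_cauchyAvg_mul {F G : ℝ → ℝ≥0∞} (hF : AEMeasurable F)
    (hG : AEMeasurable G) (t : ℝ) :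
    ∫⁻ x, cauchyAvg t F x * G x = ∫⁻ x, F x * cauchyAvg t G x := by
  have h1 : AEMeasurable (fun z : ℝ × ℝ =>
      ofReal (t / (t ^ 2 + (z.1 - z.2) ^ 2)) * F z.2 * G z.1) (volume.prod volume) :=
    (((measurable_cauchyKernel t).aemeasurable).mul hF.comp_snd).mul hG.comp_fst
  calc ∫⁻ x, cauchyAvg t F x * G x
      = ∫⁻ x, ∫⁻ y, ofReal (t / (t ^ 2 + (x - y) ^ 2)) * F y * G x := by
        refine lintegral_congr fun x => ?_
        rw [cauchyAvg, lintegral_mul_const'' _ (by fun_prop)]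
    _ = ∫⁻ y, ∫⁻ x, ofReal (t / (t ^ 2 + (x - y) ^ 2)) * F y * G x :=
        lintegral_lintegral_swap h1
    _ = _ := by
        refine lintegral_congr fun y => ?_
        rw [cauchyAvg, ← lintegral_const_mul'' _ (by fun_prop)]
        refine lintegral_congr fun x => ?_
        rw [← neg_sub y x, neg_sq]; ring

lemma lintegral_cauchyKernel {t : ℝ} (ht : 0 < t) (x : ℝ) :
    ∫⁻ y, ofReal (t / (t ^ 2 + (x - y) ^ 2)) = ofReal π := by
  have h0 : ∀ y : ℝ, t / (t ^ 2 + (x - y) ^ 2) = t⁻¹ * (1 + ((y - x) / t) ^ 2)⁻¹ := by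
    intro y
    have : t ^ 2 + (x - y) ^ 2 ≠ 0 := by positivity
    have h3 : 1 + ((y - x) / t) ^ 2 ≠ 0 := by positivity
    rw [div_pow, ← sub_eq_zero]
    field_simp
    ring_nf
  have hi : Integrable fun y : ℝ => t⁻¹ * (1 + ((y - x) / t) ^ 2)⁻¹ :=
    ((integrable_inv_one_add_sq.comp_div ht.ne').comp_sub_right x).const_mul _
  simp_rw [h0]
  rw [← ofReal_integral_eq_lintegral_ofReal hi (ae_of_all _ fun y => by
    change 0 ≤ _; positivity)]
  congr 1
  rw [integral_const_mul, integral_sub_right_eq_self (fun y => (1 + (y / t) ^ 2)⁻¹) x,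
    Measure.integral_comp_div (fun y => (1 + y ^ 2)⁻¹), integral_univ_inv_one_add_sq, smul_eq_mul,
    abs_of_pos ht]
  field_simp

lemma cauchyAvg_const {t : ℝ} (ht : 0 < t) (c : ℝ≥0∞) (x : ℝ) :
    cauchyAvg t (fun _ => c) x = ofReal π * c := by
  rw [cauchyAvg, lintegral_mul_const _ (by fun_prop), lintegral_cauchyKernel ht]

lemma rpow_half_sq (z : ℝ≥0∞) : (z ^ (1 / 2 : ℝ)) ^ 2 = z := by
  rw [← rpow_natCast, ← rpow_mul]; norm_num

lemma sq_rpow_half (z : ℝ≥0∞) (q : ℝ) : (z ^ 2) ^ (q / 2) = z ^ q := by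
  rw [← rpow_natCast, ← rpow_mul]; congr 1; push_cast; ring

/-- The square of an average is bounded by the average of the square. -/
lemma lintegral_mul_sq_le {w F : ℝ → ℝ≥0∞} (hw : AEMeasurable w)
    (hF : AEMeasurable F) :
    (∫⁻ y, w y * F y) ^ 2 ≤ (∫⁻ y, w y) * ∫⁻ y, w y * F y ^ 2 := by
  have h := lintegral_mul_le_Lp_mul_Lq volume Real.HolderConjugate.two_two (f := fun y => w y ^ (1 / 2 : ℝ)) (g := fun y =>
      w y ^ (1 / 2 : ℝ) * F y) (hw.pow_const _) ((hw.pow_const _).mul hF)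
  have h1 : ∀ y, w y ^ (1 / 2 : ℝ) * w y ^ (1 / 2 : ℝ) = w y := fun y => by
    rw [← rpow_add_of_nonneg _ _ (by norm_num) (by norm_num)]; norm_num
  have h2 : ∀ y, (w y ^ (1 / 2 : ℝ)) ^ (2 : ℝ) = w y := fun y => by
    rw [← rpow_mul]; norm_num
  simp only [Pi.mul_apply, ← mul_assoc, h1, h2, mul_rpow_of_nonneg _ _
    (by norm_num : (0 : ℝ) ≤ 2), rpow_ofNat] at h
  exact (pow_le_pow_left' h 2).trans_eq (by rw [mul_pow, rpow_half_sq, rpow_half_sq])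

lemma cauchyAvg_sq_le {t : ℝ} (ht : 0 < t) {F : ℝ → ℝ≥0∞} (hF : AEMeasurable F) (x : ℝ) :
    cauchyAvg t F x ^ 2 ≤ 4 * cauchyAvg t (fun y => F y ^ 2) x := by
  refine (lintegral_mul_sq_le (by fun_prop) hF).trans ?_
  rw [lintegral_cauchyKernel ht, cauchyAvg]
  gcongr
  rw [← ofReal_ofNat]
  exact ofReal_le_ofReal Real.pi_le_four

lemma cauchyKernel_le_of_le {s S : ℝ} (hs : 0 < s) (hS : s ≤ S) (x : ℝ) :
    s / (s ^ 2 + x ^ 2) ≤ S / s * (S / (S ^ 2 + x ^ 2)) := by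
  have hS0 : 0 < S := hs.trans_le hS
  rw [div_mul_div_comm, div_le_div_iff₀ (by positivity) (by positivity)]
  nlinarith [mul_nonneg (sub_nonneg.2 (pow_le_pow_left₀ hs.le hS 2)) (sq_nonneg x),
    mul_nonneg hs.le (sq_nonneg x)]

/-- Two consecutive averages at the same scale are controlled by one. -/
lemma cauchyAvg_cauchyAvg_le {t : ℝ} (ht : 0 < t) {F : ℝ → ℝ≥0∞} (hF : AEMeasurable F)
    (x : ℝ) : cauchyAvg t (cauchyAvg t F) x ≤ 16 * cauchyAvg t F x := by
  have hm : AEMeasurable (fun z : ℝ × ℝ => ofReal (t / (t ^ 2 + (x - z.1) ^ 2)) *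
      (ofReal (t / (t ^ 2 + (z.1 - z.2) ^ 2)) * F z.2)) (volume.prod volume) := by
    refine AEMeasurable.mul (by fun_prop) (AEMeasurable.mul ?_ hF.comp_snd)
    exact (measurable_cauchyKernel t).aemeasurable
  calc cauchyAvg t (cauchyAvg t F) x
      = ∫⁻ y, ∫⁻ z, ofReal (t / (t ^ 2 + (x - y) ^ 2)) *
          (ofReal (t / (t ^ 2 + (y - z) ^ 2)) * F z) := by
        refine lintegral_congr fun y => ?_
        rw [lintegral_const_mul' _ _ ofReal_ne_top]; rfl
    _ = ∫⁻ z, ∫⁻ y, ofReal (t / (t ^ 2 + (x - y) ^ 2)) *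
          (ofReal (t / (t ^ 2 + (y - z) ^ 2)) * F z) := lintegral_lintegral_swap hm
    _ ≤ ∫⁻ z, 16 * (ofReal (t / (t ^ 2 + (x - z) ^ 2)) * F z) := by
        refine lintegral_mono fun z => ?_
        simp_rw [← mul_assoc]
        rw [lintegral_mul_const _ (by fun_prop)]
        gcongr
        calc ∫⁻ y, ofReal (t / (t ^ 2 + (x - y) ^ 2)) *
              ofReal (t / (t ^ 2 + (y - z) ^ 2))
            ≤ ∫⁻ y, ofReal (2 * (t / (t ^ 2 + (x - z) ^ 2))) *
              (ofReal (t / (t ^ 2 + (x - y) ^ 2)) +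
                ofReal (t / (t ^ 2 + (z - y) ^ 2))) := by
              refine lintegral_mono fun y => ?_
              rw [← ofReal_mul (by positivity), ← ofReal_add (by positivity)
                (by positivity), ← ofReal_mul (by positivity)]
              refine ofReal_le_ofReal ?_
              have hA : 0 < t ^ 2 + (x - y) ^ 2 := by positivity
              have hB : 0 < t ^ 2 + (y - z) ^ 2 := by positivity
              have hC : 0 < t ^ 2 + (x - z) ^ 2 := by positivity
              have h1 : t ^ 2 + (x - z) ^ 2 ≤
                  2 * ((t ^ 2 + (x - y) ^ 2) + (t ^ 2 + (y - z) ^ 2)) := by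
                nlinarith [sq_nonneg ((x - y) - (y - z)), sq_nonneg t]
              rw [show (z - y) ^ 2 = (y - z) ^ 2 by ring]
              generalize t ^ 2 + (x - y) ^ 2 = A at *
              generalize t ^ 2 + (y - z) ^ 2 = B at *
              generalize t ^ 2 + (x - z) ^ 2 = C at *
              rw [show t / A * (t / B) = (t * t) / (A * B) by field_simp,
                show 2 * (t / C) * (t / A + t / B) = (t * t * (2 * (A + B))) / (C * (A * B)) by
                  field_simp; ring,
                div_le_div_iff₀ (by positivity) (by positivity)]
              have h2 : 0 ≤ t * t * (A * B) := by positivity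
              nlinarith [mul_le_mul_of_nonneg_left h1 h2]
          _ = ofReal (2 * (t / (t ^ 2 + (x - z) ^ 2))) *
              (ofReal π + ofReal π) := by
              rw [lintegral_const_mul' _ _ ofReal_ne_top, lintegral_add_left (by fun_prop),
                lintegral_cauchyKernel ht, lintegral_cauchyKernel ht]
          _ ≤ 16 * ofReal (t / (t ^ 2 + (x - z) ^ 2)) := by
              rw [← ofReal_add Real.pi_pos.le Real.pi_pos.le,
                ← ofReal_mul (by positivity), ← ofReal_ofNat 16,
                ← ofReal_mul (by positivity)]
              refine ofReal_le_ofReal ?_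
              have : 0 ≤ t / (t ^ 2 + (x - z) ^ 2) := by positivity
              nlinarith [Real.pi_le_four]
    _ = 16 * cauchyAvg t F x := by
        rw [lintegral_const_mul' _ _ (by norm_num)]; rfl

/-- Measurable functions that are integrable against `1 / (1 + x ^ 2)`; this covers every
`L^p`, `1 ≤ p ≤ ∞`. -/
def Tame (f : ℝ → ℂ) : Prop :=
  AEStronglyMeasurable f ∧ cauchyAvg 1 (fun y => ‖f y‖ₑ) 0 < ∞

lemma tame_of_lintegral_rpow {f : ℝ → ℂ} (hfm : AEStronglyMeasurable f) {q : ℝ}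
    (hq : 1 ≤ q) (hf : ∫⁻ y, ‖f y‖ₑ ^ q < ∞) : Tame f := by
  refine ⟨hfm, ?_⟩
  simpa [cauchyAvg] using lintegral_enorm_mul_inv_one_add_sq_lt_top hq hf 0

lemma tame_of_le {f : ℝ → ℂ} (hfm : AEStronglyMeasurable f) {c : ℝ≥0∞} (hc : c ≠ ∞)
    (hf : ∀ᵐ y, ‖f y‖ₑ ≤ c) : Tame f := by
  refine ⟨hfm, lt_of_le_of_lt (lintegral_mono_ae (g := fun y =>
    ofReal (1 / (1 ^ 2 + (0 - y) ^ 2)) * c) ?_) ?_⟩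
  · filter_upwards [hf] with y hy
    gcongr
  · have := cauchyAvg_const one_pos c 0
    rw [cauchyAvg] at this
    rw [this]
    exact mul_lt_top ofReal_lt_top hc.lt_top

lemma Tame.cauchyAvg_lt_top {f : ℝ → ℂ} (hf : Tame f) {s : ℝ} (hs : 0 < s) (x : ℝ) :
    cauchyAvg s (fun y => ‖f y‖ₑ) x < ∞ := by
  set c := s * ((1 + 2 * x ^ 2) / s ^ 2 + 2) with hc
  have hc0 : 0 ≤ c := by positivity
  refine lt_of_le_of_lt (b := ofReal c * cauchyAvg 1 (fun y => ‖f y‖ₑ) 0) ?_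
    (mul_lt_top ofReal_lt_top hf.2)
  rw [cauchyAvg, cauchyAvg, ← lintegral_const_mul' _ _ ofReal_ne_top]
  refine lintegral_mono fun y => ?_
  rw [← mul_assoc, ← ofReal_mul hc0]
  gcongr
  rw [one_pow, zero_sub, neg_sq, mul_one_div, div_le_div_iff₀ (by positivity) (by positivity), hc,
    mul_assoc]
  refine mul_le_mul_of_nonneg_left ?_ hs.le
  have h1 : (1 + 2 * x ^ 2) / s ^ 2 * s ^ 2 = 1 + 2 * x ^ 2 := by field_simp
  have h2 : 0 ≤ (1 + 2 * x ^ 2) / s ^ 2 * (x - y) ^ 2 := by positivity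
  nlinarith [sq_nonneg (x - (x - y)), sq_nonneg (2 * x - y), sq_nonneg s]

lemma conv_apply (f k : ℝ → ℂ) (x : ℝ) : conv f k x = ∫ t, f t * k (x - t) := rfl

/-- A continuous kernel dominated by `D` times the Cauchy kernel at scale `s`. -/
structure IsDecaying (D s : ℝ) (k : ℝ → ℂ) : Prop where
  pos : 0 < s
  continuous : Continuous k
  norm_le : ∀ x, ‖k x‖ ≤ D * (s / (s ^ 2 + x ^ 2))

namespace IsDecaying

variable {D s : ℝ} {k : ℝ → ℂ}

lemma nonneg (hk : IsDecaying D s k) : 0 ≤ D := by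
  have h := (norm_nonneg _).trans (hk.norm_le 0)
  have : 0 < s / (s ^ 2 + 0 ^ 2) := by have := hk.pos; positivity
  exact nonneg_of_mul_nonneg_left h this

lemma enorm_le (hk : IsDecaying D s k) (x : ℝ) :
    ‖k x‖ₑ ≤ ofReal D * ofReal (s / (s ^ 2 + x ^ 2)) := by
  rw [← ofReal_norm, ← ofReal_mul hk.nonneg]
  exact ofReal_le_ofReal (hk.norm_le x)

lemma of_le (hk : IsDecaying D s k) {S : ℝ} (hS : s ≤ S) : IsDecaying (D * (S / s)) S k :=
  ⟨hk.pos.trans_le hS, hk.continuous, fun x => (hk.norm_le x).trans (by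
    rw [mul_assoc]
    exact mul_le_mul_of_nonneg_left (cauchyKernel_le_of_le hk.pos hS x) hk.nonneg)⟩

lemma lintegral_enorm_le (hk : IsDecaying D s k) (f : ℝ → ℂ) (x : ℝ) :
    ∫⁻ t, ‖f t * k (x - t)‖ₑ ≤ ofReal D * cauchyAvg s (fun y => ‖f y‖ₑ) x := by
  rw [cauchyAvg, ← lintegral_const_mul' _ _ ofReal_ne_top]
  refine lintegral_mono fun t => ?_
  rw [enorm_mul, mul_comm, ← mul_assoc]
  gcongr
  exact hk.enorm_le _

lemma enorm_conv_le (hk : IsDecaying D s k) (f : ℝ → ℂ) (x : ℝ) :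
    ‖conv f k x‖ₑ ≤ ofReal D * cauchyAvg s (fun y => ‖f y‖ₑ) x :=
  (enorm_integral_le_lintegral_enorm _).trans (hk.lintegral_enorm_le f x)

lemma integrable (hk : IsDecaying D s k) {f : ℝ → ℂ} (hf : Tame f) (x : ℝ) :
    Integrable fun t => f t * k (x - t) :=
  ⟨hf.1.mul (hk.continuous.comp (continuous_const.sub continuous_id)).aestronglyMeasurable,
    (hk.lintegral_enorm_le f x).trans_lt
      (mul_lt_top ofReal_lt_top (hf.cauchyAvg_lt_top hk.pos x))⟩

lemma conv_sub (hk : IsDecaying D s k) {f g : ℝ → ℂ} (hf : Tame f) (hg : Tame g) (x : ℝ) :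
    conv (f - g) k x = conv f k x - conv g k x := by
  rw [conv_apply, conv_apply, conv_apply, ← integral_sub (hk.integrable hf x) (hk.integrable hg x)]
  simp only [Pi.sub_apply, sub_mul]

end IsDecaying

lemma enorm_add_sq_le (z w : ℂ) : ‖z + w‖ₑ ^ 2 ≤ 2 * ‖z‖ₑ ^ 2 + 2 * ‖w‖ₑ ^ 2 := by
  have := ENNReal.rpow_add_le_mul_rpow_add_rpow ‖z‖ₑ ‖w‖ₑ one_le_two
  norm_num at this
  rw [← mul_add]
  exact (pow_le_pow_left' (enorm_add_le _ _) 2).trans this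

lemma aestronglyMeasurable_conv {f k : ℝ → ℂ} (hf : AEStronglyMeasurable f)
    (hk : Continuous k) : AEStronglyMeasurable (conv f k) := by
  have : AEStronglyMeasurable (fun z : ℝ × ℝ => f z.2 * k (z.1 - z.2)) (volume.prod volume) :=
    hf.comp_snd.mul (hk.comp (continuous_fst.sub continuous_snd)).aestronglyMeasurable
  exact this.integral_prod_right'

lemma IsSymbol.aestronglyMeasurable_conv {f a : ℝ → ℂ} (ha : IsSymbol a)
    (hf : AEStronglyMeasurable f) : AEStronglyMeasurable (conv f (invFT a)) :=
  CurvedBHT.aestronglyMeasurable_conv hf (continuous_invFT ha.integrable)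

lemma conv_conv {f k₁ k₂ : ℝ → ℂ} (hf : Tame f) {D₁ s₁ D₂ s₂ : ℝ} (h₁ : IsDecaying D₁ s₁ k₁)
    (h₂ : IsDecaying D₂ s₂ k₂) (x : ℝ) : conv (conv f k₁) k₂ x = conv f (conv k₁ k₂) x := by
  have h₁' := h₁.of_le (le_max_left s₁ s₂)
  have h₂' := h₂.of_le (le_max_right s₁ s₂)
  set S := max s₁ s₂
  have hS0 : 0 < S := h₁'.pos
  have hm : AEMeasurable (fun y => ‖f y‖ₑ) := hf.1.enorm
  have hmeas : AEStronglyMeasurable (fun z : ℝ × ℝ => f z.2 * k₁ (z.1 - z.2) * k₂ (x - z.1))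
      (volume.prod volume) :=
    (hf.1.comp_snd.mul (h₁.continuous.comp
      (continuous_fst.sub continuous_snd)).aestronglyMeasurable).mul
      (h₂.continuous.comp (continuous_const.sub continuous_fst)).aestronglyMeasurable
  have hint : Integrable (fun z : ℝ × ℝ => f z.2 * k₁ (z.1 - z.2) * k₂ (x - z.1))
      (volume.prod volume) := by
    refine ⟨hmeas, ?_⟩
    rw [HasFiniteIntegral, lintegral_prod _ hmeas.enorm]
    refine lt_of_le_of_lt (b := ofReal (D₁ * (S / s₁)) * ofReal (D₂ * (S / s₂)) *
      cauchyAvg S (cauchyAvg S fun y => ‖f y‖ₑ) x) ?_ ?_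
    · rw [cauchyAvg, ← lintegral_const_mul' _ _ (mul_ne_top ofReal_ne_top
        ofReal_ne_top)]
      refine lintegral_mono fun y => ?_
      simp only [enorm_mul (f _ * k₁ _)]
      rw [lintegral_mul_const' _ _ enorm_ne_top]
      calc (∫⁻ t, ‖f t * k₁ (y - t)‖ₑ) * ‖k₂ (x - y)‖ₑ
          ≤ (ofReal (D₁ * (S / s₁)) * cauchyAvg S (fun y => ‖f y‖ₑ) y) *
            (ofReal (D₂ * (S / s₂)) *
              ofReal (S / (S ^ 2 + (x - y) ^ 2))) := by
            gcongr
            · exact h₁'.lintegral_enorm_le f y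
            · exact h₂'.enorm_le _
        _ = _ := by ring
    · refine mul_lt_top (mul_lt_top ofReal_lt_top ofReal_lt_top)
        ((cauchyAvg_cauchyAvg_le hS0 hm x).trans_lt ?_)
      exact mul_lt_top (by norm_num) (hf.cauchyAvg_lt_top hS0 x)
  calc conv (conv f k₁) k₂ x = ∫ y, ∫ t, f t * k₁ (y - t) * k₂ (x - y) := by
        rw [conv_apply]
        congr 1; ext y
        rw [conv_apply, integral_mul_const]
    _ = ∫ t, ∫ y, f t * k₁ (y - t) * k₂ (x - y) := integral_integral_swap hint
    _ = conv f (conv k₁ k₂) x := by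
        rw [conv_apply]
        congr 1; ext t
        rw [conv_apply, ← integral_const_mul,
          ← integral_sub_right_eq_self (fun y => f t * (k₁ y * k₂ (x - t - y))) t]
        congr 1; ext y
        rw [mul_assoc]
        congr 3; ring

/-- Convolution can be moved to the other factor of a pairing. -/
lemma integral_conv_mul {f u k : ℝ → ℂ} (hf : AEStronglyMeasurable f)
    (hu : AEStronglyMeasurable u) {D s : ℝ} (hk : IsDecaying D s k)
    (hfin : ∫⁻ x, cauchyAvg s (fun y => ‖f y‖ₑ) x * ‖u x‖ₑ < ∞) :
    ∫ x, conv f k x * u x = ∫ y, f y * conv u (fun x => k (-x)) y := by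
  have hmeas : AEStronglyMeasurable (fun z : ℝ × ℝ => f z.2 * k (z.1 - z.2) * u z.1)
      (volume.prod volume) :=
    (hf.comp_snd.mul (hk.continuous.comp
      (continuous_fst.sub continuous_snd)).aestronglyMeasurable).mul hu.comp_fst
  have hint : Integrable (fun z : ℝ × ℝ => f z.2 * k (z.1 - z.2) * u z.1)
      (volume.prod volume) := by
    refine ⟨hmeas, ?_⟩
    rw [HasFiniteIntegral, lintegral_prod _ hmeas.enorm]
    refine lt_of_le_of_lt (b := ofReal D *
      ∫⁻ x, cauchyAvg s (fun y => ‖f y‖ₑ) x * ‖u x‖ₑ) ?_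
      (mul_lt_top ofReal_lt_top hfin)
    rw [← lintegral_const_mul' _ _ ofReal_ne_top]
    refine lintegral_mono fun x => ?_
    simp only [enorm_mul (f _ * k _)]
    rw [lintegral_mul_const' _ _ enorm_ne_top, ← mul_assoc]
    gcongr
    exact hk.lintegral_enorm_le f x
  calc ∫ x, conv f k x * u x = ∫ x, ∫ y, f y * k (x - y) * u x := by
        congr 1; ext x
        rw [conv_apply, integral_mul_const]
    _ = ∫ y, ∫ x, f y * k (x - y) * u x := integral_integral_swap hint
    _ = _ := by
        congr 1; ext y
        rw [conv_apply, ← integral_const_mul]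
        congr 1; ext x
        rw [neg_sub]; ring

/-! ### Convolution operators on `L^q` and on `L²` -/

lemma IsSymbol.exists_isDecaying {a : ℝ → ℂ} (ha : IsSymbol a) :
    ∃ D, IsDecaying D 1 (invFT a) := by
  obtain ⟨D, hD⟩ := ha.exists_norm_invFT_le
  refine ⟨D, one_pos, continuous_invFT ha.integrable, fun x => ?_⟩
  simpa [div_eq_mul_inv] using hD x

/-- The kernel of a dilated symbol is a dilated kernel. -/
lemma IsDecaying.invFT_comp_mul {a : ℝ → ℂ} {D : ℝ} (ha : IsDecaying D 1 (invFT a)) {s : ℝ}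
    (hs : s ≠ 0) : IsDecaying D |s| (invFT fun η => a (s * η)) := by
  have hs' : 0 < |s| := abs_pos.2 hs
  have h : (invFT fun η => a (s * η)) = fun x => ((|s|⁻¹ : ℝ) : ℂ) * invFT a (x / s) :=
    funext fun x => CurvedBHT.invFT_comp_mul a hs x
  refine ⟨hs', ?_, fun x => ?_⟩
  · rw [h]
    exact continuous_const.mul (ha.continuous.comp (continuous_id.div_const s))
  · rw [h, norm_mul, norm_real, norm_eq_abs, abs_of_pos (inv_pos.2 hs')]
    refine (mul_le_mul_of_nonneg_left (ha.norm_le _) (inv_pos.2 hs').le).trans (le_of_eq ?_)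
    rw [div_pow, ← sq_abs s]
    have : |s| ^ 2 + x ^ 2 ≠ 0 := by positivity
    have h2 : 1 ^ 2 + x ^ 2 / |s| ^ 2 ≠ 0 := by positivity
    field_simp

/-- A crude bound for a single convolution; it provides the a priori finiteness needed in duality
arguments. -/
lemma IsDecaying.lintegral_enorm_conv_rpow_le {D s : ℝ} {k f : ℝ → ℂ} (hk : IsDecaying D s k)
    (hf : AEStronglyMeasurable f) {q : ℝ} (hq : 1 < q) :
    ∫⁻ x, ‖conv f k x‖ₑ ^ q ≤
      (ofReal D * 16) ^ q * maxConst q * ∫⁻ x, ‖f x‖ₑ ^ q := by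
  calc ∫⁻ x, ‖conv f k x‖ₑ ^ q
      ≤ ∫⁻ x, (ofReal D * 16) ^ q * maxFn (fun y => ‖f y‖ₑ) x ^ q := by
        refine lintegral_mono fun x => ?_
        rw [← mul_rpow_of_nonneg _ _ (by linarith), mul_assoc]
        gcongr
        exact (hk.enorm_conv_le f x).trans (by gcongr; exact cauchyAvg_le_maxFn₀ hk.pos hf.enorm x)
    _ ≤ _ := by
        rw [lintegral_const_mul' _ _ (rpow_ne_top_of_nonneg (by linarith)
          (mul_ne_top ofReal_ne_top (by norm_num))), mul_assoc]
        gcongr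
        exact lintegral_maxFn_rpow_le hq hf.enorm

/-- Hölder's inequality for sums of products, with square functions. -/
lemma lintegral_sum_mul_le {ι : Type*} (s : Finset ι) {u v : ι → ℝ → ℝ≥0∞}
    (hu : ∀ i ∈ s, AEMeasurable (u i)) (hv : ∀ i ∈ s, AEMeasurable (v i))
    {p q : ℝ} (hpq : p.HolderConjugate q) :
    ∫⁻ x, ∑ i ∈ s, u i x * v i x ≤ (∫⁻ x, (∑ i ∈ s, u i x ^ 2) ^ (p / 2)) ^ (1 / p) *
      (∫⁻ x, (∑ i ∈ s, v i x ^ 2) ^ (q / 2)) ^ (1 / q) := by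
  have h1 : ∀ (w : ι → ℝ → ℝ≥0∞), (∀ i ∈ s, AEMeasurable (w i)) →
      AEMeasurable (fun x => (∑ i ∈ s, w i x ^ 2) ^ (1 / 2 : ℝ)) volume := fun w hw =>
    (aemeasurable_fun_sum s fun i hi => (hw i hi).pow_const 2).pow_const _
  calc ∫⁻ x, ∑ i ∈ s, u i x * v i x
      ≤ ∫⁻ x, (∑ i ∈ s, u i x ^ 2) ^ (1 / 2 : ℝ) * (∑ i ∈ s, v i x ^ 2) ^ (1 / 2 : ℝ) := by
        refine lintegral_mono fun x => ?_
        have := ENNReal.inner_le_Lp_mul_Lq s (fun i => u i x) (fun i => v i x) (p := 2) (q := 2)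
          (by constructor <;> norm_num)
        simpa only [rpow_ofNat] using this
    _ ≤ _ := by
        refine (lintegral_mul_le_Lp_mul_Lq volume hpq (h1 u hu) (h1 v hv)).trans
          (le_of_eq ?_)
        simp only [← rpow_mul]
        rw [one_div_mul_eq_div, one_div_mul_eq_div]

/-- The integral of a function with nonnegative values, in the two theories of integration. -/
lemma lintegral_enorm_eq_enorm_integral {h : ℝ → ℂ} (hm : AEStronglyMeasurable h)
    (hh : ∀ x, h x = (‖h x‖ : ℂ)) (hfin : ∫⁻ x, ‖h x‖ₑ ≠ ∞) :
    ∫⁻ x, ‖h x‖ₑ = ‖∫ x, h x‖ₑ := by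
  have : ∫ x, h x = ((∫⁻ x, ‖h x‖ₑ).toReal : ℂ) := by
    rw [← integral_norm_eq_lintegral_enorm hm, ← integral_complex_ofReal]
    exact integral_congr_ae (Eventually.of_forall hh)
  rw [this, ← ofReal_norm, norm_real, norm_of_nonneg ENNReal.toReal_nonneg,
    ofReal_toReal hfin]

/-- A finite quantity that is bounded by `A` times its power of exponent `1 / q` is bounded by
`A ^ p`, where `p` is the exponent conjugate to `q`. -/
lemma le_rpow_of_le_mul_rpow {X A : ℝ≥0∞} {p q : ℝ} (hpq : p.HolderConjugate q) (hX : X ≠ ∞)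
    (h : X ≤ A * X ^ (1 / q)) : X ≤ A ^ p := by
  rcases eq_or_ne X 0 with h0 | h0
  · simp [h0]
  have hp := hpq.pos
  have h1 : X ^ (1 / p) ≤ A := by
    have h2 : X = X ^ (1 / p) * X ^ (1 / q) := by
      rw [← ENNReal.rpow_add _ _ h0 hX]
      simp only [one_div, hpq.inv_add_inv_eq_one, rpow_one]
    have h3 : X ^ (1 / q) ≠ 0 := (ENNReal.rpow_pos (pos_iff_ne_zero.2 h0) hX).ne'
    have h4 : X ^ (1 / q) ≠ ∞ := ENNReal.rpow_ne_top_of_ne_zero h0 hX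
    exact (ENNReal.mul_le_mul_iff_left h3 h4).1 (h2 ▸ h)
  calc X = (X ^ (1 / p)) ^ p := by
        rw [← rpow_mul, one_div_mul_cancel hp.ne', rpow_one]
    _ ≤ A ^ p := by gcongr

lemma IsSymbol.contDiff_invFT {a : ℝ → ℂ} (ha : IsSymbol a) : ContDiff ℝ 2 (invFT a) := by
  have hb : ∀ {b : ℝ → ℂ}, IsSymbol b → IsSymbol fun ξ => I * ξ * b ξ := fun hb =>
    hb.mul_contDiff (b := fun ξ : ℝ => I * ξ)
      (contDiff_const.mul Complex.ofRealCLM.contDiff)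
  have hd : ∀ {b : ℝ → ℂ}, IsSymbol b → deriv (invFT b) = invFT fun ξ => I * ξ * b ξ :=
    fun hb => funext fun x => (hb.hasDerivAt_invFT x).deriv
  have hdiff : ∀ {b : ℝ → ℂ}, IsSymbol b → Differentiable ℝ (invFT b) := fun hb x =>
    (hb.hasDerivAt_invFT x).differentiableAt
  rw [← one_add_one_eq_two, contDiff_succ_iff_deriv, hd ha]
  refine ⟨hdiff ha, by simp, ?_⟩
  rw [contDiff_one_iff_deriv, hd (hb ha)]
  exact ⟨hdiff (hb ha), continuous_invFT (hb (hb ha)).integrable⟩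

/-- Plancherel's identity, for the kernel of a symbol. -/
lemma IsSymbol.lintegral_enorm_invFT_sq {a : ℝ → ℂ} (ha : IsSymbol a) :
    ∫⁻ x, ‖invFT a x‖ₑ ^ 2 = ofReal (2 * π)⁻¹ * ∫⁻ ξ, ‖a ξ‖ₑ ^ 2 := by
  have hsq : ∀ z : ℂ, z * conj z = ((‖z * conj z‖ : ℝ) : ℂ) := fun z => by
    rw [mul_conj, norm_real, norm_of_nonneg (normSq_nonneg z)]
  have hen : ∀ z : ℂ, ‖z * conj z‖ₑ = ‖z‖ₑ ^ 2 := fun z => by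
    rw [enorm_mul, RCLike.enorm_conj, sq]
  obtain ⟨D, hD⟩ := ha.exists_isDecaying
  have ha2 : IsSymbol fun ξ => a ξ * conj (a ξ) := ha.mul ha.star
  have hi : Integrable fun x => invFT a x * conj (invFT a x) :=
    ha.integrable_invFT.mul_bdd (c := ∫ ξ, ‖a ξ‖)
      (Complex.continuous_conj.comp (continuous_invFT ha.integrable)).aestronglyMeasurable
      (ae_of_all _ fun x => by simpa using norm_invFT_le a x)
  have h1 := lintegral_enorm_eq_enorm_integral hi.1 (fun x => hsq _) hi.2.ne
  have h2 := lintegral_enorm_eq_enorm_integral ha2.integrable.1 (fun x => hsq _)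
    ha2.integrable.2.ne
  simp only [hen] at h1 h2
  rw [h1, h2, ha.integral_invFT_mul_conj ha.integrable, enorm_mul]
  congr 1
  rw [← ofReal_norm]
  congr 1
  rw [show (2 * π : ℂ)⁻¹ = (((2 * π)⁻¹ : ℝ) : ℂ) by push_cast; rfl, norm_real,
    norm_of_nonneg (by positivity)]

/-- On the Fourier side a convolution is a product. -/
lemma IsSymbol.conv_eq {f a : ℝ → ℂ} (hf : IsSymbol f) (ha : IsSymbol a) (x : ℝ) :
    conv f (invFT a) x = 2 * π * invFT (fun ξ => invFT f (-ξ) * a ξ) x := by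
  have hpi : (2 * π : ℂ) ≠ 0 := by
    have := Real.pi_ne_zero
    exact_mod_cast (by positivity : (2 * π) ≠ 0)
  have hint : Integrable (fun z : ℝ × ℝ => f z.1 * (a z.2 *
      exp (I * z.2 * (x - z.1 : ℝ)))) (volume.prod volume) := by
    have h4 := (hf.integrable.mul_prod ha.integrable).mul_bdd (c := 1)
      (g := fun z : ℝ × ℝ => exp (I * z.2 * (x - z.1 : ℝ)))
      (by fun_prop) (ae_of_all _ fun z => (norm_exp_I_mul z.2 (x - z.1)).le)
    refine h4.congr (ae_of_all _ fun z => ?_)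
    simp only; ring
  calc conv f (invFT a) x
      = (2 * π : ℂ)⁻¹ * ∫ t, ∫ ξ, f t * (a ξ *
          exp (I * ξ * (x - t : ℝ))) := by
        rw [conv_apply, ← integral_const_mul]
        congr 1; ext t
        rw [integral_const_mul, invFT]; ring
    _ = (2 * π : ℂ)⁻¹ * ∫ ξ, ∫ t, f t * (a ξ *
          exp (I * ξ * (x - t : ℝ))) := by
        rw [integral_integral_swap hint]
    _ = _ := by
        rw [invFT, ← mul_assoc, mul_inv_cancel₀ hpi, one_mul, ← integral_const_mul]
        congr 1; ext ξ
        rw [invFT, mul_assoc, mul_assoc, ← integral_mul_const]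
        congr 2; ext t
        have e : exp (I * ξ * (x - t : ℝ)) =
            exp (I * t * (-ξ : ℝ)) * exp (I * ξ * x) := by
          rw [← exp_add]
          congr 1
          push_cast; ring
        rw [e]; ring

lemma IsSymbol.mul_invFT_neg {f a : ℝ → ℂ} (hf : IsSymbol f) (ha : IsSymbol a) :
    IsSymbol fun ξ => invFT f (-ξ) * a ξ :=
  ha.mul_contDiff (hf.contDiff_invFT.comp contDiff_neg)

/-- The `L²` bound for test functions. -/
lemma IsSymbol.lintegral_conv_sq_le {f a : ℝ → ℂ} (hf : IsSymbol f) (ha : IsSymbol a) {B : ℝ≥0}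
    (hB : ∀ ξ, ‖a ξ‖ₑ ≤ B) : ∫⁻ x, ‖conv f (invFT a) x‖ₑ ^ 2 ≤ B ^ 2 * ∫⁻ x, ‖f x‖ₑ ^ 2 := by
  have hpi : 0 < 2 * π := by positivity
  have he : ‖(2 * π : ℂ)‖ₑ = ofReal (2 * π) := by
    rw [← ofReal_norm, ← norm_of_nonneg hpi.le, ← norm_real]; push_cast; rfl
  have hcan : ofReal (2 * π) * ofReal (2 * π)⁻¹ = 1 := by
    rw [← ofReal_mul hpi.le, mul_inv_cancel₀ hpi.ne', ofReal_one]
  simp_rw [hf.conv_eq ha, enorm_mul _ (invFT _ _), mul_pow, he]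
  set c := ofReal (2 * π)
  set c' := ofReal (2 * π)⁻¹
  rw [lintegral_const_mul' _ _ (by finiteness), (hf.mul_invFT_neg ha).lintegral_enorm_invFT_sq]
  calc _ ≤ c ^ 2 * (c' * ∫⁻ ξ, ‖invFT f (-ξ)‖ₑ ^ 2 * B ^ 2) := by
        gcongr with ξ
        rw [enorm_mul, mul_pow]
        gcongr
        exact hB ξ
    _ = (c * c') ^ 2 * (B ^ 2 * ∫⁻ x, ‖f x‖ₑ ^ 2) := by
        rw [lintegral_mul_const' _ _ (by finiteness),
          lintegral_neg_eq_self (fun ξ => ‖invFT f ξ‖ₑ ^ 2), hf.lintegral_enorm_invFT_sq]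
        ring
    _ = _ := by rw [hcan, one_pow, one_mul]

/-- The `L²` bound for a convolution. -/
lemma IsSymbol.lintegral_conv_sq_le_four {a : ℝ → ℂ} (ha : IsSymbol a) {B : ℝ≥0}
    (hB : ∀ ξ, ‖a ξ‖ₑ ≤ B) {f : ℝ → ℂ} (hfm : AEStronglyMeasurable f)
    (hf : ∫⁻ x, ‖f x‖ₑ ^ 2 < ∞) :
    ∫⁻ x, ‖conv f (invFT a) x‖ₑ ^ 2 ≤ 4 * B ^ 2 * ∫⁻ x, ‖f x‖ₑ ^ 2 := by
  obtain ⟨D, hD⟩ := ha.exists_isDecaying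
  set c : ℝ≥0∞ := (ofReal D * 16) ^ 2 * maxConst 2 with hc
  have hmem : MemLp f 2 volume := ⟨hfm, by
    rw [eLpNorm_lt_top_iff_lintegral_rpow_enorm_lt_top (by norm_num) (by norm_num)]
    simpa using hf⟩
  have key : ∀ ε : ℝ, 0 < ε → ∫⁻ x, ‖conv f (invFT a) x‖ₑ ^ 2 ≤
      4 * B ^ 2 * (∫⁻ x, ‖f x‖ₑ ^ 2) + (4 * B ^ 2 + 2 * c) * ofReal (ε ^ 2) := by
    intro ε hε
    obtain ⟨g, hg1, hg2, hg3⟩ := hmem.exist_eLpNorm_sub_le (by norm_num) (by norm_num) hε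
    have hgs : IsSymbol g := ⟨hg2.of_le (by norm_cast), hg1⟩
    have hgm : AEStronglyMeasurable g := hgs.continuous.aestronglyMeasurable
    have hd : ∫⁻ x, ‖(f - g) x‖ₑ ^ 2 ≤ ofReal (ε ^ 2) := by
      rw [eLpNorm_eq_lintegral_rpow_enorm_toReal (by norm_num) (by norm_num)] at hg3
      have := rpow_le_rpow hg3 (z := 2) (by norm_num)
      rw [← rpow_mul] at this
      simpa [ofReal_pow hε.le] using this
    have hgf : ∫⁻ x, ‖g x‖ₑ ^ 2 ≤ 2 * (∫⁻ x, ‖f x‖ₑ ^ 2) + 2 * ofReal (ε ^ 2) := by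
      calc ∫⁻ x, ‖g x‖ₑ ^ 2 ≤ ∫⁻ x, (2 * ‖f x‖ₑ ^ 2 + 2 * ‖(f - g) x‖ₑ ^ 2) := by
            refine lintegral_mono fun x => ?_
            have := enorm_add_sq_le (f x) (-(f - g) x)
            rwa [enorm_neg, Pi.sub_apply, ← sub_eq_add_neg, sub_sub_cancel] at this
        _ = 2 * (∫⁻ x, ‖f x‖ₑ ^ 2) + 2 * ∫⁻ x, ‖(f - g) x‖ₑ ^ 2 := by
            rw [lintegral_add_left' ((hfm.enorm.pow_const 2).const_mul 2),
              lintegral_const_mul' _ _ (by norm_num), lintegral_const_mul' _ _ (by norm_num)]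
        _ ≤ _ := by gcongr
    have htame : Tame f := tame_of_lintegral_rpow hfm one_le_two (by simpa using hf)
    have hgt : Tame g := tame_of_lintegral_rpow hgm one_le_two (by
      simp only [rpow_ofNat]
      exact hgf.trans_lt (by finiteness))
    calc ∫⁻ x, ‖conv f (invFT a) x‖ₑ ^ 2
        ≤ ∫⁻ x, (2 * ‖conv g (invFT a) x‖ₑ ^ 2 + 2 * ‖conv (f - g) (invFT a) x‖ₑ ^ 2) := by
          refine lintegral_mono fun x => le_of_eq_of_le ?_ (enorm_add_sq_le _ _)
          rw [hD.conv_sub htame hgt, add_sub_cancel]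
      _ = 2 * (∫⁻ x, ‖conv g (invFT a) x‖ₑ ^ 2) + 2 * ∫⁻ x, ‖conv (f - g) (invFT a) x‖ₑ ^ 2 := by
          rw [lintegral_add_left' (((ha.aestronglyMeasurable_conv hgm).enorm.pow_const 2).const_mul 2), lintegral_const_mul' _ _ (by norm_num),
            lintegral_const_mul' _ _ (by norm_num)]
      _ ≤ 2 * (B ^ 2 * ∫⁻ x, ‖g x‖ₑ ^ 2) + 2 * (c * ∫⁻ x, ‖(f - g) x‖ₑ ^ 2) := by
          gcongr
          · exact hgs.lintegral_conv_sq_le ha hB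
          · simpa only [rpow_ofNat, hc] using hD.lintegral_enorm_conv_rpow_le (hfm.sub hgm) one_lt_two
      _ ≤ 2 * (B ^ 2 * (2 * (∫⁻ x, ‖f x‖ₑ ^ 2) + 2 * ofReal (ε ^ 2))) +
            2 * (c * ofReal (ε ^ 2)) := by gcongr
      _ = _ := by ring
  have hlim : Tendsto (fun ε : ℝ => 4 * B ^ 2 * (∫⁻ x, ‖f x‖ₑ ^ 2) +
      (4 * B ^ 2 + 2 * c) * ofReal (ε ^ 2)) (𝓝[>] 0)
      (𝓝 (4 * B ^ 2 * (∫⁻ x, ‖f x‖ₑ ^ 2) + (4 * B ^ 2 + 2 * c) * ofReal (0 ^ 2))) :=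
    Tendsto.const_add _ (ENNReal.Tendsto.const_mul
      (ENNReal.continuous_ofReal.comp (continuous_pow 2)).continuousWithinAt
      (Or.inr (by finiteness)))
  have := ge_of_tendsto hlim (by filter_upwards [self_mem_nhdsWithin] with ε hε using key ε hε)
  simpa using this

/-! ### The Calderón–Zygmund theorem for multipliers -/

/-- The hypotheses of the Calderón–Zygmund theorem for the multiplier `a`: its size and Hörmander's
regularity condition for its kernel, both with constant `B`. -/
structure IsMultiplier (B : ℝ≥0) (a : ℝ → ℂ) : Prop where
  isSymbol : IsSymbol a
  enorm_le : ∀ ξ, ‖a ξ‖ₑ ≤ B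
  hormander : ∀ y, ∫⁻ x in {x : ℝ | 2 * |y| ≤ |x|}, ‖invFT a (x - y) - invFT a x‖ₑ ≤ B

/-- Against a function with mean zero on each component of `U`, the kernel may be recentred at the
midpoints of the components. -/
lemma enorm_conv_le_of_mean_zero {k : ℝ → ℂ} (hk : Continuous k) {D : ℝ} (hD : ∀ x, ‖k x‖ ≤ D)
    {U : Set ℝ} (ho : IsOpen U) (hU : volume U ≠ ∞) {b : ℝ → ℂ} (hb : IntegrableOn b U volume)
    (hb0 : ∀ p ∈ components U, ∫ y in Ioo p.1 p.2, b y = 0) (hbU : ∀ y ∉ U, b y = 0) (x : ℝ) :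
    ‖conv b k x‖ₑ ≤ ∫⁻ y in U,
      ‖b y‖ₑ * ‖k (x - y) - k (x - (leftEnd U y + rightEnd U y) / 2)‖ₑ := by
  set c : ℝ → ℝ := fun y => (leftEnd U y + rightEnd U y) / 2 with hc
  have hcm : Measurable c :=
    ((monotone_leftEnd hU).measurable.add (monotone_rightEnd hU).measurable).div_const 2
  have hint : ∀ d : ℝ → ℝ, Measurable d → IntegrableOn (fun y => b y * k (x - d y)) U volume :=
    fun d hd => hb.mul_bdd (c := D) (hk.measurable.comp (hd.const_sub x)).aestronglyMeasurable
      (ae_of_all _ fun y => hD _)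
  have h0 : ∫ y in U, b y * k (x - c y) = 0 := by
    have h := integral_iUnion (μ := volume) (f := fun y => b y * k (x - c y))
      (fun p : components U => measurableSet_Ioo (a := p.1.1) (b := p.1.2))
      pairwise_disjoint_components (by rw [iUnion_components ho hU]; exact hint c hcm)
    rw [iUnion_components ho hU] at h
    rw [h]
    refine (tsum_congr fun p => ?_).trans tsum_zero
    rw [setIntegral_congr_fun (g := fun y => b y * k (x - (p.1.1 + p.1.2) / 2)) measurableSet_Ioo
      fun y hy => by simp only [hc, (ends_eq ho hU p.2 hy).1, (ends_eq ho hU p.2 hy).2],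
      integral_mul_const, hb0 p.1 p.2, zero_mul]
  have h1 : conv b k x = ∫ y in U, b y * (k (x - y) - k (x - c y)) := by
    rw [conv_apply, ← setIntegral_eq_integral_of_forall_compl_eq_zero (s := U)
      (fun y hy => by rw [hbU y hy, zero_mul])]
    have h2 := integral_sub (hint id measurable_id) (hint c hcm)
    simp only [id] at h2
    simp_rw [mul_sub]
    rw [h2, h0, sub_zero]
  rw [h1]
  exact (enorm_integral_le_lintegral_enorm _).trans_eq (lintegral_congr fun y => enorm_mul _ _)

/-- The distribution function estimate behind the Calderón–Zygmund theorem. -/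
lemma IsMultiplier.volume_lt_conv_le {B : ℝ≥0} {a : ℝ → ℂ} (ha : IsMultiplier B a)
    {q : ℝ} (hq : 1 < q) (hq2 : q < 2) {f : ℝ → ℂ} (hfm : StronglyMeasurable f)
    (hf : ∫⁻ y, ‖f y‖ₑ ^ q < ∞) {l : ℝ≥0∞} (hl : l ≠ 0) (hl' : l ≠ ∞) :
    volume {x | 2 * l < ‖conv f (invFT a) x‖ₑ} ≤
      4 * B ^ 2 / l ^ 2 * (∫⁻ x, min (maxFn (‖f ·‖ₑ) x) l ^ 2) +
        (2 * B + 16) * volume {x | l < maxFn (‖f ·‖ₑ) x} := by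
  have hFm : Measurable fun y => ‖f y‖ₑ := hfm.enorm
  have hq0 : 0 < q := by linarith
  obtain ⟨D, hD⟩ := ha.isSymbol.exists_isDecaying
  have hk := hD.continuous
  set k := invFT a
  have hD' : ∀ x, ‖k x‖ ≤ ∫ ξ, ‖a ξ‖ := norm_invFT_le a
  have ho := isOpen_lt_maxFn (‖f ·‖ₑ) l
  set M := maxFn (‖f ·‖ₑ)
  have hMm : Measurable M := measurable_maxFn _
  have hM : ∫⁻ x, M x ^ q < ∞ := by
    obtain ⟨C, hC⟩ := exists_lintegral_maxFn_rpow_le hq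
    exact (hC _ hFm).trans_lt (mul_lt_top coe_lt_top hf)
  have hUfin : volume {x | l < M x} ≠ ∞ := by
    refine ((measure_mono fun x hx => rpow_le_rpow (le_of_lt hx) hq0.le).trans_lt
      ((meas_ge_le_lintegral_div (ε := l ^ q) (hMm.pow_const q).aemeasurable ?_ ?_).trans_lt
        (ENNReal.div_lt_top hM.ne ?_))).ne <;> simp [hl, hl', hq0.not_gt]
  set U := {x | l < M x} with hUdef
  set g := goodPart U f with hg
  set b : ℝ → ℂ := f - g with hbdef
  have hgm : AEStronglyMeasurable g :=
    aestronglyMeasurable_goodPart ho hUfin hfm.aestronglyMeasurable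
  have hfloc : LocallyIntegrable f volume := by
    refine MemLp.locallyIntegrable (p := ofReal q) ⟨hfm.aestronglyMeasurable, ?_⟩
      (ENNReal.one_le_ofReal.2 hq.le)
    rwa [eLpNorm_lt_top_iff_lintegral_rpow_enorm_lt_top (by simpa using hq0) ofReal_ne_top,
      toReal_ofReal hq0.le]
  -- the good part is bounded by `l` and square integrable
  have hgle : ∀ᵐ x, ‖g x‖ₑ ≤ min (M x) l := by
    filter_upwards [ae_enorm_le_maxFn hfloc] with x hx
    by_cases h : x ∈ U
    · rw [min_eq_right (le_of_lt h)]; exact enorm_goodPart_le hUfin h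
    · rw [min_eq_left (not_lt.1 h), hg, goodPart_of_notMem f h]; exact hx
  have hfU : ∫⁻ y in U, ‖f y‖ₑ ≤ l * volume U := lintegral_lt_maxFn_le hUfin
  have hgU : ∫⁻ y in U, ‖g y‖ₑ ≤ l * volume U := by
    rw [← setLIntegral_const]
    exact lintegral_mono_ae (ae_restrict_of_ae (hgle.mono fun x hx => hx.trans (min_le_right _ _)))
  have hlU : l * volume U < ∞ := mul_lt_top hl'.lt_top hUfin.lt_top
  have hfi : IntegrableOn f U volume := ⟨hfm.aestronglyMeasurable, hfU.trans_lt hlU⟩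
  have hgi : IntegrableOn g U volume := ⟨hgm.restrict, hgU.trans_lt hlU⟩
  have hg2 : ∫⁻ y, ‖g y‖ₑ ^ 2 ≤ ∫⁻ y, min (M y) l ^ 2 :=
    lintegral_mono_ae (hgle.mono fun x hx => pow_le_pow_left' hx 2)
  have hg2fin : ∫⁻ y, ‖g y‖ₑ ^ 2 < ∞ := by
    refine hg2.trans_lt (lt_of_le_of_lt (b := l ^ (2 - q) * ∫⁻ y, M y ^ q) ?_
      (mul_lt_top (rpow_lt_top_of_nonneg (by linarith) hl') hM))
    rw [← lintegral_const_mul _ (by fun_prop)]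
    refine lintegral_mono fun y => ?_
    rw [← rpow_ofNat, ← sub_add_cancel 2 q, rpow_add_of_nonneg _ _ (by linarith) hq0.le,
      sub_add_cancel]
    have : 0 ≤ 2 - q := by linarith
    gcongr
    exacts [min_le_right _ _, min_le_left _ _]
  -- the bad part
  have hbU : ∀ y ∉ U, b y = 0 := fun y hy => by
    simp only [hbdef, hg, Pi.sub_apply, goodPart_of_notMem f hy, sub_self]
  have hbi : IntegrableOn b U volume := hfi.sub hgi
  have hb0 : ∀ p ∈ components U, ∫ y in Ioo p.1 p.2, b y = 0 := by
    intro p hp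
    have h1 : ∫ y in Ioo p.1 p.2, g y = ∫ y in Ioo p.1 p.2, (⨍ z in Ioo p.1 p.2, f z) :=
      setIntegral_congr_fun measurableSet_Ioo fun y hy => goodPart_of_mem ho hUfin f hp hy
    have : IsFiniteMeasure (volume.restrict (Ioo p.1 p.2)) := ⟨by simp⟩
    simp only [hbdef, Pi.sub_apply]
    rw [integral_sub (hfi.mono_set hp.2.1) (hgi.mono_set hp.2.1), h1, integral_average, sub_self]
  have hbnorm : ∫⁻ y in U, ‖b y‖ₑ ≤ 2 * l * volume U := by
    calc ∫⁻ y in U, ‖b y‖ₑ ≤ ∫⁻ y in U, (‖f y‖ₑ + ‖g y‖ₑ) :=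
          lintegral_mono fun y => enorm_sub_le
      _ = (∫⁻ y in U, ‖f y‖ₑ) + ∫⁻ y in U, ‖g y‖ₑ := lintegral_add_left hFm _
      _ ≤ l * volume U + l * volume U := add_le_add hfU hgU
      _ = _ := by ring
  -- the enlarged exceptional set
  set V := {x | 4⁻¹ < maxFn (U.indicator 1) x} with hV
  have hVm : MeasurableSet V := (isOpen_lt_maxFn _ _).measurableSet
  have hVle : volume V ≤ 16 * volume U := by
    refine (volume_lt_maxFn_le _ (by norm_num) (by norm_num)).trans (le_of_eq ?_)
    rw [lintegral_indicator_one ho.measurableSet, ENNReal.div_eq_inv_mul, inv_inv, ← mul_assoc]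
    norm_num
  have hfar : ∀ x ∉ V, ∀ p ∈ components U, p.2 - p.1 ≤ |x - (p.1 + p.2) / 2| := by
    intro x hx p hp
    by_contra! hlt
    refine hx ?_
    have hx1 := abs_lt.1 hlt
    have hlen : 0 < p.2 - p.1 := sub_pos.2 hp.1
    set d := p.2 - p.1 with hd
    have hmem : x ∈ Ioo (p.1 - d / 2) (p.2 + d / 2) := by constructor <;> linarith
    refine lt_of_lt_of_le ?_ (average_le_maxFn _ hmem)
    have h1 : ofReal d ≤ ∫⁻ y in Ioo (p.1 - d / 2) (p.2 + d / 2), U.indicator 1 y := by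
      rw [lintegral_indicator_one ho.measurableSet, Measure.restrict_apply ho.measurableSet,
        hd, ← volume_Ioo]
      exact measure_mono fun y hy => ⟨hp.2.1 hy, by constructor <;> linarith [hy.1, hy.2]⟩
    refine lt_of_lt_of_le ?_ (ENNReal.div_le_div_right h1 _)
    rw [← ofReal_div_of_pos (by linarith), show p.2 + d / 2 - (p.1 - d / 2) = 2 * d by
      rw [hd]; ring, show d / (2 * d) = 1 / 2 by field_simp]
    rw [show (4⁻¹ : ℝ≥0∞) = ofReal (1 / 4) by
      rw [ofReal_div_of_pos (by norm_num)]; norm_num]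
    exact (ENNReal.ofReal_lt_ofReal_iff (by norm_num)).2 (by norm_num)
  set c : ℝ → ℝ := fun y => (leftEnd U y + rightEnd U y) / 2 with hc
  have hcm : Measurable c :=
    ((monotone_leftEnd hUfin).measurable.add (monotone_rightEnd hUfin).measurable).div_const 2
  set W : ℝ → ℝ≥0∞ := fun x => ∫⁻ y in U, ‖b y‖ₑ * ‖k (x - y) - k (x - c y)‖ₑ with hW
  have hprod : AEMeasurable (fun z : ℝ × ℝ => ‖b z.2‖ₑ * ‖k (z.1 - z.2) - k (z.1 - c z.2)‖ₑ)
      (volume.prod (volume.restrict U)) := by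
    refine AEMeasurable.mul (hbi.1.comp_snd).enorm ?_
    have := hk.measurable
    fun_prop
  have hWm : AEMeasurable W := hprod.lintegral_prod_right'
  have hWint : ∫⁻ x in Vᶜ, W x ≤ B * (2 * l * volume U) := by
    calc ∫⁻ x in Vᶜ, W x
        = ∫⁻ y in U, ∫⁻ x in Vᶜ, ‖b y‖ₑ * ‖k (x - y) - k (x - c y)‖ₑ := by
          rw [hW, lintegral_lintegral_swap]
          exact hprod.mono_measure (Measure.prod_mono Measure.restrict_le_self le_rfl)
      _ ≤ ∫⁻ y in U, B * ‖b y‖ₑ := by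
          refine setLIntegral_mono' ho.measurableSet fun y hy => ?_
          rw [lintegral_const_mul' _ _ enorm_ne_top, mul_comm]
          gcongr
          obtain ⟨hp, hyp⟩ := ends_mem_components ho hUfin hy
          calc ∫⁻ x in Vᶜ, ‖k (x - y) - k (x - c y)‖ₑ
              ≤ ∫⁻ x, {x | 2 * |y - c y| ≤ |x|}.indicator
                  (fun x => ‖k (x - (y - c y)) - k x‖ₑ) (x - c y) := by
                rw [← lintegral_indicator hVm.compl]
                refine lintegral_mono fun x => ?_
                by_cases hx : x ∈ Vᶜ
                · rw [indicator_of_mem hx, indicator_of_mem, sub_sub_sub_cancel_right]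
                  have h1 := hfar x hx _ hp
                  have h2 : |y - c y| ≤ (rightEnd U y - leftEnd U y) / 2 := by
                    rw [abs_le]; constructor <;> simp only [hc] <;> linarith [hyp.1, hyp.2]
                  change 2 * |y - c y| ≤ |x - c y|
                  simp only at h1
                  linarith
                · rw [indicator_of_notMem hx]; exact zero_le
            _ = ∫⁻ x in {x | 2 * |y - c y| ≤ |x|}, ‖k (x - (y - c y)) - k x‖ₑ := by
                rw [lintegral_sub_right_eq_self (fun x => {x | 2 * |y - c y| ≤ |x|}.indicator
                  (fun x => ‖k (x - (y - c y)) - k x‖ₑ) x), lintegral_indicator]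
                exact measurableSet_le measurable_const (by fun_prop)
            _ ≤ B := ha.hormander _
      _ = B * ∫⁻ y in U, ‖b y‖ₑ := lintegral_const_mul' _ _ coe_ne_top
      _ ≤ _ := by gcongr
  -- assembling the three pieces
  have hTg : AEMeasurable (fun x => ‖conv g k x‖ₑ) volume :=
    (ha.isSymbol.aestronglyMeasurable_conv hgm).enorm
  have hsub : {x | 2 * l < ‖conv f k x‖ₑ} ⊆
      {x | l ^ 2 ≤ ‖conv g k x‖ₑ ^ 2} ∪ (V ∪ ({x | l ≤ W x} ∩ Vᶜ)) := by
    intro x hx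
    by_cases hxV : x ∈ V
    · exact Or.inr (Or.inl hxV)
    by_cases hxg : l ≤ ‖conv g k x‖ₑ
    · exact Or.inl (pow_le_pow_left' hxg 2)
    refine Or.inr (Or.inr ⟨?_, hxV⟩)
    by_contra hW'
    have h1 := enorm_conv_le_of_mean_zero hk hD' ho hUfin hbi hb0 hbU x
    have h3 : ‖conv f k x‖ₑ ≤ l + l := by
      rw [← add_sub_cancel (conv g k x) (conv f k x), ← hD.conv_sub
        (tame_of_lintegral_rpow hfm.aestronglyMeasurable hq.le hf)
        (tame_of_lintegral_rpow hgm one_le_two (by simpa using hg2fin))]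
      exact (enorm_add_le _ _).trans (add_le_add (not_le.1 hxg).le (h1.trans (not_le.1 hW').le))
    rw [← two_mul] at h3
    exact absurd hx (not_lt.2 h3)
  calc volume {x | 2 * l < ‖conv f k x‖ₑ}
      ≤ volume {x | l ^ 2 ≤ ‖conv g k x‖ₑ ^ 2} +
        (volume V + volume ({x | l ≤ W x} ∩ Vᶜ)) :=
        (measure_mono hsub).trans ((measure_union_le _ _).trans
          (by gcongr; exact measure_union_le _ _))
    _ ≤ 4 * B ^ 2 / l ^ 2 * (∫⁻ x, min (M x) l ^ 2) +
          (16 * volume U + 2 * B * volume U) := by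
        gcongr ?_ + (?_ + ?_)
        · refine (meas_ge_le_lintegral_div (by fun_prop) (by simp [hl]) (by simp [hl'])).trans ?_
          rw [div_eq_mul_inv, div_eq_mul_inv, mul_right_comm]
          gcongr
          exact (ha.isSymbol.lintegral_conv_sq_le_four ha.enorm_le hgm hg2fin).trans (by gcongr)
        · rw [← Measure.restrict_apply' hVm.compl]
          refine (meas_ge_le_lintegral_div hWm.restrict hl hl').trans
            (ENNReal.div_le_of_le_mul (hWint.trans (le_of_eq ?_)))
          ring
    _ = _ := by ring

/-- The square of the truncation of `M` at height `l`, as a sum over dyadic heights. -/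
lemma min_sq_le_tsum {M : ℝ → ℝ≥0∞} {l : ℝ≥0∞} (hl' : l ≠ ∞) (x : ℝ) :
    min (M x) l ^ 2 ≤
      l ^ 2 * ∑' k : ℕ, 4⁻¹ ^ k * {x | l < 2 ^ (k + 1) * M x}.indicator 1 x := by
  by_cases hz : M x = 0
  · simp [hz]
  have hex : ∃ n : ℕ, l < 2 ^ (n + 1) * M x := by
    obtain ⟨n, hn⟩ := ENNReal.exists_nat_mul_gt hz hl'
    refine ⟨n, hn.trans_le ?_⟩
    gcongr
    exact_mod_cast (Nat.lt_succ_self n).le.trans Nat.lt_two_pow_self.le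
  classical
  refine le_trans ?_ (mul_le_mul_right (ENNReal.le_tsum (Nat.find hex)) _)
  rw [indicator_of_mem (by exact Nat.find_spec hex), Pi.one_apply, mul_one]
  have h : min (M x) l ≤ l * 2⁻¹ ^ Nat.find hex := by
    rcases hk : Nat.find hex with - | j
    · simp
    refine (min_le_left _ _).trans ?_
    rw [← ENNReal.inv_pow, ← div_eq_mul_inv, ENNReal.le_div_iff_mul_le (by simp) (by simp), mul_comm]
    exact not_lt.1 (Nat.find_min hex (hk ▸ j.lt_succ_self))
  refine (pow_le_pow_left' h 2).trans (le_of_eq ?_)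
  rw [mul_pow, ← pow_mul, mul_comm _ 2, pow_mul,
    ← ENNReal.inv_pow]
  norm_num

/-- The Calderón–Zygmund theorem on `L^q`, `1 < q < 2`. -/
lemma exists_lintegral_conv_rpow_le_of_lt_two {q : ℝ} (hq : 1 < q) (hq2 : q < 2) (B : ℝ≥0) :
    ∃ C : ℝ≥0, ∀ a : ℝ → ℂ, IsMultiplier B a → ∀ f : ℝ → ℂ, AEStronglyMeasurable f →
      ∫⁻ y, ‖f y‖ₑ ^ q < ∞ → ∫⁻ x, ‖conv f (invFT a) x‖ₑ ^ q ≤ C * ∫⁻ y, ‖f y‖ₑ ^ q := by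
  have hq0 : 0 < q := by linarith
  obtain ⟨C, hC⟩ := exists_lintegral_maxFn_rpow_le hq
  refine ⟨((4 * B ^ 2 + 2 * B + 16) * ∑' k : ℕ, 4⁻¹ ^ k * (2 ^ (k + 2)) ^ q : ℝ≥0∞).toNNReal * C,
    fun a ha f hfm hf => ?_⟩
  have hsum : ∑' k : ℕ, 4⁻¹ ^ k * (2 ^ (k + 2)) ^ q ≠ (∞ : ℝ≥0∞) := by
    have h : (4⁻¹ * 2 ^ q : ℝ≥0∞) < 1 := by
      rw [← ENNReal.div_eq_inv_mul, ENNReal.div_lt_iff (by simp) (by simp), one_mul]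
      refine (ENNReal.rpow_lt_rpow_of_exponent_lt (by norm_num) (by norm_num) hq2).trans_eq ?_
      norm_num
    have e : ∀ k : ℕ, ((2 : ℝ≥0∞) ^ k) ^ q = (2 ^ q) ^ k := fun k => by
      simp_rw [← rpow_natCast, ← rpow_mul, mul_comm]
    simp_rw [pow_add, mul_rpow_of_nonneg _ _ hq0.le, ← mul_assoc, e,
      ← mul_pow, ENNReal.tsum_mul_right, ENNReal.tsum_geometric]
    have := tsub_pos_of_lt h
    finiteness
  -- a strongly measurable representative
  wlog hfs : StronglyMeasurable f generalizing f
  · have h1 : ∫⁻ y, ‖f y‖ₑ ^ q = ∫⁻ y, ‖hfm.mk f y‖ₑ ^ q :=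
      lintegral_congr_ae (hfm.ae_eq_mk.mono fun x hx => by simp only [hx])
    have h2 : ∀ x, conv f (invFT a) x = conv (hfm.mk f) (invFT a) x := fun x =>
      integral_congr_ae (hfm.ae_eq_mk.mono fun y hy => by simp only [hy])
    simp_rw [h1, h2]
    exact this (hfm.mk f) hfm.stronglyMeasurable_mk.aestronglyMeasurable (h1 ▸ hf)
      hfm.stronglyMeasurable_mk
  have hM := hC _ hfs.enorm
  set M := maxFn (‖f ·‖ₑ)
  have hMm : Measurable M := measurable_maxFn _
  have hvm : ∀ k : ℕ, Measurable fun t : ℝ =>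
      volume {x | ofReal t < 2 ^ (k + 2) * M x} * ofReal (t ^ (q - 1)) := fun k =>
    (measurable_measure_prodMk_left (ν := volume)
      (s := {z : ℝ × ℝ | ofReal z.1 < 2 ^ (k + 2) * M z.2})
      (measurableSet_lt (by fun_prop) (by fun_prop))).mul (by fun_prop)
  have hpt : ∀ t ∈ Ioi (0 : ℝ), volume {x | ofReal t < ‖conv f (invFT a) x‖ₑ} ≤
      (4 * B ^ 2 + 2 * B + 16) * ∑' k : ℕ, 4⁻¹ ^ k * volume {x | ofReal t < 2 ^ (k + 2) * M x} := by
    intro t (ht : 0 < t)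
    set l := ofReal (t / 2) with hl
    have h2 : ofReal t = 2 * l := by
      rw [← ofReal_ofNat 2, ← ofReal_mul (by norm_num)]; congr 1; ring
    have hl0 : l ≠ 0 := by simpa [hl] using ht
    have hl' : l ≠ ∞ := ofReal_ne_top
    have hms : ∀ k : ℕ, MeasurableSet {x | l < 2 ^ (k + 1) * M x} := fun k =>
      measurableSet_lt measurable_const (by fun_prop)
    have hset : ∀ k : ℕ, {x | ofReal t < 2 ^ (k + 2) * M x} = {x | l < 2 ^ (k + 1) * M x} :=
      fun k => by
        ext x
        rw [mem_ofPred_eq, h2, pow_succ' 2 (k + 1), mul_assoc,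
          ENNReal.mul_lt_mul_iff_right (by norm_num) (by norm_num)]; rfl
    simp_rw [hset]
    set T := ∑' k : ℕ, 4⁻¹ ^ k * volume {x | l < 2 ^ (k + 1) * M x} with hT
    have h3 : ∫⁻ x, min (M x) l ^ 2 ≤ l ^ 2 * T := by
      refine (lintegral_mono (min_sq_le_tsum hl')).trans (le_of_eq ?_)
      rw [lintegral_const_mul' _ _ (by finiteness), lintegral_tsum fun k =>
        ((measurable_one.indicator (hms k)).const_mul _).aemeasurable]
      simp_rw [lintegral_const_mul _ (measurable_one.indicator (hms _)),
        lintegral_indicator_one (hms _), hT]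
    have h4 : volume {x | l < M x} ≤ T := by
      refine (measure_mono (t := {x | l < 2 ^ (0 + 1) * M x}) fun x hx => ?_).trans ((le_of_eq (by simp)).trans (ENNReal.le_tsum 0))
      exact lt_of_lt_of_le (b := M x) hx (le_mul_of_one_le_left zero_le (by norm_num))
    rw [h2]
    calc _ ≤ _ := ha.volume_lt_conv_le hq hq2 hfs hf hl0 hl'
      _ ≤ 4 * B ^ 2 / l ^ 2 * (l ^ 2 * T) + (2 * B + 16) * T := by gcongr
      _ = _ := by
        rw [← mul_assoc, ENNReal.div_mul_cancel (by simpa using hl0) (by finiteness)]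
        ring
  rw [lintegral_rpow_eq_lintegral_meas_lt
    (ha.isSymbol.aestronglyMeasurable_conv hfm).enorm hq0]
  calc _ ≤ ofReal q * ∫⁻ t in Ioi (0 : ℝ), (4 * B ^ 2 + 2 * B + 16) * ∑' k : ℕ, 4⁻¹ ^ k *
          (volume {x | ofReal t < 2 ^ (k + 2) * M x} * ofReal (t ^ (q - 1))) := by
        gcongr ofReal q * ?_
        refine setLIntegral_mono' measurableSet_Ioi fun t ht =>
          (mul_le_mul_left (hpt t ht) _).trans (le_of_eq ?_)
        simp_rw [mul_assoc, ← ENNReal.tsum_mul_right, mul_assoc]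
    _ = (4 * B ^ 2 + 2 * B + 16) * ∑' k : ℕ, 4⁻¹ ^ k * (ofReal q * ∫⁻ t in Ioi (0 : ℝ),
          volume {x | ofReal t < 2 ^ (k + 2) * M x} * ofReal (t ^ (q - 1))) := by
        rw [lintegral_const_mul' _ _ (by finiteness),
          lintegral_tsum fun k => ((hvm k).const_mul _).aemeasurable]
        simp_rw [lintegral_const_mul _ (hvm _), mul_left_comm (ofReal q), ← ENNReal.tsum_mul_left,
          mul_left_comm (ofReal q)]
    _ ≤ (4 * B ^ 2 + 2 * B + 16) * ∑' k : ℕ, 4⁻¹ ^ k * ((2 ^ (k + 2)) ^ q * (C * ∫⁻ y, ‖f y‖ₑ ^ q)) := by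
        gcongr _ * ∑' k : ℕ, _ * ?_ with k
        rw [← lintegral_rpow_eq_lintegral_meas_lt (by fun_prop) hq0]
        simp_rw [mul_rpow_of_nonneg _ _ hq0.le]
        rw [lintegral_const_mul _ (by fun_prop)]
        gcongr
    _ = _ := by
        rw [coe_mul, coe_toNNReal (by finiteness)]
        simp_rw [← mul_assoc, ENNReal.tsum_mul_right, mul_assoc]

/-! ### Multipliers and square functions on `L^q` -/

lemma lintegral_sum_sq_lt_top {ι : Type*} {s : Finset ι} {u : ι → ℝ → ℝ≥0∞}
    (hum : ∀ i ∈ s, AEMeasurable (u i)) {q : ℝ} (hq : 0 < q)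
    (hu : ∀ i ∈ s, ∫⁻ x, u i x ^ q < ∞) : ∫⁻ x, (∑ i ∈ s, u i x ^ 2) ^ (q / 2) < ∞ := by
  have h : ∀ x, (∑ i ∈ s, u i x ^ 2) ^ (q / 2) ≤
      (s.card : ℝ≥0∞) ^ (q / 2) * ∑ i ∈ s, u i x ^ q := by
    intro x
    rcases s.eq_empty_or_nonempty with rfl | hs
    · simp [hq]
    obtain ⟨j, hj, hmax⟩ := s.exists_max_image (fun i => u i x ^ 2) hs
    calc (∑ i ∈ s, u i x ^ 2) ^ (q / 2) ≤ (s.card • (u j x ^ 2)) ^ (q / 2) := by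
          gcongr
          exact sum_le_card_nsmul _ _ _ hmax
      _ = (s.card : ℝ≥0∞) ^ (q / 2) * u j x ^ q := by
          rw [nsmul_eq_mul, mul_rpow_of_nonneg _ _ (by positivity), sq_rpow_half]
      _ ≤ _ := by
          gcongr
          exact single_le_sum (f := fun i => u i x ^ q) (fun _ _ => zero_le) hj
  refine (lintegral_mono h).trans_lt ?_
  rw [lintegral_const_mul' _ _ (rpow_ne_top_of_nonneg (by positivity)
    (ENNReal.natCast_ne_top _)), lintegral_finsetSum' _ fun i hi => (hum i hi).pow_const q]
  exact mul_lt_top (rpow_lt_top_of_nonneg (by positivity)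
    (ENNReal.natCast_ne_top _)) (ENNReal.sum_lt_top.2 hu)

lemma lintegral_mul_lt_top {p q : ℝ} (hpq : p.HolderConjugate q) {u v : ℝ → ℝ≥0∞}
    (hum : AEMeasurable u) (hvm : AEMeasurable v) (hu : ∫⁻ x, u x ^ p < ∞)
    (hv : ∫⁻ x, v x ^ q < ∞) : ∫⁻ x, u x * v x < ∞ :=
  (lintegral_mul_le_Lp_mul_Lq volume hpq hum hvm).trans_lt (mul_lt_top
    (rpow_lt_top_of_nonneg (by have := hpq.pos; positivity) hu.ne)
    (rpow_lt_top_of_nonneg (by have := hpq.symm.pos; positivity) hv.ne))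

lemma lintegral_cauchyAvg_rpow_lt_top {f : ℝ → ℝ≥0∞} (hf : AEMeasurable f) {q : ℝ}
    (hq : 1 < q) (hfin : ∫⁻ x, f x ^ q < ∞) {s : ℝ} (hs : 0 < s) :
    ∫⁻ x, cauchyAvg s f x ^ q < ∞ := by
  calc ∫⁻ x, cauchyAvg s f x ^ q ≤ ∫⁻ x, 16 ^ q * maxFn f x ^ q := by
        refine lintegral_mono fun x => ?_
        rw [← mul_rpow_of_nonneg _ _ (by linarith)]
        gcongr
        exact cauchyAvg_le_maxFn₀ hs hf x
    _ < ∞ := by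
        rw [lintegral_const_mul' _ _ (rpow_ne_top_of_nonneg (by linarith) (by norm_num))]
        exact mul_lt_top (rpow_lt_top_of_nonneg (by linarith) (by norm_num))
          ((lintegral_maxFn_rpow_le hq hf).trans_lt (mul_lt_top coe_lt_top hfin))

lemma IsDecaying.lintegral_conv_lt_top {D s q : ℝ} {k f : ℝ → ℂ} (hk : IsDecaying D s k)
    (hf : AEStronglyMeasurable f) (hq : 1 < q) (hfq : ∫⁻ x, ‖f x‖ₑ ^ q < ∞) :
    ∫⁻ x, ‖conv f k x‖ₑ ^ q < ∞ :=
  (hk.lintegral_enorm_conv_rpow_le hf hq).trans_lt (mul_lt_top (mul_lt_top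
    (rpow_lt_top_of_nonneg (by linarith) (by finiteness)) coe_lt_top) hfq)

lemma IsSymbol.conv_mem {a f : ℝ → ℂ} (ha : IsSymbol a) {q : ℝ} (hq : 1 < q)
    (hf : AEStronglyMeasurable f) (hfq : ∫⁻ x, ‖f x‖ₑ ^ q < ∞) :
    AEStronglyMeasurable (conv f (invFT a)) ∧ ∫⁻ x, ‖conv f (invFT a) x‖ₑ ^ q < ∞ :=
  have ⟨_, hD⟩ := ha.exists_isDecaying
  ⟨ha.aestronglyMeasurable_conv hf, hD.lintegral_conv_lt_top hf hq hfq⟩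

/-- The extremal function in the duality between `L^q` and its dual space. -/
lemma exists_dual {q q' : ℝ} (hqq : q.HolderConjugate q') {T : ℝ → ℂ}
    (hT : AEStronglyMeasurable T) (hfin : ∫⁻ x, ‖T x‖ₑ ^ q ≠ ∞) :
    ∃ u : ℝ → ℂ, AEStronglyMeasurable u ∧ (∀ x, ‖u x‖ₑ ^ q' = ‖T x‖ₑ ^ q) ∧
      ∫⁻ x, ‖T x‖ₑ ^ q = ‖∫ x, T x * u x‖ₑ := by
  have hq := hqq.lt
  have hpow : ∀ x, ‖T x‖ * ‖T x‖ ^ (q - 2) = ‖T x‖ ^ (q - 1) := fun x => by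
    rcases eq_or_ne ‖T x‖ 0 with h | h
    · rw [h, zero_mul, Real.zero_rpow (by linarith)]
    · rw [← Real.rpow_one_add' (norm_nonneg _) (by linarith)]; congr 1; ring
  have hpow' : ∀ x, ‖T x‖ * ‖T x‖ ^ (q - 1) = ‖T x‖ ^ q := fun x => by
    rw [← Real.rpow_one_add' (norm_nonneg _) (by linarith)]; congr 1; ring
  set u : ℝ → ℂ := fun x => conj (T x) * ((‖T x‖ ^ (q - 2) : ℝ) : ℂ)
  have hu : AEStronglyMeasurable u := (continuous_conj.comp_aestronglyMeasurable hT).mul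
    (Complex.continuous_ofReal.comp_aestronglyMeasurable
      ((hT.norm.aemeasurable.pow_const (q - 2)).aestronglyMeasurable))
  have hun : ∀ x, ‖u x‖ = ‖T x‖ ^ (q - 1) := fun x => by
    rw [← hpow, norm_mul, RCLike.norm_conj, norm_real, norm_of_nonneg (by positivity)]
  have hprod : ∀ x, T x * u x = (‖T x * u x‖ : ℂ) := fun x => by
    rw [norm_mul, hun, ← hpow]
    simp only [u]
    rw [← mul_assoc, mul_conj, Complex.normSq_eq_norm_sq]
    push_cast; ring
  have hen : ∀ x, ‖T x * u x‖ₑ = ‖T x‖ₑ ^ q := fun x => by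
    rw [← ofReal_norm, norm_mul, hun, hpow', ← ofReal_norm,
      ENNReal.ofReal_rpow_of_nonneg (norm_nonneg _) (by linarith)]
  refine ⟨u, hu, fun x => ?_, ?_⟩
  · rw [← ofReal_norm, hun, ← ENNReal.ofReal_rpow_of_nonneg (norm_nonneg _) (by linarith),
      ofReal_norm, ← rpow_mul, hqq.sub_one_mul_conj]
  · rw [← lintegral_enorm_eq_enorm_integral (h := fun x => T x * u x) (hT.mul hu) hprod
      (by simpa only [hen] using hfin)]
    simp only [hen]

/-- Reflection preserves the class of multipliers. -/
lemma IsMultiplier.neg {B : ℝ≥0} {a : ℝ → ℂ} (ha : IsMultiplier B a) :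
    IsMultiplier B fun ξ => a (-ξ) := by
  refine ⟨by simpa using ha.isSymbol.comp_mul (s := -1) (by norm_num), fun ξ => ha.enorm_le _,
    fun y => ?_⟩
  have hS : MeasurableSet {x : ℝ | 2 * |y| ≤ |x|} := measurableSet_le (by fun_prop) (by fun_prop)
  have h := ha.hormander (-y)
  rw [abs_neg, ← lintegral_indicator hS, ← lintegral_neg_eq_self] at h
  rw [← lintegral_indicator hS]
  refine le_of_eq_of_le (lintegral_congr fun x => ?_) h
  simp only [indicator_apply, mem_ofPred_eq, abs_neg, invFT_neg, neg_sub, sub_neg_eq_add,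
    neg_add_eq_sub]

/-- The Calderón–Zygmund theorem on `L^q`, `1 < q < ∞`. For `q > 2` it is dual to the case
`q < 2`. -/
theorem exists_lintegral_conv_rpow_le {q : ℝ} (hq : 1 < q) (B : ℝ≥0) :
    ∃ C : ℝ≥0, ∀ a : ℝ → ℂ, IsMultiplier B a → ∀ f : ℝ → ℂ, AEStronglyMeasurable f →
      ∫⁻ y, ‖f y‖ₑ ^ q < ∞ → ∫⁻ x, ‖conv f (invFT a) x‖ₑ ^ q ≤ C * ∫⁻ y, ‖f y‖ₑ ^ q := by
  rcases lt_trichotomy q 2 with hq2 | rfl | hq2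
  · exact exists_lintegral_conv_rpow_le_of_lt_two hq hq2 B
  · refine ⟨4 * B ^ 2, fun a ha f hfm hf => ?_⟩
    simp only [rpow_ofNat] at hf ⊢
    exact_mod_cast ha.isSymbol.lintegral_conv_sq_le_four ha.enorm_le hfm hf
  set q' := Real.conjExponent q with hq'
  have hqq : q.HolderConjugate q' := Real.HolderConjugate.conjExponent hq
  have hq'2 : q' < 2 := by
    rw [hq', Real.conjExponent, div_lt_iff₀ (by linarith)]; linarith
  have hq0 : 0 < q := by linarith
  have hq'0 : 0 ≤ 1 / q' := by have := hqq.symm.pos; positivity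
  obtain ⟨C, hC⟩ := exists_lintegral_conv_rpow_le_of_lt_two hqq.symm.lt hq'2 B
  refine ⟨C ^ (q / q'), fun a ha f hfm hf => ?_⟩
  obtain ⟨D, hD⟩ := ha.isSymbol.exists_isDecaying
  obtain ⟨hTm, hX⟩ := ha.isSymbol.conv_mem hq hfm hf
  obtain ⟨u, hum, hu, hTu⟩ := exists_dual hqq hTm hX.ne
  set X := ∫⁻ x, ‖conv f (invFT a) x‖ₑ ^ q
  have hfin := lintegral_mul_lt_top hqq (measurable_cauchyAvg hfm.enorm 1).aemeasurable hum.enorm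
    (lintegral_cauchyAvg_rpow_lt_top hfm.enorm hq hf one_pos) (by simpa only [hu] using hX)
  have key : X ≤ (∫⁻ x, ‖f x‖ₑ ^ q) ^ (1 / q) * C ^ (1 / q') * X ^ (1 / q') := by
    calc X = ‖∫ x, f x * conv u (invFT fun ξ => a (-ξ)) x‖ₑ := by
          rw [hTu, integral_conv_mul hfm hum hD hfin]
          simp_rw [← invFT_neg]
      _ ≤ ∫⁻ x, ‖f x‖ₑ * ‖conv u (invFT fun ξ => a (-ξ)) x‖ₑ :=
          (enorm_integral_le_lintegral_enorm _).trans_eq (lintegral_congr fun x => enorm_mul _ _)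
      _ ≤ (∫⁻ x, ‖f x‖ₑ ^ q) ^ (1 / q) *
            (∫⁻ x, ‖conv u (invFT fun ξ => a (-ξ)) x‖ₑ ^ q') ^ (1 / q') :=
          lintegral_mul_le_Lp_mul_Lq volume hqq hfm.enorm (ha.neg.isSymbol.aestronglyMeasurable_conv hum).enorm
      _ ≤ (∫⁻ x, ‖f x‖ₑ ^ q) ^ (1 / q) * (C * X) ^ (1 / q') := by
          gcongr
          simpa only [hu] using hC _ ha.neg u hum (by simpa only [hu] using hX)
      _ = _ := by rw [mul_rpow_of_nonneg _ _ hq'0, mul_assoc]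
  refine (le_rpow_of_le_mul_rpow hqq hX.ne key).trans_eq ?_
  rw [mul_rpow_of_nonneg _ _ hq0.le, ← rpow_mul, one_div_mul_cancel hq0.ne', rpow_one, ← rpow_mul,
    one_div_mul_eq_div, mul_comm, ENNReal.coe_rpow_of_nonneg _ (by have := hqq.symm.pos; positivity)]

section Khinchine

variable {ι : Type*} [DecidableEq ι]

/-- The sum of the numbers `z i`, `i ∈ s`, with the sign `+` for `i ∈ t` and `-` otherwise. -/
def signSum (s t : Finset ι) (z : ι → ℂ) : ℂ := ∑ i ∈ s, (if i ∈ t then 1 else -1) * z i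

/-- The second and the fourth moments of a random signed sum. -/
lemma sum_powerset_signSum (s : Finset ι) (z : ι → ℂ) :
    ∑ t ∈ s.powerset, ‖signSum s t z‖ ^ 2 = 2 ^ s.card * ∑ i ∈ s, ‖z i‖ ^ 2 ∧
    ∑ t ∈ s.powerset, ‖signSum s t z‖ ^ 4 ≤ 3 * 2 ^ s.card * (∑ i ∈ s, ‖z i‖ ^ 2) ^ 2 := by
  induction s using Finset.induction_on with
  | empty => simp [signSum]
  | insert a s ha ih =>
    have h1 : ∀ t ∈ s.powerset, signSum (insert a s) t z = signSum s t z - z a := fun t ht => by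
      have : a ∉ t := fun h => ha (Finset.mem_powerset.1 ht h)
      rw [signSum, Finset.sum_insert ha, if_neg this, signSum]; ring
    have h2 : ∀ t, signSum (insert a s) (insert a t) z = signSum s t z + z a := fun t => by
      rw [signSum, Finset.sum_insert ha, if_pos (mem_insert_self a t), one_mul, add_comm, signSum]
      congr 1
      refine sum_congr rfl fun i hi => ?_
      have : i ≠ a := fun h => ha (h ▸ hi)
      simp [this]
    have e2 : ∀ w v : ℂ, ‖w - v‖ ^ 2 + ‖w + v‖ ^ 2 = 2 * (‖w‖ ^ 2 + ‖v‖ ^ 2) := fun w v => by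
      simp only [Complex.sq_norm, Complex.normSq_apply, Complex.sub_re, Complex.sub_im,
        Complex.add_re, Complex.add_im]
      ring
    have e4 : ∀ w v : ℂ, ‖w - v‖ ^ 4 + ‖w + v‖ ^ 4 ≤
        2 * ‖w‖ ^ 4 + 12 * ‖v‖ ^ 2 * ‖w‖ ^ 2 + 2 * ‖v‖ ^ 4 := fun w v => by
      have h4 : ∀ x : ℂ, ‖x‖ ^ 4 = (‖x‖ ^ 2) ^ 2 := fun x => by ring
      simp only [h4, Complex.sq_norm, Complex.normSq_apply, Complex.sub_re, Complex.sub_im,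
        Complex.add_re, Complex.add_im]
      nlinarith [sq_nonneg (w.re * v.im - w.im * v.re)]
    rw [Finset.sum_powerset_insert ha, Finset.sum_powerset_insert ha, Finset.card_insert_of_notMem ha,
      Finset.sum_insert ha, ← sum_add_distrib, ← sum_add_distrib]
    have h3 : ∀ n, ∑ t ∈ s.powerset, (‖signSum (insert a s) t z‖ ^ n +
        ‖signSum (insert a s) (insert a t) z‖ ^ n) =
        ∑ t ∈ s.powerset, (‖signSum s t z - z a‖ ^ n + ‖signSum s t z + z a‖ ^ n) := fun n =>
      sum_congr rfl fun t ht => by rw [h1 t ht, h2 t]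
    have hc : (s.powerset.card : ℝ) = 2 ^ s.card := by simp
    rw [h3, h3]
    constructor
    · simp only [e2]
      rw [← mul_sum, sum_add_distrib, ih.1, Finset.sum_const, nsmul_eq_mul, hc]
      ring
    · refine (sum_le_sum fun t _ => e4 _ _).trans ?_
      simp only [sum_add_distrib, ← mul_sum]
      rw [ih.1, Finset.sum_const, nsmul_eq_mul, hc]
      have : 0 ≤ (2 : ℝ) ^ s.card * ‖z a‖ ^ 4 := by positivity
      rw [pow_succ 2 s.card]
      nlinarith [ih.2]

/-- Khinchine's inequality. -/
lemma sum_sq_rpow_le_sum_signSum {q : ℝ} (hq : 0 < q) (s : Finset ι) (z : ι → ℂ) :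
    2 ^ s.card * (∑ i ∈ s, ‖z i‖ₑ ^ 2) ^ (q / 2) ≤
      3 * ∑ t ∈ s.powerset, ‖signSum s t z‖ₑ ^ q := by
  set A := ∑ i ∈ s, ‖z i‖ ^ 2 with hA
  have hA0 : 0 ≤ A := by positivity
  obtain ⟨h2, h4⟩ := sum_powerset_signSum s z
  have hc : (s.powerset.card : ℝ) = 2 ^ s.card := by simp
  have hr : 2 ^ s.card * A ^ (q / 2) ≤ 3 * ∑ t ∈ s.powerset, ‖signSum s t z‖ ^ q := by
    rcases hA0.eq_or_lt with h0 | h0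
    · rw [← h0, Real.zero_rpow (by positivity), mul_zero]; positivity
    -- the squares of the signed sums, normalised to have mean one
    set y : Finset ι → ℝ := fun t => ‖signSum s t z‖ ^ 2 / A with hy
    have hy0 : ∀ t, 0 ≤ y t := fun t => by positivity
    have hyq : ∀ t, ‖signSum s t z‖ ^ q = A ^ (q / 2) * y t ^ (q / 2) := fun t => by
      rw [← Real.mul_rpow hA0 (hy0 t), hy, mul_div_cancel₀ _ h0.ne', ← Real.rpow_natCast_mul
        (norm_nonneg _)]
      congr 1; push_cast; ring
    have hy1 : ∑ t ∈ s.powerset, y t = 2 ^ s.card := by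
      rw [hy, ← sum_div, h2, mul_div_cancel_right₀ _ h0.ne']
    have hy2 : ∑ t ∈ s.powerset, y t ^ 2 ≤ 3 * 2 ^ s.card := by
      have : ∀ t, y t ^ 2 = ‖signSum s t z‖ ^ 4 / A ^ 2 := fun t => by rw [hy, div_pow, ← pow_mul]
      simp_rw [this]
      rw [← sum_div, div_le_iff₀ (by positivity)]
      exact h4
    have hm : 2 ^ s.card ≤ 3 * ∑ t ∈ s.powerset, y t ^ (q / 2) := by
      rcases le_total q 2 with hq2 | hq2
      · have hpt : ∀ t ∈ s.powerset, 2 / 3 * y t - 1 / 9 * y t ^ 2 ≤ y t ^ (q / 2) := fun t _ => by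
          rcases le_total (y t) 1 with h | h
          · have := Real.rpow_le_rpow_of_exponent_ge' (hy0 t) h (by positivity)
              (by linarith : q / 2 ≤ 1)
            rw [Real.rpow_one] at this
            nlinarith [hy0 t]
          · have := Real.one_le_rpow h (by positivity : 0 ≤ q / 2)
            nlinarith [sq_nonneg (y t - 3)]
        have h := sum_le_sum hpt
        rw [Finset.sum_sub_distrib, ← mul_sum, ← mul_sum] at h
        linarith
      · have hpt : ∀ t ∈ s.powerset, 1 + q / 2 * (y t - 1) ≤ y t ^ (q / 2) := fun t _ => by
          simpa using one_add_mul_self_le_rpow_one_add (s := y t - 1) (by linarith [hy0 t])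
            (by linarith : 1 ≤ q / 2)
        have h := sum_le_sum hpt
        simp only [sum_add_distrib, ← mul_sum, Finset.sum_sub_distrib, hy1, Finset.sum_const,
          nsmul_eq_mul, hc] at h
        have : (0 : ℝ) < 2 ^ s.card := by positivity
        linarith
    simp_rw [hyq]
    rw [← mul_sum]
    nlinarith [Real.rpow_pos_of_pos h0 (q / 2)]
  have hE := ofReal_le_ofReal hr
  rw [ofReal_mul (by positivity), ofReal_mul (by positivity), ofReal_pow (by norm_num),
    ← ENNReal.ofReal_rpow_of_nonneg hA0 (by positivity), hA, ofReal_sum_of_nonneg (fun i _ => by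
    positivity), ofReal_sum_of_nonneg fun t _ => by positivity] at hE
  simpa [ofReal_pow, ← ENNReal.ofReal_rpow_of_nonneg (norm_nonneg _) hq.le] using hE

end Khinchine

lemma invFT_sum {ι : Type*} (s : Finset ι) {a : ι → ℝ → ℂ} (ha : ∀ i ∈ s, Integrable (a i))
    (x : ℝ) : invFT (fun ξ => ∑ i ∈ s, a i ξ) x = ∑ i ∈ s, invFT (a i) x := by
  simp only [invFT, sum_mul]
  rw [integral_finsetSum s fun i hi => integrable_mul_exp (ha i hi) x, mul_sum]

lemma invFT_const_mul (c : ℂ) (a : ℝ → ℂ) (x : ℝ) :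
    invFT (fun ξ => c * a ξ) x = c * invFT a x := by
  simp only [invFT, mul_assoc]
  rw [integral_const_mul]; ring

/-- A finite family of symbols, all signed sums of which are multipliers with constant `B`. -/
structure IsSquareFamily {ι : Type*} (B : ℝ≥0) (s : Finset ι) (a : ι → ℝ → ℂ) : Prop where
  isSymbol : ∀ i ∈ s, IsSymbol (a i)
  sum_le : ∀ ξ, ∑ i ∈ s, ‖a i ξ‖ₑ ≤ B
  hormander : ∀ y, ∑ i ∈ s, ∫⁻ x in {x : ℝ | 2 * |y| ≤ |x|},
    ‖invFT (a i) (x - y) - invFT (a i) x‖ₑ ≤ B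

namespace IsSquareFamily

variable {ι : Type*} {B : ℝ≥0} {s : Finset ι} {a : ι → ℝ → ℂ} {ε : ι → ℂ}

lemma invFT_sum_mul (ha : IsSquareFamily B s a) (x : ℝ) :
    invFT (fun ξ => ∑ i ∈ s, ε i * a i ξ) x = ∑ i ∈ s, ε i * invFT (a i) x := by
  rw [invFT_sum s fun i hi => ((ha.isSymbol i hi).const_mul _).integrable]
  simp_rw [invFT_const_mul]

lemma isMultiplier (ha : IsSquareFamily B s a) (hε : ∀ i, ‖ε i‖ ≤ 1) :
    IsMultiplier B fun ξ => ∑ i ∈ s, ε i * a i ξ := by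
  have h1 : ∀ i (w : ℂ), ‖ε i * w‖ₑ ≤ ‖w‖ₑ := fun i w => by
    rw [← ofReal_norm, ← ofReal_norm, norm_mul]
    exact ofReal_le_ofReal (mul_le_of_le_one_left (norm_nonneg _) (hε i))
  refine ⟨IsSymbol.sum s fun i hi => (ha.isSymbol i hi).const_mul _, fun ξ =>
    (enorm_sum_le _ _).trans ((sum_le_sum fun i _ => h1 i _).trans (ha.sum_le ξ)), fun y => ?_⟩
  refine le_trans ?_ (ha.hormander y)
  rw [← lintegral_finsetSum' s fun i hi => ?_]
  · refine lintegral_mono fun x => ?_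
    simp only [ha.invFT_sum_mul, ← Finset.sum_sub_distrib, ← mul_sub]
    exact (enorm_sum_le _ _).trans (sum_le_sum fun i _ => h1 i _)
  · have := (continuous_invFT (ha.isSymbol i hi).integrable)
    exact ((this.comp (continuous_sub_right y)).sub this).enorm.aemeasurable

end IsSquareFamily

/-- Square functions are bounded on `L^q`, by the Calderón–Zygmund theorem for the signed sums of
the multipliers and Khinchine's inequality. -/
theorem exists_lintegral_squareFn_rpow_le {q : ℝ} (hq : 1 < q) (B : ℝ≥0) :
    ∃ C : ℝ≥0, ∀ {ι : Type} (s : Finset ι) (a : ι → ℝ → ℂ), IsSquareFamily B s a →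
      ∀ f : ℝ → ℂ, AEStronglyMeasurable f → ∫⁻ y, ‖f y‖ₑ ^ q < ∞ →
        ∫⁻ x, (∑ i ∈ s, ‖conv f (invFT (a i)) x‖ₑ ^ 2) ^ (q / 2) ≤ C * ∫⁻ y, ‖f y‖ₑ ^ q := by
  classical
  obtain ⟨C, hC⟩ := exists_lintegral_conv_rpow_le hq B
  refine ⟨3 * C, fun {ι} s a ha f hfm hf => ?_⟩
  have hcard : (2 : ℝ≥0∞) ^ s.card ≠ 0 := by simp
  set ε : Finset ι → ι → ℂ := fun t i => if i ∈ t then 1 else -1 with hεdef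
  have hε : ∀ t i, ‖ε t i‖ ≤ 1 := fun t i => by
    simp only [hεdef]; split_ifs <;> simp
  have hconv : ∀ t x, signSum s t (fun i => conv f (invFT (a i)) x) =
      conv f (invFT fun ξ => ∑ i ∈ s, ε t i * a i ξ) x := fun t x => by
    have ht := tame_of_lintegral_rpow hfm hq.le hf
    simp only [conv_apply, signSum, ha.invFT_sum_mul, mul_sum]
    rw [integral_finsetSum s fun i hi => ?_]
    · refine sum_congr rfl fun i _ => ?_
      rw [← integral_const_mul]
      congr 1; ext y; simp only [hεdef]; ring
    · obtain ⟨D, hD⟩ := (ha.isSymbol i hi).exists_isDecaying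
      exact ((hD.integrable ht x).const_mul _).congr (ae_of_all _ fun y => mul_left_comm _ _ _)
  rw [← ENNReal.mul_le_mul_iff_right hcard (by simp), ← lintegral_const_mul' _ _ (by simp)]
  calc _ ≤ ∫⁻ x, 3 * ∑ t ∈ s.powerset, ‖conv f (invFT fun ξ => ∑ i ∈ s, ε t i * a i ξ) x‖ₑ ^ q := by
        refine lintegral_mono fun x => ?_
        simp_rw [← hconv]
        exact sum_sq_rpow_le_sum_signSum (by linarith) s _
    _ = 3 * ∑ t ∈ s.powerset, ∫⁻ x, ‖conv f (invFT fun ξ => ∑ i ∈ s, ε t i * a i ξ) x‖ₑ ^ q := by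
        rw [lintegral_const_mul' _ _ (by simp), lintegral_finsetSum' _ fun t _ =>
          ((ha.isMultiplier (hε t)).isSymbol.aestronglyMeasurable_conv hfm).enorm.pow_const q]
    _ ≤ 3 * ∑ t ∈ s.powerset, C * ∫⁻ y, ‖f y‖ₑ ^ q := by
        gcongr with t
        exact hC _ (ha.isMultiplier (hε t)) f hfm hf
    _ = _ := by
        rw [Finset.sum_const, nsmul_eq_mul, Finset.card_powerset]
        push_cast; ring

/-! ### Lacunary families of dilates -/

/-- The numbers `t i`, `i ∈ s`, are positive and any two of them differ by a factor of at least
two. -/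
def IsLacunary {ι : Type*} (s : Finset ι) (t : ι → ℝ) : Prop :=
  ∀ i ∈ s, 0 < t i ∧ ∀ j ∈ s, i ≠ j → 2 * t i ≤ t j ∨ 2 * t j ≤ t i

namespace IsLacunary

variable {ι : Type*} {s : Finset ι} {t : ι → ℝ}

lemma subset (h : IsLacunary s t) {s' : Finset ι} (hs : s' ⊆ s) : IsLacunary s' t :=
  fun i hi => ⟨(h i (hs hi)).1, fun j hj => (h i (hs hi)).2 j (hs hj)⟩

lemma inv (h : IsLacunary s t) : IsLacunary s fun i => (t i)⁻¹ := fun i hi => by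
  refine ⟨inv_pos.2 (h i hi).1, fun j hj hij => ?_⟩
  have hi0 := (h i hi).1
  have hj0 := (h j hj).1
  rcases (h i hi).2 j hj hij with h1 | h1
  · right
    rw [← div_eq_mul_inv, div_le_iff₀ hj0, ← div_eq_inv_mul, le_div_iff₀ hi0]; linarith
  · left
    rw [← div_eq_mul_inv, div_le_iff₀ hi0, ← div_eq_inv_mul, le_div_iff₀ hj0]; linarith

lemma const_mul (h : IsLacunary s t) {c : ℝ} (hc : 0 < c) : IsLacunary s fun i => c * t i :=
  fun i hi => ⟨mul_pos hc (h i hi).1, fun j hj hij => by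
    rcases (h i hi).2 j hj hij with h1 | h1
    · left; nlinarith
    · right; nlinarith⟩

lemma sum_le (h : IsLacunary s t) : ∀ {y : ℝ}, 0 ≤ y → (∀ i ∈ s, t i ≤ y) →
    ∑ i ∈ s, t i ≤ 2 * y := by
  classical
  induction s using Finset.induction_on_max_value t with
  | empty => intro y hy _; simpa using hy
  | insert a s ha hmax ih =>
    intro y _ hy
    rw [Finset.sum_insert ha]
    have ha0 : 0 < t a := (h a (mem_insert_self a s)).1
    have h1 := ih (h.subset (Finset.subset_insert a s)) (y := t a / 2) (by positivity)
      fun i hi => by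
        have hia : i ≠ a := fun e => ha (e ▸ hi)
        rcases (h i (Finset.mem_insert_of_mem hi)).2 a (mem_insert_self a s) hia with h2 | h2
        · linarith
        · have := hmax i hi
          linarith
    have h2 := hy a (mem_insert_self a s)
    linarith

/-- Only boundedly many terms of a lacunary family are comparable to a given number. -/
lemma sum_min_le (h : IsLacunary s t) {y : ℝ} (hy : 0 ≤ y) :
    ∑ i ∈ s, min (y / t i) (t i / y) ≤ 4 := by
  classical
  rcases hy.eq_or_lt with rfl | hy
  · simp
  rw [← Finset.sum_filter_add_sum_filter_not s fun i => t i ≤ y]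
  have h1 : ∑ i ∈ s with t i ≤ y, min (y / t i) (t i / y) ≤ 2 := by
    calc ∑ i ∈ s with t i ≤ y, min (y / t i) (t i / y)
        ≤ (∑ i ∈ s with t i ≤ y, t i) / y := by
          rw [sum_div]; exact sum_le_sum fun i _ => min_le_right _ _
      _ ≤ 2 := by
          rw [div_le_iff₀ hy]
          exact (h.subset (Finset.filter_subset _ _)).sum_le hy.le fun i hi =>
            (Finset.mem_filter.1 hi).2
  have h2 : ∑ i ∈ s with ¬ t i ≤ y, min (y / t i) (t i / y) ≤ 2 := by
    calc ∑ i ∈ s with ¬ t i ≤ y, min (y / t i) (t i / y)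
        ≤ y * ∑ i ∈ s with ¬ t i ≤ y, (t i)⁻¹ := by
          rw [mul_sum]
          exact sum_le_sum fun i _ => (min_le_left _ _).trans (le_of_eq (div_eq_mul_inv _ _))
      _ ≤ y * (2 * y⁻¹) := by
          refine mul_le_mul_of_nonneg_left ?_ hy.le
          refine (h.inv.subset (Finset.filter_subset _ _)).sum_le (by positivity) fun i hi => ?_
          have := (Finset.mem_filter.1 hi).2
          exact inv_anti₀ hy (not_le.1 this).le
      _ = 2 := by field_simp
  linarith

end IsLacunary

lemma IsSymbol.exists_norm_le {a : ℝ → ℂ} (ha : IsSymbol a) : ∃ M, 0 ≤ M ∧ ∀ x, ‖a x‖ ≤ M := by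
  obtain ⟨M, hM⟩ := ha.continuous.bounded_above_of_compact_support ha.2
  exact ⟨M, (norm_nonneg _).trans (hM 0), hM⟩

lemma IsSymbol.exists_norm_mul_le {a : ℝ → ℂ} (ha : IsSymbol a) :
    ∃ M, 0 ≤ M ∧ ∀ x, ‖a x‖ * |x| ≤ M := by
  obtain ⟨M, hM0, hM⟩ := (ha.mul_contDiff (b := fun x : ℝ => (x : ℂ))
    Complex.ofRealCLM.contDiff).exists_norm_le
  refine ⟨M, hM0, fun x => ?_⟩
  have := hM x
  rwa [norm_mul, norm_real, norm_eq_abs, mul_comm] at this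

lemma IsSymbol.exists_norm_sub_le {a : ℝ → ℂ} (ha : IsSymbol a) :
    ∃ M, 0 ≤ M ∧ ∀ x y, ‖a x - a y‖ ≤ M * |x - y| := by
  obtain ⟨M, hM⟩ := (ha.1.continuous_deriv (by norm_num)).bounded_above_of_compact_support
    (ha.2.deriv)
  refine ⟨M, (norm_nonneg _).trans (hM 0), fun x y => ?_⟩
  exact Convex.norm_image_sub_le_of_norm_deriv_le (𝕜 := ℝ) (fun z _ =>
    ha.1.differentiable (by norm_num) z) (fun z _ => hM z) convex_univ (mem_univ y) (mem_univ x)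

/-- A symbol vanishing at the origin is small both near the origin and near infinity. -/
lemma IsSymbol.exists_norm_le_min {a : ℝ → ℂ} (ha : IsSymbol a) (ha0 : a 0 = 0) :
    ∃ M, 0 ≤ M ∧ ∀ x, ‖a x‖ ≤ M * min |x| (1 / |x|) := by
  obtain ⟨M₁, h1, hM₁⟩ := ha.exists_norm_mul_le
  obtain ⟨M₂, h2, hM₂⟩ := ha.exists_norm_sub_le
  refine ⟨max M₁ M₂, le_max_of_le_left h1, fun x => ?_⟩
  rcases eq_or_ne x 0 with rfl | hx
  · simp [ha0]
  have hx' : 0 < |x| := abs_pos.2 hx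
  rw [mul_min_of_nonneg _ _ (le_max_of_le_left h1)]
  refine le_min ?_ ?_
  · have := hM₂ x 0
    rw [ha0, sub_zero, sub_zero] at this
    exact this.trans (by gcongr; exact le_max_right _ _)
  · rw [mul_one_div, le_div_iff₀ hx']
    exact (hM₁ x).trans (le_max_left _ _)

/-- Hörmander's condition for one dilate. When `|y| ≤ |s|` the gain comes from the smoothness of the
kernel, otherwise from its decay. -/
lemma IsBump.hormander_le {a : ℝ → ℂ} {D : ℝ} (ha : IsBump D (invFT a)) {s : ℝ} (hs : s ≠ 0)
    (y : ℝ) : ∫⁻ x in {x : ℝ | 2 * |y| ≤ |x|},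
      ‖invFT (fun η => a (s * η)) (x - y) - invFT (fun η => a (s * η)) x‖ₑ ≤
        ofReal (25 * D * min (|y| / |s|) (|s| / |y|)) := by
  have hS : MeasurableSet {x : ℝ | 2 * |y| ≤ |x|} := measurableSet_le (by fun_prop) (by fun_prop)
  rcases eq_or_ne y 0 with rfl | hy
  · simp
  have hy' : 0 < |y| := abs_pos.2 hy
  have hs' : 0 < |s| := abs_pos.2 hs
  have hD := ha.nonneg
  have hfar : ∀ x w : ℝ, |x| ≤ 2 * |w| → D / (1 + w ^ 2) ≤ 4 * D / (1 + x ^ 2) := by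
    intro x w h
    rw [div_le_div_iff₀ (by positivity) (by positivity)]
    have : x ^ 2 ≤ 4 * w ^ 2 := by
      rw [← sq_abs x, ← sq_abs w]; nlinarith [abs_nonneg x]
    nlinarith
  have hunit : ∀ x v : ℝ, 2 * |v| ≤ |x| →
      ‖invFT a (x - v) - invFT a x‖ ≤ 5 * D / (1 + x ^ 2) * min 1 |v| := by
    intro x v hv
    have htri : ∀ w, |w| ≤ |v| → |x| ≤ 2 * |x - w| := fun w hw => by
      have := abs_sub_abs_le_abs_sub x w
      linarith
    have hpos : 0 ≤ D / (1 + x ^ 2) := by positivity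
    rw [mul_min_of_nonneg _ _ (by positivity)]
    refine le_min ?_ ?_
    · have h1 := (ha.norm_le (x - v)).trans (hfar x (x - v) (htri v le_rfl))
      have h2 := ha.norm_le x
      have h3 := norm_sub_le (invFT a (x - v)) (invFT a x)
      have h4 : 5 * D / (1 + x ^ 2) * 1 = 4 * D / (1 + x ^ 2) + D / (1 + x ^ 2) := by ring
      linarith
    · have h1 : ∀ z ∈ uIcc x (x - v), ‖deriv (invFT a) z‖ ≤ 4 * D / (1 + x ^ 2) := by
        intro z hz
        refine (ha.norm_deriv_le z).trans ?_
        have := htri (x - z) (by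
          have := abs_sub_left_of_mem_uIcc hz
          rw [abs_sub_comm]
          simpa using this)
        rw [sub_sub_cancel] at this
        exact hfar x z this
      have h2 := Convex.norm_image_sub_le_of_norm_deriv_le (𝕜 := ℝ) (fun z _ =>
        ha.differentiable z) h1 (convex_uIcc x (x - v)) left_mem_uIcc right_mem_uIcc
      rw [sub_sub_cancel_left, norm_neg, norm_eq_abs] at h2
      refine h2.trans ?_
      gcongr
      linarith
  have hpt : ∀ x, 2 * |y| ≤ |x| →
      ‖invFT (fun η => a (s * η)) (x - y) - invFT (fun η => a (s * η)) x‖ ≤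
        5 * D * min 1 (|y| / |s|) * (|s| / (|s| ^ 2 + x ^ 2)) := by
    intro x hx
    rw [invFT_comp_mul a hs, invFT_comp_mul a hs, ← mul_sub, norm_mul, norm_real,
      norm_of_nonneg (by positivity), sub_div]
    have h1 := hunit (x / s) (y / s) (by
      rw [abs_div, abs_div, ← mul_div_assoc]; gcongr)
    refine (mul_le_mul_of_nonneg_left h1 (by positivity)).trans (le_of_eq ?_)
    rw [abs_div, div_pow, ← sq_abs s]
    have h3 : |s| ^ 2 + x ^ 2 ≠ 0 := by positivity
    have h2 : 1 + x ^ 2 / |s| ^ 2 ≠ 0 := by positivity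
    generalize min 1 (|y| / |s|) = m
    field_simp
  rw [mul_min_of_nonneg _ _ (by positivity), ENNReal.ofReal_min]
  have hfin : ∀ (c t : ℝ), 0 ≤ c → 0 < t →
      ∫⁻ x, ofReal (c * (t / (t ^ 2 + x ^ 2))) ≤ ofReal (4 * c) := by
    intro c t hc ht
    have h := lintegral_cauchyKernel ht 0
    simp only [zero_sub, neg_sq] at h
    simp_rw [ofReal_mul hc]
    rw [lintegral_const_mul' _ _ ofReal_ne_top, h, ← ofReal_mul hc]
    exact ofReal_le_ofReal (by nlinarith [Real.pi_le_four])
  refine le_min ?_ ?_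
  · calc _ ≤ ∫⁻ x in {x : ℝ | 2 * |y| ≤ |x|},
          ofReal (5 * D * (|y| / |s|) * (|s| / (|s| ^ 2 + x ^ 2))) := by
          refine setLIntegral_mono' hS fun x hx => ?_
          rw [← ofReal_norm]
          refine ofReal_le_ofReal ((hpt x hx).trans ?_)
          gcongr
          exact min_le_right _ _
      _ ≤ _ := (setLIntegral_le_lintegral _ _).trans (hfin _ _ (by positivity) hs')
      _ ≤ _ := by
          refine ofReal_le_ofReal ?_
          have : 0 ≤ D * (|y| / |s|) := by positivity
          nlinarith
  · calc _ ≤ ∫⁻ x in {x : ℝ | 2 * |y| ≤ |x|},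
          ofReal (5 / 4 * (5 * D * (|s| / |y|)) * (|y| / (|y| ^ 2 + x ^ 2))) := by
          refine setLIntegral_mono' hS fun x hx => ?_
          rw [← ofReal_norm]
          refine ofReal_le_ofReal ((hpt x hx).trans ?_)
          have hx2 : 4 * |y| ^ 2 ≤ x ^ 2 := by
            have : 2 * |y| ≤ |x| := hx
            rw [← sq_abs x]; nlinarith
          calc 5 * D * min 1 (|y| / |s|) * (|s| / (|s| ^ 2 + x ^ 2))
              ≤ 5 * D * 1 * (5 / 4 * (|s| / (|y| ^ 2 + x ^ 2))) := by
                gcongr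
                · exact min_le_left _ _
                · rw [mul_div_assoc', div_le_div_iff₀ (by positivity) (by positivity)]
                  nlinarith [mul_nonneg hs'.le (sq_nonneg |s|), mul_nonneg hs'.le (sq_nonneg x)]
            _ = _ := by field_simp
      _ ≤ ofReal (4 * (5 / 4 * (5 * D * (|s| / |y|)))) :=
          (setLIntegral_le_lintegral _ _).trans (hfin _ _ (by positivity) hy')
      _ ≤ _ := by
          refine ofReal_le_ofReal ?_
          have : 0 ≤ D * (|s| / |y|) := by positivity
          nlinarith

/-- The family of the dilates `a (t i * ·)` of one symbol. -/
lemma IsSymbol.exists_hormander_sum_le {a : ℝ → ℂ} (ha : IsSymbol a) :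
    ∃ B : ℝ≥0, ∀ {ι : Type} (s : Finset ι) (t : ι → ℝ), IsLacunary s (fun i => |t i|) → ∀ y,
      ∑ i ∈ s, ∫⁻ x in {x : ℝ | 2 * |y| ≤ |x|},
        ‖invFT (fun η => a (t i * η)) (x - y) - invFT (fun η => a (t i * η)) x‖ₑ ≤ B := by
  obtain ⟨D, hD⟩ := ha.exists_isBump
  have hD0 := hD.nonneg
  refine ⟨(100 * D).toNNReal, fun s t ht y => ?_⟩
  calc _ ≤ ∑ i ∈ s, ofReal (25 * D * min (|y| / |t i|) (|t i| / |y|)) :=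
        sum_le_sum fun i hi => hD.hormander_le (abs_pos.1 (ht i hi).1) y
    _ = ofReal (25 * D * ∑ i ∈ s, min (|y| / |t i|) (|t i| / |y|)) := by
        rw [mul_sum, ofReal_sum_of_nonneg fun i _ => by positivity]
    _ ≤ ofReal (100 * D) := by
        refine ofReal_le_ofReal ?_
        have := ht.sum_min_le (abs_nonneg y)
        nlinarith

lemma IsSymbol.exists_sum_norm_le {a : ℝ → ℂ} (ha : IsSymbol a) (ha0 : a 0 = 0) :
    ∃ M, 0 ≤ M ∧ ∀ {ι : Type} (s : Finset ι) (t : ι → ℝ), IsLacunary s (fun i => |t i|) →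
      ∀ ξ, ∑ i ∈ s, ‖a (t i * ξ)‖ ≤ M := by
  obtain ⟨M, hM0, hM⟩ := ha.exists_norm_le_min ha0
  refine ⟨M * 4, by positivity, fun s t ht ξ => ?_⟩
  have h := ht.sum_min_le (y := |ξ|⁻¹) (by positivity)
  calc ∑ i ∈ s, ‖a (t i * ξ)‖ ≤ ∑ i ∈ s, M * min (|ξ|⁻¹ / |t i|) (|t i| / |ξ|⁻¹) := by
        refine sum_le_sum fun i _ => (hM _).trans (le_of_eq ?_)
        rw [min_comm, abs_mul, div_inv_eq_mul, one_div, mul_inv, mul_comm |t i|⁻¹, div_eq_mul_inv]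
    _ ≤ M * 4 := by
        rw [← mul_sum]
        exact mul_le_mul_of_nonneg_left h hM0

/-- The dilates of a symbol that vanishes at the origin by the members of a lacunary family. -/
lemma IsSymbol.exists_isSquareFamily {a : ℝ → ℂ} (ha : IsSymbol a) (ha0 : a 0 = 0) :
    ∃ B : ℝ≥0, ∀ (s : Finset ℕ) (t : ℕ → ℝ), IsLacunary s (fun i => |t i|) →
      IsSquareFamily B s fun i η => a (t i * η) := by
  obtain ⟨B, hB⟩ := ha.exists_hormander_sum_le
  obtain ⟨M, -, hM⟩ := ha.exists_sum_norm_le ha0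
  refine ⟨max B M.toNNReal, fun s t ht => ⟨fun i hi => ha.comp_mul (abs_pos.1 (ht i hi).1),
    fun ξ => ?_, fun y => (hB s t ht y).trans (by exact_mod_cast le_max_left _ _)⟩⟩
  simp_rw [← ofReal_norm]
  rw [← ofReal_sum_of_nonneg fun i _ => norm_nonneg _]
  exact (ofReal_le_ofReal (hM s t ht ξ)).trans (coe_le_coe.2 (le_max_right _ _))

/-- Square functions of lacunary dilates of a symbol that vanishes at the origin. -/
theorem IsSymbol.exists_lintegral_squareFn_rpow_le {a : ℝ → ℂ} (ha : IsSymbol a) (ha0 : a 0 = 0)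
    {q : ℝ} (hq : 1 < q) : ∃ C : ℝ≥0, ∀ (s : Finset ℕ) (t : ℕ → ℝ),
      IsLacunary s (fun i => |t i|) →
      ∀ f : ℝ → ℂ, AEStronglyMeasurable f → ∫⁻ y, ‖f y‖ₑ ^ q < ∞ →
        ∫⁻ x, (∑ i ∈ s, ‖conv f (invFT fun η => a (t i * η)) x‖ₑ ^ 2) ^ (q / 2) ≤
          C * ∫⁻ y, ‖f y‖ₑ ^ q := by
  obtain ⟨B, hB⟩ := ha.exists_isSquareFamily ha0
  obtain ⟨C, hC⟩ := CurvedBHT.exists_lintegral_squareFn_rpow_le hq B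
  exact ⟨C, fun s t ht => hC s _ (hB s t ht)⟩

/-- Multipliers of the form `∑ ε i * a (t i * ξ)` are bounded on `L^q`. -/
theorem IsSymbol.exists_lintegral_conv_sum_rpow_le {a : ℝ → ℂ} (ha : IsSymbol a) (ha0 : a 0 = 0)
    {q : ℝ} (hq : 1 < q) : ∃ C : ℝ≥0, ∀ (s : Finset ℕ) (t : ℕ → ℝ) (ε : ℕ → ℂ),
      IsLacunary s (fun i => |t i|) → (∀ i, ‖ε i‖ ≤ 1) →
      ∀ f : ℝ → ℂ, AEStronglyMeasurable f → ∫⁻ y, ‖f y‖ₑ ^ q < ∞ →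
        ∫⁻ x, ‖conv f (invFT fun η => ∑ i ∈ s, ε i * a (t i * η)) x‖ₑ ^ q ≤
          C * ∫⁻ y, ‖f y‖ₑ ^ q := by
  obtain ⟨B, hB⟩ := ha.exists_isSquareFamily ha0
  obtain ⟨C, hC⟩ := exists_lintegral_conv_rpow_le hq B
  exact ⟨C, fun s t ε ht hε => hC _ ((hB s t ht).isMultiplier hε)⟩

/-! ### Almost orthogonal families of kernels -/

lemma memLp_two_iff {f : ℝ → ℂ} (hf : AEStronglyMeasurable f) :
    MemLp f 2 volume ↔ ∫⁻ x, ‖f x‖ₑ ^ 2 < ∞ := by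
  rw [MemLp, and_iff_right hf,
    eLpNorm_lt_top_iff_lintegral_rpow_enorm_lt_top (by norm_num) (by norm_num)]
  simp

/-- Bessel's inequality for an almost orthogonal system in a Hilbert space. -/
lemma sum_norm_inner_sq_le {E ι : Type*} [NormedAddCommGroup E] [InnerProductSpace ℂ E] [Fintype ι]
    {v : ι → E} {c : ι → ι → ℝ} (hc : ∀ p p', ‖inner ℂ (v p) (v p')‖ ≤ c p p')
    (hsymm : ∀ p p', c p p' = c p' p) {M : ℝ} (hM0 : 0 ≤ M)
    (hM : ∀ p, ∑ p', c p p' ≤ M) (x : E) :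
    ∑ p, ‖inner ℂ (v p) x‖ ^ 2 ≤ M * ‖x‖ ^ 2 := by
  set b : ι → ℂ := fun p => inner ℂ (v p) x
  set X := ∑ p, ‖b p‖ ^ 2
  set W := ∑ p, b p • v p with hW
  have h1 : X ≤ ‖W‖ * ‖x‖ := by
    have : inner ℂ W x = (X : ℂ) := by
      simp only [hW, sum_inner, inner_smul_left, X, ← Complex.conj_mul', Complex.ofReal_sum,
        Complex.ofReal_pow, b]
    have h := norm_inner_le_norm (𝕜 := ℂ) W x
    rwa [this, norm_real, norm_of_nonneg (by positivity)] at h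
  have h2 : ‖W‖ ^ 2 ≤ M * X := by
    calc ‖W‖ ^ 2 = ‖inner ℂ W W‖ := by rw [inner_self_eq_norm_sq_to_K]; simp
      _ ≤ ∑ p, ∑ p', (c p p' * ‖b p‖ ^ 2 + c p' p * ‖b p'‖ ^ 2) / 2 := by
          simp only [hW, sum_inner, inner_sum, inner_smul_left, inner_smul_right, mul_sum]
          refine (norm_sum_le _ _).trans (sum_le_sum fun p _ =>
            (norm_sum_le _ _).trans (sum_le_sum fun p' _ => ?_))
          rw [norm_mul, norm_mul, RCLike.norm_conj, hsymm p' p, norm_inner_symm (v p') (v p)]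
          nlinarith [mul_le_mul_of_nonneg_left (hc p p') (by positivity : 0 ≤ ‖b p‖ * ‖b p'‖),
            mul_nonneg ((norm_nonneg _).trans (hc p p')) (sq_nonneg (‖b p‖ - ‖b p'‖))]
      _ = ∑ p, (∑ p', c p p') * ‖b p‖ ^ 2 := by
          simp_rw [← sum_div, sum_add_distrib]
          rw [Finset.sum_comm (f := fun p p' => c p' p * ‖b p'‖ ^ 2)]
          simp_rw [sum_mul]; ring
      _ ≤ M * X := by rw [mul_sum]; gcongr; exact hM _
  rcases (by positivity : 0 ≤ X).eq_or_lt with h0 | h0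
  · rw [← h0]
    positivity
  · have := mul_self_le_mul_self h0.le h1
    nlinarith [sq_nonneg ‖x‖]

/-- Bessel's inequality for an almost orthogonal system of functions. -/
lemma sum_enorm_integral_mul_sq_le {ι : Type*} (s : Finset ι) {v : ι → ℝ → ℂ}
    (hv : ∀ p ∈ s, MemLp (v p) 2 volume) {c : ι → ι → ℝ}
    (hc : ∀ p ∈ s, ∀ p' ∈ s, ‖∫ x, v p x * conj (v p' x)‖ ≤ c p p')
    (hsymm : ∀ p p', c p p' = c p' p) {M : ℝ} (hM0 : 0 < M)
    (hM : ∀ p ∈ s, ∑ p' ∈ s, c p p' ≤ M) {G : ℝ → ℂ} (hG : AEStronglyMeasurable G) :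
    ∑ p ∈ s, ‖∫ x, G x * v p x‖ₑ ^ 2 ≤ ofReal M * ∫⁻ x, ‖G x‖ₑ ^ 2 := by
  rcases eq_or_ne (∫⁻ x, ‖G x‖ₑ ^ 2) ∞ with hfin | hfin
  · rw [hfin, mul_top (by simpa using hM0)]
    exact le_top
  have hG2 : MemLp G 2 volume := (memLp_two_iff hG).2 hfin.lt_top
  have hin : ∀ {f g : ℝ → ℂ} (hf : MemLp f 2 volume) (hg : MemLp g 2 volume),
      inner ℂ hf.star.toLp hg.toLp = ∫ x, g x * f x := fun hf hg => by
    rw [L2.inner_def]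
    refine integral_congr_ae ?_
    filter_upwards [hf.star.coeFn_toLp, hg.coeFn_toLp] with x h1 h2
    simp [h1, h2]
  have h := sum_norm_inner_sq_le (v := fun p : s => (hv p p.2).star.toLp) (c := fun p p' => c p p')
    (fun p p' => ?_) (fun p p' => hsymm p p') hM0.le
    (fun p => (Finset.sum_coe_sort s fun p' => c p p').trans_le (hM p p.2)) hG2.toLp
  · simp only [fun p : s => hin (hv p p.2) hG2] at h
    rw [sum_coe_sort s fun p => ‖∫ x, G x * v p x‖ ^ 2] at h
    have h := ofReal_le_ofReal h
    rw [ofReal_mul hM0.le, ofReal_sum_of_nonneg fun _ _ => by positivity, ofReal_pow (norm_nonneg _),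
      ofReal_norm, Lp.enorm_toLp] at h
    have e := eLpNorm_nnreal_pow_eq_lintegral (f := G) (μ := volume) (p := 2) two_ne_zero
    simp only [NNReal.coe_ofNat, rpow_ofNat] at e
    rw [← e]
    simpa [ofReal_pow] using h
  · rw [hin (hv _ p.2) (hv _ p'.2).star]
    simpa [mul_comm] using hc p p.2 p' p'.2

lemma exists_sum_inv_one_add_sq_le : ∃ M : ℝ, 0 < M ∧ ∀ (s : Finset ℕ) (p : ℕ),
    ∑ p' ∈ s, 1 / (1 + ((p : ℝ) - p') ^ 2) ≤ M := by
  have hs : Summable fun n : ℤ => 1 / (1 + (n : ℝ) ^ 2) := by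
    refine Summable.of_nonneg_of_le (fun n => by positivity) (fun n => ?_)
      ((Real.summable_one_div_int_pow (p := 2)).2 one_lt_two |>.add
        (hasSum_ite_eq (0 : ℤ) (1 : ℝ)).summable)
    rcases eq_or_ne n 0 with rfl | hn
    · simp
    · have : 0 < (n : ℝ) ^ 2 := by positivity
      simp only [hn, if_false, add_zero]
      exact one_div_le_one_div_of_le this (by linarith)
  refine ⟨∑' n : ℤ, 1 / (1 + (n : ℝ) ^ 2), hs.tsum_pos (fun n => by positivity) 0 (by norm_num),
    fun s p => ?_⟩
  have hinj : Function.Injective fun p' : ℕ => (p : ℤ) - p' := fun a b h => by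
    simpa using h
  calc ∑ p' ∈ s, 1 / (1 + ((p : ℝ) - p') ^ 2)
      = ∑ n ∈ s.map ⟨_, hinj⟩, 1 / (1 + (n : ℝ) ^ 2) := by
        rw [Finset.sum_map]
        simp
    _ ≤ _ := hs.sum_le_tsum _ fun n _ => by positivity

/-- Symbols `a p` are almost orthogonal with constant `K` if the Gram matrix of the functions
`a p - (a p)'`, whose kernels are `(1 + i x) (a p)^∨ (x)`, decays quadratically. -/
structure IsAlmostOrthogonal (K : ℝ) (s : Finset ℕ) (a : ℕ → ℝ → ℂ) : Prop where
  isSymbol : ∀ p ∈ s, IsSymbol (a p)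
  isSymbol_deriv : ∀ p ∈ s, IsSymbol (deriv (a p))
  gram_le : ∀ p ∈ s, ∀ p' ∈ s, ‖∫ ξ, (a p ξ - deriv (a p) ξ) *
    conj (a p' ξ - deriv (a p') ξ)‖ ≤ K / (1 + ((p : ℝ) - p') ^ 2)

/-- Almost orthogonality gives square summability of the convolutions at a single point, at any
scale: dividing the kernels' weight `1 + i x` out of `F` leaves Bessel's inequality for an almost
orthogonal system. -/
lemma exists_sum_enorm_conv_sq_le (K : ℝ) : ∃ C : ℝ≥0, ∀ (s : Finset ℕ) (a : ℕ → ℝ → ℂ),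
    IsAlmostOrthogonal K s a → ∀ t : ℝ, t ≠ 0 → ∀ F : ℝ → ℂ, AEStronglyMeasurable F →
      ∀ z, ∑ p ∈ s, ‖conv F (invFT fun η => a p (t * η)) z‖ₑ ^ 2 ≤
        C * cauchyAvg |t| (fun y => ‖F y‖ₑ ^ 2) z := by
  obtain ⟨M, hM0, hM⟩ := exists_sum_inv_one_add_sq_le
  refine ⟨(max K 1 * M).toNNReal, fun s a ha t ht F hF z => ?_⟩
  have ht' : 0 < |t| := abs_pos.2 ht
  have hK1 : 0 < max K 1 := lt_max_of_lt_right one_pos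
  set V : ℕ → ℝ → ℂ := fun p ξ => a p ξ - deriv (a p) ξ with hV
  have hVs : ∀ p ∈ s, IsSymbol (V p) := fun p hp => (ha.isSymbol p hp).sub (ha.isSymbol_deriv p hp)
  have hVinv : ∀ p ∈ s, ∀ x : ℝ, invFT (V p) x = (1 + I * x) * invFT (a p) x := by
    intro p hp x
    have h1 := invFT_of_hasDerivAt (ha.isSymbol p hp).integrable (ha.isSymbol_deriv p hp).integrable
      (fun ξ => ((ha.isSymbol p hp).1.differentiable (by norm_num) ξ).hasDerivAt) x
    have h2 : invFT (V p) x = invFT (a p) x - invFT (deriv (a p)) x := by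
      simp only [invFT, hV, sub_mul]
      rw [integral_sub (integrable_mul_exp (ha.isSymbol p hp).integrable x)
        (integrable_mul_exp (ha.isSymbol_deriv p hp).integrable x), mul_sub]
    rw [h2, h1]; ring
  have hne : ∀ x : ℝ, (1 + I * x) ≠ 0 := fun x h => by
    simpa using congrArg Complex.re h
  have hnormsq : ∀ x : ℝ, ‖(1 + I * x : ℂ)‖ ^ 2 = 1 + x ^ 2 := fun x => by
    rw [← Complex.normSq_eq_norm_sq, Complex.normSq_apply]
    simp; ring
  -- the vectors and the function to be expanded
  set v : ℕ → ℝ → ℂ := fun p y => ((|t|⁻¹ : ℝ) : ℂ) * invFT (V p) ((z - y) / t) with hv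
  set G : ℝ → ℂ := fun y => F y * (1 + I * ((z - y) / t : ℝ))⁻¹ with hG
  have hGm : AEStronglyMeasurable G := by
    refine hF.mul (Continuous.aestronglyMeasurable ?_)
    exact Continuous.inv₀ (by fun_prop) fun y => hne _
  have hvs : ∀ p ∈ s, MemLp (v p) 2 volume := by
    intro p hp
    have hc : Continuous (v p) := continuous_const.mul
      ((continuous_invFT (hVs p hp).integrable).comp (by fun_prop))
    refine (memLp_two_iff hc.aestronglyMeasurable).2 ?_
    obtain ⟨N, hN0, hN⟩ : ∃ N, 0 ≤ N ∧ ∀ x, ‖invFT (V p) x‖ ≤ N :=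
      ⟨_, (norm_nonneg _).trans (norm_invFT_le (V p) 0), norm_invFT_le (V p)⟩
    have hi : Integrable (v p) := by
      have := ((hVs p hp).integrable_invFT.comp_div ht).comp_sub_left z
      exact this.const_mul _
    calc ∫⁻ y, ‖v p y‖ₑ ^ 2 ≤ ∫⁻ y, ofReal (|t|⁻¹ * N) * ‖v p y‖ₑ := by
          refine lintegral_mono fun y => ?_
          rw [sq]
          gcongr
          rw [← ofReal_norm]
          refine ofReal_le_ofReal ?_
          rw [norm_mul, norm_real, norm_of_nonneg (by positivity)]
          gcongr
          exact hN _
      _ < ∞ := by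
          rw [lintegral_const_mul' _ _ ofReal_ne_top]
          exact mul_lt_top ofReal_lt_top hi.2
  have hGv : ∀ p ∈ s, conv F (invFT fun η => a p (t * η)) z = ∫ y, G y * v p y := by
    intro p hp
    rw [conv_apply]
    congr 1; ext y
    simp only [hG, hv]
    rw [invFT_comp_mul _ ht, hVinv p hp]
    have := hne ((z - y) / t)
    field_simp
  have hgram : ∀ p ∈ s, ∀ p' ∈ s, ‖∫ y, v p y * conj (v p' y)‖ ≤
      |t|⁻¹ * max K 1 / (1 + ((p : ℝ) - p') ^ 2) := by
    intro p hp p' hp'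
    have h1 : ∫ y, v p y * conj (v p' y) = ((|t|⁻¹ ^ 2 : ℝ) : ℂ) *
        (|t| * ∫ x, invFT (V p) x * conj (invFT (V p') x)) := by
      have h2 : ∀ y, v p y * conj (v p' y) = ((|t|⁻¹ ^ 2 : ℝ) : ℂ) *
          (invFT (V p) ((z - y) / t) * conj (invFT (V p') ((z - y) / t))) := fun y => by
        simp only [hv]
        rw [map_mul, conj_ofReal]
        push_cast; ring
      simp_rw [h2]
      rw [integral_const_mul, integral_sub_left_eq_self (fun y => invFT (V p) (y / t) *
        conj (invFT (V p') (y / t))) volume z,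
        Measure.integral_comp_div (fun y => invFT (V p) y * conj (invFT (V p') y)),
        real_smul]
    have hpi : ‖(2 * π : ℂ)⁻¹‖ ≤ 1 := by
      rw [show (2 * π : ℂ)⁻¹ = (((2 * π)⁻¹ : ℝ) : ℂ) by push_cast; rfl,
        norm_real, norm_of_nonneg (by positivity)]
      exact inv_le_one_of_one_le₀ (by linarith [Real.pi_gt_three])
    rw [h1, (hVs p hp).integral_invFT_mul_conj (hVs p' hp').integrable, norm_mul, norm_mul,
      norm_mul, norm_real, norm_real, norm_of_nonneg (by positivity),
      norm_of_nonneg (by positivity)]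
    have h3 := ha.gram_le p hp p' hp'
    calc |t|⁻¹ ^ 2 * (|t| * (‖(2 * π : ℂ)⁻¹‖ * ‖∫ ξ, V p ξ * conj (V p' ξ)‖))
        ≤ |t|⁻¹ ^ 2 * (|t| * (1 * (max K 1 / (1 + ((p : ℝ) - p') ^ 2)))) := by
          gcongr
          exact h3.trans (by gcongr; exact le_max_left _ _)
      _ = _ := by field_simp
  have hbes := sum_enorm_integral_mul_sq_le s hvs hgram (fun p p' => by
      rw [show ((p : ℝ) - p') ^ 2 = ((p' : ℝ) - p) ^ 2 by ring])
    (M := |t|⁻¹ * max K 1 * M) (by positivity) (fun p hp => by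
      have := hM s p
      calc ∑ p' ∈ s, |t|⁻¹ * max K 1 / (1 + ((p : ℝ) - p') ^ 2) =
          |t|⁻¹ * max K 1 * ∑ p' ∈ s, 1 / (1 + ((p : ℝ) - p') ^ 2) := by
            rw [mul_sum]; simp_rw [mul_one_div]
        _ ≤ _ := by gcongr) hGm
  calc _ = ∑ p ∈ s, ‖∫ y, G y * v p y‖ₑ ^ 2 := sum_congr rfl fun p hp => by rw [hGv p hp]
    _ ≤ _ := hbes
    _ = _ := by
      rw [cauchyAvg, ← lintegral_const_mul' _ _ ofReal_ne_top,
        ← lintegral_const_mul' _ _ coe_ne_top]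
      refine lintegral_congr fun y => ?_
      simp only [hG]
      rw [enorm_mul, mul_pow, mul_comm (‖F y‖ₑ ^ 2), ← mul_assoc, ← mul_assoc]
      congr 1
      rw [← ofReal_norm, ← ofReal_pow (norm_nonneg _), norm_inv, inv_pow, hnormsq,
        ← ofReal_mul (by positivity)]
      change _ = ofReal _ * _
      rw [← ofReal_mul (by positivity)]
      congr 1
      rw [div_pow, ← sq_abs t]
      have h1 : |t| ^ 2 + (z - y) ^ 2 ≠ 0 := by positivity
      have h2 : 1 + (z - y) ^ 2 / |t| ^ 2 ≠ 0 := by positivity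
      field_simp

/-! ### Oscillatory integrals with flat amplitudes -/

/-- On `O` the function `A` has `n` derivatives; they and `A` itself are bounded by `M * w`. The
weight `w = 1` is used for coefficients, and a weight vanishing on the boundary of `O` for
amplitudes. -/
def JetLE (O : Set ℝ) (w : ℝ → ℝ) : ℕ → ℝ → (ℝ → ℂ) → Prop
  | 0, M, A => ∀ u ∈ O, ‖A u‖ ≤ M * w u
  | n + 1, M, A => (∀ u ∈ O, ‖A u‖ ≤ M * w u) ∧
      ∃ A' : ℝ → ℂ, (∀ u ∈ O, HasDerivAt A (A' u) u) ∧ JetLE O w n M A'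

namespace JetLE

variable {O : Set ℝ} {w : ℝ → ℝ} {n : ℕ} {M M' : ℝ} {A B : ℝ → ℂ}

lemma norm_le (h : JetLE O w n M A) : ∀ u ∈ O, ‖A u‖ ≤ M * w u := by
  cases n with
  | zero => exact h
  | succ n => exact h.1

lemma of_succ (h : JetLE O w (n + 1) M A) : JetLE O w n M A := by
  induction n generalizing A with
  | zero => exact h.1
  | succ n ih =>
    obtain ⟨h1, A', hA', h2⟩ := h
    exact ⟨h1, A', hA', ih h2⟩

lemma weaken {w' : ℝ → ℝ} (h : JetLE O w n M A) (hw : ∀ u ∈ O, M * w u ≤ M' * w' u) :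
    JetLE O w' n M' A := by
  induction n generalizing A with
  | zero => exact fun u hu => (h u hu).trans (hw u hu)
  | succ n ih =>
    obtain ⟨h1, A', hA', h2⟩ := h
    exact ⟨fun u hu => (h1 u hu).trans (hw u hu), A', hA', ih h2⟩

lemma congr (hO : IsOpen O) (h : JetLE O w n M A) (hAB : ∀ u ∈ O, B u = A u) :
    JetLE O w n M B := by
  cases n with
  | zero => exact fun u hu => by rw [hAB u hu]; exact h u hu
  | succ n =>
    obtain ⟨h1, A', hA', h2⟩ := h
    refine ⟨fun u hu => by rw [hAB u hu]; exact h1 u hu, A', fun u hu => ?_, h2⟩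
    exact (hA' u hu).congr_of_eventuallyEq (by filter_upwards [hO.mem_nhds hu] with x hx using hAB x hx)

lemma add (hA : JetLE O w n M A) (hB : JetLE O w n M' B) :
    JetLE O w n (M + M') fun u => A u + B u := by
  have h0 : ∀ A B : ℝ → ℂ, (∀ u ∈ O, ‖A u‖ ≤ M * w u) → (∀ u ∈ O, ‖B u‖ ≤ M' * w u) →
      ∀ u ∈ O, ‖A u + B u‖ ≤ (M + M') * w u := fun A B h1 h2 u hu => by
    rw [add_mul]; exact (norm_add_le _ _).trans (add_le_add (h1 u hu) (h2 u hu))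
  induction n generalizing A B with
  | zero => exact h0 A B hA hB
  | succ n ih =>
    obtain ⟨h1, A', hA', h2⟩ := hA
    obtain ⟨h3, B', hB', h4⟩ := hB
    exact ⟨h0 A B h1 h3, _, fun u hu => (hA' u hu).add (hB' u hu), ih h2 h4⟩

lemma const_mul (c : ℂ) (hA : JetLE O w n M A) : JetLE O w n (‖c‖ * M) fun u => c * A u := by
  have h0 : ∀ A : ℝ → ℂ, (∀ u ∈ O, ‖A u‖ ≤ M * w u) → ∀ u ∈ O, ‖c * A u‖ ≤ ‖c‖ * M * w u :=
    fun A h1 u hu => by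
      rw [norm_mul, mul_assoc]; exact mul_le_mul_of_nonneg_left (h1 u hu) (norm_nonneg _)
  induction n generalizing A with
  | zero => exact h0 A hA
  | succ n ih =>
    obtain ⟨h1, A', hA', h2⟩ := hA
    exact ⟨h0 A h1, _, fun u hu => (hA' u hu).const_mul c, ih h2⟩

lemma star (hA : JetLE O w n M A) : JetLE O w n M fun u => conj (A u) := by
  induction n generalizing A with
  | zero => exact fun u hu => by rw [RCLike.norm_conj]; exact hA u hu
  | succ n ih =>
    obtain ⟨h1, A', hA', h2⟩ := hA
    exact ⟨fun u hu => by rw [RCLike.norm_conj]; exact h1 u hu, _,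
      fun u hu => (hA' u hu).star, ih h2⟩

lemma mul (hM : 0 ≤ M) (hM' : 0 ≤ M') (hw : ∀ u ∈ O, 0 ≤ w u) (hA : JetLE O (fun _ => 1) n M A)
    (hB : JetLE O w n M' B) : JetLE O w n (2 ^ n * (M * M')) fun u => A u * B u := by
  have h0 : ∀ n : ℕ, ∀ A B : ℝ → ℂ, (∀ u ∈ O, ‖A u‖ ≤ M * 1) → (∀ u ∈ O, ‖B u‖ ≤ M' * w u) →
      ∀ u ∈ O, ‖A u * B u‖ ≤ 2 ^ n * (M * M') * w u := fun n A B h1 h2 u hu => by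
    rw [norm_mul]
    have h3 : ‖A u‖ * ‖B u‖ ≤ M * 1 * (M' * w u) :=
      mul_le_mul (h1 u hu) (h2 u hu) (norm_nonneg _) (by simpa using hM)
    have h4 : (1 : ℝ) ≤ 2 ^ n := one_le_pow₀ one_le_two
    have h5 : 0 ≤ M * M' * w u := mul_nonneg (mul_nonneg hM hM') (hw u hu)
    nlinarith
  induction n generalizing A B with
  | zero => exact h0 0 A B hA hB
  | succ n ih =>
    have hA1 := hA.of_succ
    have hB1 := hB.of_succ
    obtain ⟨h1, A', hA', h2⟩ := hA
    obtain ⟨h3, B', hB', h4⟩ := hB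
    refine ⟨h0 _ A B h1 h3, _, fun u hu => (hA' u hu).mul (hB' u hu), ?_⟩
    have := (ih h2 hB1).add (ih hA1 h4)
    rwa [show (2 : ℝ) ^ n * (M * M') + 2 ^ n * (M * M') = 2 ^ (n + 1) * (M * M') by ring] at this

/-- Inverses of functions bounded from below; the bound depends on the given bounds only. -/
lemma exists_inv (n : ℕ) {M c : ℝ} (hM : 0 ≤ M) (hc : 0 < c) : ∃ M', 0 ≤ M' ∧
    ∀ (O : Set ℝ) (A : ℝ → ℂ), JetLE O (fun _ => 1) n M A → (∀ u ∈ O, c ≤ ‖A u‖) →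
      JetLE O (fun _ => 1) n M' fun u => (A u)⁻¹ := by
  have h0 : ∀ (O : Set ℝ) (A : ℝ → ℂ), (∀ u ∈ O, c ≤ ‖A u‖) → ∀ u ∈ O, ‖(A u)⁻¹‖ ≤ c⁻¹ :=
    fun O A h u hu => by rw [norm_inv]; exact inv_anti₀ hc (h u hu)
  induction n with
  | zero => exact ⟨c⁻¹, by positivity, fun O A _ h u hu => by simpa using h0 O A h u hu⟩
  | succ n ih =>
    obtain ⟨M₁, hM₁, hi⟩ := ih
    set M₂ := 2 ^ n * (M * (2 ^ n * (M₁ * M₁)))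
    have hM₂ : 0 ≤ M₂ := by positivity
    refine ⟨max c⁻¹ M₂, le_max_of_le_right hM₂, fun O A hA hAc => ?_⟩
    have h1 := hi O A hA.of_succ hAc
    obtain ⟨h2, A', hA', h3⟩ := hA
    have h4 := ((h3.mul hM (by positivity) (fun _ _ => zero_le_one)
      (h1.mul hM₁ hM₁ (fun _ _ => zero_le_one) h1)).const_mul (-1))
    refine ⟨fun u hu => (h0 O A hAc u hu).trans (by simp),
      fun u => -1 * (A' u * ((A u)⁻¹ * (A u)⁻¹)), fun u hu => ?_, h4.weaken fun u _ => ?_⟩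
    · have hne : A u ≠ 0 := norm_pos_iff.1 (hc.trans_le (hAc u hu))
      have e : -1 * (A' u * ((A u)⁻¹ * (A u)⁻¹)) = -A' u / A u ^ 2 := by
        field_simp
      simp only [e]
      exact (hA' u hu).inv hne
    · simp [M₂]

end JetLE

/-- The weight `w` is nonnegative, bounded by `W`, and vanishes to second order at all points
outside the bounded open set `O`. -/
structure IsFlatWeight (O : Set ℝ) (w : ℝ → ℝ) (W : ℝ) : Prop where
  isOpen : IsOpen O
  subset : O ⊆ Icc (-10) 10
  nonneg : ∀ u, 0 ≤ w u
  le : ∀ u, w u ≤ W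
  isLittleO : ∀ u₀ ∉ O, w =o[𝓝 u₀] fun u => u - u₀

namespace IsFlatWeight

variable {O : Set ℝ} {w : ℝ → ℝ} {W : ℝ}

lemma W_nonneg (h : IsFlatWeight O w W) : 0 ≤ W := (h.nonneg 0).trans (h.le 0)

/-- A function dominated by a flat weight can be extended by zero. -/
lemma hasDerivAt (h : IsFlatWeight O w W) {F F' : ℝ → ℂ} {M : ℝ} (hF0 : ∀ u ∉ O, F u = 0)
    (hM : ∀ u ∈ O, ‖F u‖ ≤ M * w u) (hd : ∀ u ∈ O, HasDerivAt F (F' u) u) (u : ℝ) :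
    HasDerivAt F (O.indicator F' u) u := by
  by_cases hu : u ∈ O
  · rw [indicator_of_mem hu]; exact hd u hu
  rw [indicator_of_notMem hu, hasDerivAt_iff_isLittleO]
  simp only [hF0 u hu, sub_zero, smul_zero]
  refine Asymptotics.IsBigO.trans_isLittleO
    (Asymptotics.IsBigO.of_bound |M| (Eventually.of_forall fun x => ?_)) (h.isLittleO u hu)
  rw [norm_of_nonneg (h.nonneg x)]
  have hnn : 0 ≤ |M| * w x := mul_nonneg (abs_nonneg _) (h.nonneg x)
  by_cases hx : x ∈ O
  · exact (hM x hx).trans (mul_le_mul_of_nonneg_right (le_abs_self M) (h.nonneg x))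
  · rw [hF0 x hx, norm_zero]; exact hnn

lemma contDiff (h : IsFlatWeight O w W) {n : ℕ} {F : ℝ → ℂ} {M : ℝ} (hF0 : ∀ u ∉ O, F u = 0)
    (hF : JetLE O w (n + 1) M F) : ContDiff ℝ n F := by
  induction n generalizing F with
  | zero =>
    obtain ⟨h1, F', hF', -⟩ := hF
    have hd := h.hasDerivAt hF0 h1 hF'
    exact contDiff_zero.2 (continuous_iff_continuousAt.2 fun u => (hd u).continuousAt)
  | succ n ih =>
    obtain ⟨h1, F', hF', h2⟩ := hF
    have hd := h.hasDerivAt hF0 h1 hF'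
    have hderiv : deriv F = O.indicator F' := funext fun u => (hd u).deriv
    have : ((n + 1 : ℕ) : WithTop ℕ∞) = (n : WithTop ℕ∞) + 1 := by push_cast; rfl
    rw [this, contDiff_succ_iff_deriv]
    refine ⟨fun u => (hd u).differentiableAt, by simp, ?_⟩
    rw [hderiv]
    exact ih (fun u hu => indicator_of_notMem hu _)
      (h2.congr h.isOpen fun u hu => indicator_of_mem hu _)

lemma volume_lt_top (h : IsFlatWeight O w W) : volume O < ∞ :=
  (measure_mono h.subset).trans_lt measure_Icc_lt_top

/-- Integration by parts. The boundary terms vanish as `b` is dominated by a flat weight. -/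
lemma integral_by_parts (h : IsFlatWeight O w W) {E H b b' : ℝ → ℂ} {Λ M N : ℝ}
    (hE : ∀ u ∈ O, HasDerivAt E (-(I * Λ) * H u * E u) u) (hE1 : ∀ u ∈ O, ‖E u‖ ≤ 1)
    (hH : ContinuousOn H O) (hHN : ∀ u ∈ O, ‖H u‖ ≤ N) (hM : 0 ≤ M)
    (hb : ∀ u ∈ O, ‖b u‖ ≤ M * w u) (hbd : ∀ u ∈ O, HasDerivAt b (b' u) u)
    (hb' : ∀ u ∈ O, ‖b' u‖ ≤ M * w u) :
    I * Λ * ∫ u in O, E u * (H u * b u) = ∫ u in O, E u * b' u := by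
  have hW := h.W_nonneg
  have hOm := h.isOpen.measurableSet
  set X : ℝ → ℂ := O.indicator fun u => E u * b u with hX
  have hX0 : ∀ u ∉ O, X u = 0 := fun u hu => indicator_of_notMem hu _
  have hEb : ∀ u ∈ O, ‖E u * b u‖ ≤ M * w u := fun u hu => by
    rw [norm_mul]
    exact (mul_le_of_le_one_left (norm_nonneg _) (hE1 u hu)).trans (hb u hu)
  have hXd := h.hasDerivAt (F := X) (F' := fun u => -(I * Λ) * H u * E u * b u + E u * b' u)
    (M := M) hX0 (fun u hu => by rw [hX, indicator_of_mem hu]; exact hEb u hu) fun u hu =>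
      ((hE u hu).mul (hbd u hu)).congr_of_eventuallyEq (by
        filter_upwards [h.isOpen.mem_nhds hu] with x hx using indicator_of_mem hx _)
  have hXc : Continuous X := continuous_iff_continuousAt.2 fun u => (hXd u).continuousAt
  have hXs : HasCompactSupport X := HasCompactSupport.intro (isCompact_Icc (a := (-10 : ℝ)) (b := 10))
    fun u hu => hX0 u fun hO => hu (h.subset hO)
  have hXi : Integrable X := hXc.integrable_of_hasCompactSupport hXs
  have hwb : ∀ u, M * w u ≤ M * W := fun u => mul_le_mul_of_nonneg_left (h.le u) hM
  have hfm : IsFiniteMeasure (volume.restrict O) :=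
    ⟨by rw [Measure.restrict_apply_univ]; exact h.volume_lt_top⟩
  have hi1 : IntegrableOn (fun u => E u * (H u * b u)) O := by
    refine Integrable.of_bound (C := N * (M * W)) ?_ ?_
    · refine ContinuousOn.aestronglyMeasurable ?_ hOm
      have hEc : ContinuousOn E O := fun u hu => (hE u hu).continuousAt.continuousWithinAt
      exact hEc.mul (hH.mul fun u hu => (hbd u hu).continuousAt.continuousWithinAt)
    · refine (ae_restrict_iff' hOm).2 (ae_of_all _ fun u hu => ?_)
      rw [mul_left_comm, norm_mul]
      exact mul_le_mul (hHN u hu) ((hEb u hu).trans (hwb u)) (norm_nonneg _)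
        ((norm_nonneg _).trans (hHN u hu))
  have hi2 : IntegrableOn (fun u => -(I * Λ) * H u * E u * b u + E u * b' u) O := by
    refine Integrable.of_bound (C := |Λ| * N * (M * W) + M * W) ?_ ?_
    · refine ((measurable_deriv X).aestronglyMeasurable.restrict).congr
        ((ae_restrict_iff' hOm).2 (ae_of_all _ fun u hu => ?_))
      rw [(hXd u).deriv, indicator_of_mem hu]
    · refine (ae_restrict_iff' hOm).2 (ae_of_all _ fun u hu => ?_)
      refine (norm_add_le _ _).trans (add_le_add ?_ ?_)
      · rw [mul_assoc, norm_mul, norm_mul, norm_neg, norm_mul, norm_I, one_mul,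
          norm_real, norm_eq_abs]
        have := hHN u hu
        have h3 := (hEb u hu).trans (hwb u)
        have hN := (norm_nonneg _).trans this
        gcongr
      · rw [norm_mul]
        exact (mul_le_of_le_one_left (norm_nonneg _) (hE1 u hu)).trans ((hb' u hu).trans (hwb u))
  have hzero : ∫ u in O, (-(I * Λ) * H u * E u * b u + E u * b' u) = 0 := by
    rw [← integral_indicator hOm]
    exact integral_eq_zero_of_hasDerivAt_of_integrable hXd
      ((integrable_indicator_iff hOm).2 hi2) hXi
  have hi3 : IntegrableOn (fun u => I * Λ * (E u * (H u * b u))) O := hi1.const_mul _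
  have e : ∀ u, E u * b' u = (-(I * Λ) * H u * E u * b u + E u * b' u) +
      I * Λ * (E u * (H u * b u)) := fun u => by ring
  calc _ = ∫ u in O, I * Λ * (E u * (H u * b u)) := (integral_const_mul _ _).symm
    _ = ∫ u in O, ((-(I * Λ) * H u * E u * b u + E u * b' u) +
        I * Λ * (E u * (H u * b u))) := by rw [integral_add hi2 hi3, hzero, zero_add]
    _ = _ := by simp_rw [← e]

lemma norm_setIntegral_le (h : IsFlatWeight O w W) {F : ℝ → ℂ} {M : ℝ} (hM : 0 ≤ M)
    (hF : ∀ u ∈ O, ‖F u‖ ≤ M * w u) : ‖∫ u in O, F u‖ ≤ 20 * (M * W) := by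
  have h1 := norm_setIntegral_le_of_norm_le_const h.volume_lt_top (f := F) (C := M * W)
    fun u hu => (hF u hu).trans (mul_le_mul_of_nonneg_left (h.le u) hM)
  refine h1.trans ?_
  rw [mul_comm]
  refine mul_le_mul_of_nonneg_right ?_ (mul_nonneg hM h.W_nonneg)
  have h2 : volume.real O ≤ volume.real (Icc (-10 : ℝ) 10) :=
    measureReal_mono h.subset measure_Icc_lt_top.ne
  rw [Real.volume_real_Icc] at h2
  norm_num at h2
  exact h2

/-- Nonstationary phase: two integrations by parts gain `Λ⁻²`. -/
lemma exists_norm_integral_le {M N c : ℝ} (hM : 0 ≤ M) (hN : 0 ≤ N) (hc : 0 < c) (W : ℝ) :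
    ∃ K, 0 ≤ K ∧ ∀ (O : Set ℝ) (w : ℝ → ℝ), IsFlatWeight O w W → ∀ (E H a : ℝ → ℂ) (Λ : ℝ), Λ ≠ 0 →
      (∀ u ∈ O, HasDerivAt E (-(I * Λ) * H u * E u) u) → (∀ u ∈ O, ‖E u‖ ≤ 1) →
      JetLE O (fun _ => 1) 2 N H → (∀ u ∈ O, c ≤ ‖H u‖) → JetLE O w 2 M a →
      ‖∫ u in O, E u * a u‖ ≤ K / Λ ^ 2 := by
  obtain ⟨N', hN', hinv⟩ := JetLE.exists_inv 2 hN hc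
  set M₁ := 2 ^ 2 * (N' * M) with hM₁
  have hM₁0 : 0 ≤ M₁ := by positivity
  set M₂ := 2 ^ 1 * (N' * M₁) with hM₂
  have hM₂0 : 0 ≤ M₂ := by positivity
  refine ⟨20 * (M₂ * |W|), by positivity, fun O w h E H a Λ hΛ hE hE1 hH hHc ha => ?_⟩
  have hHi := hinv O H hH hHc
  have hHne : ∀ u ∈ O, H u ≠ 0 := fun u hu => norm_pos_iff.1 (hc.trans_le (hHc u hu))
  have hHcont : ContinuousOn H O := fun u hu => by
    obtain ⟨-, H', hH', -⟩ := hH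
    exact (hH' u hu).continuousAt.continuousWithinAt
  have hHN : ∀ u ∈ O, ‖H u‖ ≤ N := fun u hu => by simpa using hH.norm_le u hu
  have hOm := h.isOpen.measurableSet
  have hb := hHi.mul hN' hM (fun u _ => h.nonneg u) ha
  have hb0 := hb.norm_le
  obtain ⟨-, b', hbd, hb1⟩ := hb
  have hd := hHi.of_succ.mul hN' hM₁0 (fun u _ => h.nonneg u) hb1
  have hd0 := hd.norm_le
  obtain ⟨-, d', hdd, hd1⟩ := hd
  have h1 := h.integral_by_parts hE hE1 hHcont hHN hM₁0 hb0 hbd hb1.norm_le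
  have h2 := h.integral_by_parts hE hE1 hHcont hHN hM₂0 hd0 hdd hd1
  have e1 : ∫ u in O, E u * (H u * ((H u)⁻¹ * a u)) = ∫ u in O, E u * a u :=
    setIntegral_congr_fun hOm fun u hu => by
      rw [mul_inv_cancel_left₀ (hHne u hu)]
  have e2 : ∫ u in O, E u * (H u * ((H u)⁻¹ * b' u)) = ∫ u in O, E u * b' u :=
    setIntegral_congr_fun hOm fun u hu => by
      rw [mul_inv_cancel_left₀ (hHne u hu)]
  rw [e1] at h1
  rw [e2] at h2
  have h3 : (I * Λ) * (I * Λ) * ∫ u in O, E u * a u = ∫ u in O, E u * d' u := by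
    rw [mul_assoc, h1, h2]
  have h4 := congrArg norm h3
  simp only [norm_mul, norm_I, one_mul, norm_real, norm_eq_abs] at h4
  rw [le_div_iff₀ (by positivity), ← sq_abs, sq, mul_comm, h4]
  have h5 := h.norm_setIntegral_le (F := fun u => E u * d' u) hM₂0 fun u hu => by
    rw [norm_mul]
    exact (mul_le_of_le_one_left (norm_nonneg _) (hE1 u hu)).trans (hd1 u hu)
  refine h5.trans ?_
  gcongr
  exact le_abs_self W

end IsFlatWeight

/-! ### The oscillatory symbols -/

/-- The interior of the support of `φ`. -/
def innerSupport (φ : ℝ → ℂ) : Set ℝ := interior (tsupport φ)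

/-- A weight dominating `φ` and its first four derivatives. -/
noncomputable def jetWeight (φ : ℝ → ℂ) (u : ℝ) : ℝ := ∑ i ∈ Finset.range 5, ‖iteratedDeriv i φ u‖

lemma tsupport_iteratedDeriv_subset (φ : ℝ → ℂ) (i : ℕ) :
    tsupport (iteratedDeriv i φ) ⊆ tsupport φ := by
  induction i with
  | zero => simp
  | succ i ih =>
    rw [iteratedDeriv_succ]
    exact (tsupport_deriv_subset).trans ih

/-- At boundary points of its support, a smooth function vanishes with all its derivatives. -/
lemma iteratedDeriv_eq_zero {φ : ℝ → ℂ} (hφ : ContDiff ℝ (⊤ : ℕ∞) φ) (i : ℕ) {u : ℝ}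
    (hu : u ∉ innerSupport φ) : iteratedDeriv i φ u = 0 := by
  have hc : Continuous (iteratedDeriv i φ) := hφ.continuous_iteratedDeriv i (by exact_mod_cast le_top)
  have h1 : u ∈ closure (tsupport φ)ᶜ := by
    rw [closure_compl]; exact hu
  have h2 : closure (tsupport φ)ᶜ ⊆ {x | iteratedDeriv i φ x = 0} :=
    closure_minimal (fun x hx => image_eq_zero_of_notMem_tsupport
      fun h => hx (tsupport_iteratedDeriv_subset φ i h)) (isClosed_eq hc continuous_const)
  exact h2 h1

lemma hasDerivAt_iteratedDeriv {φ : ℝ → ℂ} (hφ : ContDiff ℝ (⊤ : ℕ∞) φ) (i : ℕ) (u : ℝ) :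
    HasDerivAt (iteratedDeriv i φ) (iteratedDeriv (i + 1) φ u) u := by
  rw [iteratedDeriv_succ]
  exact (hφ.differentiable_iteratedDeriv i (by exact_mod_cast ENat.natCast_lt_top i) u).hasDerivAt

lemma exists_isFlatWeight {φ : ℝ → ℂ} (hφ : ContDiff ℝ (⊤ : ℕ∞) φ)
    (hφsupp : tsupport φ ⊆ {x : ℝ | 1 / 10 < |x| ∧ |x| < 10}) :
    ∃ W, IsFlatWeight (innerSupport φ) (jetWeight φ) W := by
  have hsub : tsupport φ ⊆ Icc (-10) 10 := fun x hx => by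
    have := abs_lt.1 (hφsupp hx).2
    exact ⟨this.1.le, this.2.le⟩
  have hcs : HasCompactSupport φ :=
    isCompact_Icc.of_isClosed_subset (isClosed_tsupport φ) hsub
  have hci : ∀ i, Continuous (iteratedDeriv i φ) := fun i =>
    hφ.continuous_iteratedDeriv i (by exact_mod_cast le_top)
  have hb : ∀ i : ℕ, ∃ C, ∀ u, ‖iteratedDeriv i φ u‖ ≤ C := fun i =>
    (hci i).bounded_above_of_compact_support
      (hcs.mono' ((subset_tsupport _).trans (tsupport_iteratedDeriv_subset φ i)))
  choose C hC using hb
  refine ⟨∑ i ∈ Finset.range 5, C i, isOpen_interior, interior_subset.trans hsub,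
    fun u => sum_nonneg fun i _ => norm_nonneg _,
    fun u => sum_le_sum fun i _ => hC i u, fun u₀ hu₀ => ?_⟩
  refine Asymptotics.IsLittleO.fun_sum fun i _ => ?_
  have h := hasDerivAt_iteratedDeriv hφ i u₀
  rw [iteratedDeriv_eq_zero hφ _ hu₀, hasDerivAt_iff_isLittleO] at h
  simp only [iteratedDeriv_eq_zero hφ i hu₀, sub_zero, smul_zero] at h
  exact h.norm_left

lemma jetLE_iteratedDeriv {φ : ℝ → ℂ} (hφ : ContDiff ℝ (⊤ : ℕ∞) φ) (n : ℕ) :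
    ∀ i, i + n ≤ 4 → JetLE (innerSupport φ) (jetWeight φ) n 1 (iteratedDeriv i φ) := by
  have h0 : ∀ i ≤ 4, ∀ u ∈ innerSupport φ, ‖iteratedDeriv i φ u‖ ≤ 1 * jetWeight φ u :=
    fun i hi u _ => by
      rw [one_mul]
      exact single_le_sum (f := fun i => ‖iteratedDeriv i φ u‖) (fun _ _ => norm_nonneg _)
        (Finset.mem_range.2 (by omega))
  induction n with
  | zero => exact fun i hi => h0 i (by omega)
  | succ n ih =>
    exact fun i hi => ⟨h0 i (by omega), _, fun u _ => hasDerivAt_iteratedDeriv hφ i u,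
      ih (i + 1) (by omega)⟩

/-- `ρ 0, …, ρ 3` are successive derivatives, `ρ 0` is the derivative of `R`, all of this at the
points `u * t` with `u ∈ O` and `1 / 2 ≤ t ≤ 1`; moreover `|ρ i| ≤ M` and `|ρ 1| ≥ c`. -/
structure IsPhase (O : Set ℝ) (R : ℝ → ℝ) (ρ : ℕ → ℝ → ℝ) (M c : ℝ) : Prop where
  hasDerivAt_phase : ∀ u ∈ O, ∀ t ∈ Icc (1 / 2 : ℝ) 1, HasDerivAt R (ρ 0 (u * t)) (u * t)
  hasDerivAt : ∀ i < 3, ∀ u ∈ O, ∀ t ∈ Icc (1 / 2 : ℝ) 1,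
    HasDerivAt (ρ i) (ρ (i + 1) (u * t)) (u * t)
  bound : ∀ i ≤ 3, ∀ u ∈ O, ∀ t ∈ Icc (1 / 2 : ℝ) 1, |ρ i (u * t)| ≤ M
  lower : ∀ u ∈ O, ∀ t ∈ Icc (1 / 2 : ℝ) 1, c ≤ |ρ 1 (u * t)|

/-- The oscillating factor `e^{-i (Λ/t) R(u t)}`. -/
noncomputable def wave (R : ℝ → ℝ) (Λ t u : ℝ) : ℂ :=
  exp (-I * ((Λ / t) * R (u * t) : ℝ))

lemma norm_wave (R : ℝ → ℝ) (Λ t u : ℝ) : ‖wave R Λ t u‖ = 1 := by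
  rw [wave, show -I * ((Λ / t * R (u * t) : ℝ) : ℂ) =
    ((-(Λ / t * R (u * t)) : ℝ) : ℂ) * I by push_cast; ring, Complex.norm_exp_ofReal_mul_I]

namespace IsPhase

variable {O : Set ℝ} {R : ℝ → ℝ} {ρ : ℕ → ℝ → ℝ} {M c : ℝ}

lemma hasDerivAt_left (h : IsPhase O R ρ M c) {i : ℕ} (hi : i < 3) {u t : ℝ} (hu : u ∈ O)
    (ht : t ∈ Icc (1 / 2 : ℝ) 1) :
    HasDerivAt (fun u => t ^ i * ρ i (u * t)) (t ^ (i + 1) * ρ (i + 1) (u * t)) u := by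
  have h1 := ((h.hasDerivAt i hi u hu t ht).comp u (hasDerivAt_mul_const t)).const_mul (t ^ i)
  rw [show t ^ i * (ρ (i + 1) (u * t) * t) = t ^ (i + 1) * ρ (i + 1) (u * t) by ring] at h1
  exact h1

lemma hasDerivAt_right (h : IsPhase O R ρ M c) {i : ℕ} (hi : i < 3) {u t : ℝ} (hu : u ∈ O)
    (ht : t ∈ Icc (1 / 2 : ℝ) 1) :
    HasDerivAt (fun t => ρ i (u * t)) (ρ (i + 1) (u * t) * u) t :=
  (h.hasDerivAt i hi u hu t ht).comp t (hasDerivAt_const_mul u)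

lemma jetLE (h : IsPhase O R ρ M c) {t : ℝ} (ht : t ∈ Icc (1 / 2 : ℝ) 1) (n : ℕ) :
    ∀ i, i + n ≤ 3 → JetLE O (fun _ => 1) n M fun u => ((t ^ i * ρ i (u * t) : ℝ) : ℂ) := by
  have h0 : ∀ i ≤ 3, ∀ u ∈ O, ‖((t ^ i * ρ i (u * t) : ℝ) : ℂ)‖ ≤ M * 1 := fun i hi u hu => by
    rw [norm_real, norm_mul, norm_pow, norm_eq_abs, norm_eq_abs, mul_one]
    have h1 : |t| ≤ 1 := abs_le.2 ⟨by linarith [ht.1], ht.2⟩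
    exact (mul_le_of_le_one_left (abs_nonneg _) (pow_le_one₀ (abs_nonneg _) h1)).trans
      (h.bound i hi u hu t ht)
  induction n with
  | zero => exact fun i hi => h0 i (by omega)
  | succ n ih =>
    refine fun i hi => ⟨h0 i (by omega), _, fun u hu => ?_, ih (i + 1) (by omega)⟩
    exact (h.hasDerivAt_left (by omega) hu ht).ofReal_comp

lemma abs_sub_le (h : IsPhase O R ρ M c) (hO : ∀ u ∈ O, |u| ≤ 10) {i : ℕ} (hi : i ≤ 2) {u : ℝ}
    (hu : u ∈ O) {t t' : ℝ} (ht : t ∈ Icc (1 / 2 : ℝ) 1) (ht' : t' ∈ Icc (1 / 2 : ℝ) 1) :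
    |t ^ i * ρ i (u * t) - t' ^ i * ρ i (u * t')| ≤ 12 * M * |t - t'| := by
  have hd : ∀ τ ∈ Icc (1 / 2 : ℝ) 1, HasDerivWithinAt (fun τ => τ ^ i * ρ i (u * τ))
      (i * τ ^ (i - 1) * ρ i (u * τ) + τ ^ i * (ρ (i + 1) (u * τ) * u)) (Icc (1 / 2 : ℝ) 1) τ := by
    intro τ hτ
    exact ((hasDerivAt_pow i τ).mul (h.hasDerivAt_right (by omega) hu hτ)).hasDerivWithinAt
  have hM : 0 ≤ M := (abs_nonneg _).trans (h.bound i (by omega) u hu t ht)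
  refine (Convex.norm_image_sub_le_of_norm_hasDerivWithin_le hd (C := 12 * M) (fun τ hτ => ?_)
    (convex_Icc _ _) ht' ht)
  have hτ1 : |τ| ≤ 1 := abs_le.2 ⟨by linarith [hτ.1], hτ.2⟩
  have h2 := h.bound i (by omega) u hu τ hτ
  have h3 := h.bound (i + 1) (by omega) u hu τ hτ
  have hi' : (i : ℝ) ≤ 2 := by exact_mod_cast hi
  refine (norm_add_le _ _).trans ?_
  simp only [norm_mul, norm_pow, norm_eq_abs, Nat.abs_cast]
  calc (i : ℝ) * |τ| ^ (i - 1) * |ρ i (u * τ)| + |τ| ^ i * (|ρ (i + 1) (u * τ)| * |u|)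
      ≤ 2 * 1 * M + 1 * (M * 10) := by
        gcongr
        · exact pow_le_one₀ (abs_nonneg _) hτ1
        · exact pow_le_one₀ (abs_nonneg _) hτ1
        · exact hO u hu
    _ = 12 * M := by ring

/-- The difference quotient of the derivatives of two phases. -/
lemma jetLE_slope (h : IsPhase O R ρ M c) (hO : ∀ u ∈ O, |u| ≤ 10) {t t' : ℝ}
    (ht : t ∈ Icc (1 / 2 : ℝ) 1) (ht' : t' ∈ Icc (1 / 2 : ℝ) 1) (hne : t ≠ t') (n : ℕ) :
    ∀ i, i + n ≤ 2 → JetLE O (fun _ => 1) n (12 * M) fun u =>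
      (((t ^ i * ρ i (u * t) - t' ^ i * ρ i (u * t')) / (t - t') : ℝ) : ℂ) := by
  have hpos : 0 < |t - t'| := abs_pos.2 (sub_ne_zero.2 hne)
  have h0 : ∀ i ≤ 2, ∀ u ∈ O,
      ‖(((t ^ i * ρ i (u * t) - t' ^ i * ρ i (u * t')) / (t - t') : ℝ) : ℂ)‖ ≤ 12 * M * 1 := by
    intro i hi u hu
    rw [norm_real, norm_div, norm_eq_abs, norm_eq_abs, mul_one,
      div_le_iff₀ hpos]
    exact h.abs_sub_le hO hi hu ht ht'
  induction n with
  | zero => exact fun i hi => h0 i (by omega)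
  | succ n ih =>
    refine fun i hi => ⟨h0 i (by omega), _, fun u hu => ?_, ih (i + 1) (by omega)⟩
    exact (((h.hasDerivAt_left (by omega) hu ht).sub
      (h.hasDerivAt_left (by omega) hu ht')).div_const (t - t')).ofReal_comp

lemma le_abs_slope (h : IsPhase O R ρ M c) (hO : ∀ u ∈ O, 1 / 10 ≤ |u|) {u : ℝ}
    (hu : u ∈ O) {t t' : ℝ} (ht : t ∈ Icc (1 / 2 : ℝ) 1) (ht' : t' ∈ Icc (1 / 2 : ℝ) 1)
    (hne : t ≠ t') : c / 10 ≤ |(ρ 0 (u * t) - ρ 0 (u * t')) / (t - t')| := by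
  wlog hlt : t' < t generalizing t t'
  · have := this ht' ht hne.symm (lt_of_le_of_ne (not_lt.1 hlt) hne)
    rwa [← neg_sub, ← neg_sub t, neg_div_neg_eq] at this
  have hmem : ∀ τ ∈ Icc t' t, τ ∈ Icc (1 / 2 : ℝ) 1 := fun τ hτ =>
    ⟨ht'.1.trans hτ.1, hτ.2.trans ht.2⟩
  have hd : ∀ τ ∈ Icc t' t, HasDerivAt (fun τ => ρ 0 (u * τ)) (ρ 1 (u * τ) * u) τ :=
    fun τ hτ => h.hasDerivAt_right (by omega) hu (hmem τ hτ)
  obtain ⟨τ, hτ, hτ'⟩ := exists_hasDerivAt_eq_slope (fun τ => ρ 0 (u * τ)) _ hlt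
    (fun τ hτ => (hd τ hτ).continuousAt.continuousWithinAt) fun τ hτ => hd τ (Ioo_subset_Icc_self hτ)
  rw [← hτ', abs_mul]
  have h1 := h.lower u hu τ (hmem τ (Ioo_subset_Icc_self hτ))
  have h2 := hO u hu
  calc c / 10 = c * (1 / 10) := by ring
    _ ≤ _ := by gcongr

lemma hasDerivAt_wave (h : IsPhase O R ρ M c) {Λ t u : ℝ} (ht : t ∈ Icc (1 / 2 : ℝ) 1)
    (hu : u ∈ O) : HasDerivAt (wave R Λ t)
      (-(I * Λ) * (ρ 0 (u * t) : ℝ) * wave R Λ t u) u := by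
  have ht0 : (t : ℂ) ≠ 0 := by
    have : 0 < t := by linarith [ht.1]
    exact_mod_cast (by positivity : t ≠ 0)
  have h1 := ((h.hasDerivAt_phase u hu t ht).comp u (hasDerivAt_mul_const t)).const_mul (Λ / t)
  have h2 := ((h1.ofReal_comp).const_mul (-I)).cexp
  have e : -(I * Λ) * (ρ 0 (u * t) : ℝ) * wave R Λ t u =
      wave R Λ t u * (-I * ((Λ / t * (ρ 0 (u * t) * t) : ℝ) : ℂ)) := by
    push_cast
    field_simp
  rw [e]
  exact h2

lemma exists_jetLE_wave (h : IsPhase O R ρ M c) (hM : 0 ≤ M) (Λ : ℝ) {t : ℝ}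
    (ht : t ∈ Icc (1 / 2 : ℝ) 1) (n : ℕ) : n ≤ 4 →
      ∃ M', 0 ≤ M' ∧ JetLE O (fun _ => 1) n M' (wave R Λ t) := by
  have h0 : ∀ u ∈ O, ‖wave R Λ t u‖ ≤ 1 * 1 := fun u _ => by rw [norm_wave, one_mul]
  induction n with
  | zero => exact fun _ => ⟨1, zero_le_one, h0⟩
  | succ n ih =>
    intro hn
    obtain ⟨M₁, hM₁, h1⟩ := ih (by omega)
    have h2 := ((h.jetLE ht n 0 (by omega)).mul hM hM₁ (fun _ _ => zero_le_one) h1).const_mul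
      (-(I * Λ))
    set M₂ := ‖-(I * Λ)‖ * (2 ^ n * (M * M₁)) with hM₂
    refine ⟨max 1 M₂, le_max_of_le_left zero_le_one, fun u hu => (h0 u hu).trans (by simp), _,
      fun u hu => ?_, h2.weaken fun u _ => by simp⟩
    have := h.hasDerivAt_wave (Λ := Λ) ht hu
    simp only [pow_zero, one_mul, ← mul_assoc]
    exact this

end IsPhase

/-! ### Almost orthogonality of the wave packets -/

/-- The amplitude times the wave, `e^{-i (Λ/t) R(u t)} φ(u)`. -/
noncomputable def wavePacket (R : ℝ → ℝ) (φ : ℝ → ℂ) (Λ t u : ℝ) : ℂ := wave R Λ t u * φ u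

/-- The amplitude of `S - S' / Λ`, where `S` is the wave packet. -/
noncomputable def packetAmplitude (ρ : ℕ → ℝ → ℝ) (φ : ℝ → ℂ) (Λ t u : ℝ) : ℂ :=
  φ u + I * ((ρ 0 (u * t) : ℝ) * φ u) + -((Λ : ℂ)⁻¹) * deriv φ u

namespace IsPhase

variable {R : ℝ → ℝ} {ρ : ℕ → ℝ → ℝ} {M c W : ℝ} {φ : ℝ → ℂ}

lemma eq_zero_of_notMem_innerSupport (hφ : ContDiff ℝ (⊤ : ℕ∞) φ) {u : ℝ}
    (hu : u ∉ innerSupport φ) : φ u = 0 := by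
  have := iteratedDeriv_eq_zero hφ 0 hu
  rwa [iteratedDeriv_zero] at this

lemma wavePacket_regular (h : IsPhase (innerSupport φ) R ρ M c) (hM : 0 ≤ M)
    (hφ : ContDiff ℝ (⊤ : ℕ∞) φ) (hw : IsFlatWeight (innerSupport φ) (jetWeight φ) W) (Λ : ℝ)
    {t : ℝ} (ht : t ∈ Icc (1 / 2 : ℝ) 1) :
    IsSymbol (wavePacket R φ Λ t) ∧ IsSymbol (deriv (wavePacket R φ Λ t)) := by
  obtain ⟨M', hM', h1⟩ := h.exists_jetLE_wave hM Λ ht 4 le_rfl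
  have h2 := jetLE_iteratedDeriv hφ 4 0 (by omega)
  rw [iteratedDeriv_zero] at h2
  have h3 : JetLE (innerSupport φ) (jetWeight φ) 4 (2 ^ 4 * (M' * 1)) (wavePacket R φ Λ t) :=
    h1.mul hM' zero_le_one (fun u _ => hw.nonneg u) h2
  have hzero : ∀ u ∉ innerSupport φ, wavePacket R φ Λ t u = 0 := fun u hu => by
    rw [wavePacket, eq_zero_of_notMem_innerSupport hφ hu, mul_zero]
  have h4 : ContDiff ℝ 3 (wavePacket R φ Λ t) := hw.contDiff (n := 3) hzero h3
  have hcs : HasCompactSupport (wavePacket R φ Λ t) :=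
    HasCompactSupport.intro (isCompact_Icc (a := (-10 : ℝ)) (b := 10))
      fun u hu => hzero u fun hO => hu (hw.subset hO)
  have h5 : ContDiff ℝ (2 + 1) (wavePacket R φ Λ t) := by
    rw [two_add_one_eq_three]; exact h4
  exact ⟨⟨h4.of_le (by norm_num), hcs⟩, (contDiff_succ_iff_deriv.1 h5).2.2, hcs.deriv⟩

lemma wavePacket_sub_deriv (h : IsPhase (innerSupport φ) R ρ M c) (hφ : ContDiff ℝ (⊤ : ℕ∞) φ)
    {Λ t u : ℝ} (hΛ : Λ ≠ 0) (ht : t ∈ Icc (1 / 2 : ℝ) 1) (hu : u ∈ innerSupport φ) :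
    wavePacket R φ Λ t u - (Λ : ℂ)⁻¹ * deriv (wavePacket R φ Λ t) u =
      wave R Λ t u * packetAmplitude ρ φ Λ t u := by
  have hΛ' : (Λ : ℂ) ≠ 0 := by exact_mod_cast hΛ
  have h1 : HasDerivAt φ (deriv φ u) u :=
    (hφ.differentiable (by simp) u).hasDerivAt
  have h2 : HasDerivAt (wavePacket R φ Λ t) _ u := (h.hasDerivAt_wave (Λ := Λ) ht hu).mul h1
  rw [h2.deriv, wavePacket, packetAmplitude]
  field_simp
  ring

lemma packetAmplitude_jetLE (h : IsPhase (innerSupport φ) R ρ M c) (hM : 0 ≤ M)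
    (hφ : ContDiff ℝ (⊤ : ℕ∞) φ) (hw : IsFlatWeight (innerSupport φ) (jetWeight φ) W)
    {Λ t : ℝ} (hΛ : 1 ≤ Λ) (ht : t ∈ Icc (1 / 2 : ℝ) 1) :
    JetLE (innerSupport φ) (jetWeight φ) 2 (2 + 4 * M) (packetAmplitude ρ φ Λ t) := by
  have h0 := jetLE_iteratedDeriv hφ 2 0 (by omega)
  have h1 := jetLE_iteratedDeriv hφ 2 1 (by omega)
  rw [iteratedDeriv_zero] at h0
  rw [iteratedDeriv_one] at h1
  have hρ := h.jetLE ht 2 0 (by omega)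
  simp only [pow_zero, one_mul] at hρ
  have h2 := (hρ.mul hM zero_le_one (fun u _ => hw.nonneg u) h0).const_mul I
  have h3 := (h0.add h2).add (h1.const_mul (-((Λ : ℂ)⁻¹)))
  refine h3.weaken fun u _ => mul_le_mul_of_nonneg_right ?_ (hw.nonneg u)
  rw [norm_neg, norm_inv, norm_real, norm_I, norm_of_nonneg (by linarith)]
  have := inv_le_one_of_one_le₀ hΛ
  linarith

/-- The Gram matrix of the modified wave packets decays like the inverse square of the distance
between the frequencies. -/
lemma exists_gram_le (hM : 0 ≤ M) (hc : 0 < c) (hφ : ContDiff ℝ (⊤ : ℕ∞) φ)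
    (hφsupp : tsupport φ ⊆ {x : ℝ | 1 / 10 < |x| ∧ |x| < 10})
    (h : IsPhase (innerSupport φ) R ρ M c) :
    ∃ K, 0 ≤ K ∧ ∀ Λ t t' : ℝ, 1 ≤ Λ → t ∈ Icc (1 / 2 : ℝ) 1 → t' ∈ Icc (1 / 2 : ℝ) 1 →
      ‖∫ u in innerSupport φ, wave R Λ t u * packetAmplitude ρ φ Λ t u *
        conj (wave R Λ t' u * packetAmplitude ρ φ Λ t' u)‖ ≤
          K / (1 + (Λ * (t - t')) ^ 2) := by
  obtain ⟨W, hw⟩ := exists_isFlatWeight hφ hφsupp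
  have hW := hw.W_nonneg
  have hO : ∀ u ∈ innerSupport φ, 1 / 10 ≤ |u| ∧ |u| ≤ 10 := fun u hu =>
    ⟨(hφsupp (interior_subset hu)).1.le, (hφsupp (interior_subset hu)).2.le⟩
  set N := 2 + 4 * M with hN
  have hN0 : 0 ≤ N := by positivity
  set A := 2 ^ 2 * (N * W * N) with hA
  have hA0 : 0 ≤ A := by positivity
  obtain ⟨K, hK0, hK⟩ := IsFlatWeight.exists_norm_integral_le hA0 (N := 12 * M) (by positivity)
    (c := c / 10) (by positivity) W
  refine ⟨2 * K + 2 * (20 * (A * W)), by positivity, fun Λ t t' hΛ ht ht' => ?_⟩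
  have hamp := fun τ (hτ : τ ∈ Icc (1 / 2 : ℝ) 1) => h.packetAmplitude_jetLE hM hφ hw hΛ hτ
  have ha : JetLE (innerSupport φ) (jetWeight φ) 2 A fun u => packetAmplitude ρ φ Λ t u *
      conj (packetAmplitude ρ φ Λ t' u) :=
    ((hamp t ht).weaken (M' := N * W) (w' := fun _ => 1) fun u _ => by
      rw [mul_one]; exact mul_le_mul_of_nonneg_left (hw.le u) hN0).mul (by positivity) hN0
      (fun u _ => hw.nonneg u) (hamp t' ht').star
  have e : ∀ u, wave R Λ t u * packetAmplitude ρ φ Λ t u *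
      conj (wave R Λ t' u * packetAmplitude ρ φ Λ t' u) =
      wave R Λ t u * conj (wave R Λ t' u) * (packetAmplitude ρ φ Λ t u *
      conj (packetAmplitude ρ φ Λ t' u)) := fun u => by
    rw [map_mul]; ring
  simp_rw [e]
  have hE1 : ∀ u ∈ innerSupport φ, ‖wave R Λ t u * conj (wave R Λ t' u)‖ ≤ 1 :=
    fun u _ => by rw [norm_mul, RCLike.norm_conj, norm_wave, norm_wave, one_mul]
  have htriv : ‖∫ u in innerSupport φ, wave R Λ t u * conj (wave R Λ t' u) *
      (packetAmplitude ρ φ Λ t u * conj (packetAmplitude ρ φ Λ t' u))‖ ≤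
        20 * (A * W) := by
    refine hw.norm_setIntegral_le hA0 fun u hu => ?_
    rw [norm_mul]
    exact (mul_le_of_le_one_left (norm_nonneg _) (hE1 u hu)).trans (ha.norm_le u hu)
  rw [le_div_iff₀ (by positivity)]
  -- close frequencies need no cancellation; for the others the phase is nonstationary
  by_cases hsmall : (Λ * (t - t')) ^ 2 ≤ 1
  · calc _ ≤ 20 * (A * W) * (1 + 1) := by gcongr
      _ ≤ _ := by linarith
  push Not at hsmall
  have hne : t ≠ t' := by
    rintro rfl
    simp at hsmall
    linarith
  have hΛne : Λ * (t - t') ≠ 0 := mul_ne_zero (by positivity) (sub_ne_zero.2 hne)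
  have hslope := h.jetLE_slope (fun u hu => (hO u hu).2) ht ht' hne 2 0 (by omega)
  simp only [pow_zero, one_mul] at hslope
  have hmain := hK _ _ hw _ _ _ (Λ * (t - t')) hΛne (fun u hu => ?_) hE1 hslope (fun u hu => ?_) ha
  · calc _ ≤ K / (Λ * (t - t')) ^ 2 * (1 + (Λ * (t - t')) ^ 2) := by gcongr
      _ ≤ K / (Λ * (t - t')) ^ 2 * (2 * (Λ * (t - t')) ^ 2) := by gcongr; linarith
      _ = 2 * K := by field_simp
      _ ≤ _ := by linarith [mul_nonneg hA0 hW]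
  · have h1 := (h.hasDerivAt_wave (Λ := Λ) ht hu).mul (h.hasDerivAt_wave (Λ := Λ) ht' hu).star
    have htt : ((t : ℂ) - t') ≠ 0 := by
      exact_mod_cast sub_ne_zero.2 hne
    refine h1.congr_deriv ?_
    simp only [RCLike.star_def, map_mul, map_neg, Complex.conj_I, conj_ofReal]
    push_cast
    field_simp
    ring
  · rw [norm_real, norm_eq_abs]
    exact h.le_abs_slope (fun u hu => (hO u hu).1) hu ht ht' hne

end IsPhase

lemma psi_eq_wavePacket (R : ℝ → ℝ) (φ : ℝ → ℂ) (m : ℕ) {p : ℕ} (hp : p ≠ 0) (j : ℕ) (ξ : ℝ) :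
    psi R φ m p j ξ = (((2 : ℝ) ^ (-(m : ℝ) / 2) : ℝ) : ℂ) *
      wavePacket R φ (2 ^ m) (2 ^ m / p) (((2 : ℝ) ^ (m + j))⁻¹ * ξ) := by
  have hp' : (p : ℝ) ≠ 0 := by exact_mod_cast hp
  rw [psi, wavePacket, wave, mul_assoc]
  have e1 : (2 : ℝ) ^ m / (2 ^ m / p) = p := by field_simp
  have e2 : ((2 : ℝ) ^ (m + j))⁻¹ * ξ * (2 ^ m / p) = ξ / (2 ^ j * p) := by
    rw [pow_add]; field_simp
  have e3 : ((2 : ℝ) ^ (m + j))⁻¹ * ξ = ξ / 2 ^ (m + j) := by rw [div_eq_inv_mul]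
  rw [e1, e2, e3]

lemma psi_eq_comp_mul (R : ℝ → ℝ) (φ : ℝ → ℂ) (m p j : ℕ) :
    psi R φ m p j = fun ξ => psi R φ m p 0 ((2 : ℝ)⁻¹ ^ j * ξ) := by
  ext ξ
  have e1 : (2 : ℝ)⁻¹ ^ j * ξ / (2 ^ 0 * p) = ξ / (2 ^ j * p) := by
    rw [inv_pow, pow_zero, one_mul, div_mul_eq_div_div, div_eq_inv_mul ξ]
  have e2 : (2 : ℝ)⁻¹ ^ j * ξ / 2 ^ (m + 0) = ξ / 2 ^ (m + j) := by
    rw [inv_pow, add_zero, pow_add]; field_simp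
  rw [psi, psi, e1, e2]

lemma ratio_mem_Icc {m p : ℕ} (hp : p ∈ Finset.Icc (2 ^ m) (2 ^ (m + 1))) :
    (2 : ℝ) ^ m / p ∈ Icc (1 / 2 : ℝ) 1 := by
  obtain ⟨h1, h2⟩ := Finset.mem_Icc.1 hp
  have h1' : (2 : ℝ) ^ m ≤ p := by exact_mod_cast h1
  have h2' : (p : ℝ) ≤ 2 ^ (m + 1) := by exact_mod_cast h2
  have hp0 : 0 < (p : ℝ) := lt_of_lt_of_le (by positivity) h1'
  constructor
  · rw [div_le_div_iff₀ two_pos hp0]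
    rw [pow_succ] at h2'; linarith
  · rw [div_le_one hp0]; exact h1'

/-- The symbols `ψ_{m,p,0}` are almost orthogonal, uniformly in `m`. -/
lemma IsPhase.exists_isAlmostOrthogonal {R : ℝ → ℝ} {ρ : ℕ → ℝ → ℝ} {M c : ℝ} {φ : ℝ → ℂ}
    (hM : 0 ≤ M) (hc : 0 < c) (hφ : ContDiff ℝ (⊤ : ℕ∞) φ)
    (hφsupp : tsupport φ ⊆ {x : ℝ | 1 / 10 < |x| ∧ |x| < 10})
    (h : IsPhase (innerSupport φ) R ρ M c) :
    ∃ K, ∀ m : ℕ, IsAlmostOrthogonal K (Finset.Icc (2 ^ m) (2 ^ (m + 1)))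
      fun p => psi R φ m p 0 := by
  obtain ⟨K, hK0, hK⟩ := exists_gram_le hM hc hφ hφsupp h
  obtain ⟨W, hw⟩ := exists_isFlatWeight hφ hφsupp
  refine ⟨16 * K, fun m => ?_⟩
  set Λ : ℝ := 2 ^ m with hΛ
  have hΛ1 : 1 ≤ Λ := one_le_pow₀ one_le_two
  have hΛ0 : Λ ≠ 0 := by positivity
  set s := Finset.Icc (2 ^ m) (2 ^ (m + 1)) with hs
  have hp0 : ∀ p ∈ s, p ≠ 0 := fun p hp => by
    have := (Finset.mem_Icc.1 hp).1
    have h2 : 0 < 2 ^ m := by positivity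
    omega
  set a : ℂ := (((2 : ℝ) ^ (-(m : ℝ) / 2) : ℝ) : ℂ) with ha
  have haa : a * conj a = ((Λ⁻¹ : ℝ) : ℂ) := by
    rw [ha, conj_ofReal, ← Complex.ofReal_mul, ← Real.rpow_add two_pos, hΛ,
      ← Real.rpow_natCast, ← Real.rpow_neg two_pos.le]
    congr 2; ring
  have heq : ∀ p ∈ s, psi R φ m p 0 = fun ξ => a * wavePacket R φ Λ (Λ / p) (Λ⁻¹ * ξ) :=
    fun p hp => funext fun ξ => by
      rw [psi_eq_wavePacket R φ m (hp0 p hp), add_zero]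
  have hreg := fun p (hp : p ∈ s) => h.wavePacket_regular hM hφ hw Λ (ratio_mem_Icc hp)
  have hderiv : ∀ p ∈ s, deriv (psi R φ m p 0) = fun ξ => a *
      ((Λ⁻¹ : ℝ) * deriv (wavePacket R φ Λ (Λ / p)) (Λ⁻¹ * ξ)) := fun p hp => by
    ext ξ
    rw [heq p hp]
    have h1 : HasDerivAt (wavePacket R φ Λ (Λ / p)) (deriv (wavePacket R φ Λ (Λ / p)) (Λ⁻¹ * ξ))
        (Λ⁻¹ * ξ) := ((hreg p hp).1.1.differentiable (by norm_num) _).hasDerivAt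
    have h2 := (h1.scomp ξ (hasDerivAt_const_mul Λ⁻¹)).const_mul a
    rw [real_smul] at h2
    exact h2.deriv
  refine ⟨fun p hp => ?_, fun p hp => ?_, fun p hp p' hp' => ?_⟩
  · rw [heq p hp]
    exact ((hreg p hp).1.comp_mul (inv_ne_zero hΛ0)).const_mul a
  · rw [hderiv p hp]
    exact (((hreg p hp).2.comp_mul (inv_ne_zero hΛ0)).const_mul _).const_mul a
  set V : ℕ → ℝ → ℂ := fun p u => wavePacket R φ Λ (Λ / p) u -
    (Λ : ℂ)⁻¹ * deriv (wavePacket R φ Λ (Λ / p)) u with hV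
  have h1 : ∀ ξ, (psi R φ m p 0 ξ - deriv (psi R φ m p 0) ξ) *
      conj (psi R φ m p' 0 ξ - deriv (psi R φ m p' 0) ξ) = (Λ⁻¹ : ℝ) *
        (V p (Λ⁻¹ * ξ) * conj (V p' (Λ⁻¹ * ξ))) := fun ξ => by
    rw [hderiv p hp, hderiv p' hp', heq p hp, heq p' hp', ← mul_sub, ← mul_sub, map_mul]
    simp only [hV, ← Complex.ofReal_inv]
    rw [← haa]
    ring
  simp_rw [h1]
  rw [integral_const_mul, Measure.integral_comp_mul_left
    (fun u => V p u * conj (V p' u)) Λ⁻¹, inv_inv, abs_of_pos (by positivity),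
    real_smul, ← mul_assoc, ← Complex.ofReal_mul, inv_mul_cancel₀ hΛ0, Complex.ofReal_one,
    one_mul]
  have hVzero : ∀ u ∉ innerSupport φ, V p u * conj (V p' u) = 0 := fun u hu => by
    have hS0 : ∀ t, wavePacket R φ Λ t u = 0 := fun t => by
      rw [wavePacket, eq_zero_of_notMem_innerSupport hφ hu, mul_zero]
    have hd0 : deriv (wavePacket R φ Λ (Λ / p)) u = 0 := by
      by_contra hne
      have h5 : u ∈ closure (tsupport φ)ᶜ := by rw [closure_compl]; exact hu
      have h6 : closure (tsupport φ)ᶜ ⊆ {x | deriv (wavePacket R φ Λ (Λ / p)) x = 0} := by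
        refine closure_minimal (fun x hx => ?_) (isClosed_eq (hreg p hp).2.continuous
          continuous_const)
        refine image_eq_zero_of_notMem_tsupport fun h7 => hx ?_
        refine (closure_mono ?_) (tsupport_deriv_subset h7)
        intro y hy hy0
        exact hy (by rw [wavePacket, hy0, mul_zero])
      exact hne (h6 h5)
    simp only [hV]
    rw [hS0, hd0]; simp
  rw [← setIntegral_eq_integral_of_forall_compl_eq_zero hVzero]
  have h2 : ∀ u ∈ innerSupport φ, V p u * conj (V p' u) =
      wave R Λ (Λ / p) u * packetAmplitude ρ φ Λ (Λ / p) u *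
        conj (wave R Λ (Λ / p') u * packetAmplitude ρ φ Λ (Λ / p') u) := fun u hu => by
    simp only [hV]
    rw [h.wavePacket_sub_deriv hφ hΛ0 (ratio_mem_Icc hp) hu,
      h.wavePacket_sub_deriv hφ hΛ0 (ratio_mem_Icc hp') hu]
  have hOm : MeasurableSet (innerSupport φ) := isOpen_interior.measurableSet
  rw [setIntegral_congr_fun hOm h2]
  refine (hK Λ _ _ hΛ1 (ratio_mem_Icc hp) (ratio_mem_Icc hp')).trans ?_
  have hpp : (0 : ℝ) < p := by exact_mod_cast Nat.pos_of_ne_zero (hp0 p hp)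
  have hpp' : (0 : ℝ) < p' := by exact_mod_cast Nat.pos_of_ne_zero (hp0 p' hp')
  have h3 : ((p : ℝ) - p') ^ 2 ≤ 16 * (Λ * (Λ / p - Λ / p')) ^ 2 := by
    have e : Λ * (Λ / p - Λ / p') = (Λ / p) * (Λ / p') * (p' - p) := by field_simp
    have h4 : 1 / 4 ≤ (Λ / p) * (Λ / p') := by
      have := mul_le_mul (ratio_mem_Icc hp).1 (ratio_mem_Icc hp').1 (by norm_num)
        (by positivity)
      linarith
    rw [e, mul_pow]
    have h5 : (1 / 4 : ℝ) ^ 2 ≤ ((Λ / p) * (Λ / p')) ^ 2 := pow_le_pow_left₀ (by norm_num) h4 2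
    nlinarith [sq_nonneg ((p : ℝ) - p')]
  rw [div_le_div_iff₀ (by positivity) (by positivity)]
  nlinarith

/-! ### Translates of a symbol, and compositions of multipliers -/

/-- Integer translates of a smooth symbol are almost orthogonal, because only boundedly many of
them overlap. -/
lemma exists_isAlmostOrthogonal_translates {φ : ℝ → ℂ} (hφ : ContDiff ℝ (⊤ : ℕ∞) φ)
    (hφ10 : ∀ x, φ x ≠ 0 → |x| ≤ 10) :
    ∃ K, ∀ s : Finset ℕ, IsAlmostOrthogonal K s fun p u => φ (u - p) := by
  have hcs : HasCompactSupport φ :=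
    HasCompactSupport.intro (isCompact_Icc (a := (-10 : ℝ)) (b := 10)) fun u hu => by
      by_contra h; exact hu (abs_le.1 (hφ10 u h))
  have h1 : IsSymbol φ := ⟨hφ.of_le (WithTop.coe_le_coe.2 le_top), hcs⟩
  have h2 : IsSymbol (deriv φ) :=
    ⟨(contDiff_infty_iff_deriv.1 hφ).2.of_le (WithTop.coe_le_coe.2 le_top), hcs.deriv⟩
  obtain ⟨B, hB0, hB⟩ := (h1.sub h2).exists_norm_le
  have hd : ∀ x, φ x - deriv φ x ≠ 0 → |x| ≤ 10 := fun x hx => by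
    have h3 : tsupport φ ⊆ {x | |x| ≤ 10} :=
      closure_minimal (fun x hx => hφ10 x hx) (isClosed_le continuous_abs continuous_const)
    by_contra hx'
    have h4 : x ∉ tsupport φ := fun h => hx' (h3 h)
    refine hx ?_
    rw [image_eq_zero_of_notMem_tsupport h4,
      image_eq_zero_of_notMem_tsupport fun h => h4 (tsupport_deriv_subset h), sub_zero]
  have hderiv : ∀ p : ℕ, deriv (fun u => φ (u - p)) = fun u => deriv φ (u - p) := fun p => by
    ext u; exact deriv_comp_sub_const _ _ _
  refine ⟨20 * (B * B) * 401, fun s => ⟨fun p _ => h1.comp_sub p, fun p _ => ?_,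
    fun p _ p' _ => ?_⟩⟩
  · rw [hderiv]; exact h2.comp_sub p
  rw [hderiv, hderiv, le_div_iff₀ (by positivity)]
  set G : ℝ → ℂ := fun ξ => (φ (ξ - p) - deriv φ (ξ - p)) *
    conj (φ (ξ - p') - deriv φ (ξ - p')) with hG
  have hzero : ∀ ξ ∉ Icc ((p : ℝ) - 10) (p + 10), G ξ = 0 := fun ξ hξ => by
    have : φ (ξ - p) - deriv φ (ξ - p) = 0 := by
      by_contra h
      have := abs_le.1 (hd _ h)
      exact hξ ⟨by linarith, by linarith⟩
    simp only [hG, this, zero_mul]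
  have hbound : ‖∫ ξ, G ξ‖ ≤ 20 * (B * B) := by
    rw [← setIntegral_eq_integral_of_forall_compl_eq_zero hzero]
    have := norm_setIntegral_le_of_norm_le_const (μ := volume) (f := G)
      (s := Icc ((p : ℝ) - 10) (p + 10)) (C := B * B) (by simp) fun ξ _ => by
        rw [hG, norm_mul, RCLike.norm_conj]
        exact mul_le_mul (hB _) (hB _) (norm_nonneg _) hB0
    rw [measureReal_def, Real.volume_Icc, toReal_ofReal (by linarith)] at this
    linarith
  by_cases hpp : |(p : ℝ) - p'| ≤ 20
  · have : ((p : ℝ) - p') ^ 2 ≤ 400 := by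
      rw [← sq_abs]; nlinarith [abs_nonneg ((p : ℝ) - p')]
    exact mul_le_mul hbound (by linarith) (by positivity) (by positivity)
  · have h0 : ∀ ξ, G ξ = 0 := fun ξ => by
      by_contra h
      have h5 := hd _ (left_ne_zero_of_mul h)
      have h6 := hd (ξ - p') fun h0 => h (by simp only [hG, h0, map_zero, mul_zero])
      have h7 := abs_sub_abs_le_abs_sub (ξ - p') (ξ - p)
      have h8 : |(p : ℝ) - p'| ≤ |ξ - p'| + |ξ - p| := by
        have := abs_sub (ξ - p') (ξ - p)
        rwa [show ξ - (p' : ℝ) - (ξ - p) = p - p' by ring] at this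
      linarith
    have e : ∫ ξ, G ξ = 0 := by simp [h0]
    rw [e, norm_zero, zero_mul]
    positivity

lemma IsSymbol.conv_invFT {a b : ℝ → ℂ} (ha : IsSymbol a) (hb : IsSymbol b) (x : ℝ) :
    conv (invFT a) (invFT b) x = invFT (fun ξ => a ξ * b ξ) x := by
  set c : ℝ → ℂ := fun ξ => conj (b ξ * exp (I * ξ * x)) with hc
  have hci : Integrable c := by
    have h1 := integrable_mul_exp hb.integrable x
    exact h1.congr' (by
      have : Continuous c := Complex.continuous_conj.comp (by have := hb.continuous; fun_prop)
      exact this.aestronglyMeasurable) (ae_of_all _ fun ξ => by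
        simp only [hc]; rw [RCLike.norm_conj])
  have h := ha.integral_invFT_mul_conj hci
  have e : ∀ t, conj (invFT c t) = invFT b (x - t) := fun t => by
    rw [conj_invFT]
    simp only [hc, conj_conj, invFT]
    congr 1
    refine integral_congr_ae (ae_of_all _ fun ξ => ?_)
    simp only []
    rw [mul_assoc, ← exp_add]
    congr 2
    push_cast; ring
  simp_rw [e] at h
  rw [conv_apply, h, invFT]
  congr 1
  refine integral_congr_ae (ae_of_all _ fun ξ => ?_)
  simp only [hc, conj_conj]
  ring

lemma conv_conv_invFT {f a b : ℝ → ℂ} (hf : Tame f) (ha : IsSymbol a) (hb : IsSymbol b)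
    (x : ℝ) : conv (conv f (invFT a)) (invFT b) x = conv f (invFT fun ξ => a ξ * b ξ) x := by
  obtain ⟨D, hD⟩ := ha.exists_isDecaying
  obtain ⟨D', hD'⟩ := hb.exists_isDecaying
  rw [conv_conv hf hD hD']
  congr 1
  ext y
  exact ha.conv_invFT hb y

/-! ### The curve near the origin -/

lemma bandI_eq : bandI = Icc (-4 : ℝ) (-(1 / 4)) ∪ Icc (1 / 4) 4 := by
  ext t
  simp only [bandI, mem_ofPred_eq, mem_union, mem_Icc, le_abs, abs_le]
  constructor
  · rintro ⟨h | h, h1, h2⟩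
    · exact Or.inr ⟨h, h2⟩
    · exact Or.inl ⟨h1, by linarith⟩
  · rintro (⟨h1, h2⟩ | ⟨h1, h2⟩)
    · exact ⟨Or.inr (by linarith), h1, by linarith⟩
    · exact ⟨Or.inl h1, by linarith, h2⟩

lemma uniqueDiffOn_bandI : UniqueDiffOn ℝ bandI := by
  intro t ht
  have ht' := ht
  rw [bandI_eq] at ht'
  rcases ht' with h | h
  · exact (uniqueDiffOn_Icc (by norm_num) t h).mono (by rw [bandI_eq]; exact subset_union_left)
  · exact (uniqueDiffOn_Icc (by norm_num) t h).mono (by rw [bandI_eq]; exact subset_union_right)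

lemma isCompact_bandI : IsCompact bandI := by
  rw [bandI_eq]; exact isCompact_Icc.union isCompact_Icc

lemma isOpen_punctured (δ : ℝ) : IsOpen (punctured δ) :=
  isOpen_Ioo.sdiff isClosed_singleton

lemma bandI_ne_zero {t : ℝ} (ht : t ∈ bandI) : t ≠ 0 := by
  rintro rfl
  have := ht.1
  norm_num at this

lemma mul_mem_punctured {δ : ℝ} {x t : ℝ} (hx : 0 < x) (hxδ : 4 * x < δ) (ht : t ∈ bandI) :
    x * t ∈ punctured δ := by
  have h1 := (abs_le.1 ht.2)
  refine ⟨⟨by nlinarith, by nlinarith⟩, ?_⟩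
  exact mul_ne_zero hx.ne' (bandI_ne_zero ht)

/-- The slope `γ'(2^{-j})`. -/
noncomputable def slope (γ : ℝ → ℝ) (j : ℕ) : ℝ := deriv γ ((2 : ℝ)⁻¹ ^ j)

lemma eventually_pow_lt {δ : ℝ} (hδ : 0 < δ) : ∀ᶠ j : ℕ in atTop, 4 * (2 : ℝ)⁻¹ ^ j < δ := by
  have h := (tendsto_pow_atTop_nhds_zero_of_lt_one (r := (2 : ℝ)⁻¹) (by norm_num)
    (by norm_num)).const_mul 4
  rw [mul_zero] at h
  exact h.eventually_lt_const hδ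

namespace NonFlatNearZero

variable {N : ℕ} {γ Q r : ℝ → ℝ}

lemma eventually_slope_ne_zero (hγ : NonFlatNearZero N γ Q r) :
    ∀ᶠ j : ℕ in atTop, slope γ j ≠ 0 := by
  obtain ⟨δ, hδ, -, h⟩ := hγ.smooth
  filter_upwards [eventually_pow_lt hδ] with j hj
  have h0 : 0 < (2 : ℝ)⁻¹ ^ j := by positivity
  exact h _ ⟨⟨by linarith, by linarith⟩, h0.ne'⟩

/-- The rescaled derivative `γ'(2^{-j} t) / γ'(2^{-j})` converges to `Q'` on the band, with a
uniformly bounded derivative. -/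
lemma exists_rescaled (hγ : NonFlatNearZero N γ Q r) (hN : 2 ≤ N) :
    ∃ M : ℝ, 0 ≤ M ∧ ∃ a : ℕ → ℝ, Tendsto a atTop (𝓝 0) ∧ ∀ᶠ j : ℕ in atTop, ∀ t ∈ bandI,
      |deriv γ ((2 : ℝ)⁻¹ ^ j * t) / slope γ j - derivWithin Q bandI t| ≤ a j ∧
      ∃ d, |d| ≤ M ∧
        HasDerivAt (fun t => deriv γ ((2 : ℝ)⁻¹ ^ j * t) / slope γ j) d t := by
  obtain ⟨δ, hδ, hsm, hne⟩ := hγ.smooth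
  obtain ⟨a, ha0, ha, hasym⟩ := hγ.asymptotic
  have hQ2 : ContinuousOn (iteratedDerivWithin 2 Q bandI) bandI :=
    hγ.smooth_main.continuousOn_iteratedDerivWithin (by exact_mod_cast hN) uniqueDiffOn_bandI
  obtain ⟨M, hM⟩ := isCompact_bandI.exists_bound_of_continuousOn hQ2
  refine ⟨max M 0 + 1, by positivity, a, ha, ?_⟩
  filter_upwards [hasym, eventually_pow_lt hδ, hγ.eventually_slope_ne_zero,
    ha.eventually_le_const one_pos] with j hj hjδ hg ha1 t ht
  set x : ℝ := (2 : ℝ)⁻¹ ^ j with hx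
  have hx0 : 0 < x := by positivity
  have hU : ∀ t ∈ bandI, x * t ∈ punctured δ := fun t ht => mul_mem_punctured hx0 hjδ ht
  have hγd : ∀ y ∈ punctured δ, HasDerivAt γ (deriv γ y) y := fun y hy =>
    ((hsm.contDiffAt ((isOpen_punctured δ).mem_nhds hy)).differentiableAt
      (by have : N ≠ 0 := by omega
          exact_mod_cast this)).hasDerivAt
  have hγdd : ∀ y ∈ punctured δ, HasDerivAt (deriv γ) (deriv (deriv γ) y) y := fun y hy => by
    have h1 : ContDiffOn ℝ 1 (deriv γ) (punctured δ) :=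
      hsm.deriv_of_isOpen (isOpen_punctured δ) (by
        rw [one_add_one_eq_two]; exact_mod_cast hN)
    exact ((h1.contDiffAt ((isOpen_punctured δ).mem_nhds hy)).differentiableAt
      one_ne_zero).hasDerivAt
  have hlin : ∀ t : ℝ, HasDerivAt (fun t : ℝ => x * t) x t := fun t => hasDerivAt_const_mul x
  set F : ℝ → ℝ := fun t => γ (x * t) / (x * slope γ j) - Q t with hF
  have hQd : ∀ t ∈ bandI, HasDerivWithinAt Q (derivWithin Q bandI t) bandI t := fun t ht =>
    ((hγ.smooth_main.differentiableOn (by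
      have : N ≠ 0 := by omega
      exact_mod_cast this)) t ht).hasDerivWithinAt
  have hF1 : ∀ t ∈ bandI, derivWithin F bandI t =
      deriv γ (x * t) / slope γ j - derivWithin Q bandI t := fun t ht => by
    have h1 : HasDerivAt (fun t => γ (x * t)) (deriv γ (x * t) * x) t :=
      (hγd _ (hU t ht)).comp t (hlin t)
    have h2 := ((h1.div_const (x * slope γ j)).hasDerivWithinAt (s := bandI)).sub (hQd t ht)
    have h3 : derivWithin F bandI t = _ := h2.derivWithin (uniqueDiffOn_bandI t ht)
    rw [h3]
    field_simp
  have hder : HasDerivAt (fun t => deriv γ (x * t) / slope γ j)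
      (deriv (deriv γ) (x * t) * x / slope γ j) t :=
    ((hγdd _ (hU t ht)).comp t (hlin t)).div_const _
  refine ⟨?_, _, ?_, hder⟩
  · have := hj.2 1 (by omega) t ht
    rw [iteratedDerivWithin_one] at this
    rw [← hF1 t ht]
    exact this
  · have h2 := hj.2 2 hN t ht
    have hQdd : HasDerivWithinAt (derivWithin Q bandI) (iteratedDerivWithin 2 Q bandI t) bandI t := by
      have h4 : DifferentiableOn ℝ (iteratedDerivWithin 1 Q bandI) bandI :=
        hγ.smooth_main.differentiableOn_iteratedDerivWithin (by
          exact_mod_cast (by omega : 1 < N)) uniqueDiffOn_bandI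
      have h5 := (h4 t ht).hasDerivWithinAt
      rw [← iteratedDerivWithin_succ] at h5
      refine h5.congr (fun y hy => ?_) ?_ <;> rw [iteratedDerivWithin_one]
    have h6 : iteratedDerivWithin 2 F bandI t =
        deriv (deriv γ) (x * t) * x / slope γ j - iteratedDerivWithin 2 Q bandI t := by
      rw [iteratedDerivWithin_succ]
      have h7 := (hder.hasDerivWithinAt (s := bandI)).sub hQdd
      refine (h7.congr (fun y hy => ?_) ?_).derivWithin (uniqueDiffOn_bandI t ht)
      · rw [iteratedDerivWithin_one, hF1 y hy]; rfl
      · rw [iteratedDerivWithin_one, hF1 t ht]; rfl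
    have h8 : |iteratedDerivWithin 2 F bandI t| ≤ a j := h2
    rw [h6] at h8
    have h9 := hM t ht
    rw [norm_eq_abs] at h9
    have h10 := abs_sub_abs_le_abs_sub (deriv (deriv γ) (x * t) * x / slope γ j)
      (iteratedDerivWithin 2 Q bandI t)
    linarith [le_max_left M 0]

lemma tendsto_slope_ratio (hγ : NonFlatNearZero N γ Q r) (hN : 2 ≤ N) {t : ℝ} (ht : t ∈ bandI) :
    Tendsto (fun j : ℕ => deriv γ ((2 : ℝ)⁻¹ ^ j * t) / slope γ j) atTop
      (𝓝 (derivWithin Q bandI t)) := by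
  obtain ⟨M, -, a, ha, h⟩ := hγ.exists_rescaled hN
  rw [tendsto_iff_dist_tendsto_zero]
  refine squeeze_zero' (Eventually.of_forall fun _ => dist_nonneg) ?_ ha
  filter_upwards [h] with j hj
  exact (hj t ht).1

lemma one_mem_bandI : (1 : ℝ) ∈ bandI := by constructor <;> norm_num

lemma half_mem_bandI : (2 : ℝ)⁻¹ ∈ bandI := by
  constructor <;> rw [abs_of_pos (by norm_num)] <;> norm_num

lemma two_mem_bandI : (2 : ℝ) ∈ bandI := by constructor <;> norm_num

lemma derivWithin_one (hγ : NonFlatNearZero N γ Q r) (hN : 2 ≤ N) :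
    derivWithin Q bandI 1 = 1 := by
  refine tendsto_nhds_unique (hγ.tendsto_slope_ratio hN one_mem_bandI) ?_
  refine tendsto_const_nhds.congr' ?_
  filter_upwards [hγ.eventually_slope_ne_zero] with j hj
  rw [mul_one]
  exact (div_self hj).symm

/-- The slopes at consecutive dyadic points are comparable, and decrease geometrically. -/
lemma exists_slope_le (hγ : NonFlatNearZero N γ Q r) (hN : 2 ≤ N)
    (hγ0 : Tendsto (deriv γ) (𝓝[≠] 0) (𝓝 0)) :
    ∃ θ L : ℝ, 0 ≤ θ ∧ θ < 1 ∧ 0 ≤ L ∧ ∀ᶠ j : ℕ in atTop, slope γ j ≠ 0 ∧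
      |slope γ (j + 1)| ≤ θ * |slope γ j| ∧ |slope γ j| ≤ L * |slope γ (j + 1)| := by
  set κ := derivWithin Q bandI (2 : ℝ)⁻¹ with hκ
  have hlim : Tendsto (fun j : ℕ => slope γ (j + 1) / slope γ j) atTop (𝓝 κ) := by
    have := hγ.tendsto_slope_ratio hN half_mem_bandI
    simpa only [slope, pow_succ] using this
  have hlim2 : Tendsto (fun j : ℕ => slope γ j / slope γ (j + 1)) atTop
      (𝓝 (derivWithin Q bandI 2)) := by
    have h1 := (tendsto_add_atTop_iff_nat 1).2 (hγ.tendsto_slope_ratio hN two_mem_bandI)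
    refine h1.congr fun j => ?_
    rw [pow_succ, mul_assoc, inv_mul_cancel₀ two_ne_zero, mul_one]
    rfl
  have hs0 : Tendsto (slope γ) atTop (𝓝 0) := by
    refine hγ0.comp (tendsto_nhdsWithin_iff.2 ⟨tendsto_pow_atTop_nhds_zero_of_lt_one
      (by norm_num) (by norm_num), Eventually.of_forall fun j => ?_⟩)
    exact (by positivity : (0 : ℝ) < (2 : ℝ)⁻¹ ^ j).ne'
  obtain ⟨δ, hδ, hsm, hne⟩ := hγ.smooth
  -- `γ'` has no zero on `(0, δ)`, so the slopes have the same sign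
  have hκ0 : 0 ≤ κ := by
    refine ge_of_tendsto hlim ?_
    filter_upwards [eventually_pow_lt hδ] with j hj
    have h0 : 0 < (2 : ℝ)⁻¹ ^ j := by positivity
    have hcont : ContinuousOn (deriv γ) (Ioo 0 δ) :=
      ((hsm.continuousOn_deriv_of_isOpen (isOpen_punctured δ)
        (by exact_mod_cast (by omega : 1 ≤ N)))).mono fun y hy =>
          ⟨⟨by linarith [hy.1], hy.2⟩, hy.1.ne'⟩
    by_contra hneg
    have h1 : (2 : ℝ)⁻¹ ^ j ∈ Ioo 0 δ := ⟨h0, by linarith⟩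
    have h2 : (2 : ℝ)⁻¹ ^ (j + 1) ∈ Ioo 0 δ := ⟨by positivity, by rw [pow_succ]; linarith⟩
    have hz : (0 : ℝ) ∈ deriv γ '' Ioo 0 δ := by
      have himg := (isPreconnected_Ioo.image _ hcont).ordConnected
      rcases div_neg_iff.1 (not_le.1 hneg) with ⟨ha, hb⟩ | ⟨ha, hb⟩
      · exact himg.out ⟨_, h1, rfl⟩ ⟨_, h2, rfl⟩ ⟨hb.le, ha.le⟩
      · exact himg.out ⟨_, h2, rfl⟩ ⟨_, h1, rfl⟩ ⟨ha.le, hb.le⟩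
    obtain ⟨y, hy, hy0⟩ := hz
    exact hne y ⟨⟨by linarith [hy.1], hy.2⟩, hy.1.ne'⟩ hy0
  have hκ1 : κ ≤ 1 := by
    by_contra hgt
    have h1 : ∀ᶠ j : ℕ in atTop, slope γ j ≠ 0 ∧ |slope γ j| ≤ |slope γ (j + 1)| := by
      filter_upwards [hlim.eventually_const_le (not_le.1 hgt), hγ.eventually_slope_ne_zero]
        with j hj hj0
      refine ⟨hj0, ?_⟩
      have := hj.trans (le_abs_self _)
      rwa [abs_div, one_le_div (abs_pos.2 hj0)] at this
    obtain ⟨j₀, hj₀⟩ := eventually_atTop.1 h1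
    have h2 : ∀ n, |slope γ j₀| ≤ |slope γ (j₀ + n)| := fun n => by
      induction n with
      | zero => exact le_rfl
      | succ n ih => exact ih.trans (hj₀ _ (by omega)).2
    have h3 : Tendsto (fun n => |slope γ (n + j₀)|) atTop (𝓝 |0|) :=
      ((tendsto_add_atTop_iff_nat j₀).2 hs0).abs
    rw [abs_zero] at h3
    have h4 := ge_of_tendsto h3 (Eventually.of_forall fun n => by
      rw [add_comm]; exact h2 n)
    exact (hj₀ j₀ le_rfl).1 (abs_nonpos_iff.1 h4)
  -- by Rolle's theorem `Q'(1/2) = Q'(1)` would contradict `Q'' ≠ 0`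
  have hκne : κ ≠ 1 := fun h1 => by
    have hsub : Icc (2 : ℝ)⁻¹ 1 ⊆ bandI := fun y hy => by
      rw [bandI_eq]; exact Or.inr ⟨by linarith [hy.1], by linarith [hy.2]⟩
    have hd : DifferentiableOn ℝ (iteratedDerivWithin 1 Q bandI) bandI :=
      hγ.smooth_main.differentiableOn_iteratedDerivWithin (by
        exact_mod_cast (by omega : 1 < N)) uniqueDiffOn_bandI
    have hr : ∃ y ∈ Ioo (2 : ℝ)⁻¹ 1, deriv (iteratedDerivWithin 1 Q bandI) y = 0 := by
      refine exists_deriv_eq_zero (by norm_num) (hd.continuousOn.mono hsub) ?_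
      rw [iteratedDerivWithin_one, hγ.derivWithin_one hN]
      exact h1
    obtain ⟨y, hy, hy0⟩ := hr
    have hyb := hsub (Ioo_subset_Icc_self hy)
    have hnb : bandI ∈ 𝓝 y := mem_of_superset (Ioo_mem_nhds hy.1 hy.2)
      (Ioo_subset_Icc_self.trans hsub)
    obtain ⟨c, hc, h2, -⟩ := hγ.nonflat
    have h3 := h2 y hyb
    rw [iteratedDerivWithin_succ, derivWithin_of_mem_nhds hnb, hy0, abs_zero] at h3
    linarith
  have hκlt : κ < 1 := lt_of_le_of_ne hκ1 hκne
  refine ⟨(κ + 1) / 2, |derivWithin Q bandI 2| + 1, by linarith, by linarith, by positivity, ?_⟩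
  filter_upwards [hlim.abs.eventually_le_const (by rw [abs_of_nonneg hκ0]; linarith :
    |κ| < (κ + 1) / 2), hlim2.abs.eventually_le_const (lt_add_one _),
    hγ.eventually_slope_ne_zero, (tendsto_add_atTop_nat 1).eventually hγ.eventually_slope_ne_zero]
    with j h1 h2 h3 h4
  rw [abs_div, div_le_iff₀ (abs_pos.2 h3)] at h1
  rw [abs_div, div_le_iff₀ (abs_pos.2 h4)] at h2
  exact ⟨h3, h1, h2⟩

end NonFlatNearZero

/-! ### The phase function -/

/-- The function `(γ')⁻¹(s γ'(2^{-j})) / (γ')⁻¹(γ'(2^{-j}))` is a solution `τ` of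
`γ'(2^{-j} τ) = s γ'(2^{-j})`, and it converges to `r(s)`. -/
lemma DualAsymptotics.exists_solution {N : ℕ} {γ r : ℝ → ℝ} {D : Set ℝ}
    (hD : DualAsymptotics N γ D r) : ∃ τ : ℕ → ℝ → ℝ,
      (∀ s ∈ D, Tendsto (fun j => τ j s) atTop (𝓝 (r s))) ∧
      ∀ᶠ j : ℕ in atTop, ∀ s ∈ D, τ j s ≠ 0 ∧
        deriv γ ((2 : ℝ)⁻¹ ^ j * τ j s) = s * slope γ j := by
  obtain ⟨-, δ, hδ, ι, hι, a, -, ha, h⟩ := hD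
  have key : ∀ y ∈ deriv γ '' punctured δ, ι y ≠ 0 ∧ deriv γ (ι y) = y := by
    rintro y hy
    by_cases hy0 : y ∈ deriv γ '' Ioo 0 δ
    · obtain ⟨t, ht, rfl⟩ := hy0
      rw [hι.1 t ht]
      exact ⟨ht.1.ne', rfl⟩
    · obtain ⟨t, ⟨ht, ht0⟩, rfl⟩ := hy
      have htneg : t ∈ Ioo (-δ) 0 := by
        refine ⟨ht.1, lt_of_le_of_ne (not_lt.1 fun h0 => hy0 ⟨t, ⟨h0, ht.2⟩, rfl⟩) ht0⟩
      rw [hι.2 t htneg hy0]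
      exact ⟨ht0, rfl⟩
  refine ⟨fun j s => ι (s * slope γ j) / ι (slope γ j), fun s hs => ?_, ?_⟩
  · rw [tendsto_iff_dist_tendsto_zero]
    refine squeeze_zero' (Eventually.of_forall fun _ => dist_nonneg) ?_ ha
    filter_upwards [h] with j hj
    have := hj.2.2 0 (Nat.zero_le _) s hs
    rwa [iteratedDerivWithin_zero] at this
  · filter_upwards [h, eventually_pow_lt hδ] with j hj hjδ s hs
    have h0 : 0 < (2 : ℝ)⁻¹ ^ j := by positivity
    have h1 : ι (slope γ j) = (2 : ℝ)⁻¹ ^ j := hι.1 _ ⟨h0, by linarith⟩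
    obtain ⟨h2, h3⟩ := key _ (hj.1 s hs)
    rw [h1, mul_div_cancel₀ _ h0.ne']
    exact ⟨div_ne_zero h2 h0.ne', h3⟩

namespace NonFlatNearZero

variable {N : ℕ} {γ Q r : ℝ → ℝ} {D : Set ℝ}

/-- If `2^a τ / 2^b` lies in the band then `γ'(2^{-(n+b)} τ) / γ'(2^{-(n+a)})` is bounded, and so
on: the quotients of slopes at a bounded distance are bounded. -/
lemma exists_slope_ratio_le (hγ : NonFlatNearZero N γ Q r) (hN : 2 ≤ N)
    (hγ0 : Tendsto (deriv γ) (𝓝[≠] 0) (𝓝 0)) (b : ℕ) :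
    ∃ L : ℝ, 0 ≤ L ∧ ∀ᶠ n : ℕ in atTop, ∀ a, |slope γ (n + a)| ≤ L * |slope γ (n + b)| := by
  obtain ⟨θ, L, hθ0, hθ, hL0, h⟩ := hγ.exists_slope_le hN hγ0
  obtain ⟨j₀, hj₀⟩ := eventually_atTop.1 h
  refine ⟨L ^ b, by positivity, eventually_atTop.2 ⟨j₀, fun n hn a => ?_⟩⟩
  have h1 : ∀ a, |slope γ (n + a)| ≤ |slope γ n| := fun a => by
    induction a with
    | zero => exact le_rfl
    | succ a ih =>
      refine ((hj₀ (n + a) (by omega)).2.1.trans ?_).trans ih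
      exact mul_le_of_le_one_left (abs_nonneg _) hθ.le
  have h2 : ∀ b, |slope γ n| ≤ L ^ b * |slope γ (n + b)| := fun b => by
    induction b with
    | zero => simp
    | succ b ih =>
      refine ih.trans ?_
      rw [pow_succ, mul_assoc]
      exact mul_le_mul_of_nonneg_left (hj₀ (n + b) (by omega)).2.2 (by positivity)
  exact (h1 a).trans (h2 b)

lemma zero_notMem (hγ : NonFlatNearZero N γ Q r) (hD : DualAsymptotics N γ D r) :
    (0 : ℝ) ∉ D := fun h0 => by
  obtain ⟨τ, hτ, h⟩ := hD.exists_solution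
  obtain ⟨δ, hδ, -, hne⟩ := hγ.smooth
  have h1 : Tendsto (fun j : ℕ => (2 : ℝ)⁻¹ ^ j * τ j 0) atTop (𝓝 (0 * r 0)) :=
    (tendsto_pow_atTop_nhds_zero_of_lt_one (by norm_num) (by norm_num)).mul (hτ 0 h0)
  rw [zero_mul] at h1
  obtain ⟨j, hj, hj'⟩ := (h.and (h1.eventually (Ioo_mem_nhds (neg_lt_zero.2 hδ) hδ))).exists
  have h2 := hj 0 h0
  rw [zero_mul] at h2
  exact hne _ ⟨hj', mul_ne_zero (by positivity) h2.1⟩ h2.2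

lemma dual_ne_zero (hγ : NonFlatNearZero N γ Q r) (hN : 2 ≤ N)
    (hγ0 : Tendsto (deriv γ) (𝓝[≠] 0) (𝓝 0)) (hD : DualAsymptotics N γ D r) {s : ℝ}
    (hs : s ∈ D) : r s ≠ 0 := fun hr => by
  obtain ⟨τ, hτ, h⟩ := hD.exists_solution
  obtain ⟨M, hM, a, ha, hres⟩ := hγ.exists_rescaled hN
  have hτs := hτ s hs
  rw [hr] at hτs
  have hQ1 : ContinuousOn (derivWithin Q bandI) bandI := by
    have := hγ.smooth_main.continuousOn_iteratedDerivWithin (m := 1)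
      (by exact_mod_cast (by omega : 1 ≤ N)) uniqueDiffOn_bandI
    refine this.congr fun y _ => ?_
    rw [iteratedDerivWithin_one]
  obtain ⟨B, hB⟩ := isCompact_bandI.exists_bound_of_continuousOn hQ1
  obtain ⟨θ, L, hθ0, hθ, -, hsl⟩ := hγ.exists_slope_le hN hγ0
  obtain ⟨j₀, hj₀⟩ := eventually_atTop.1 (hsl.and (hres.and (ha.eventually_le_const one_pos)))
  have hs0 : s ≠ 0 := fun h0 => hγ.zero_notMem hD (h0 ▸ hs)
  have hB1 : 0 < max B 0 + 1 := by positivity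
  -- `|s| ≤ (B + 1) θ^l` as soon as `|τ_j(s)| < 2^{-l}`
  have key : ∀ l : ℕ, |s| ≤ (max B 0 + 1) * θ ^ l := fun l => by
    have h2 : ∀ᶠ j in atTop, |τ j s| < (2 : ℝ)⁻¹ ^ l := by
      have := hτs.abs
      rw [abs_zero] at this
      exact this.eventually_lt_const (by positivity)
    obtain ⟨j, ⟨hj, hjl⟩, hjj⟩ := ((h.and h2).and (eventually_ge_atTop j₀)).exists
    obtain ⟨hτ0, hτe⟩ := hj s hs
    obtain ⟨k, hk1, hk2⟩ := exists_nat_pow_near_of_lt_one (abs_pos.2 hτ0)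
      (hjl.le.trans (pow_le_one₀ (by norm_num) (by norm_num))) (y := (2 : ℝ)⁻¹) (by norm_num)
      (by norm_num)
    have hlk : l ≤ k := by
      by_contra hlt
      have h3 : (2 : ℝ)⁻¹ ^ l ≤ (2 : ℝ)⁻¹ ^ (k + 1) :=
        pow_le_pow_of_le_one (by norm_num) (by norm_num) (by omega)
      linarith
    have hband : 2 ^ k * τ j s ∈ bandI := by
      have h2k : (0 : ℝ) < 2 ^ k := by positivity
      constructor
      · rw [abs_mul, abs_of_pos h2k]
        rw [inv_pow, pow_succ, mul_inv, mul_comm, ← div_eq_mul_inv] at hk1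
        rw [lt_iff_exists_pos_add] at hk1
        obtain ⟨c, hc, hk1⟩ := hk1
        rw [← hk1, mul_add]
        have : (2 : ℝ) ^ k * (2⁻¹ / 2 ^ k) = 1 / 2 := by field_simp
        have : 0 < 2 ^ k * c := by positivity
        linarith
      · rw [abs_mul, abs_of_pos h2k]
        calc (2 : ℝ) ^ k * |τ j s| ≤ 2 ^ k * (2 : ℝ)⁻¹ ^ k := by gcongr
          _ = 1 := by rw [← mul_pow]; norm_num
          _ ≤ 4 := by norm_num
    have h4 := ((hj₀ (j + k) (by omega)).2.1 _ hband).1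
    have e : (2 : ℝ)⁻¹ ^ (j + k) * (2 ^ k * τ j s) = (2 : ℝ)⁻¹ ^ j * τ j s := by
      rw [pow_add, inv_pow, inv_pow]; field_simp
    rw [e, hτe] at h4
    have h5 := (hj₀ (j + k) (by omega)).2.2
    have h6 := hB _ hband
    rw [norm_eq_abs] at h6
    have h7 : |s * slope γ j / slope γ (j + k)| ≤ max B 0 + 1 := by
      have := abs_sub_abs_le_abs_sub (s * slope γ j / slope γ (j + k))
        (derivWithin Q bandI (2 ^ k * τ j s))
      linarith [le_max_left B 0]
    have h8 : ∀ k, |slope γ (j + k)| ≤ θ ^ k * |slope γ j| := fun k => by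
      induction k with
      | zero => simp
      | succ k ih =>
        refine (hj₀ (j + k) (by omega)).1.2.1.trans ?_
        rw [pow_succ', mul_assoc]
        exact mul_le_mul_of_nonneg_left ih hθ0
    have hpos : 0 < |slope γ j| := abs_pos.2 (hj₀ j hjj).1.1
    have hposk : 0 < |slope γ (j + k)| := abs_pos.2 (hj₀ (j + k) (by omega)).1.1
    rw [abs_div, abs_mul, div_le_iff₀ hposk] at h7
    have h9 : |s| * |slope γ j| ≤ (max B 0 + 1) * θ ^ k * |slope γ j| := by
      rw [mul_assoc]
      exact h7.trans (mul_le_mul_of_nonneg_left (h8 k) hB1.le)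
    refine (le_of_mul_le_mul_right h9 hpos).trans ?_
    exact mul_le_mul_of_nonneg_left (pow_le_pow_of_le_one hθ0 hθ.le hlk) hB1.le
  have hlim : Tendsto (fun l : ℕ => (max B 0 + 1) * θ ^ l) atTop (𝓝 ((max B 0 + 1) * 0)) :=
    (tendsto_pow_atTop_nhds_zero_of_lt_one hθ0 hθ).const_mul _
  rw [mul_zero] at hlim
  exact hs0 (abs_nonpos_iff.1 (ge_of_tendsto' hlim key))

/-- The limit `r` of the inverses is expanding, locally: `γ'` is Lipschitz at the scale of
`2^{-j}`, with constant comparable to `γ'(2^{-j}) / 2^{-j}`. -/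
lemma exists_abs_sub_le (hγ : NonFlatNearZero N γ Q r) (hN : 2 ≤ N)
    (hγ0 : Tendsto (deriv γ) (𝓝[≠] 0) (𝓝 0)) (hD : DualAsymptotics N γ D r) {s : ℝ}
    (hs : s ∈ D) : ∃ C : ℝ, ∀ᶠ s' in 𝓝[D] s, |s' - s| ≤ C * |r s' - r s| := by
  obtain ⟨τ, hτ, h⟩ := hD.exists_solution
  obtain ⟨M, hM, _, _, hres⟩ := hγ.exists_rescaled hN
  have hr := hγ.dual_ne_zero hN hγ0 hD hs
  -- the two exponents shift `r(s)` to the middle of the band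
  obtain ⟨a, b, hab⟩ : ∃ a b : ℕ, 2 ^ a * (2 : ℝ)⁻¹ ^ b * |r s| ∈ Icc (1 : ℝ) 2 := by
    obtain ⟨l, hl1, hl2⟩ := exists_mem_Ico_zpow (abs_pos.2 hr) (one_lt_two (α := ℝ))
    rcases le_total 0 l with hl | hl
    · lift l to ℕ using hl
      refine ⟨0, l, ?_⟩
      have h2 : (0 : ℝ) < 2 ^ l := by positivity
      rw [zpow_natCast] at hl1
      rw [zpow_add₀ two_ne_zero, zpow_natCast, zpow_one] at hl2
      rw [pow_zero, one_mul, inv_pow, ← div_eq_inv_mul]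
      exact ⟨by rwa [le_div_iff₀ h2, one_mul], by rw [div_le_iff₀ h2]; linarith⟩
    · obtain ⟨n, hn⟩ := Int.eq_ofNat_of_zero_le (neg_nonneg.2 hl)
      obtain rfl : l = -(n : ℤ) := by linarith
      refine ⟨n, 0, ?_⟩
      have h2 : (0 : ℝ) < 2 ^ n := by positivity
      rw [zpow_neg, zpow_natCast, inv_le_iff_one_le_mul₀ h2] at hl1
      rw [zpow_add₀ two_ne_zero, zpow_neg, zpow_natCast, zpow_one, inv_mul_eq_div,
        lt_div_iff₀ h2] at hl2
      rw [pow_zero, mul_one]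
      exact ⟨by linarith, by linarith⟩
  set e : ℝ := 2 ^ a * (2 : ℝ)⁻¹ ^ b with he
  have he0 : 0 < e := by positivity
  obtain ⟨L, hL0, hL⟩ := hγ.exists_slope_ratio_le hN hγ0 b
  have hcont : ContinuousWithinAt r D s := hD.1.continuousOn s hs
  have hnear : ∀ᶠ s' in 𝓝[D] s, |e * r s' - e * r s| < 1 / 4 := by
    have h1 : Tendsto (fun s' => |e * r s' - e * r s|) (𝓝[D] s) (𝓝 |e * r s - e * r s|) :=
      ((hcont.tendsto.const_mul e).sub_const _).abs
    rw [sub_self, abs_zero] at h1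
    exact h1.eventually_lt_const (by norm_num)
  refine ⟨L * (M * e), ?_⟩
  filter_upwards [hnear, self_mem_nhdsWithin] with s' hs' hs'D
  have hshift : ∀ c : ℕ, Tendsto (fun n : ℕ => n + c) atTop atTop := fun c => tendsto_add_atTop_nat c
  have hlim : ∀ x ∈ D, Tendsto (fun n => e * τ (n + b) x) atTop (𝓝 (e * r x)) := fun x hx =>
    (((hτ x hx).comp (hshift b))).const_mul e
  have hclose : ∀ x ∈ D, ∀ᶠ n in atTop, |e * τ (n + b) x - e * r x| < 1 / 4 := fun x hx => by
    have h1 := ((hlim x hx).sub_const (e * r x)).abs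
    rw [sub_self, abs_zero] at h1
    exact h1.eventually_lt_const (by norm_num)
  -- the convex neighbourhood of `e r(s)` in the band
  set I : Set ℝ := Icc (e * r s - 1 / 2) (e * r s + 1 / 2) with hI
  have hIb : I ⊆ bandI := fun y hy => by
    have h1 : |y - e * r s| ≤ 1 / 2 := abs_le.2 ⟨by linarith [hy.1], by linarith [hy.2]⟩
    have h2 : |e * r s| ∈ Icc (1 : ℝ) 2 := by rwa [abs_mul, abs_of_pos he0]
    have h3 := abs_sub_abs_le_abs_sub (e * r s) y
    have h4 := abs_sub_abs_le_abs_sub y (e * r s)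
    rw [abs_sub_comm] at h3
    exact ⟨by linarith [h2.1], by linarith [h2.2]⟩
  have hfin : ∀ᶠ n in atTop, |s' - s| ≤ L * (M * |e * τ (n + b) s' - e * τ (n + b) s|) := by
    filter_upwards [hclose s hs, hclose s' hs'D, hL, (hshift b).eventually h,
      (hshift a).eventually hres, (hshift a).eventually hγ.eventually_slope_ne_zero,
      (hshift b).eventually hγ.eventually_slope_ne_zero] with n h1 h2 h3 h4 h5 h6 h7
    have hmem : ∀ x ∈ D, |e * τ (n + b) x - e * r x| < 1 / 4 → |e * r x - e * r s| < 1 / 4 →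
        e * τ (n + b) x ∈ I := fun x _ hx1 hx2 => by
      rw [abs_lt] at hx1 hx2
      exact ⟨by linarith, by linarith⟩
    have hm := hmem s hs h1 (by rw [sub_self, abs_zero]; norm_num)
    have hm' := hmem s' hs'D h2 hs'
    set G : ℝ → ℝ := fun t => deriv γ ((2 : ℝ)⁻¹ ^ (n + a) * t) / slope γ (n + a) with hG
    have hlip : |G (e * τ (n + b) s') - G (e * τ (n + b) s)| ≤
        M * |e * τ (n + b) s' - e * τ (n + b) s| := by
      have hd : ∀ y ∈ I, DifferentiableAt ℝ G y := fun y hy =>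
        (h5 y (hIb hy)).2.choose_spec.2.differentiableAt
      have hb : ∀ y ∈ I, ‖deriv G y‖ ≤ M := fun y hy => by
        have h8 := (h5 y (hIb hy)).2.choose_spec
        rw [h8.2.deriv]; exact h8.1
      exact (convex_Icc _ _).norm_image_sub_le_of_norm_deriv_le hd hb hm hm'
    have hGe : ∀ x ∈ D, G (e * τ (n + b) x) = x * slope γ (n + b) / slope γ (n + a) :=
      fun x hx => by
        have e1 : (2 : ℝ)⁻¹ ^ (n + a) * (e * τ (n + b) x) = (2 : ℝ)⁻¹ ^ (n + b) * τ (n + b) x := by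
          rw [he, pow_add, pow_add, inv_pow, inv_pow, inv_pow]; field_simp
        simp only [hG]
        rw [e1, (h4 x hx).2]
    rw [hGe s hs, hGe s' hs'D, ← sub_div, ← sub_mul, abs_div, abs_mul,
      div_le_iff₀ (abs_pos.2 h6)] at hlip
    have hpos := abs_pos.2 h7
    refine le_of_mul_le_mul_right (hlip.trans ?_) hpos
    calc M * |e * τ (n + b) s' - e * τ (n + b) s| * |slope γ (n + a)|
        ≤ M * |e * τ (n + b) s' - e * τ (n + b) s| * (L * |slope γ (n + b)|) := by
          gcongr; exact h3 a
      _ = _ := by ring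
  have hlim2 := ((((hlim s' hs'D).sub (hlim s hs)).abs.const_mul M).const_mul L)
  have := ge_of_tendsto hlim2 hfin
  rw [← mul_sub, abs_mul, abs_of_pos he0] at this
  linarith

end NonFlatNearZero

/-- The set of the quotients `u / q`, where `u` is in the support of `φ` and `q ∈ [1, 2]`. -/
def quotientSet (φ : ℝ → ℂ) : Set ℝ :=
  (fun z : ℝ × ℝ => z.1 / z.2) '' (tsupport φ ×ˢ Icc (1 : ℝ) 2)

lemma mul_mem_quotientSet {φ : ℝ → ℂ} {u t : ℝ} (hu : u ∈ tsupport φ)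
    (ht : t ∈ Icc (1 / 2 : ℝ) 1) : u * t ∈ quotientSet φ := by
  have ht0 : 0 < t := by linarith [ht.1]
  refine ⟨(u, t⁻¹), ⟨hu, one_le_inv_iff₀.2 ⟨ht0, ht.2⟩, ?_⟩, ?_⟩
  · rw [inv_le_comm₀ ht0 two_pos]; linarith [ht.1]
  · simp

lemma isCompact_quotientSet {φ : ℝ → ℂ} (hφ : HasCompactSupport φ) :
    IsCompact (quotientSet φ) := by
  refine (hφ.isCompact.prod isCompact_Icc).image_of_continuousOn ?_
  exact continuousOn_fst.div continuousOn_snd fun z hz => by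
    have := hz.2.1
    positivity

lemma uniqueDiffOn_quotientSet {φ : ℝ → ℂ} (hφ0 : ∀ u ∈ tsupport φ, u ≠ 0) :
    UniqueDiffOn ℝ (quotientSet φ) := by
  rintro x ⟨⟨u, q⟩, ⟨hu, hq⟩, rfl⟩
  have hu0 := hφ0 u hu
  -- the quotient set contains the segment from `u / 2` to `u`
  have e : segment ℝ (u * (1 / 2)) (u * 1) = (fun t => u * t) '' segment ℝ (1 / 2 : ℝ) 1 :=
    (image_segment ℝ (LinearMap.mulLeft ℝ u).toAffineMap (1 / 2 : ℝ) 1).symm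
  have hsub : segment ℝ (u * (1 / 2)) (u * 1) ⊆ quotientSet φ := by
    rw [e, segment_eq_Icc (by norm_num)]
    rintro _ ⟨t, ht, rfl⟩
    exact mul_mem_quotientSet hu ht
  have hmem : u / q ∈ segment ℝ (u * (1 / 2)) (u * 1) := by
    rw [e, segment_eq_Icc (by norm_num)]
    have hq0 : 0 < q := by linarith [hq.1]
    refine ⟨q⁻¹, ⟨?_, inv_le_one_of_one_le₀ hq.1⟩, by simp [div_eq_mul_inv]⟩
    rw [one_div]
    exact inv_anti₀ hq0 hq.2
  rw [segment_eq_uIcc] at hsub hmem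
  refine UniqueDiffWithinAt.mono ?_ hsub
  refine uniqueDiffOn_Icc ?_ _ hmem
  rw [min_lt_max]
  intro h
  apply hu0
  linarith

lemma mul_mem_interior {φ : ℝ → ℂ} {u t : ℝ} (hu : u ∈ innerSupport φ)
    (ht : t ∈ Icc (1 / 2 : ℝ) 1) : quotientSet φ ∈ 𝓝 (u * t) := by
  have ht0 : t ≠ 0 := by linarith [ht.1]
  have h1 : (fun x => x * t⁻¹) ⁻¹' interior (tsupport φ) ∈ 𝓝 (u * t) := by
    refine (continuous_mul_const t⁻¹).continuousAt.preimage_mem_nhds ?_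
    rw [mul_inv_cancel_right₀ ht0]
    exact isOpen_interior.mem_nhds hu
  refine mem_of_superset h1 fun x hx => ?_
  have := mul_mem_quotientSet (interior_subset hx) ht
  rwa [inv_mul_cancel_right₀ ht0] at this

lemma hasDerivAt_dualPhase {D : Set ℝ} (hDc : IsCompact D) {r : ℝ → ℝ} (hr : ContinuousOn r D)
    {x : ℝ} (hx : D ∈ 𝓝 x) : HasDerivAt (dualPhase D r) (r x) x := by
  have hi : Integrable (D.indicator r) :=
    (hr.integrableOn_compact hDc).integrable_indicator hDc.measurableSet
  have he : D.indicator r =ᶠ[𝓝 x] r := by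
    filter_upwards [hx] with y hy
    rw [indicator_of_mem hy]
  have hc : ContinuousAt (D.indicator r) x := (hr.continuousAt hx).congr he.symm
  have := intervalIntegral.integral_hasDerivAt_right (a := 1) hi.intervalIntegrable
    (hi.1.stronglyMeasurableAtFilter) hc
  rw [indicator_of_mem (mem_of_mem_nhds hx)] at this
  exact this

/-- The dual phase satisfies the hypotheses of the stationary phase estimate. -/
theorem exists_isPhase {N : ℕ} (hN : 4 ≤ N) {γ Q r : ℝ → ℝ} (hγ : NonFlatNearZero N γ Q r)
    (hγ0 : Tendsto (deriv γ) (𝓝[≠] 0) (𝓝 0)) {D : Set ℝ} (hDc : IsCompact D)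
    (hD : DualAsymptotics N γ D r) {φ : ℝ → ℂ} (hφc : HasCompactSupport φ)
    (hφ0 : ∀ u ∈ tsupport φ, u ≠ 0) (hφD : ∀ u ∈ tsupport φ, ∀ q ∈ Icc (1 : ℝ) 2, u / q ∈ D) :
    ∃ ρ : ℕ → ℝ → ℝ, ∃ M c : ℝ, 0 ≤ M ∧ 0 < c ∧
      IsPhase (innerSupport φ) (dualPhase D r) ρ M c := by
  set E := quotientSet φ with hE
  have hED : E ⊆ D := by
    rintro _ ⟨⟨u, q⟩, ⟨hu, hq⟩, rfl⟩
    exact hφD u hu q hq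
  have hEc : IsCompact E := isCompact_quotientSet hφc
  have hEu : UniqueDiffOn ℝ E := uniqueDiffOn_quotientSet hφ0
  have hrE : ContDiffOn ℝ (N - 1 : ℕ) r E := hD.1.mono hED
  have hcont : ∀ i ≤ 3, ContinuousOn (iteratedDerivWithin i r E) E := fun i hi =>
    hrE.continuousOn_iteratedDerivWithin (by exact_mod_cast (by omega : i ≤ N - 1)) hEu
  have hdiff : ∀ i < 3, DifferentiableOn ℝ (iteratedDerivWithin i r E) E := fun i hi =>
    hrE.differentiableOn_iteratedDerivWithin (by exact_mod_cast (by omega : i < N - 1)) hEu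
  obtain ⟨M, hM⟩ : ∃ M : ℝ, ∀ i ≤ 3, ∀ x ∈ E, |iteratedDerivWithin i r E x| ≤ M := by
    choose! B hB using fun i (hi : i ≤ 3) => hEc.exists_bound_of_continuousOn (hcont i hi)
    refine ⟨∑ i ∈ Finset.range 4, |B i|, fun i hi x hx => (hB i hi x hx).trans ?_⟩
    exact (le_abs_self _).trans (single_le_sum (f := fun i => |B i|)
      (fun i _ => abs_nonneg _) (Finset.mem_range.2 (by omega)))
  -- by the local expansion of `r`, its derivative does not vanish
  have hne : ∀ x ∈ E, iteratedDerivWithin 1 r E x ≠ 0 := fun x hx h0 => by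
    have hd : HasDerivWithinAt r 0 E x := by
      have h1 := (hdiff 0 (by omega) x hx).hasDerivWithinAt
      rw [iteratedDerivWithin_one] at h0
      rw [iteratedDerivWithin_zero, h0] at h1
      exact h1
    obtain ⟨C, hC⟩ := hγ.exists_abs_sub_le (by omega) hγ0 hD (hED hx)
    have hC' := hC.filter_mono (nhdsWithin_mono x hED)
    rw [hasDerivWithinAt_iff_isLittleO] at hd
    have h2 := hd.def (c := 1 / (2 * (|C| + 1))) (by positivity)
    have h3 : ∃ᶠ x' in 𝓝[E] x, x' ≠ x := by
      have h4 : (𝓝[E \ {x}] x).NeBot :=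
        accPt_principal_iff_nhdsWithin.1 (hEu x hx).accPt
      have h5 : ∃ᶠ x' in 𝓝[E \ {x}] x, x' ≠ x :=
        (eventually_mem_nhdsWithin.mono fun y hy => hy.2).frequently
      exact h5.filter_mono (nhdsWithin_mono x sdiff_subset)
    obtain ⟨x', hx', h6, h7⟩ := (h3.and_eventually (h2.and hC')).exists
    have hpos : 0 < |x' - x| := abs_pos.2 (sub_ne_zero.2 hx')
    simp only [smul_zero, sub_zero, norm_eq_abs] at h6
    have h8 : C * |r x' - r x| ≤ (|C| + 1) * (1 / (2 * (|C| + 1)) * |x' - x|) := by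
      have : C ≤ |C| + 1 := by linarith [le_abs_self C]
      exact mul_le_mul this h6 (abs_nonneg _) (by positivity)
    have h9 : (|C| + 1) * (1 / (2 * (|C| + 1)) * |x' - x|) = |x' - x| / 2 := by
      have : |C| + 1 ≠ 0 := by positivity
      field_simp
    linarith
  obtain ⟨c, hc, hcE⟩ : ∃ c > 0, ∀ x ∈ E, c ≤ |iteratedDerivWithin 1 r E x| := by
    rcases E.eq_empty_or_nonempty with h | h
    · exact ⟨1, one_pos, by rw [h]; simp⟩
    obtain ⟨x₀, hx₀, hmin⟩ := hEc.exists_isMinOn h (hcont 1 (by omega)).abs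
    exact ⟨_, abs_pos.2 (hne x₀ hx₀), fun x hx => hmin hx⟩
  have hmem : ∀ u ∈ innerSupport φ, ∀ t ∈ Icc (1 / 2 : ℝ) 1, u * t ∈ E := fun u hu t ht =>
    mul_mem_quotientSet (interior_subset hu) ht
  refine ⟨fun i => iteratedDerivWithin i r E, max M 0, c, le_max_right _ _, hc, ?_, ?_, ?_, ?_⟩
  · intro u hu t ht
    simp only [iteratedDerivWithin_zero]
    exact hasDerivAt_dualPhase hDc hD.1.continuousOn
      (mem_of_superset (mul_mem_interior hu ht) hED)
  · intro i hi u hu t ht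
    have h1 := (hdiff i hi _ (hmem u hu t ht)).hasDerivWithinAt
    rw [← iteratedDerivWithin_succ] at h1
    exact h1.hasDerivAt (mul_mem_interior hu ht)
  · exact fun i hi u hu t ht => (hM i hi _ (hmem u hu t ht)).trans (le_max_left _ _)
  · exact fun u hu t ht => hcE _ (hmem u hu t ht)

/-! ### The trilinear form at high frequencies -/

lemma cauchyAvg_le_of_ae_le {t : ℝ} (ht : 0 < t) {F : ℝ → ℝ≥0∞} {c : ℝ≥0∞}
    (h : ∀ᵐ y, F y ≤ c) (x : ℝ) : cauchyAvg t F x ≤ ofReal π * c := by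
  rw [← cauchyAvg_const ht c x]
  exact lintegral_mono_ae (h.mono fun y hy => mul_le_mul_right hy _)

/-- An `L^r` bound follows from a weighted `L¹` bound with the maximal function of the weight, by
duality. -/
lemma exists_lintegral_rpow_le_of_weighted {r : ℝ} (hr : 1 ≤ r) :
    ∃ C : ℝ≥0, ∀ V H : ℝ → ℝ≥0∞, AEMeasurable V → AEMeasurable H →
      ∫⁻ x, V x ^ r < ∞ →
      (∀ w : ℝ → ℝ≥0∞, AEMeasurable w → ∫⁻ x, V x * w x ≤ ∫⁻ x, H x * maxFn w x) →
      ∫⁻ x, V x ^ r ≤ C * ∫⁻ x, H x ^ r := by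
  rcases hr.eq_or_lt with rfl | hr1
  · refine ⟨1, fun V H _ _ _ hw => ?_⟩
    simp only [rpow_one, ENNReal.coe_one, one_mul]
    have h := hw (fun _ => 1) aemeasurable_const
    simp only [mul_one] at h
    exact h.trans (lintegral_mono fun x => mul_le_of_le_one_right' (maxFn_const_le 1 x))
  have hr0 : 0 < r := by linarith
  obtain ⟨q, hrq⟩ : ∃ q, r.HolderConjugate q := ⟨_, Real.HolderConjugate.conjExponent hr1⟩
  have hq0 : 0 < q := hrq.symm.pos
  set A : ℝ≥0∞ := (maxConst q : ℝ≥0∞) ^ (1 / q) with hA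
  have hAtop : A ≠ ∞ := rpow_ne_top_of_nonneg (by positivity) (by simp)
  refine ⟨(A ^ r).toNNReal, fun V H hV hH hX hw => ?_⟩
  rw [coe_toNNReal (rpow_ne_top_of_nonneg hr0.le hAtop)]
  have hum : AEMeasurable (fun x => V x ^ (r - 1)) volume := hV.pow_const _
  have key : ∫⁻ x, V x ^ r ≤ A * (∫⁻ x, H x ^ r) ^ (1 / r) * (∫⁻ x, V x ^ r) ^ (1 / q) := by
    calc ∫⁻ x, V x ^ r = ∫⁻ x, V x * V x ^ (r - 1) := by
          refine lintegral_congr fun x => ?_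
          have : V x ^ r = V x ^ (1 : ℝ) * V x ^ (r - 1) := by
            rw [← rpow_add_of_nonneg _ _ zero_le_one (by linarith)]; congr 1; ring
          rw [this, rpow_one]
      _ ≤ ∫⁻ x, H x * maxFn (fun y => V y ^ (r - 1)) x := hw _ hum
      _ ≤ (∫⁻ x, H x ^ r) ^ (1 / r) * (∫⁻ x, maxFn (fun y => V y ^ (r - 1)) x ^ q) ^ (1 / q) :=
          lintegral_mul_le_Lp_mul_Lq _ hrq hH (measurable_maxFn _).aemeasurable
      _ ≤ (∫⁻ x, H x ^ r) ^ (1 / r) * (maxConst q * ∫⁻ x, V x ^ r) ^ (1 / q) := by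
          gcongr
          refine (lintegral_maxFn_rpow_le hrq.symm.lt hum).trans_eq ?_
          congr 1
          refine lintegral_congr fun x => ?_
          rw [← rpow_mul]
          congr 1
          have := hrq.mul_eq_add
          linarith
      _ = _ := by
          rw [mul_rpow_of_nonneg _ _ (by positivity), hA]
          ring
  refine (le_rpow_of_le_mul_rpow hrq hX.ne key).trans_eq ?_
  rw [mul_rpow_of_nonneg _ _ hr0.le, ← rpow_mul (∫⁻ x, H x ^ r),
    one_div_mul_cancel hr0.ne', rpow_one]

/-- Averaging the members of a family at arbitrary scales is bounded for the `L^r` norm of the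
sum. -/
lemma exists_lintegral_sum_cauchyAvg_rpow_le {r : ℝ} (hr : 1 ≤ r) :
    ∃ C : ℝ≥0, ∀ (S : Finset ℕ) (t : ℕ → ℝ) (w : ℕ → ℝ → ℝ≥0∞), (∀ j ∈ S, 0 < t j) →
      (∀ j ∈ S, AEMeasurable (w j)) → ∫⁻ x, (∑ j ∈ S, w j x) ^ r < ∞ →
      ∫⁻ x, (∑ j ∈ S, cauchyAvg (t j) (w j) x) ^ r ≤ C * ∫⁻ x, (∑ j ∈ S, w j x) ^ r := by
  have hr0 : 0 < r := by linarith
  obtain ⟨C, hC⟩ := exists_lintegral_rpow_le_of_weighted hr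
  refine ⟨C * ((16 : ℝ≥0∞) ^ r).toNNReal, fun S t w ht hw hfin => ?_⟩
  have hWm : AEMeasurable (fun x => ∑ j ∈ S, w j x) := aemeasurable_fun_sum _ hw
  have hwt : ∀ v : ℝ → ℝ≥0∞, AEMeasurable v →
      ∫⁻ x, (∑ j ∈ S, cauchyAvg (t j) (w j) x) * v x ≤
        ∫⁻ x, (16 * ∑ j ∈ S, w j x) * maxFn v x := fun v hv => by
    have e := lintegral_finsetSum' (μ := volume)
      (f := fun j x => cauchyAvg (t j) (w j) x * v x) S fun j hj =>
        (measurable_cauchyAvg (hw j hj) _).aemeasurable.mul hv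
    have e' := lintegral_finsetSum' (μ := volume)
      (f := fun j x => w j x * (16 * maxFn v x)) S fun j hj =>
        (hw j hj).mul ((measurable_maxFn v).const_mul _).aemeasurable
    have e2 : ∀ x, 16 * (∑ j ∈ S, w j x) * maxFn v x = ∑ j ∈ S, w j x * (16 * maxFn v x) :=
      fun x => by rw [← sum_mul]; ring
    simp only [e2, sum_mul]
    rw [e, e']
    refine sum_le_sum fun j hj => ?_
    rw [lintegral_cauchyAvg_mul (hw j hj) hv]
    exact lintegral_mono fun x => mul_le_mul_right (cauchyAvg_le_maxFn₀ (ht j hj) hv x) _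
  have hX : ∫⁻ x, (∑ j ∈ S, cauchyAvg (t j) (w j) x) ^ r < ∞ := by
    have h2r : 2 * r / 2 = r := by ring
    have h1 := lintegral_sum_sq_lt_top (s := S)
      (u := fun j x => cauchyAvg (t j) (w j) x ^ (1 / 2 : ℝ)) (q := 2 * r)
      (fun j hj => ((measurable_cauchyAvg (hw j hj) _).pow_const _).aemeasurable) (by positivity)
      fun j hj => ?_
    · simpa only [rpow_half_sq, h2r] using h1
    · have e2 : ∀ z : ℝ≥0∞, (z ^ (1 / 2 : ℝ)) ^ (2 * r) = z ^ r := fun z => by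
        rw [← rpow_mul]; congr 1; ring
      simp only [e2]
      have hwj : ∫⁻ x, w j x ^ r < ∞ := by
        refine (lintegral_mono fun x => ?_).trans_lt hfin
        exact rpow_le_rpow (single_le_sum (f := fun j => w j x)
          (fun _ _ => zero_le) hj) hr0.le
      rcases hr.eq_or_lt with rfl | hr1
      · simp only [rpow_one] at hwj ⊢
        have h := lintegral_cauchyAvg_mul (hw j hj) (G := fun _ => 1) aemeasurable_const (t j)
        simp only [mul_one, cauchyAvg_const (ht j hj)] at h
        rw [h, lintegral_mul_const'' _ (hw j hj)]
        exact mul_lt_top hwj ofReal_lt_top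
      · exact lintegral_cauchyAvg_rpow_lt_top (hw j hj) hr1 hwj (ht j hj)
  refine (hC _ _ (aemeasurable_fun_sum _ fun j hj =>
    (measurable_cauchyAvg (hw j hj) _).aemeasurable) (hWm.const_mul 16) hX hwt).trans_eq ?_
  simp_rw [mul_rpow_of_nonneg _ _ hr0.le]
  rw [lintegral_const_mul'' _ (hWm.pow_const r), coe_mul, coe_toNNReal
    (rpow_ne_top_of_nonneg hr0.le (by simp)), mul_assoc]

/-- A smooth function that is one on `[1/2, 3]` and vanishes near the origin. -/
noncomputable def annulusBump (x : ℝ) : ℂ :=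
  ((⟨5 / 4, 3 / 2, by norm_num, by norm_num⟩ : ContDiffBump (7 / 4 : ℝ)) x : ℝ)

lemma isSymbol_annulusBump : IsSymbol annulusBump := by
  refine ⟨Complex.ofRealCLM.contDiff.comp (ContDiffBump.contDiff _), ?_⟩
  exact (ContDiffBump.hasCompactSupport _).comp_left (g := fun x : ℝ => (x : ℂ)) rfl

lemma annulusBump_zero : annulusBump 0 = 0 := by
  rw [annulusBump, ContDiffBump.zero_of_le_dist, Complex.ofReal_zero]
  rw [dist_zero_left, norm_of_nonneg (by norm_num)]
  norm_num

lemma annulusBump_eq_one {x : ℝ} (hx : x ∈ Icc (1 / 2 : ℝ) 3) : annulusBump x = 1 := by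
  rw [annulusBump, ContDiffBump.one_of_mem_closedBall, Complex.ofReal_one]
  rw [mem_closedBall_iff_norm, norm_eq_abs, abs_le]
  exact ⟨by linarith [hx.1], by linarith [hx.2]⟩

/-- The dilation parameter `σ_j = γ'(2^{-j}) / 2^j` of the localisations `φ_{j,p₀}`. -/
noncomputable def dilation (γ : ℝ → ℝ) (j : ℕ) : ℝ := slope γ j / 2 ^ j

lemma phiLoc_eq (γ : ℝ → ℝ) (φ : ℝ → ℂ) (j p : ℕ) :
    phiLoc γ φ j p = fun η => φ (dilation γ j * η - p) := by
  ext η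
  rw [phiLoc, dilation, slope, div_mul_eq_mul_div]

lemma phiScale_eq (φ : ℝ → ℂ) (k : ℕ) : phiScale φ k = fun η => φ ((2 : ℝ)⁻¹ ^ k * η) := by
  ext η
  rw [phiScale, inv_pow, div_eq_inv_mul]

lemma IsDecaying.comp_sub {a : ℝ → ℂ} {D : ℝ} (ha : IsDecaying D 1 (invFT a)) (c : ℝ) :
    IsDecaying D 1 (invFT fun η => a (η - c)) := by
  have e : ∀ x, invFT (fun η => a (η - c)) x = exp (I * c * x) * invFT a x :=
    invFT_comp_sub a c
  refine ⟨ha.pos, ?_, fun x => ?_⟩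
  · rw [funext e]
    exact (by fun_prop : Continuous fun x : ℝ => exp (I * c * x)).mul ha.continuous
  · rw [e, norm_mul, norm_exp_I_mul, one_mul]; exact ha.norm_le x

lemma sum_mul_le_sqrt_mul_sqrt {ι : Type*} (s : Finset ι) (u v : ι → ℝ≥0∞) :
    ∑ i ∈ s, u i * v i ≤ (∑ i ∈ s, u i ^ 2) ^ (1 / 2 : ℝ) * (∑ i ∈ s, v i ^ 2) ^ (1 / 2 : ℝ) := by
  have := ENNReal.inner_le_Lp_mul_Lq s u v Real.HolderConjugate.two_two
  simpa only [ENNReal.rpow_two] using this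

lemma cauchyAvg_sqrt_le {t : ℝ} (ht : 0 < t) {F : ℝ → ℝ≥0∞} (hF : AEMeasurable F) (x : ℝ) :
    cauchyAvg t (fun y => F y ^ (1 / 2 : ℝ)) x ≤ 2 * cauchyAvg t F x ^ (1 / 2 : ℝ) := by
  have h := cauchyAvg_sq_le ht (hF.pow_const (1 / 2 : ℝ)) x
  simp only [rpow_half_sq] at h
  have h2 := rpow_le_rpow h (by norm_num : (0 : ℝ) ≤ 1 / 2)
  rw [mul_rpow_of_nonneg _ _ (by norm_num), ← rpow_natCast, ← rpow_mul]
    at h2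
  have e4 : (4 : ℝ≥0∞) ^ (1 / 2 : ℝ) = 2 := by
    rw [show (4 : ℝ≥0∞) = 2 ^ (2 : ℝ) by norm_num, ← rpow_mul]; norm_num
  rw [e4] at h2
  simpa using h2

lemma isLacunary_two_pow (S : Finset ℕ) (m : ℕ) :
    IsLacunary S fun j => |(2 : ℝ)⁻¹ ^ (m + j)| := by
  have h0 : ∀ n, |(2 : ℝ)⁻¹ ^ n| = (2 : ℝ)⁻¹ ^ n := fun n => abs_of_pos (by positivity)
  have h1 : ∀ i j : ℕ, i < j → 2 * (2 : ℝ)⁻¹ ^ (m + j) ≤ (2 : ℝ)⁻¹ ^ (m + i) := fun i j hij => by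
    have : (2 : ℝ)⁻¹ ^ (m + j) ≤ (2 : ℝ)⁻¹ ^ (m + i + 1) :=
      pow_le_pow_of_le_one (by norm_num) (by norm_num) (by omega)
    rw [pow_succ] at this
    linarith
  refine fun i _ => ⟨by simp only [h0]; positivity, fun j _ hij => ?_⟩
  simp only [h0]
  rcases lt_or_gt_of_ne hij with h | h
  · exact Or.inr (h1 i j h)
  · exact Or.inl (h1 j i h)

lemma conv_annulus_eq {φ : ℝ → ℂ} (hφ : IsSymbol φ) (hφ10 : ∀ x, φ x ≠ 0 → |x| ≤ 10) {m p : ℕ}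
    (hm : 32 ≤ 2 ^ m) (hp : p ∈ Finset.Icc (2 ^ m) (2 ^ (m + 1))) {σ : ℝ} (hσ : σ ≠ 0) {h : ℝ → ℂ}
    (hh : Tame h) (x : ℝ) :
    conv (conv h (invFT fun η => annulusBump (((2 : ℝ) ^ m)⁻¹ * σ * η)))
      (invFT fun η => φ (σ * η - p)) x = conv h (invFT fun η => φ (σ * η - p)) x := by
  have h2 : (0 : ℝ) < 2 ^ m := by positivity
  rw [conv_conv_invFT hh (isSymbol_annulusBump.comp_mul (mul_ne_zero (inv_ne_zero h2.ne') hσ))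
    ((hφ.comp_sub p).comp_mul hσ)]
  congr 2
  ext η
  by_cases h0 : φ (σ * η - p) = 0
  · rw [h0, mul_zero]
  · rw [annulusBump_eq_one, one_mul]
    obtain ⟨h3, h4⟩ := abs_le.1 (hφ10 _ h0)
    obtain ⟨h5, h6⟩ := Finset.mem_Icc.1 hp
    have h5' : (2 : ℝ) ^ m ≤ p := by exact_mod_cast h5
    have h6' : (p : ℝ) ≤ 2 ^ m * 2 := by rw [← pow_succ]; exact_mod_cast h6
    have hm' : (32 : ℝ) ≤ 2 ^ m := by exact_mod_cast hm
    rw [mul_assoc, ← div_eq_inv_mul]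
    constructor
    · rw [le_div_iff₀ h2]; linarith
    · rw [div_le_iff₀ h2]; linarith

/-- The trilinear form at high frequencies `2^m`. The frequency localisation makes `f` and `h`
contribute through square functions, while almost orthogonality in `p₀` bounds the contribution
of `g` at each point by its supremum. -/
theorem exists_lintegral_trilinear_le {R : ℝ → ℝ} {φ : ℝ → ℂ} (hφ : ContDiff ℝ (⊤ : ℕ∞) φ)
    (hφc : HasCompactSupport φ) (hφ0 : φ 0 = 0) (hφ10 : ∀ x, φ x ≠ 0 → |x| ≤ 10) {K : ℝ}
    (hK : ∀ m : ℕ, IsAlmostOrthogonal K (Finset.Icc (2 ^ m) (2 ^ (m + 1)))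
      fun p => psi R φ m p 0) {p p' : ℝ} (hp : 2 ≤ p) (hpp' : p.HolderConjugate p') :
    ∃ C : ℝ≥0, ∀ m : ℕ, 32 ≤ 2 ^ m → ∀ (S : Finset ℕ) (σ : ℕ → ℝ),
      IsLacunary S (fun j => |σ j|) → ∀ f g h : ℝ → ℂ, AEStronglyMeasurable f →
      AEStronglyMeasurable g → AEStronglyMeasurable h →
      ∫⁻ x, ‖f x‖ₑ ^ p < ∞ → ∫⁻ x, ‖h x‖ₑ ^ p' < ∞ →
      ∀ c : ℝ≥0∞, (∀ᵐ x, ‖g x‖ₑ ≤ c) →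
      ∫⁻ x, ∑ j ∈ S, ∑ p₀ ∈ Finset.Icc (2 ^ m) (2 ^ (m + 1)),
        ‖conv (conv f (invFT (phiScale φ (m + j)))) (invFT (psi R φ m p₀ j)) x‖ₑ *
        ‖conv g (invFT fun η => φ (σ j * η - p₀)) x‖ₑ *
        ‖conv h (invFT fun η => φ (σ j * η - p₀)) x‖ₑ ≤
      C * (∫⁻ x, ‖f x‖ₑ ^ p) ^ (1 / p) * c * (∫⁻ x, ‖h x‖ₑ ^ p') ^ (1 / p') := by
  have hsym : IsSymbol φ := ⟨hφ.of_le (WithTop.coe_le_coe.2 le_top), hφc⟩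
  have hp0 : 0 < p := by linarith
  have hp'1 : 1 < p' := hpp'.symm.lt
  have hp'0 : 0 < p' := by linarith
  obtain ⟨D, hD⟩ := hsym.exists_isDecaying
  obtain ⟨K', hK'⟩ := exists_isAlmostOrthogonal_translates hφ hφ10
  obtain ⟨C₁, hC₁⟩ := exists_sum_enorm_conv_sq_le K
  obtain ⟨C₂, hC₂⟩ := exists_sum_enorm_conv_sq_le K'
  obtain ⟨C₃, hC₃⟩ := exists_lintegral_sum_cauchyAvg_rpow_le (r := p / 2) (by linarith)
  obtain ⟨C₄, hC₄⟩ := hsym.exists_lintegral_squareFn_rpow_le hφ0 (q := p) (by linarith)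
  obtain ⟨C₅, hC₅⟩ := isSymbol_annulusBump.exists_lintegral_squareFn_rpow_le annulusBump_zero hp'1
  set B : ℝ≥0∞ := ofReal D * ((C₁ : ℝ≥0∞) ^ (1 / 2 : ℝ) *
    (C₂ * ofReal π) ^ (1 / 2 : ℝ)) with hB
  have hBtop : B ≠ ∞ := by
    have h1 : ∀ z : ℝ≥0∞, z ≠ ∞ → z ^ (1 / 2 : ℝ) ≠ ∞ := fun z hz =>
      rpow_ne_top_of_nonneg (by norm_num) hz
    exact mul_ne_top ofReal_ne_top (mul_ne_top (h1 _ coe_ne_top)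
      (h1 _ (mul_ne_top coe_ne_top ofReal_ne_top)))
  set A : ℝ≥0∞ := 2 * B * ((C₃ * (C₃ * C₄) : ℝ≥0) : ℝ≥0∞) ^ (1 / p) *
    (C₅ : ℝ≥0∞) ^ (1 / p') with hA
  have hAtop : A ≠ ∞ := by
    refine mul_ne_top (mul_ne_top (mul_ne_top (by simp) hBtop) ?_) ?_ <;>
    exact rpow_ne_top_of_nonneg (by positivity) coe_ne_top
  refine ⟨A.toNNReal, fun m hm S σ hS f g h hf hg hh hfp hhp c hc => ?_⟩
  rw [coe_toNNReal hAtop]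
  have hσ : ∀ j ∈ S, σ j ≠ 0 := fun j hj => abs_pos.1 (hS j hj).1
  have hht : Tame h := tame_of_lintegral_rpow hh hp'1.le hhp
  set fj : ℕ → ℝ → ℂ := fun j => conv f (invFT (phiScale φ (m + j))) with hfj
  set hj' : ℕ → ℝ → ℂ := fun j =>
    conv h (invFT fun η => annulusBump (((2 : ℝ) ^ m)⁻¹ * σ j * η)) with hhj
  have hfm : ∀ j, AEStronglyMeasurable (fj j) := fun j =>
    IsSymbol.aestronglyMeasurable_conv (by
      rw [phiScale_eq]; exact hsym.comp_mul (by positivity)) hf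
  have hhm : ∀ j ∈ S, AEStronglyMeasurable (hj' j) := fun j hj =>
    (isSymbol_annulusBump.comp_mul (mul_ne_zero (by positivity)
      (hσ j hj))).aestronglyMeasurable_conv hh
  have h2j : ∀ j : ℕ, (0 : ℝ) < (2 : ℝ)⁻¹ ^ j := fun j => by positivity
  -- the averages of `|f_j|²` at the scales `2^{-j}` and `|σ_j|`
  set Y : ℕ → ℝ → ℝ≥0∞ := fun j => cauchyAvg ((2 : ℝ)⁻¹ ^ j) fun y => ‖fj j y‖ₑ ^ 2 with hY
  have hf2 : ∀ j, AEMeasurable (fun y => ‖fj j y‖ₑ ^ 2) := fun j => (hfm j).enorm.pow_const 2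
  have hYm : ∀ j, Measurable (Y j) := fun j => measurable_cauchyAvg (hf2 j) _
  set V : ℕ → ℝ → ℝ≥0∞ := fun j => cauchyAvg |σ j| (Y j) with hV
  have hVm : ∀ j, Measurable (V j) := fun j => measurable_cauchyAvg (hYm j).aemeasurable _
  -- at each point the sum over `p₀` is bounded by the Cauchy–Schwarz inequality in `f` and `g`
  have hpt : ∀ j ∈ S, ∀ x, ∑ p₀ ∈ Finset.Icc (2 ^ m) (2 ^ (m + 1)),
      ‖conv (fj j) (invFT (psi R φ m p₀ j)) x‖ₑ *
      ‖conv g (invFT fun η => φ (σ j * η - p₀)) x‖ₑ *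
      ‖conv h (invFT fun η => φ (σ j * η - p₀)) x‖ₑ ≤
      B * c * (cauchyAvg |σ j| (fun y => ‖hj' j y‖ₑ) x * Y j x ^ (1 / 2 : ℝ)) := fun j hj x => by
    have hH : ∀ p₀ ∈ Finset.Icc (2 ^ m : ℕ) (2 ^ (m + 1)),
        ‖conv h (invFT fun η => φ (σ j * η - p₀)) x‖ₑ ≤
          ofReal D * cauchyAvg |σ j| (fun y => ‖hj' j y‖ₑ) x := fun p₀ hp₀ => by
      rw [← conv_annulus_eq hsym hφ10 hm hp₀ (hσ j hj) hht]
      exact ((hD.comp_sub p₀).invFT_comp_mul (hσ j hj)).enorm_conv_le _ _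
    have hF := hC₁ _ _ (hK m) _ (h2j j).ne' (fj j) (hfm j) x
    have hG := hC₂ _ _ (hK' (Finset.Icc (2 ^ m) (2 ^ (m + 1)))) _ (hσ j hj) g hg x
    simp only [← psi_eq_comp_mul] at hF
    rw [abs_of_pos (h2j j)] at hF
    have hG' : ∑ p₀ ∈ Finset.Icc (2 ^ m : ℕ) (2 ^ (m + 1)),
        ‖conv g (invFT fun η => φ (σ j * η - p₀)) x‖ₑ ^ 2 ≤
        C₂ * ofReal π * c ^ 2 := by
      refine hG.trans ?_
      rw [mul_assoc]
      gcongr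
      exact cauchyAvg_le_of_ae_le (abs_pos.2 (hσ j hj)) (hc.mono fun y hy => by gcongr) x
    have ec : (c ^ 2) ^ (1 / 2 : ℝ) = c := by rw [sq_rpow_half, rpow_one]
    calc _ ≤ ∑ p₀ ∈ Finset.Icc (2 ^ m) (2 ^ (m + 1)),
          ‖conv (fj j) (invFT (psi R φ m p₀ j)) x‖ₑ *
          ‖conv g (invFT fun η => φ (σ j * η - p₀)) x‖ₑ *
          (ofReal D * cauchyAvg |σ j| (fun y => ‖hj' j y‖ₑ) x) :=
          sum_le_sum fun p₀ hp₀ => mul_le_mul_right (hH p₀ hp₀) _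
      _ ≤ ((C₁ * Y j x) ^ (1 / 2 : ℝ) * (C₂ * ofReal π * c ^ 2) ^ (1 / 2 : ℝ)) *
          (ofReal D * cauchyAvg |σ j| (fun y => ‖hj' j y‖ₑ) x) := by
          rw [← sum_mul]
          gcongr
          refine (sum_mul_le_sqrt_mul_sqrt _ _ _).trans ?_
          gcongr
      _ = _ := by
          rw [mul_rpow_of_nonneg _ _ (by norm_num : (0 : ℝ) ≤ 1 / 2),
            mul_rpow_of_nonneg _ (c ^ 2) (by norm_num : (0 : ℝ) ≤ 1 / 2), ec, hB]
          ring
  -- the averages are moved to `f`, where they are harmless since `p / 2 ≥ 1`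
  have hstep : ∫⁻ x, ∑ j ∈ S, cauchyAvg |σ j| (fun y => ‖hj' j y‖ₑ) x * Y j x ^ (1 / 2 : ℝ) ≤
      2 * ∫⁻ x, ∑ j ∈ S, V j x ^ (1 / 2 : ℝ) * ‖hj' j x‖ₑ := by
    have e1 := lintegral_finsetSum' (μ := volume)
      (f := fun j x => cauchyAvg |σ j| (fun y => ‖hj' j y‖ₑ) x * Y j x ^ (1 / 2 : ℝ)) S
      fun j hj => ((measurable_cauchyAvg (hhm j hj).enorm _).mul
        ((hYm j).pow_const _)).aemeasurable
    have e2 := lintegral_finsetSum' (μ := volume)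
      (f := fun j x => V j x ^ (1 / 2 : ℝ) * ‖hj' j x‖ₑ) S
      fun j hj => ((hVm j).pow_const _).aemeasurable.mul (hhm j hj).enorm
    rw [e1, e2, mul_sum]
    refine sum_le_sum fun j hj => ?_
    rw [lintegral_cauchyAvg_mul (hhm j hj).enorm ((hYm j).pow_const _).aemeasurable,
      ← lintegral_const_mul' _ _ (by simp)]
    refine lintegral_mono fun x => ?_
    calc _ ≤ ‖hj' j x‖ₑ * (2 * V j x ^ (1 / 2 : ℝ)) :=
          mul_le_mul_right (cauchyAvg_sqrt_le (abs_pos.2 (hσ j hj)) (hYm j).aemeasurable x) _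
      _ = _ := by ring
  have hf4 : ∫⁻ x, (∑ j ∈ S, ‖fj j x‖ₑ ^ 2) ^ (p / 2) ≤ C₄ * ∫⁻ x, ‖f x‖ₑ ^ p := by
    simp only [hfj, phiScale_eq]
    exact hC₄ S (fun j => (2 : ℝ)⁻¹ ^ (m + j)) (isLacunary_two_pow S m) f hf hfp
  have hY4 : ∫⁻ x, (∑ j ∈ S, Y j x) ^ (p / 2) ≤ C₃ * (C₄ * ∫⁻ x, ‖f x‖ₑ ^ p) :=
    (hC₃ S _ _ (fun j _ => h2j j) (fun j _ => hf2 j)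
      (hf4.trans_lt (mul_lt_top coe_lt_top hfp))).trans (by gcongr)
  have hV4 : ∫⁻ x, (∑ j ∈ S, V j x) ^ (p / 2) ≤ C₃ * (C₃ * (C₄ * ∫⁻ x, ‖f x‖ₑ ^ p)) :=
    (hC₃ S _ _ (fun j hj => (hS j hj).1) (fun j _ => (hYm j).aemeasurable)
      (hY4.trans_lt (mul_lt_top coe_lt_top
        (mul_lt_top coe_lt_top hfp)))).trans (by gcongr)
  have hh5 : ∫⁻ x, (∑ j ∈ S, ‖hj' j x‖ₑ ^ 2) ^ (p' / 2) ≤ C₅ * ∫⁻ x, ‖h x‖ₑ ^ p' := by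
    refine hC₅ S (fun j => ((2 : ℝ) ^ m)⁻¹ * σ j) ?_ h hh hhp
    have e : (fun j => |((2 : ℝ) ^ m)⁻¹ * σ j|) = fun j => ((2 : ℝ) ^ m)⁻¹ * |σ j| := by
      ext j; rw [abs_mul, abs_of_pos (by positivity)]
    rw [e]
    exact hS.const_mul (by positivity)
  calc _ ≤ ∫⁻ x, B * c * ∑ j ∈ S,
        cauchyAvg |σ j| (fun y => ‖hj' j y‖ₑ) x * Y j x ^ (1 / 2 : ℝ) := by
        refine lintegral_mono fun x => ?_
        rw [mul_sum]
        exact sum_le_sum fun j hj => hpt j hj x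
    _ = B * c * ∫⁻ x, ∑ j ∈ S,
        cauchyAvg |σ j| (fun y => ‖hj' j y‖ₑ) x * Y j x ^ (1 / 2 : ℝ) := by
        refine lintegral_const_mul'' _ (aemeasurable_fun_sum _ fun j hj => ?_)
        exact ((measurable_cauchyAvg (hhm j hj).enorm _).mul ((hYm j).pow_const _)).aemeasurable
    _ ≤ B * c * (2 * ∫⁻ x, ∑ j ∈ S, V j x ^ (1 / 2 : ℝ) * ‖hj' j x‖ₑ) := by gcongr
    _ ≤ B * c * (2 * ((C₃ * (C₃ * (C₄ * ∫⁻ x, ‖f x‖ₑ ^ p))) ^ (1 / p) *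
        (C₅ * ∫⁻ x, ‖h x‖ₑ ^ p') ^ (1 / p'))) := by
        gcongr
        refine (lintegral_sum_mul_le S (fun j _ => ((hVm j).pow_const _).aemeasurable)
          (fun j hj => (hhm j hj).enorm) hpp').trans ?_
        simp only [rpow_half_sq]
        gcongr
    _ = _ := by
        have e : (C₃ : ℝ≥0∞) * (C₃ * (C₄ * ∫⁻ x, ‖f x‖ₑ ^ p)) =
            ((C₃ * (C₃ * C₄) : ℝ≥0) : ℝ≥0∞) * ∫⁻ x, ‖f x‖ₑ ^ p := by
          push_cast; ring
        rw [e, mul_rpow_of_nonneg _ _ (by positivity),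
          mul_rpow_of_nonneg _ _ (by positivity), hA]
        ring

/-! ### Decay, translations and commutators -/

/-- A smooth symbol: a smooth compactly supported function on the frequency line. -/
def IsSmoothSymbol (a : ℝ → ℂ) : Prop := ContDiff ℝ (⊤ : ℕ∞) a ∧ HasCompactSupport a

namespace IsSmoothSymbol

variable {a : ℝ → ℂ}

lemma isSymbol (ha : IsSmoothSymbol a) : IsSymbol a :=
  ⟨ha.1.of_le (WithTop.coe_le_coe.2 le_top), ha.2⟩

lemma deriv (ha : IsSmoothSymbol a) : IsSmoothSymbol (deriv a) :=
  ⟨(contDiff_infty_iff_deriv.1 ha.1).2, ha.2.deriv⟩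

/-- The inverse Fourier transform of a smooth symbol decays rapidly. -/
lemma exists_norm_invFT_le_pow (n : ℕ) : ∀ {a : ℝ → ℂ}, IsSmoothSymbol a →
    ∃ D : ℝ, 0 ≤ D ∧ ∀ x, ‖invFT a x‖ ≤ D / (1 + x ^ 2) ^ n := by
  induction n with
  | zero =>
    intro a _
    refine ⟨∫ ξ, ‖a ξ‖, integral_nonneg fun ξ => norm_nonneg (a ξ), fun x => ?_⟩
    rw [pow_zero, div_one]
    exact norm_invFT_le a x
  | succ n ih =>
    intro a ha
    obtain ⟨D, hD0, hD⟩ := ih ha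
    obtain ⟨D', hD'0, hD'⟩ := ih ha.deriv.deriv
    refine ⟨D + D', by positivity, fun x => ?_⟩
    have hd : ∀ {b : ℝ → ℂ}, IsSmoothSymbol b →
        ‖invFT (_root_.deriv b) x‖ = |x| * ‖invFT b x‖ := fun {b} hb => by
      rw [invFT_of_hasDerivAt hb.isSymbol.integrable hb.deriv.isSymbol.integrable
        (fun ξ => (hb.1.differentiable (by simp) ξ).hasDerivAt), norm_mul, norm_neg, norm_mul,
        norm_I, one_mul, norm_real, norm_eq_abs]
    have h2 : ‖invFT (_root_.deriv (_root_.deriv a)) x‖ = x ^ 2 * ‖invFT a x‖ := by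
      rw [hd ha.deriv, hd ha, ← mul_assoc, abs_mul_abs_self, sq]
    have h3 := hD' x
    rw [h2] at h3
    have hpos : 0 < (1 + x ^ 2) ^ n := by positivity
    have h4 := hD x
    rw [le_div_iff₀ hpos] at h3 h4
    rw [le_div_iff₀ (by positivity), pow_succ]
    linarith

/-- The first absolute moment of the kernel of a dilated symbol is proportional to the scale. -/
lemma exists_moment_le (ha : IsSmoothSymbol a) : ∃ C : ℝ≥0, ∀ s : ℝ, s ≠ 0 →
    ∫⁻ v, ofReal |v| * ‖invFT (fun η => a (s * η)) v‖ₑ ≤ C * ofReal |s| := by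
  obtain ⟨D, hD0, hD⟩ := exists_norm_invFT_le_pow 2 ha
  refine ⟨(D * π).toNNReal, fun s hs => ?_⟩
  have hs' : 0 < |s| := abs_pos.2 hs
  have hpt : ∀ v, |v| * ‖invFT (fun η => a (s * η)) v‖ ≤ D * |s| * (|s| / (|s| ^ 2 + (0 - v) ^ 2)) :=
    fun v => by
    rw [invFT_comp_mul a hs, norm_mul, norm_real, norm_of_nonneg (by positivity)]
    set x := v / s with hx
    have hv : |v| = |x| * |s| := by rw [hx, abs_div, div_mul_cancel₀ _ hs'.ne']
    have hv2 : (0 - v) ^ 2 = x ^ 2 * |s| ^ 2 := by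
      rw [zero_sub, neg_sq, ← sq_abs v, hv, mul_pow, sq_abs x]
    have h1 : |x| ≤ 1 + x ^ 2 := by
      rw [← sq_abs x]; nlinarith [sq_nonneg (|x| - 1), abs_nonneg x]
    have h2 := hD x
    calc |v| * (|s|⁻¹ * ‖invFT a x‖) = |x| * ‖invFT a x‖ := by rw [hv]; field_simp
      _ ≤ (1 + x ^ 2) * (D / (1 + x ^ 2) ^ 2) := by gcongr
      _ = D * |s| * (|s| / (|s| ^ 2 + (0 - v) ^ 2)) := by rw [hv2]; field_simp
  calc _ ≤ ∫⁻ v, ofReal (D * |s|) * ofReal (|s| / (|s| ^ 2 + (0 - v) ^ 2)) := by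
        refine lintegral_mono fun v => ?_
        rw [← ofReal_norm, ← ofReal_mul (abs_nonneg _),
          ← ofReal_mul (by positivity)]
        exact ofReal_le_ofReal (hpt v)
    _ = _ := by
        rw [lintegral_const_mul' _ _ ofReal_ne_top, lintegral_cauchyKernel hs',
          ← ofReal_mul (by positivity), ofNNReal_toNNReal,
          ← ofReal_mul (by positivity)]
        congr 1; ring

end IsSmoothSymbol

lemma eLpNorm'_sub_translate_le {A : ℝ → ℂ} (hA : AEStronglyMeasurable A) {q : ℝ}
    (hq : 1 ≤ q) (v : ℝ) :
    eLpNorm' (fun x => A x - A (x - v)) q volume ≤ 2 * eLpNorm' A q volume := by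
  have h1 : AEStronglyMeasurable (fun x => A (x - v)) volume :=
    hA.comp_measurePreserving (measurePreserving_sub_right volume v)
  have h2 : eLpNorm' (fun x => A (x - v)) q volume = eLpNorm' A q volume := by
    rw [eLpNorm'_eq_lintegral_enorm, eLpNorm'_eq_lintegral_enorm,
      lintegral_sub_right_eq_self (fun x => ‖A x‖ₑ ^ q) v]
  have h3 : eLpNorm' (fun x => -A (x - v)) q volume = eLpNorm' (fun x => A (x - v)) q volume := by
    simp only [eLpNorm'_eq_lintegral_enorm, enorm_neg]
  have := eLpNorm'_add_le hA h1.neg hq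
  calc _ = eLpNorm' (A + -fun x => A (x - v)) q volume := by
        congr 1
    _ ≤ _ := this
    _ = _ := by
        rw [two_mul]
        rw [← h2, ← h3]; rfl

lemma eLpNorm'_conv_le {D s : ℝ} {k f : ℝ → ℂ} (hk : IsDecaying D s k)
    (hf : AEStronglyMeasurable f) {q : ℝ} (hq : 1 < q) :
    eLpNorm' (conv f k) q volume ≤
      ofReal D * (16 * (maxConst q : ℝ≥0∞) ^ (1 / q)) * eLpNorm' f q volume := by
  have hq0 : 0 < q := by linarith
  rw [eLpNorm'_eq_lintegral_enorm, eLpNorm'_eq_lintegral_enorm]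
  refine (rpow_le_rpow (hk.lintegral_enorm_conv_rpow_le hf hq)
    (by positivity)).trans_eq ?_
  rw [mul_rpow_of_nonneg _ _ (by positivity), mul_rpow_of_nonneg _ _ (by positivity),
    ← rpow_mul, mul_one_div_cancel hq0.ne', rpow_one]
  ring

/-- Convolution with a kernel at scale `t` gives a function that is Lipschitz under translations
in `L^q`, with constant of order `1 / t`. -/
lemma IsBump.exists_eLpNorm'_sub_translate_le {a : ℝ → ℂ} {D : ℝ} (ha : IsBump D (invFT a))
    {q : ℝ} (hq : 1 < q) : ∃ C : ℝ≥0, ∀ t : ℝ, 0 < t → ∀ f : ℝ → ℂ, AEStronglyMeasurable f →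
      ∫⁻ x, ‖f x‖ₑ ^ q < ∞ → ∀ v : ℝ,
      eLpNorm' (fun x => conv f (invFT fun η => a (t * η)) x -
        conv f (invFT fun η => a (t * η)) (x - v)) q volume ≤
          C * ofReal (t⁻¹) * eLpNorm' f q volume * ofReal |v| := by
  set E : ℝ≥0∞ := 16 * (maxConst q : ℝ≥0∞) ^ (1 / q) with hE
  have hEtop : E ≠ ∞ := mul_ne_top (by simp)
    (rpow_ne_top_of_nonneg (by positivity) coe_ne_top)
  have hD0 := ha.nonneg
  have hdec : IsDecaying D 1 (invFT a) :=
    ⟨one_pos, ha.differentiable.continuous, fun x => by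
      rw [one_pow, mul_one_div]; exact ha.norm_le x⟩
  refine ⟨(3 * D).toNNReal * E.toNNReal, fun t ht f hf hfq v => ?_⟩
  rw [coe_mul, coe_toNNReal hEtop]
  set κ : ℝ → ℂ := invFT fun η => a (t * η) with hκ
  have hκd : IsDecaying D t κ := by
    have := hdec.invFT_comp_mul ht.ne'
    rwa [abs_of_pos ht] at this
  have hft : Tame f := tame_of_lintegral_rpow hf hq.le hfq
  rcases le_total |v| t with hv | hv
  · have hK : IsDecaying (3 * D * (t⁻¹ * |v|)) t fun u => κ u - κ (u - v) := by
      refine ⟨ht, hκd.continuous.sub (hκd.continuous.comp (continuous_sub_right v)), fun u => ?_⟩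
      simp only [hκ]
      rw [invFT_comp_mul a ht.ne', invFT_comp_mul a ht.ne', ← mul_sub, norm_mul, norm_real,
        abs_of_pos ht, norm_of_nonneg (by positivity)]
      have hmv : ‖invFT a (u / t) - invFT a ((u - v) / t)‖ ≤
          3 * D / (1 + (u / t) ^ 2) * |u / t - (u - v) / t| := by
        refine (convex_uIcc ((u - v) / t) (u / t)).norm_image_sub_le_of_norm_deriv_le
          (fun y _ => ha.differentiable y) (fun y hy => ?_) left_mem_uIcc right_mem_uIcc
        refine (ha.norm_deriv_le y).trans ?_
        have h1 : |u / t - y| ≤ 1 := by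
          have h2 := abs_sub_right_of_mem_uIcc hy
          refine h2.trans ?_
          rw [← sub_div, sub_sub_cancel, abs_div, abs_of_pos ht, div_le_one ht]
          exact hv
        rw [div_le_div_iff₀ (by positivity) (by positivity)]
        have h3 := abs_le.1 h1
        have h5 : (u / t) ^ 2 ≤ 2 * y ^ 2 + 2 := by nlinarith [sq_nonneg (u / t - 2 * y)]
        nlinarith
      refine (mul_le_mul_of_nonneg_left hmv (by positivity)).trans_eq ?_
      rw [← sub_div, sub_sub_cancel, abs_div, abs_of_pos ht]
      field_simp
    have e : (fun x => conv f κ x - conv f κ (x - v)) = conv f fun u => κ u - κ (u - v) := by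
      ext x
      rw [conv_apply, conv_apply, conv_apply, ← integral_sub (hκd.integrable hft x)
        (hκd.integrable hft (x - v))]
      refine integral_congr_ae (ae_of_all _ fun y => ?_)
      simp only []
      rw [mul_sub, show x - v - y = x - y - v by ring]
    rw [e]
    refine (eLpNorm'_conv_le hK hf hq).trans_eq ?_
    rw [ofReal_mul (by positivity : 0 ≤ 3 * D),
      ofReal_mul (by positivity : 0 ≤ t⁻¹), ofNNReal_toNNReal, hE]
    ring
  · refine (eLpNorm'_sub_translate_le (aestronglyMeasurable_conv hf hκd.continuous) hq.le v).trans ?_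
    have h1 : 1 ≤ ofReal t⁻¹ * ofReal |v| := by
      rw [← ofReal_mul (by positivity), ← ofReal_one]
      refine ofReal_le_ofReal ?_
      rw [← div_eq_inv_mul, one_le_div ht]
      exact hv
    calc 2 * eLpNorm' (conv f κ) q volume ≤ 2 * (ofReal D * E * eLpNorm' f q volume) := by
          gcongr; exact eLpNorm'_conv_le hκd hf hq
      _ ≤ 3 * (ofReal D * E * eLpNorm' f q volume) *
          (ofReal t⁻¹ * ofReal |v|) := by
          refine le_trans ?_ (le_mul_of_one_le_right zero_le h1)
          gcongr
          norm_num
      _ = _ := by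
          rw [ofNNReal_toNNReal, ofReal_mul (by norm_num : (0 : ℝ) ≤ 3)]
          simp only [ofReal_ofNat]
          ring

lemma lintegral_enorm_mul_rpow_lt_top {A g : ℝ → ℂ} {q : ℝ} (hq : 0 < q) (hAq : ∫⁻ x, ‖A x‖ₑ ^ q < ∞)
    {c : ℝ≥0∞} (hc : c ≠ ∞) (hgc : ∀ᵐ x, ‖g x‖ₑ ≤ c) :
    ∫⁻ x, ‖g x * A x‖ₑ ^ q < ∞ := by
  refine (lintegral_mono_ae (hgc.mono fun x hx => ?_)).trans_lt
    (b := ∫⁻ x, c ^ q * ‖A x‖ₑ ^ q) ?_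
  · rw [enorm_mul, mul_rpow_of_nonneg _ _ hq.le]
    gcongr
  · rw [lintegral_const_mul' _ _ (rpow_ne_top_of_nonneg hq.le hc)]
    exact mul_lt_top (rpow_lt_top_of_nonneg hq.le hc) hAq

/-- The commutator of a convolution operator with multiplication by a function `A` that is
Lipschitz under translations in `L^p`, as a form on `L^∞ × L^{p'}`: it is bounded by the first
moment of the kernel. -/
lemma enorm_commutator_le {p p' : ℝ} (hpp' : p.HolderConjugate p') {A g H k : ℝ → ℂ}
    (hA : AEStronglyMeasurable A) (hAp : ∫⁻ x, ‖A x‖ₑ ^ p < ∞)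
    (hg : AEStronglyMeasurable g) {c : ℝ≥0∞} (hc : c ≠ ∞) (hgc : ∀ᵐ x, ‖g x‖ₑ ≤ c)
    (hH : AEStronglyMeasurable H) (hHp : ∫⁻ x, ‖H x‖ₑ ^ p' < ∞) {D s : ℝ}
    (hk : IsDecaying D s k) {L : ℝ≥0∞} (hL : ∀ v : ℝ,
      eLpNorm' (fun x => A x - A (x - v)) p volume ≤ L * ofReal |v|) {μ₁ : ℝ≥0∞}
    (hμ : ∫⁻ v, ofReal |v| * ‖k v‖ₑ ≤ μ₁) :
    ‖(∫ x, A x * conv g k x * H x) - ∫ x, g x * A x * conv H (fun y => k (-y)) x‖ₑ ≤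
      c * L * μ₁ * eLpNorm' H p' volume := by
  have hgA : AEStronglyMeasurable (fun x => g x * A x) := hg.mul hA
  have hgAp := lintegral_enorm_mul_rpow_lt_top hpp'.pos hAp hc hgc
  have hp1 := hpp'.lt
  have hgt : Tame g := tame_of_le hg hc hgc
  have hgAt : Tame fun x => g x * A x := tame_of_lintegral_rpow hgA hp1.le hgAp
  have hfin : ∫⁻ x, cauchyAvg s (fun y => ‖g y * A y‖ₑ) x * ‖H x‖ₑ < ∞ :=
    lintegral_mul_lt_top hpp' (measurable_cauchyAvg hgA.enorm _).aemeasurable hH.enorm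
      (lintegral_cauchyAvg_rpow_lt_top hgA.enorm hp1 hgAp hk.pos) hHp
  rw [← integral_conv_mul hgA hH hk hfin]
  have hi1 : Integrable fun x => A x * conv g k x * H x := by
    refine ⟨(hA.mul (aestronglyMeasurable_conv hg hk.continuous)).mul hH, ?_⟩
    refine (lintegral_mono fun x => ?_).trans_lt
      (b := ∫⁻ x, ofReal D * (ofReal π * c) * (‖A x‖ₑ * ‖H x‖ₑ)) ?_
    · rw [enorm_mul, enorm_mul]
      have h1 : ‖conv g k x‖ₑ ≤ ofReal D * (ofReal π * c) :=
        (hk.enorm_conv_le g x).trans (by gcongr; exact cauchyAvg_le_of_ae_le hk.pos hgc x)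
      calc _ ≤ ‖A x‖ₑ * (ofReal D * (ofReal π * c)) * ‖H x‖ₑ := by gcongr
        _ = _ := by ring
    · have h2 : ofReal D * (ofReal π * c) ≠ ∞ := by
        finiteness
      rw [lintegral_const_mul' _ _ h2]
      exact mul_lt_top h2.lt_top (lintegral_mul_lt_top hpp' hA.enorm hH.enorm hAp hHp)
  have hi2 : Integrable fun x => conv (fun x => g x * A x) k x * H x := by
    refine ⟨(aestronglyMeasurable_conv hgA hk.continuous).mul hH, ?_⟩
    refine (lintegral_mono fun x => ?_).trans_lt (b := ∫⁻ x, ofReal D *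
      (cauchyAvg s (fun y => ‖g y * A y‖ₑ) x * ‖H x‖ₑ)) ?_
    · rw [enorm_mul, ← mul_assoc]
      gcongr
      exact hk.enorm_conv_le _ x
    · rw [lintegral_const_mul' _ _ ofReal_ne_top]
      exact mul_lt_top ofReal_lt_top hfin
  rw [← integral_sub hi1 hi2]
  have hpt : ∀ x, ‖A x * conv g k x * H x - conv (fun x => g x * A x) k x * H x‖ₑ ≤
      ∫⁻ v, c * (‖A x - A (x - v)‖ₑ * ‖k v‖ₑ * ‖H x‖ₑ) := fun x => by
    have e : A x * conv g k x - conv (fun x => g x * A x) k x =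
        ∫ y, g y * (A x - A y) * k (x - y) := by
      rw [conv_apply, conv_apply, ← integral_const_mul,
        ← integral_sub ((hk.integrable hgt x).const_mul _) (hk.integrable hgAt x)]
      refine integral_congr_ae (ae_of_all _ fun y => ?_)
      simp only []
      ring
    rw [← sub_mul, e, enorm_mul]
    calc _ ≤ (∫⁻ y, ‖g y * (A x - A y) * k (x - y)‖ₑ) * ‖H x‖ₑ := by
          gcongr; exact enorm_integral_le_lintegral_enorm _
      _ ≤ (∫⁻ y, c * (‖A x - A y‖ₑ * ‖k (x - y)‖ₑ)) * ‖H x‖ₑ := by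
          refine mul_le_mul_left (lintegral_mono_ae (hgc.mono fun y hy => ?_)) _
          rw [enorm_mul, enorm_mul, mul_assoc]
          gcongr
      _ = (∫⁻ v, c * (‖A x - A (x - v)‖ₑ * ‖k v‖ₑ)) * ‖H x‖ₑ := by
          congr 1
          rw [← lintegral_sub_left_eq_self (μ := volume)
            (fun v => c * (‖A x - A (x - v)‖ₑ * ‖k v‖ₑ)) x]
          simp only [sub_sub_cancel]
      _ = _ := by
          rw [← lintegral_mul_const' _ _ enorm_ne_top]
          simp only [mul_assoc]
  have hAm : AEStronglyMeasurable (fun z : ℝ × ℝ => A (z.1 - z.2)) (volume.prod volume) :=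
    hA.comp_quasiMeasurePreserving (quasiMeasurePreserving_sub_of_right_invariant volume volume)
  have hjoint : AEMeasurable (Function.uncurry fun x v : ℝ =>
      c * (‖A x - A (x - v)‖ₑ * ‖k v‖ₑ * ‖H x‖ₑ)) (volume.prod volume) :=
    (((hA.comp_fst.sub hAm).enorm.mul
      (hk.continuous.comp continuous_snd).aestronglyMeasurable.enorm).mul
      hH.comp_fst.enorm).const_mul c
  have hsec : ∀ v, AEStronglyMeasurable (fun x => A x - A (x - v)) volume := fun v =>
    hA.sub (hA.comp_measurePreserving (measurePreserving_sub_right volume v))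
  calc _ ≤ ∫⁻ x, ∫⁻ v, c * (‖A x - A (x - v)‖ₑ * ‖k v‖ₑ * ‖H x‖ₑ) :=
        (enorm_integral_le_lintegral_enorm _).trans (lintegral_mono hpt)
    _ = ∫⁻ v, ∫⁻ x, c * (‖A x - A (x - v)‖ₑ * ‖k v‖ₑ * ‖H x‖ₑ) :=
        lintegral_lintegral_swap hjoint
    _ ≤ ∫⁻ v, (c * L * eLpNorm' H p' volume) * (ofReal |v| * ‖k v‖ₑ) := by
        refine lintegral_mono fun v => ?_
        have e : ∀ x, c * (‖A x - A (x - v)‖ₑ * ‖k v‖ₑ * ‖H x‖ₑ) =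
            (c * ‖k v‖ₑ) * (‖A x - A (x - v)‖ₑ * ‖H x‖ₑ) := fun x => by ring
        simp only [e]
        rw [lintegral_const_mul' _ _ (mul_ne_top hc enorm_ne_top)]
        calc _ ≤ c * ‖k v‖ₑ * ((L * ofReal |v|) * eLpNorm' H p' volume) := by
              gcongr
              refine (lintegral_mul_le_Lp_mul_Lq _ hpp' (hsec v).enorm hH.enorm).trans ?_
              have := hL v
              rw [eLpNorm'_eq_lintegral_enorm] at this ⊢
              gcongr
          _ = _ := by ring
    _ = (c * L * eLpNorm' H p' volume) * ∫⁻ v, ofReal |v| * ‖k v‖ₑ := by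
        have h1 : AEMeasurable (fun v : ℝ => ofReal |v|) := by fun_prop
        exact lintegral_const_mul'' _ (h1.mul hk.continuous.aestronglyMeasurable.enorm)
    _ ≤ c * L * eLpNorm' H p' volume * μ₁ := by gcongr
    _ = _ := by ring

/-! ### Frequency bands between consecutive scales -/

/-- A smooth cutoff function that is one on `[-1, 1]` and vanishes outside `(-2, 2)`. -/
noncomputable def lowpass (x : ℝ) : ℂ :=
  ((⟨1, 2, by norm_num, by norm_num⟩ : ContDiffBump (0 : ℝ)) x : ℝ)

lemma isSmoothSymbol_lowpass : IsSmoothSymbol lowpass := by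
  refine ⟨Complex.ofRealCLM.contDiff.comp (ContDiffBump.contDiff _), ?_⟩
  exact (ContDiffBump.hasCompactSupport _).comp_left (g := fun x : ℝ => (x : ℂ)) rfl

lemma lowpass_neg (x : ℝ) : lowpass (-x) = lowpass x := by
  rw [lowpass, ContDiffBump.neg, lowpass]

lemma lowpass_eq_one {x : ℝ} (hx : |x| ≤ 1) : lowpass x = 1 := by
  rw [lowpass, ContDiffBump.one_of_mem_closedBall, Complex.ofReal_one]
  simpa using hx

lemma lowpass_eq_zero {x : ℝ} (hx : 2 ≤ |x|) : lowpass x = 0 := by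
  rw [lowpass, ContDiffBump.zero_of_le_dist, Complex.ofReal_zero]
  simpa using hx

lemma norm_lowpass_le (x : ℝ) : ‖lowpass x‖ ≤ 1 := by
  rw [lowpass, norm_real, norm_of_nonneg (ContDiffBump.nonneg _)]
  exact ContDiffBump.le_one _

/-- A sequence of nonzero scales each of which is at most half the preceding one. -/
def IsScale (σ : ℕ → ℝ) : Prop := ∀ k, σ k ≠ 0 ∧ 2 * |σ (k + 1)| ≤ |σ k|

namespace IsScale

variable {σ : ℕ → ℝ}

lemma pow_mul_le (hσ : IsScale σ) (k n : ℕ) : 2 ^ n * |σ (k + n)| ≤ |σ k| := by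
  induction n with
  | zero => simp
  | succ n ih =>
    refine le_trans ?_ ih
    rw [pow_succ, mul_assoc]
    exact mul_le_mul_of_nonneg_left (hσ (k + n)).2 (by positivity)

lemma le_of_le (hσ : IsScale σ) {k l : ℕ} (h : k ≤ l) : |σ l| ≤ |σ k| := by
  obtain ⟨n, rfl⟩ := Nat.exists_eq_add_of_le h
  refine le_trans ?_ (hσ.pow_mul_le k n)
  exact le_mul_of_one_le_left (abs_nonneg _) (one_le_pow₀ one_le_two)

lemma isLacunary (hσ : IsScale σ) (S : Finset ℕ) : IsLacunary S fun k => |σ k| := by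
  have h1 : ∀ k l, k < l → 2 * |σ l| ≤ |σ k| := fun k l h =>
    (mul_le_mul_of_nonneg_left (hσ.le_of_le h) zero_le_two).trans (hσ k).2
  refine fun k _ => ⟨abs_pos.2 (hσ k).1, fun l _ hkl => ?_⟩
  rcases lt_or_gt_of_ne hkl with h | h
  · exact Or.inr (h1 k l h)
  · exact Or.inl (h1 l k h)

lemma succ (hσ : IsScale σ) : IsScale fun k => σ (k + 1) := fun k => hσ (k + 1)

lemma const_mul (hσ : IsScale σ) {c : ℝ} (hc : c ≠ 0) : IsScale fun k => c * σ k := fun k => by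
  refine ⟨mul_ne_zero hc (hσ k).1, ?_⟩
  simp only [abs_mul]
  have := mul_le_mul_of_nonneg_left (hσ k).2 (abs_nonneg c)
  linarith

end IsScale

/-- The symbol of the frequency band between `1 / (c |σ_k|)` and `2 c / |σ_{k+1}|`. -/
noncomputable def band (σ : ℕ → ℝ) (c : ℝ) (k : ℕ) (ξ : ℝ) : ℂ :=
  lowpass (c⁻¹ * σ (k + 1) * ξ) - lowpass (c * σ k * ξ)

section band

variable {σ : ℕ → ℝ} {c : ℝ}

lemma isSymbol_band (hσ : IsScale σ) (hc : c ≠ 0) (k : ℕ) : IsSymbol (band σ c k) :=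
  (isSmoothSymbol_lowpass.isSymbol.comp_mul (mul_ne_zero (inv_ne_zero hc) (hσ _).1)).sub
    (isSmoothSymbol_lowpass.isSymbol.comp_mul (mul_ne_zero hc (hσ _).1))

lemma invFT_sub {a b : ℝ → ℂ} (ha : Integrable a) (hb : Integrable b) (x : ℝ) :
    invFT (fun ξ => a ξ - b ξ) x = invFT a x - invFT b x := by
  simp only [invFT, sub_mul]
  rw [integral_sub (integrable_mul_exp ha x) (integrable_mul_exp hb x), mul_sub]

lemma invFT_band (hσ : IsScale σ) (hc : c ≠ 0) (k : ℕ) (x : ℝ) : invFT (band σ c k) x =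
    invFT (fun ξ => lowpass (c⁻¹ * σ (k + 1) * ξ)) x - invFT (fun ξ => lowpass (c * σ k * ξ)) x :=
  invFT_sub (isSmoothSymbol_lowpass.isSymbol.comp_mul
    (mul_ne_zero (inv_ne_zero hc) (hσ _).1)).integrable
    (isSmoothSymbol_lowpass.isSymbol.comp_mul (mul_ne_zero hc (hσ _).1)).integrable x

lemma abs_of_band_ne_zero (hσ : IsScale σ) (hc : 1 ≤ c) {k : ℕ} {ξ : ℝ} (h : band σ c k ξ ≠ 0) :
    |σ (k + 1) * ξ| < 2 * c ∧ 1 < c * |σ k * ξ| := by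
  have hc0 : 0 < c := by linarith
  have e1 : |c⁻¹ * σ (k + 1) * ξ| = c⁻¹ * |σ (k + 1) * ξ| := by
    rw [mul_assoc, abs_mul, abs_of_pos (by positivity)]
  have e2 : |c * σ k * ξ| = c * |σ k * ξ| := by rw [mul_assoc, abs_mul, abs_of_pos hc0]
  have hle : c⁻¹ * |σ (k + 1) * ξ| ≤ c * |σ k * ξ| := by
    have h1 : |σ (k + 1) * ξ| ≤ |σ k * ξ| := by
      rw [abs_mul, abs_mul]
      exact mul_le_mul_of_nonneg_right (hσ.le_of_le (Nat.le_succ k)) (abs_nonneg _)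
    exact mul_le_mul ((inv_le_one_of_one_le₀ hc).trans hc) h1 (abs_nonneg _) hc0.le
  constructor
  · by_contra hge
    push Not at hge
    refine h ?_
    have h2 : 2 ≤ c⁻¹ * |σ (k + 1) * ξ| := by
      rw [← div_eq_inv_mul, le_div_iff₀ hc0]; exact hge
    rw [band, lowpass_eq_zero (by rw [e1]; exact h2),
      lowpass_eq_zero (by rw [e2]; exact h2.trans hle), sub_zero]
  · by_contra hge
    push Not at hge
    refine h ?_
    rw [band, lowpass_eq_one (by rw [e1]; exact hle.trans hge),
      lowpass_eq_one (by rw [e2]; exact hge), sub_self]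

lemma card_band_le (hσ : IsScale σ) (hc : 1 ≤ c) (hc2 : c ≤ 2) (S : Finset ℕ) (ξ : ℝ) :
    (S.filter fun k => band σ c k ξ ≠ 0).card ≤ 4 := by
  rcases (S.filter fun k => band σ c k ξ ≠ 0).eq_empty_or_nonempty with h | h
  · rw [h]; simp
  set T := S.filter fun k => band σ c k ξ ≠ 0 with hT
  have hsub : T ⊆ Finset.Icc (T.min' h) (T.min' h + 3) := fun l hl => by
    refine Finset.mem_Icc.2 ⟨T.min'_le l hl, ?_⟩
    by_contra hlt
    push Not at hlt
    obtain ⟨n, rfl⟩ := Nat.exists_eq_add_of_lt hlt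
    have h1 := (abs_of_band_ne_zero hσ hc (Finset.mem_filter.1 (T.min'_mem h)).2).1
    have h2 := (abs_of_band_ne_zero hσ hc (Finset.mem_filter.1 hl).2).2
    set k := T.min' h
    have h3 := hσ.pow_mul_le (k + 1) (n + 3)
    rw [show k + 1 + (n + 3) = k + 3 + n + 1 by ring] at h3
    rw [abs_mul] at h1 h2
    have h4 : (8 : ℝ) ≤ 2 ^ (n + 3) := by
      rw [pow_add]; nlinarith [one_le_pow₀ (one_le_two (α := ℝ)) (n := n)]
    have h5 : 8 * |σ (k + 3 + n + 1)| ≤ |σ (k + 1)| :=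
      (mul_le_mul_of_nonneg_right h4 (abs_nonneg _)).trans h3
    have h6 := mul_le_mul_of_nonneg_right h5 (abs_nonneg ξ)
    nlinarith [abs_nonneg ξ, mul_nonneg (abs_nonneg (σ (k + 3 + n + 1))) (abs_nonneg ξ)]
  refine (Finset.card_le_card hsub).trans ?_
  rw [Nat.card_Icc]; omega

lemma sum_enorm_band_le (hσ : IsScale σ) (hc : 1 ≤ c) (hc2 : c ≤ 2) (S : Finset ℕ) (ξ : ℝ) :
    ∑ k ∈ S, ‖band σ c k ξ‖ₑ ≤ (8 : ℝ≥0) := by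
  have h1 : ∀ k, ‖band σ c k ξ‖ₑ ≤ 2 := fun k => by
    rw [← ofReal_norm, ← ofReal_ofNat]
    exact ofReal_le_ofReal ((norm_sub_le _ _).trans (by
      linarith [norm_lowpass_le (c⁻¹ * σ (k + 1) * ξ), norm_lowpass_le (c * σ k * ξ)]))
  rw [← Finset.sum_filter_of_ne (p := fun k => band σ c k ξ ≠ 0) fun k _ h => by simpa using h]
  refine (sum_le_card_nsmul _ _ 2 fun k _ => h1 k).trans ?_
  rw [nsmul_eq_mul]
  have := card_band_le hσ hc hc2 S ξ
  calc _ ≤ ((4 : ℕ) : ℝ≥0∞) * 2 := by gcongr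
    _ = _ := by norm_num

/-- The square function of the frequency bands is bounded on `L^q`. -/
theorem exists_lintegral_band_squareFn_le {q : ℝ} (hq : 1 < q) : ∃ C : ℝ≥0,
    ∀ σ : ℕ → ℝ, IsScale σ → ∀ c : ℝ, 1 ≤ c → c ≤ 2 → ∀ S : Finset ℕ, ∀ f : ℝ → ℂ,
      AEStronglyMeasurable f → ∫⁻ y, ‖f y‖ₑ ^ q < ∞ →
      ∫⁻ x, (∑ k ∈ S, ‖conv f (invFT (band σ c k)) x‖ₑ ^ 2) ^ (q / 2) ≤
        C * ∫⁻ y, ‖f y‖ₑ ^ q := by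
  obtain ⟨B, hB⟩ := isSmoothSymbol_lowpass.isSymbol.exists_hormander_sum_le
  obtain ⟨C, hC⟩ := exists_lintegral_squareFn_rpow_le hq (max (2 * B) 8)
  refine ⟨C, fun σ hσ c hc hc2 S f hfm hf => ?_⟩
  have hc0 : c ≠ 0 := by linarith
  refine hC S _ ⟨fun k _ => isSymbol_band hσ hc0 k, fun ξ =>
    (sum_enorm_band_le hσ hc hc2 S ξ).trans (by exact_mod_cast le_max_right _ _), fun y => ?_⟩ f hfm hf
  have h1 := hB S (fun k => c⁻¹ * σ (k + 1))
    ((hσ.succ.const_mul (inv_ne_zero hc0)).isLacunary S) y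
  have h2 := hB S (fun k => c * σ k) ((hσ.const_mul hc0).isLacunary S) y
  have hcont : ∀ s : ℝ, s ≠ 0 → Continuous (invFT fun ξ => lowpass (s * ξ)) := fun s hs =>
    continuous_invFT (isSmoothSymbol_lowpass.isSymbol.comp_mul hs).integrable
  calc _ ≤ ∑ k ∈ S, ((∫⁻ x in {x : ℝ | 2 * |y| ≤ |x|},
        ‖invFT (fun ξ => lowpass (c⁻¹ * σ (k + 1) * ξ)) (x - y) -
          invFT (fun ξ => lowpass (c⁻¹ * σ (k + 1) * ξ)) x‖ₑ) +
        ∫⁻ x in {x : ℝ | 2 * |y| ≤ |x|}, ‖invFT (fun ξ => lowpass (c * σ k * ξ)) (x - y) -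
          invFT (fun ξ => lowpass (c * σ k * ξ)) x‖ₑ) := by
        refine sum_le_sum fun k _ => ?_
        have hm := hcont _ (mul_ne_zero (inv_ne_zero hc0) (hσ (k + 1)).1)
        have hm' : Measurable fun x => ‖invFT (fun ξ => lowpass (c⁻¹ * σ (k + 1) * ξ)) (x - y) -
            invFT (fun ξ => lowpass (c⁻¹ * σ (k + 1) * ξ)) x‖ₑ :=
          ((hm.comp (continuous_sub_right y)).sub hm).enorm.measurable
        refine (lintegral_mono fun x => ?_).trans (lintegral_add_left hm' _).le
        rw [invFT_band hσ hc0, invFT_band hσ hc0, sub_sub_sub_comm]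
        exact enorm_sub_le
    _ ≤ B + B := by rw [sum_add_distrib]; exact add_le_add h1 h2
    _ ≤ _ := by
        rw [← two_mul]
        exact_mod_cast le_max_left _ _

end band

/-! ### A Carleson measure estimate for bounded functions -/

lemma lintegral_mul_eq_lintegral_layers {b u : ℝ → ℝ≥0∞} (hb : Measurable b)
    (hu : AEMeasurable u) : ∫⁻ x, b x * u x =
      ∫⁻ l in Ioi (0 : ℝ), ∫⁻ x in {x | ofReal l < b x}, u x := by
  have h := lintegral_rpow_eq_lintegral_meas_lt (μ := volume.withDensity u) hb.aemeasurable one_pos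
  simp_rw [rpow_one, ofReal_one, one_mul, sub_self, Real.rpow_zero, ofReal_one, mul_one,
    withDensity_apply u (measurableSet_lt measurable_const hb)] at h
  rw [← h, lintegral_withDensity_eq_lintegral_mul₀' hu hb.aemeasurable]
  exact lintegral_congr fun x => mul_comm _ _

lemma IsDecaying.enorm_conv_le_min {D s : ℝ} {k f : ℝ → ℂ} (hk : IsDecaying D s k) {B : ℝ≥0∞}
    (hf : ∀ᵐ y, ‖f y‖ₑ ≤ B) {x d : ℝ} (hd : 0 < d) (hfd : ∀ y, |x - y| < d → f y = 0) :
    ‖conv f k x‖ₑ ≤ ofReal (2 * π * D * min 1 (s / d)) * B := by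
  have hs := hk.pos
  have hD := hk.nonneg
  rcases le_total 1 (s / d) with h | h
  · rw [min_eq_left h, mul_one]
    refine (hk.enorm_conv_le f x).trans ?_
    refine (mul_le_mul_right (cauchyAvg_le_of_ae_le hs hf x) _).trans ?_
    rw [← mul_assoc, ← ofReal_mul hD]
    refine mul_le_mul_left (ofReal_le_ofReal ?_) _
    nlinarith [pi_pos, mul_nonneg hD Real.pi_pos.le]
  · rw [min_eq_right h]
    calc ‖conv f k x‖ₑ ≤ ∫⁻ y, ‖f y * k (x - y)‖ₑ := enorm_integral_le_lintegral_enorm _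
      _ ≤ ∫⁻ y, ofReal (2 * D * (s / d)) *
          (ofReal (d / (d ^ 2 + (x - y) ^ 2)) * ‖f y‖ₑ) := by
          refine lintegral_mono fun y => ?_
          rcases lt_or_ge |x - y| d with hy | hy
          · simp [hfd y hy]
          rw [enorm_mul, mul_comm, ← mul_assoc]
          gcongr
          refine (hk.enorm_le (x - y)).trans ?_
          rw [← ofReal_mul hD, ← ofReal_mul (by positivity)]
          refine ofReal_le_ofReal ?_
          rw [show 2 * D * (s / d) * (d / (d ^ 2 + (x - y) ^ 2)) =
            D * (2 * s / (d ^ 2 + (x - y) ^ 2)) by field_simp]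
          refine mul_le_mul_of_nonneg_left ?_ hD
          rw [div_le_div_iff₀ (by positivity) (by positivity)]
          have h1 : d ^ 2 ≤ (x - y) ^ 2 := by
            rw [← sq_abs (x - y)]; exact pow_le_pow_left₀ hd.le hy 2
          nlinarith [mul_pos hs hs, sq_nonneg s]
      _ = ofReal (2 * D * (s / d)) * cauchyAvg d (fun y => ‖f y‖ₑ) x :=
          lintegral_const_mul' _ _ ofReal_ne_top
      _ ≤ ofReal (2 * D * (s / d)) * (ofReal π * B) := by
          gcongr; exact cauchyAvg_le_of_ae_le hd hf x
      _ = _ := by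
          rw [← mul_assoc, ← ofReal_mul (by positivity)]
          congr 2; ring

lemma conv_sub_kernel {f k₁ k₂ : ℝ → ℂ} (hf : Tame f) {D₁ s₁ D₂ s₂ : ℝ}
    (h₁ : IsDecaying D₁ s₁ k₁) (h₂ : IsDecaying D₂ s₂ k₂) (x : ℝ) :
    conv f (fun y => k₁ y - k₂ y) x = conv f k₁ x - conv f k₂ x := by
  rw [conv_apply, conv_apply, conv_apply, ← integral_sub (h₁.integrable hf x) (h₂.integrable hf x)]
  simp only [mul_sub]

lemma exists_isDecaying_band : ∃ D, ∀ σ : ℕ → ℝ, IsScale σ → ∀ c : ℝ, 1 ≤ c → ∀ k,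
    IsDecaying D (|c⁻¹ * σ (k + 1)|) (invFT fun ξ => lowpass (c⁻¹ * σ (k + 1) * ξ)) ∧
    IsDecaying D (|c * σ k|) (invFT fun ξ => lowpass (c * σ k * ξ)) := by
  obtain ⟨D, hD⟩ := isSmoothSymbol_lowpass.isSymbol.exists_isDecaying
  refine ⟨D, fun σ hσ c hc k => ?_⟩
  have hc0 : c ≠ 0 := by linarith
  exact ⟨hD.invFT_comp_mul (mul_ne_zero (inv_ne_zero hc0) (hσ _).1),
    hD.invFT_comp_mul (mul_ne_zero hc0 (hσ _).1)⟩

lemma IsScale.sum_min_le {σ : ℕ → ℝ} (hσ : IsScale σ) (S : Finset ℕ) {d : ℝ} (hd : 0 < d)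
    (hS : ∀ k ∈ S, |σ (k + 1)| ≤ d) : ∑ k ∈ S, min 1 (|σ k| / d) ≤ 3 := by
  rw [← Finset.sum_filter_add_sum_filter_not S fun k => |σ k| ≤ d]
  have h1 : ∑ k ∈ S.filter (fun k => |σ k| ≤ d), min 1 (|σ k| / d) ≤ 2 := by
    calc _ ≤ ∑ k ∈ S.filter (fun k => |σ k| ≤ d), |σ k| / d :=
          sum_le_sum fun k _ => min_le_right _ _
      _ = (∑ k ∈ S.filter (fun k => |σ k| ≤ d), |σ k|) / d := (sum_div _ _ _).symm
      _ ≤ 2 * d / d := by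
          gcongr
          exact (hσ.isLacunary _).sum_le hd.le fun k hk => (Finset.mem_filter.1 hk).2
      _ = 2 := by field_simp
  -- at most one of the scales is larger than `d` while its successor is not
  have h2 : (S.filter fun k => ¬|σ k| ≤ d).card ≤ 1 := by
    rw [Finset.card_le_one]
    intro k hk l hl
    obtain ⟨hkS, hk⟩ := Finset.mem_filter.1 hk
    obtain ⟨hlS, hl⟩ := Finset.mem_filter.1 hl
    by_contra hne
    rcases lt_or_gt_of_ne hne with h | h
    · exact hl ((hσ.le_of_le h).trans (hS k hkS))
    · exact hk ((hσ.le_of_le h).trans (hS l hlS))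
  have h3 : ∑ k ∈ S.filter (fun k => ¬|σ k| ≤ d), min 1 (|σ k| / d) ≤ 1 := by
    refine (sum_le_card_nsmul _ _ 1 fun k _ => min_le_left _ _).trans ?_
    rw [nsmul_eq_mul, mul_one]
    exact_mod_cast h2
  linarith

/-- The band pieces of a bounded function define a Carleson measure: over the part of the band
`k` that stays at distance `|σ_{k+1}|` from the complement of `Ω` they are square summable, with
sum at most a multiple of the measure of `Ω`. The part of `g` in `Ω` is controlled in `L²`, the
part outside by the decay of the kernels. -/
lemma exists_carleson_le : ∃ K : ℝ≥0, ∀ σ : ℕ → ℝ, IsScale σ → ∀ (S : Finset ℕ) (g : ℝ → ℂ),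
    AEStronglyMeasurable g → ∀ B : ℝ≥0∞, B ≠ 0 → B ≠ ∞ → (∀ᵐ x, ‖g x‖ₑ ≤ B) →
    ∀ (Ω : Set ℝ) (E : ℕ → Set ℝ), MeasurableSet Ω → (∀ k, MeasurableSet (E k)) →
    (∀ k ∈ S, ∀ y ∈ E k, Metric.ball y |σ (k + 1)| ⊆ Ω) →
    ∑ k ∈ S, ∫⁻ y in E k, ‖conv g (invFT (band σ 2 k)) y‖ₑ ^ 2 ≤ K * B ^ 2 * volume Ω := by
  obtain ⟨D, hD⟩ := exists_isDecaying_band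
  obtain ⟨L, hL⟩ := exists_lintegral_band_squareFn_le one_lt_two
  set A : ℝ := 2 * π * D * 3 with hA
  refine ⟨2 * L + 1 + (6 * A ^ 2).toNNReal, fun σ hσ S g hg B hB0 hB hgB Ω E hΩ hE hball => ?_⟩
  have hD0 : 0 ≤ D := (hD σ hσ 2 one_le_two 0).1.nonneg
  have hA0 : 0 ≤ A := by have := pi_pos; positivity
  by_cases hfin : volume Ω = ∞
  · rw [hfin, mul_top]
    · exact le_top
    · refine mul_ne_zero ?_ (pow_ne_zero 2 hB0)
      have : (0 : ℝ≥0) < 2 * L + 1 + (6 * A ^ 2).toNNReal := by positivity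
      exact_mod_cast this.ne'
  have hne : (Ωᶜ).Nonempty := by
    by_contra h
    rw [not_nonempty_iff_eq_empty, compl_empty_iff] at h
    rw [h] at hfin
    simp at hfin
  set g₁ := Ω.indicator g with hg₁
  set g₂ := Ωᶜ.indicator g with hg₂
  have hg₁m : AEStronglyMeasurable g₁ := hg.indicator hΩ
  have hg₂m : AEStronglyMeasurable g₂ := hg.indicator hΩ.compl
  have hg₁B : ∀ᵐ x, ‖g₁ x‖ₑ ≤ B := hgB.mono fun x hx => (enorm_indicator_le_enorm_self _ _).trans hx
  have hg₂B : ∀ᵐ x, ‖g₂ x‖ₑ ≤ B := hgB.mono fun x hx => (enorm_indicator_le_enorm_self _ _).trans hx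
  have hm₁ : ∀ k, AEMeasurable (fun y => ‖conv g₁ (invFT (band σ 2 k)) y‖ₑ ^ 2) volume := fun k =>
    ((isSymbol_band hσ two_ne_zero k).aestronglyMeasurable_conv hg₁m).enorm.pow_const 2
  have hm₂ : ∀ k, AEMeasurable (fun y => ‖conv g₂ (invFT (band σ 2 k)) y‖ₑ ^ 2) volume := fun k =>
    ((isSymbol_band hσ two_ne_zero k).aestronglyMeasurable_conv hg₂m).enorm.pow_const 2
  have hin : ∑ k ∈ S, ∫⁻ y in E k, ‖conv g₁ (invFT (band σ 2 k)) y‖ₑ ^ 2 ≤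
      L * B ^ 2 * volume Ω := by
    have hL2 : ∫⁻ x, ‖g₁ x‖ₑ ^ 2 ≤ B ^ 2 * volume Ω := by
      rw [← setLIntegral_const]
      rw [← lintegral_indicator hΩ]
      refine lintegral_mono_ae (hgB.mono fun x hx => ?_)
      by_cases hxΩ : x ∈ Ω
      · simp only [hg₁, indicator_of_mem hxΩ]; gcongr
      · simp [hg₁, indicator_of_notMem hxΩ]
    calc _ ≤ ∑ k ∈ S, ∫⁻ y, ‖conv g₁ (invFT (band σ 2 k)) y‖ₑ ^ 2 :=
          sum_le_sum fun k _ => setLIntegral_le_lintegral _ _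
      _ = ∫⁻ y, ∑ k ∈ S, ‖conv g₁ (invFT (band σ 2 k)) y‖ₑ ^ 2 :=
          (lintegral_finsetSum' _ fun k _ => hm₁ k).symm
      _ ≤ L * ∫⁻ x, ‖g₁ x‖ₑ ^ 2 := by
          simpa using hL σ hσ 2 one_le_two le_rfl S g₁ hg₁m (by
            simpa using hL2.trans_lt (mul_lt_top (ENNReal.pow_lt_top hB.lt_top) (Ne.lt_top hfin)))
      _ ≤ L * (B ^ 2 * volume Ω) := by gcongr
      _ = _ := (mul_assoc _ _ _).symm
  have hout : ∑ k ∈ S, ∫⁻ y in E k, ‖conv g₂ (invFT (band σ 2 k)) y‖ₑ ^ 2 ≤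
      ofReal (3 * A ^ 2) * B ^ 2 * volume Ω := by
    rw [← setLIntegral_const, ← lintegral_indicator hΩ]
    calc _ = ∫⁻ y, ∑ k ∈ S, (E k).indicator
          (fun y => ‖conv g₂ (invFT (band σ 2 k)) y‖ₑ ^ 2) y := by
          rw [lintegral_finsetSum' _ fun k _ => (hm₂ k).indicator (hE k)]
          exact sum_congr rfl fun k _ => (lintegral_indicator (hE k) _).symm
      _ ≤ _ := lintegral_mono fun y => ?_
    classical
    set T := S.filter fun k => y ∈ E k with hT
    have hsum : ∑ k ∈ S, (E k).indicator (fun y => ‖conv g₂ (invFT (band σ 2 k)) y‖ₑ ^ 2) y =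
        ∑ k ∈ T, ‖conv g₂ (invFT (band σ 2 k)) y‖ₑ ^ 2 := by
      rw [hT, Finset.sum_filter]
      exact sum_congr rfl fun k _ => by simp [indicator_apply]
    rw [hsum]
    rcases T.eq_empty_or_nonempty with hTe | ⟨k₀, hk₀⟩
    · rw [hTe]; simp
    have hk₀' := Finset.mem_filter.1 hk₀
    have hyΩ : y ∈ Ω := hball k₀ hk₀'.1 y hk₀'.2
      (Metric.mem_ball_self (abs_pos.2 (hσ _).1))
    rw [indicator_of_mem hyΩ]
    -- `g₂` vanishes at distances less than `d` from `y`, and `y ∈ E k` only if `|σ_{k+1}| ≤ d`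
    set d := Metric.infDist y Ωᶜ with hd
    have hdk : ∀ k ∈ T, |σ (k + 1)| ≤ d := fun k hk => by
      obtain ⟨hkS, hkE⟩ := Finset.mem_filter.1 hk
      rw [hd, Metric.le_infDist hne]
      intro z hz
      by_contra hlt
      push Not at hlt
      exact hz (hball k hkS y hkE (by rwa [Metric.mem_ball, dist_comm]))
    have hd0 : 0 < d := lt_of_lt_of_le (abs_pos.2 (hσ _).1) (hdk k₀ hk₀)
    have hg₂0 : ∀ z, |y - z| < d → g₂ z = 0 := fun z hz => by
      refine indicator_of_notMem (fun hzc => ?_) _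
      exact absurd (Metric.infDist_le_dist_of_mem hzc) (not_le.2 (by rwa [Real.dist_eq]))
    have hpt : ∀ k, ‖conv g₂ (invFT (band σ 2 k)) y‖ₑ ≤
        ofReal (A * min 1 (|σ k| / d)) * B := fun k => by
      obtain ⟨h1, h2⟩ := hD σ hσ 2 one_le_two k
      have e : invFT (band σ 2 k) = fun x => invFT (fun ξ => lowpass (2⁻¹ * σ (k + 1) * ξ)) x -
          invFT (fun ξ => lowpass (2 * σ k * ξ)) x := funext (invFT_band hσ two_ne_zero k)
      rw [e, conv_sub_kernel (tame_of_le hg₂m hB hg₂B) h1 h2]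
      refine enorm_sub_le.trans ((add_le_add (h1.enorm_conv_le_min hg₂B hd0 hg₂0)
        (h2.enorm_conv_le_min hg₂B hd0 hg₂0)).trans ?_)
      rw [← add_mul, ← ofReal_add (by positivity) (by positivity)]
      refine mul_le_mul_left (ofReal_le_ofReal ?_) _
      have h3 : |2⁻¹ * σ (k + 1)| ≤ |σ k| := by
        rw [abs_mul, abs_of_pos (by norm_num : (0 : ℝ) < 2⁻¹)]
        linarith [hσ.le_of_le (Nat.le_succ k), abs_nonneg (σ (k + 1))]
      have h4 : min 1 (|2⁻¹ * σ (k + 1)| / d) ≤ min 1 (|σ k| / d) :=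
        min_le_min_left _ (by gcongr)
      have h5 : min 1 (|2 * σ k| / d) ≤ 2 * min 1 (|σ k| / d) := by
        rw [abs_mul, abs_two, mul_div_assoc]
        rcases min_cases 1 (|σ k| / d) with ⟨e1, _⟩ | ⟨e1, _⟩ <;> rw [e1]
        · exact (min_le_left _ _).trans (by norm_num)
        · exact min_le_right _ _
      have h6 : 0 ≤ 2 * π * D := by positivity
      rw [hA]
      nlinarith [mul_le_mul_of_nonneg_left h4 h6, mul_le_mul_of_nonneg_left h5 h6]
    calc ∑ k ∈ T, ‖conv g₂ (invFT (band σ 2 k)) y‖ₑ ^ 2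
        ≤ ∑ k ∈ T, ofReal (A ^ 2 * min 1 (|σ k| / d)) * B ^ 2 := by
          refine sum_le_sum fun k _ => (pow_le_pow_left' (hpt k) 2).trans ?_
          rw [mul_pow, ← ofReal_pow (by positivity), mul_pow]
          refine mul_le_mul_left (ofReal_le_ofReal
            (mul_le_mul_of_nonneg_left ?_ (sq_nonneg A))) _
          exact pow_le_of_le_one (by positivity) (min_le_left _ _) two_ne_zero
      _ = ofReal (A ^ 2 * ∑ k ∈ T, min 1 (|σ k| / d)) * B ^ 2 := by
          rw [← sum_mul, mul_sum,
            ofReal_sum_of_nonneg fun k _ => by positivity]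
      _ ≤ _ := by
          refine mul_le_mul_left (ofReal_le_ofReal ?_) _
          rw [mul_comm 3]
          exact mul_le_mul_of_nonneg_left (hσ.sum_min_le T hd0 hdk) (sq_nonneg A)
  calc _ ≤ ∑ k ∈ S, ∫⁻ y in E k, (2 * ‖conv g₁ (invFT (band σ 2 k)) y‖ₑ ^ 2 +
        2 * ‖conv g₂ (invFT (band σ 2 k)) y‖ₑ ^ 2) := by
        refine sum_le_sum fun k _ => lintegral_mono fun y => ?_
        obtain ⟨D', hk⟩ := (isSymbol_band hσ two_ne_zero k).exists_isDecaying
        refine le_of_eq_of_le ?_ (enorm_add_sq_le _ _)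
        rw [hg₂, indicator_compl, hk.conv_sub (tame_of_le hg hB hgB) (tame_of_le hg₁m hB hg₁B),
          add_sub_cancel]
    _ = 2 * (∑ k ∈ S, ∫⁻ y in E k, ‖conv g₁ (invFT (band σ 2 k)) y‖ₑ ^ 2) +
        2 * ∑ k ∈ S, ∫⁻ y in E k, ‖conv g₂ (invFT (band σ 2 k)) y‖ₑ ^ 2 := by
        rw [mul_sum, mul_sum, ← sum_add_distrib]
        refine sum_congr rfl fun k _ => ?_
        rw [lintegral_add_left' ((hm₁ k).restrict.const_mul 2), lintegral_const_mul' _ _ (by simp),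
          lintegral_const_mul' _ _ (by simp)]
    _ ≤ 2 * (L * B ^ 2 * volume Ω) + 2 * (ofReal (3 * A ^ 2) * B ^ 2 * volume Ω) := by
        gcongr
    _ = (2 * L + ofReal (6 * A ^ 2)) * B ^ 2 * volume Ω := by
        rw [show 6 * A ^ 2 = 2 * (3 * A ^ 2) by ring, ofReal_mul (by norm_num : (0 : ℝ) ≤ 2)]
        norm_num
        ring
    _ ≤ _ := by
        push_cast [ofNNReal_toNNReal]
        gcongr
        exact le_self_add

/-! ### Carleson embeddings -/

lemma cauchyAvg_le_cauchyAvg {t : ℝ} (ht : 0 < t) (F : ℝ → ℝ≥0∞) (x y : ℝ) :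
    cauchyAvg t F y ≤ ofReal (2 * (1 + ((x - y) / t) ^ 2)) * cauchyAvg t F x := by
  rw [cauchyAvg, cauchyAvg, ← lintegral_const_mul' _ _ ofReal_ne_top]
  refine lintegral_mono fun z => ?_
  rw [← mul_assoc, ← ofReal_mul (by positivity)]
  refine mul_le_mul_left (ofReal_le_ofReal ?_) _
  rw [← mul_div_assoc, div_le_div_iff₀ (by positivity) (by positivity), div_pow]
  have h : t ^ 2 + (x - z) ^ 2 ≤ 2 * (1 + (x - y) ^ 2 / t ^ 2) * (t ^ 2 + (y - z) ^ 2) := by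
    have h1 : 2 * (1 + (x - y) ^ 2 / t ^ 2) * (t ^ 2 + (y - z) ^ 2) = 2 * t ^ 2 + 2 * (x - y) ^ 2 +
        2 * (y - z) ^ 2 + 2 * ((x - y) ^ 2 / t ^ 2) * (y - z) ^ 2 := by field_simp; ring
    have h2 : 0 ≤ 2 * ((x - y) ^ 2 / t ^ 2) * (y - z) ^ 2 := by positivity
    nlinarith [sq_nonneg (x - y - (y - z)), sq_nonneg t]
  nlinarith [mul_le_mul_of_nonneg_left h ht.le]

/-- Averages at scale `t ≥ s` vary slowly: at distance `4s` they are comparable, up to polynomial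
factors in the distance to the reference point. -/
lemma cauchyAvg_le_maxFn_of_dist {s t : ℝ} (hs : 0 < s) (hst : s ≤ t) {F : ℝ → ℝ≥0∞}
    (hF : AEMeasurable F) {x z : ℝ} (hxz : |x - z| < 4 * s) (y : ℝ) :
    cauchyAvg t F y ≤ ofReal (1056 * (1 + ((y - z) / s) ^ 2)) * maxFn F x := by
  have ht := hs.trans_le hst
  refine (cauchyAvg_le_cauchyAvg ht F x y).trans ((mul_le_mul_right
    (cauchyAvg_le_maxFn₀ ht hF x) _).trans ?_)
  rw [← mul_assoc, show (16 : ℝ≥0∞) = ofReal 16 by simp,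
    ← ofReal_mul (by positivity)]
  refine mul_le_mul_left (ofReal_le_ofReal ?_) _
  have h1 : ((x - y) / t) ^ 2 ≤ ((x - y) / s) ^ 2 := by
    rw [div_pow, div_pow]; gcongr
  have h2 : ((x - z) / s) ^ 2 ≤ 16 := by
    have : |(x - z) / s| ≤ 4 := by
      rw [abs_div, abs_of_pos hs, div_le_iff₀ hs]; exact hxz.le
    nlinarith [abs_le.1 this]
  have h3 : (x - y) / s = (x - z) / s - (y - z) / s := by ring
  rw [h3] at h1
  nlinarith [sq_nonneg ((x - z) / s + (y - z) / s), sq_nonneg ((y - z) / s)]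

/-- The Carleson embedding for the band pieces of a bounded function, with a weight. A piece in
the band `k` is reproduced by a kernel at scale `σ_{k+1}`, so that the weight may be smoothed at
that scale; the smoothed weights are dominated by a single function on the balls of radius
`|σ_{k+1}|`, and the Carleson condition is applied to their level sets. -/
lemma exists_lintegral_sum_sq_mul_band_le : ∃ K : ℝ≥0, ∀ σ : ℕ → ℝ, IsScale σ → ∀ (S : Finset ℕ)
    (t : ℕ → ℝ), (∀ k, |σ k| ≤ t k) → ∀ g : ℝ → ℂ, AEStronglyMeasurable g →
    ∀ B : ℝ≥0∞, B ≠ 0 → B ≠ ∞ → (∀ᵐ x, ‖g x‖ₑ ≤ B) → ∀ F w : ℝ → ℝ≥0∞, AEMeasurable F →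
    AEMeasurable w → ∀ u : ℕ → ℝ → ℝ≥0∞, (∀ k, AEMeasurable (u k)) →
    (∀ k ∈ S, ∀ x, u k x ≤ cauchyAvg (t k) F x) →
    ∫⁻ x, (∑ k ∈ S, (u k x * ‖conv g (invFT (band σ 2 k)) x‖ₑ) ^ 2) * w x ≤
      ∫⁻ x, (K * B ^ 2 * maxFn F x ^ 2) * maxFn w x := by
  obtain ⟨K, hK⟩ := exists_carleson_le
  obtain ⟨D, hD0, hD⟩ := isSmoothSymbol_lowpass.exists_norm_invFT_le_pow 3
  set P : ℝ≥0∞ := ofReal D * ofReal π with hP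
  set A : ℝ≥0∞ := ofReal (D * 1056 ^ 2) * (34 * 16) with hA
  refine ⟨(P * (K * A)).toNNReal, fun σ hσ S t hσt g hg B hB0 hB hgB F w hF hw u hu hut => ?_⟩
  have hPA : ((P * (K * A)).toNNReal : ℝ≥0∞) = P * (K * A) := coe_toNNReal (by finiteness)
  rw [hPA]
  set W : ℕ → ℝ → ℂ := fun k => conv g (invFT (band σ 2 k)) with hW
  have hWm : ∀ k, AEStronglyMeasurable (W k) := fun k =>
    (isSymbol_band hσ two_ne_zero k).aestronglyMeasurable_conv hg
  have hgt := tame_of_le hg hB hgB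
  set v : ℕ → ℝ → ℝ≥0∞ := fun k => (((hu k).pow_const 2).mul hw).mk _ with hv
  have hvm : ∀ k, Measurable (v k) := fun k => (((hu k).pow_const 2).mul hw).measurable_mk
  have hve : ∀ k, ∀ᵐ y, v k y = u k y ^ 2 * w y := fun k =>
    (((hu k).pow_const 2).mul hw).ae_eq_mk.symm
  set s : ℕ → ℝ := fun k => |σ (k + 1)| / 4 with hs
  have hs0 : ∀ k, 0 < s k := fun k => div_pos (abs_pos.2 (hσ _).1) four_pos
  set q : ℕ → ℝ → ℝ := fun k y => D / s k / (1 + (y / s k) ^ 2) ^ 3 with hq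
  have hqm : ∀ k, Measurable (q k) := fun k => by fun_prop
  have hq₁ : ∀ k x, Measurable fun z => ofReal (q k (x - z)) := fun k x => by fun_prop
  have hq₂ : ∀ k z, Measurable fun x => ofReal (q k (x - z)) := fun k z => by fun_prop
  have hqC : ∀ k y, q k y * (1 + (y / s k) ^ 2) ^ 2 = D * (s k / (s k ^ 2 + y ^ 2)) := fun k y => by
    have := hs0 k
    simp only [hq]; field_simp
  have hqle : ∀ k y, q k y ≤ D * (s k / (s k ^ 2 + y ^ 2)) := fun k y => by
    have := (hs0 k).le
    rw [← hqC]
    exact le_mul_of_one_le_right (by positivity) (one_le_pow₀ (by nlinarith [sq_nonneg (y / s k)]))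
  set b : ℕ → ℝ → ℝ≥0∞ := fun k z => ∫⁻ y, v k y * ofReal (q k (y - z)) with hb
  have hbm : ∀ k, Measurable (b k) := fun k => by
    have : Measurable fun z : ℝ × ℝ => v k z.2 * ofReal (q k (z.2 - z.1)) :=
      ((hvm k).comp measurable_snd).mul ((hqm k).comp (measurable_snd.sub measurable_fst)).ennreal_ofReal
    exact this.lintegral_prod_right'
  -- the reproducing formula and the Cauchy–Schwarz inequality
  have hrep : ∀ k y, ‖W k y‖ₑ ^ 2 ≤ P * ∫⁻ z, ofReal (q k (y - z)) * ‖W k z‖ₑ ^ 2 := by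
    intro k y
    have hc : (4 : ℝ)⁻¹ * σ (k + 1) ≠ 0 := mul_ne_zero (by norm_num) (hσ _).1
    have hcs : |(4 : ℝ)⁻¹ * σ (k + 1)| = s k := by
      rw [abs_mul, abs_of_pos (by norm_num : (0 : ℝ) < 4⁻¹)]; simp only [hs]; ring
    have e : W k y = conv (W k) (invFT fun ξ => lowpass (4⁻¹ * σ (k + 1) * ξ)) y := by
      simp only [hW]
      rw [conv_conv_invFT hgt (isSymbol_band hσ two_ne_zero k)
        (isSmoothSymbol_lowpass.isSymbol.comp_mul hc)]
      congr 2
      funext ξ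
      by_cases h : band σ 2 k ξ = 0
      · rw [h, zero_mul]
      · rw [lowpass_eq_one, mul_one]
        have := (abs_of_band_ne_zero hσ one_le_two h).1
        rw [mul_assoc, abs_mul, abs_of_pos (by norm_num : (0 : ℝ) < 4⁻¹)]
        linarith
    have hker : ∀ x, ‖invFT (fun ξ => lowpass (4⁻¹ * σ (k + 1) * ξ)) x‖ₑ ≤
        ofReal (q k x) := fun x => by
      rw [← ofReal_norm, invFT_comp_mul _ hc, norm_mul, norm_real, hcs,
        norm_of_nonneg (inv_nonneg.2 (hs0 k).le)]
      refine ofReal_le_ofReal ((mul_le_mul_of_nonneg_left (hD _)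
        (inv_nonneg.2 (hs0 k).le)).trans_eq ?_)
      rw [← sq_abs (x / (4⁻¹ * σ (k + 1))), abs_div, hcs, ← abs_of_pos (hs0 k), ← abs_div, sq_abs,
        abs_of_pos (hs0 k)]
      simp only [hq]; ring
    have h1 : ‖W k y‖ₑ ≤ ∫⁻ z, ofReal (q k (y - z)) * ‖W k z‖ₑ := by
      rw [e, conv_apply]
      refine (enorm_integral_le_lintegral_enorm _).trans (lintegral_mono fun z => ?_)
      rw [enorm_mul, mul_comm]
      exact mul_le_mul_left (hker _) _
    have h2 : ∫⁻ z, ofReal (q k (y - z)) ≤ P := by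
      rw [hP, ← lintegral_cauchyKernel (hs0 k) y, ← lintegral_const_mul' _ _ ofReal_ne_top]
      refine lintegral_mono fun z => ?_
      rw [← ofReal_mul hD0]
      exact ofReal_le_ofReal (hqle k _)
    exact (pow_le_pow_left' h1 2).trans ((lintegral_mul_sq_le
      (hq₁ k y).aemeasurable
      (hWm k).enorm).trans (mul_le_mul_left h2 _))
  have hterm : ∀ k, ∫⁻ x, v k x * ‖W k x‖ₑ ^ 2 ≤ P * ∫⁻ z, b k z * ‖W k z‖ₑ ^ 2 := fun k => by
    calc ∫⁻ x, v k x * ‖W k x‖ₑ ^ 2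
        ≤ ∫⁻ x, P * ∫⁻ z, v k x * (ofReal (q k (x - z)) * ‖W k z‖ₑ ^ 2) :=
          lintegral_mono fun x => by
            have e := lintegral_const_mul'' (v k x) (f := fun z => ofReal (q k (x - z)) *
              ‖W k z‖ₑ ^ 2) ((hq₁ k x).aemeasurable.mul ((hWm k).enorm.pow_const 2))
            rw [e, mul_left_comm]
            exact mul_le_mul_right (hrep k x) _
      _ = P * ∫⁻ z, ∫⁻ x, v k x * (ofReal (q k (x - z)) * ‖W k z‖ₑ ^ 2) := by
          rw [lintegral_const_mul' _ _ (by finiteness), lintegral_lintegral_swap]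
          exact ((hvm k).comp measurable_fst).aemeasurable.mul (((hqm k).comp (measurable_fst.sub
            measurable_snd)).ennreal_ofReal.aemeasurable.mul
            ((hWm k).enorm.pow_const 2).comp_snd)
      _ = _ := by
          congr 1
          refine lintegral_congr fun z => ?_
          simp only [hb, ← mul_assoc]
          exact lintegral_mul_const _ ((hvm k).mul (hq₂ k z))
  set G : ℝ → ℝ≥0∞ := fun x => A * maxFn F x ^ 2 * maxFn w x with hG
  have hGm : Measurable G :=
    (((measurable_maxFn F).pow_const 2).const_mul A).mul (measurable_maxFn w)
  have hbG : ∀ k ∈ S, ∀ x z, |x - z| < 4 * s k → b k z ≤ G x := fun k hk x z hxz => by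
    have hst : s k ≤ t k := by
      have := (hσ.le_of_le (Nat.le_succ k)).trans (hσt k)
      simp only [hs]; linarith [abs_nonneg (σ (k + 1))]
    calc b k z ≤ ∫⁻ y, ofReal (D * 1056 ^ 2) * maxFn F x ^ 2 *
          (ofReal (s k / (s k ^ 2 + (z - y) ^ 2)) * w y) := by
          refine lintegral_mono_ae ((hve k).mono fun y hy => ?_)
          rw [hy]
          have h1 := pow_le_pow_left' ((hut k hk y).trans
            (cauchyAvg_le_maxFn_of_dist (hs0 k) hst hF hxz y)) 2
          rw [mul_pow, ← ofReal_pow (by positivity)] at h1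
          have h2 : (1056 * (1 + ((y - z) / s k) ^ 2)) ^ 2 * q k (y - z) =
              D * 1056 ^ 2 * (s k / (s k ^ 2 + (z - y) ^ 2)) := by
            rw [mul_pow, mul_assoc, mul_comm (_ ^ 2) (q k _), hqC, sub_sq_comm z y]; ring
          calc _ ≤ ofReal ((1056 * (1 + ((y - z) / s k) ^ 2)) ^ 2) * maxFn F x ^ 2 * w y *
                ofReal (q k (y - z)) := by gcongr
            _ = ofReal ((1056 * (1 + ((y - z) / s k) ^ 2)) ^ 2 * q k (y - z)) *
                maxFn F x ^ 2 * w y := by rw [ofReal_mul (by positivity)]; ring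
            _ = _ := by rw [h2, ofReal_mul (by positivity)]; ring
      _ = ofReal (D * 1056 ^ 2) * maxFn F x ^ 2 * cauchyAvg (s k) w z :=
          lintegral_const_mul'' _ (((measurable_cauchyKernel _).comp
            (measurable_const.prodMk measurable_id)).aemeasurable.mul hw)
      _ ≤ ofReal (D * 1056 ^ 2) * maxFn F x ^ 2 * (34 * (16 * maxFn w x)) := by
          refine mul_le_mul_right ((cauchyAvg_le_cauchyAvg (hs0 k) w x z).trans
            (mul_le_mul' ?_ (cauchyAvg_le_maxFn₀ (hs0 k) hw x))) _
          rw [show (34 : ℝ≥0∞) = ofReal 34 by simp]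
          refine ofReal_le_ofReal ?_
          have : |(x - z) / s k| ≤ 4 := by
            rw [abs_div, abs_of_pos (hs0 k), div_le_iff₀ (hs0 k)]; exact hxz.le
          nlinarith [abs_le.1 this]
      _ = _ := by simp only [hG, hA]; ring
  calc _ = ∑ k ∈ S, ∫⁻ x, v k x * ‖W k x‖ₑ ^ 2 := by
        rw [← lintegral_finsetSum' (f := fun k x => v k x * ‖W k x‖ₑ ^ 2) _ fun k _ =>
          (hvm k).aemeasurable.mul ((hWm k).enorm.pow_const 2)]
        refine lintegral_congr_ae ((ae_all_iff.2 hve).mono fun x hx => ?_)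
        simp only [hx, sum_mul, mul_pow]
        exact sum_congr rfl fun k _ => by ring
    _ ≤ ∑ k ∈ S, P * ∫⁻ z, b k z * ‖W k z‖ₑ ^ 2 := sum_le_sum fun k _ => hterm k
    _ = P * ∫⁻ l in Ioi (0 : ℝ), ∑ k ∈ S,
        ∫⁻ x in {x | ofReal l < b k x}, ‖W k x‖ₑ ^ 2 := by
        rw [← mul_sum, lintegral_finsetSum']
        · congr 1
          exact sum_congr rfl fun k _ =>
            lintegral_mul_eq_lintegral_layers (hbm k) ((hWm k).enorm.pow_const 2)
        · refine fun k _ => (Antitone.measurable fun l l' hl => ?_).aemeasurable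
          exact lintegral_mono_set fun x hx => (ofReal_le_ofReal hl).trans_lt hx
    _ ≤ P * ∫⁻ l in Ioi (0 : ℝ), K * B ^ 2 * ∫⁻ x in {x | ofReal l < G x}, 1 := by
        refine mul_le_mul_right (lintegral_mono fun l => ?_) _
        rw [setLIntegral_one]
        refine hK σ hσ S g hg B hB0 hB hgB _ (fun k => {x | ofReal l < b k x})
          (measurableSet_lt measurable_const hGm)
          (fun k => measurableSet_lt measurable_const (hbm k)) fun k hk z hz x hx => ?_
        refine lt_of_lt_of_le hz (hbG k hk x z ?_)
        rw [Metric.mem_ball, Real.dist_eq] at hx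
        simp only [hs]; linarith
    _ = P * (K * B ^ 2 * ∫⁻ x, G x * 1) := by
        rw [lintegral_const_mul' _ _ (by finiteness),
          ← lintegral_mul_eq_lintegral_layers hGm aemeasurable_const]
    _ = ∫⁻ x, P * (K * B ^ 2) * G x := by
        simp only [mul_one]
        rw [lintegral_const_mul' _ _ (by finiteness)]
        exact (mul_assoc _ _ _).symm
    _ = _ := lintegral_congr fun x => by simp only [hG]; ring

/-- The `L^p` form of the Carleson embedding, for `p ≥ 2`. -/
lemma exists_lintegral_sum_sq_band_rpow_le {p : ℝ} (hp : 2 ≤ p) : ∃ K : ℝ≥0, ∀ σ : ℕ → ℝ,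
    IsScale σ → ∀ (S : Finset ℕ) (t : ℕ → ℝ), (∀ k, |σ k| ≤ t k) → ∀ g : ℝ → ℂ,
    AEStronglyMeasurable g → ∀ B : ℝ≥0∞, B ≠ 0 → B ≠ ∞ → (∀ᵐ x, ‖g x‖ₑ ≤ B) →
    ∀ F : ℝ → ℝ≥0∞, AEMeasurable F → ∫⁻ x, F x ^ p < ∞ →
    ∀ u : ℕ → ℝ → ℝ≥0∞, (∀ k, AEMeasurable (u k)) →
    (∀ k ∈ S, ∀ x, u k x ≤ cauchyAvg (t k) F x) →
    (∫⁻ x, (∑ k ∈ S, (u k x * ‖conv g (invFT (band σ 2 k)) x‖ₑ) ^ 2) ^ (p / 2)) ^ (1 / p) ≤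
      K * B * (∫⁻ x, F x ^ p) ^ (1 / p) := by
  have hp0 : 0 < p := by linarith
  obtain ⟨K, hK⟩ := exists_lintegral_sum_sq_mul_band_le
  obtain ⟨C, hC⟩ := exists_lintegral_rpow_le_of_weighted (by linarith : 1 ≤ p / 2)
  set A : ℝ≥0∞ := ((C : ℝ≥0∞) * ((K : ℝ≥0∞) ^ (p / 2) * maxConst p)) ^ (1 / p) with hA
  have hAt : A ≠ ∞ := rpow_ne_top_of_nonneg (by positivity) (by finiteness)
  refine ⟨A.toNNReal, fun σ hσ S t hσt g hg B hB0 hB hgB F hF hFp u hu hut => ?_⟩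
  rw [coe_toNNReal hAt]
  obtain ⟨Dk, hDk⟩ : ∃ Dk : ℕ → ℝ, ∀ k, IsDecaying (Dk k) 1 (invFT (band σ 2 k)) :=
    ⟨_, fun k => (isSymbol_band hσ two_ne_zero k).exists_isDecaying.choose_spec⟩
  have hm : ∀ k, AEMeasurable (fun x => u k x * ‖conv g (invFT (band σ 2 k)) x‖ₑ) volume :=
    fun k => (hu k).mul (aestronglyMeasurable_conv hg (hDk k).continuous).enorm
  have hM := lintegral_maxFn_rpow_le (by linarith : 1 < p) hF
  have ht : ∀ k, 0 < t k := fun k => (abs_pos.2 (hσ k).1).trans_le (hσt k)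
  have hfin : ∫⁻ x, (∑ k ∈ S, (u k x * ‖conv g (invFT (band σ 2 k)) x‖ₑ) ^ 2) ^ (p / 2) < ∞ := by
    refine lintegral_sum_sq_lt_top (fun k _ => hm k) hp0 fun k hk => ?_
    set c : ℝ≥0∞ := 16 * (ofReal (Dk k) * (ofReal π * B)) with hc
    have hct : c ≠ ∞ := by finiteness
    refine (lintegral_mono (g := fun x => c ^ p * maxFn F x ^ p) fun x => ?_).trans_lt ?_
    · beta_reduce
      rw [← mul_rpow_of_nonneg _ _ hp0.le]
      refine rpow_le_rpow ?_ hp0.le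
      calc _ ≤ (16 * maxFn F x) * (ofReal (Dk k) * (ofReal π * B)) :=
            mul_le_mul' ((hut k hk x).trans (cauchyAvg_le_maxFn₀ (ht k) hF x))
              (((hDk k).enorm_conv_le g x).trans
                (mul_le_mul_right (cauchyAvg_le_of_ae_le one_pos hgB x) _))
        _ = _ := by rw [hc]; ring
    · rw [lintegral_const_mul' _ _ (rpow_ne_top_of_nonneg hp0.le hct)]
      exact mul_lt_top (rpow_lt_top_of_nonneg hp0.le hct)
        (hM.trans_lt (mul_lt_top coe_lt_top hFp))
  have h := hC _ (fun x => K * B ^ 2 * maxFn F x ^ 2)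
    (aemeasurable_fun_sum _ fun k _ => (hm k).pow_const 2)
    (((measurable_maxFn F).pow_const 2).const_mul _).aemeasurable hfin fun w hw =>
      hK σ hσ S t hσt g hg B hB0 hB hgB F w hF hw u hu hut
  have e : ∀ x, (K * B ^ 2 * maxFn F x ^ 2) ^ (p / 2) = K ^ (p / 2) * B ^ p * maxFn F x ^ p :=
    fun x => by
    rw [mul_rpow_of_nonneg _ _ (by positivity), mul_rpow_of_nonneg _ _
      (by positivity), sq_rpow_half, sq_rpow_half]
  simp only [e] at h
  rw [lintegral_const_mul' _ _ (mul_ne_top (rpow_ne_top_of_nonneg (by positivity)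
    coe_ne_top) (rpow_ne_top_of_nonneg hp0.le hB))] at h
  have h' : _ ≤ C * ((K : ℝ≥0∞) ^ (p / 2) * maxConst p) * (B ^ p * ∫⁻ x, F x ^ p) :=
    h.trans ((mul_le_mul_right (mul_le_mul_right hM _) _).trans_eq (by ring))
  refine (rpow_le_rpow h' (by positivity)).trans_eq ?_
  rw [mul_rpow_of_nonneg _ _ (by positivity), mul_rpow_of_nonneg (B ^ p) _
    (by positivity), ← rpow_mul, mul_one_div_cancel hp0.ne', rpow_one, ← mul_assoc]

/-! ### Trilinear forms and partial sums of multipliers -/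

/-- The standing assumptions on the three functions of a trilinear form on `L^p × L^∞ × L^{p'}`;
`B` is a bound for the second one. -/
structure IsAdmissible (p p' : ℝ) (B : ℝ≥0∞) (f g h : ℝ → ℂ) : Prop where
  fm : AEStronglyMeasurable f
  fp : ∫⁻ x, ‖f x‖ₑ ^ p < ∞
  gm : AEStronglyMeasurable g
  B_ne_zero : B ≠ 0
  B_ne_top : B ≠ ∞
  gB : ∀ᵐ x, ‖g x‖ₑ ≤ B
  hm : AEStronglyMeasurable h
  hp' : ∫⁻ x, ‖h x‖ₑ ^ p' < ∞

variable {p p' : ℝ} {B : ℝ≥0∞} {f g h : ℝ → ℂ} {a b : ℝ → ℂ}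

lemma IsAdmissible.congr (hF : IsAdmissible p p' B f g h) {u v : ℝ → ℂ}
    (hu : AEStronglyMeasurable u ∧ ∫⁻ x, ‖u x‖ₑ ^ p < ∞)
    (hv : AEStronglyMeasurable v ∧ ∫⁻ x, ‖v x‖ₑ ^ p' < ∞) : IsAdmissible p p' B u g v :=
  ⟨hu.1, hu.2, hF.gm, hF.B_ne_zero, hF.B_ne_top, hF.gB, hv.1, hv.2⟩

lemma exists_rpow_one_div_le {q : ℝ} (hq : 0 < q) (C : ℝ≥0) : ∃ C' : ℝ≥0, ∀ X Y : ℝ≥0∞,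
    X ≤ C * Y → X ^ (1 / q) ≤ C' * Y ^ (1 / q) := by
  have h0 : 0 ≤ 1 / q := by positivity
  refine ⟨C ^ (1 / q), fun X Y h => ?_⟩
  rw [ENNReal.coe_rpow_of_nonneg _ h0, ← mul_rpow_of_nonneg _ _ h0]
  exact rpow_le_rpow h h0

lemma IsSymbol.exists_eLpNorm'_conv_le (ha : IsSymbol a) {q : ℝ} (hq : 1 < q) : ∃ C : ℝ≥0,
    ∀ s : ℝ, s ≠ 0 → ∀ f : ℝ → ℂ, AEStronglyMeasurable f →
      eLpNorm' (conv f (invFT fun η => a (s * η))) q volume ≤ C * eLpNorm' f q volume := by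
  obtain ⟨D, hD⟩ := ha.exists_isDecaying
  have hE : ofReal D * (16 * (maxConst q : ℝ≥0∞) ^ (1 / q)) ≠ ∞ :=
    mul_ne_top (by finiteness) (mul_ne_top (by finiteness)
      (rpow_ne_top_of_nonneg (by positivity) coe_ne_top))
  exact ⟨_, fun s hs f hf => (eLpNorm'_conv_le (hD.invFT_comp_mul hs) hf hq).trans_eq
    (by rw [coe_toNNReal hE])⟩

lemma integrable_mul_mul (hpp' : p.HolderConjugate p') (hF : IsAdmissible p p' B f g h) :
    Integrable (fun x => g x * f x * h x) := by
  refine ⟨(hF.gm.mul hF.fm).mul hF.hm, ?_⟩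
  refine (lintegral_mono fun x => (enorm_mul _ _).le).trans_lt ?_
  exact lintegral_mul_lt_top hpp' (hF.gm.mul hF.fm).enorm hF.hm.enorm
    (lintegral_enorm_mul_rpow_lt_top hpp'.pos hF.fp hF.B_ne_top hF.gB) hF.hp'

/-- Hölder's inequality for a sum of trilinear integrals, through square functions. -/
lemma sum_enorm_integral_le (hpp' : p.HolderConjugate p') (hgB : ∀ᵐ x, ‖g x‖ₑ ≤ B)
    (hB : B ≠ ∞) (S : Finset ℕ) {u v : ℕ → ℝ → ℂ}
    (hu : ∀ k, AEStronglyMeasurable (u k)) (hv : ∀ k, AEStronglyMeasurable (v k)) :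
    ∑ k ∈ S, ‖∫ x, g x * u k x * v k x‖ₑ ≤ B * ((∫⁻ x, (∑ k ∈ S, ‖u k x‖ₑ ^ 2) ^ (p / 2)) ^ (1 / p) *
      (∫⁻ x, (∑ k ∈ S, ‖v k x‖ₑ ^ 2) ^ (p' / 2)) ^ (1 / p')) := by
  refine le_trans ?_ (mul_le_mul_right (lintegral_sum_mul_le S (fun k _ => (hu k).enorm)
    (fun k _ => (hv k).enorm) hpp') _)
  rw [lintegral_finsetSum' (f := fun k x => ‖u k x‖ₑ * ‖v k x‖ₑ) _
    fun k _ => (hu k).enorm.mul (hv k).enorm, mul_sum]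
  refine sum_le_sum fun k _ => (enorm_integral_le_lintegral_enorm _).trans ?_
  rw [← lintegral_const_mul' _ _ hB]
  refine lintegral_mono_ae (hgB.mono fun x hx => ?_)
  rw [enorm_mul, enorm_mul, mul_assoc]
  exact mul_le_mul_left hx _

/-- The error made in moving a convolution at scale `s` from one bounded factor to another, past a
function that lives at a scale `t`, is `O(s/t)`. -/
lemma IsSymbol.exists_commutator_le (ha : IsSymbol a) (hb : IsSmoothSymbol b)
    (hpp' : p.HolderConjugate p') : ∃ C : ℝ≥0, ∀ t s : ℝ, 0 < t → s ≠ 0 → ∀ (B : ℝ≥0∞)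
    (f g h : ℝ → ℂ), IsAdmissible p p' B f g h →
    ‖(∫ x, conv f (invFT fun η => a (t * η)) x * conv g (invFT fun η => b (s * η)) x * h x) -
      ∫ x, g x * conv f (invFT fun η => a (t * η)) x *
        conv h (fun y => invFT (fun η => b (s * η)) (-y)) x‖ₑ ≤
      C * ofReal (|s| / t) * (B * eLpNorm' f p volume * eLpNorm' h p' volume) := by
  obtain ⟨D₁, h₁⟩ := ha.exists_isBump
  obtain ⟨D₂, h₂⟩ := ha.exists_isDecaying
  obtain ⟨D₃, h₃⟩ := hb.isSymbol.exists_isDecaying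
  obtain ⟨C₁, hC₁⟩ := h₁.exists_eLpNorm'_sub_translate_le hpp'.lt
  obtain ⟨C₂, hC₂⟩ := hb.exists_moment_le
  refine ⟨C₁ * C₂, fun t s ht hs B f g h hF => ?_⟩
  have hk := h₂.invFT_comp_mul ht.ne'
  refine (enorm_commutator_le hpp' (CurvedBHT.aestronglyMeasurable_conv hF.fm hk.continuous)
    (hk.lintegral_conv_lt_top hF.fm hpp'.lt hF.fp) hF.gm hF.B_ne_top hF.gB hF.hm hF.hp'
    (h₃.invFT_comp_mul hs) (hC₁ t ht f hF.fm hF.fp) (hC₂ s hs)).trans_eq ?_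
  rw [div_eq_mul_inv, ofReal_mul (abs_nonneg s), coe_mul]
  ring

/-- The partial sums of the multiplier `∑ ε_j a(t_j ξ)`, `t_j = 2^{-j} τ`. -/
noncomputable def partialSymbol (a : ℝ → ℂ) (τ : ℝ) (ε : ℕ → ℂ) (n : ℕ) (ξ : ℝ) : ℂ :=
  ∑ j ∈ Finset.range n, ε j * a (τ * 2⁻¹ ^ j * ξ)

lemma isSymbol_partialSymbol (ha : IsSymbol a) {τ : ℝ} (hτ : 0 < τ) (ε : ℕ → ℂ) (n : ℕ) :
    IsSymbol (partialSymbol a τ ε n) :=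
  IsSymbol.sum _ fun j _ => (ha.comp_mul (by positivity)).const_mul _

lemma conv_partialSymbol (ha : IsSymbol a) {τ : ℝ} (hτ : 0 < τ) (ε : ℕ → ℂ) (n : ℕ)
    (hf : Tame f) (x : ℝ) : conv f (invFT (partialSymbol a τ ε n)) x =
      ∑ j ∈ Finset.range n, ε j * conv f (invFT fun ξ => a (τ * 2⁻¹ ^ j * ξ)) x := by
  obtain ⟨D, hD⟩ := ha.exists_isDecaying
  have hs : ∀ j, IsSymbol fun ξ => a (τ * 2⁻¹ ^ j * ξ) := fun j => ha.comp_mul (by positivity)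
  have e : invFT (partialSymbol a τ ε n) = fun y =>
      ∑ j ∈ Finset.range n, ε j * invFT (fun ξ => a (τ * 2⁻¹ ^ j * ξ)) y := funext fun y => by
    simp only [← invFT_const_mul]
    exact invFT_sum _ (fun j _ => ((hs j).const_mul _).integrable) y
  rw [e, conv_apply]
  simp only [conv_apply, mul_sum, ← integral_const_mul]
  rw [integral_finsetSum _ fun j _ => ?_]
  · exact sum_congr rfl fun j _ => integral_congr_ae (ae_of_all _ fun y => by ring)
  · refine (((hD.invFT_comp_mul (s := τ * 2⁻¹ ^ j) (by positivity)).integrable hf x).const_mul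
      (ε j)).congr (ae_of_all _ fun y => by ring)

/-- The low-pass multiplier at the scale of the term `k` reproduces the partial sum up to `k`. -/
lemma partialSymbol_mul_lowpass {ρ : ℝ} (hρ : 0 < ρ) (haρ : ∀ x, a x ≠ 0 → |x| ≤ ρ) {τ : ℝ}
    (hτ : 0 < τ) (ε : ℕ → ℂ) (k : ℕ) (ξ : ℝ) :
    partialSymbol a τ ε (k + 1) ξ * lowpass (ρ⁻¹ * (τ * 2⁻¹ ^ k * ξ)) =
      partialSymbol a τ ε (k + 1) ξ := by
  rw [partialSymbol, sum_mul]
  refine sum_congr rfl fun j hj => ?_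
  by_cases h : a (τ * 2⁻¹ ^ j * ξ) = 0
  · rw [h]; ring
  rw [lowpass_eq_one, mul_one]
  have h1 : |τ * 2⁻¹ ^ k * ξ| ≤ |τ * 2⁻¹ ^ j * ξ| := by
    rw [abs_mul _ ξ, abs_mul _ ξ, abs_of_pos (by positivity : 0 < τ * 2⁻¹ ^ k),
      abs_of_pos (by positivity : 0 < τ * 2⁻¹ ^ j)]
    refine mul_le_mul_of_nonneg_right (mul_le_mul_of_nonneg_left (pow_le_pow_of_le_one
      (by norm_num) (by norm_num) ?_) hτ.le) (abs_nonneg ξ)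
    have := Finset.mem_range.1 hj; omega
  rw [abs_mul, abs_of_pos (inv_pos.2 hρ), inv_mul_le_iff₀ hρ, mul_one]
  exact h1.trans (haρ _ h)

/-- All partial sums are controlled by averages of a single function: the partial sum up to `k` is
a low-pass piece of a longer sum, up to a bounded number of terms at scales comparable to that of
the term `k`. -/
lemma exists_enorm_conv_partialSymbol_le (ha : IsSymbol a) {r ρ : ℝ} (hr : 0 < r) (hρ : 0 < ρ)
    (har : ∀ x, a x ≠ 0 → r ≤ |x|) (haρ : ∀ x, a x ≠ 0 → |x| ≤ ρ) : ∃ (K : ℝ≥0) (L : ℕ),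
    ∀ τ : ℝ, 0 < τ → ∀ ε : ℕ → ℂ, (∀ j, ‖ε j‖ ≤ 1) → ∀ f, Tame f → ∀ k n : ℕ, k < n → ∀ x,
      ‖conv f (invFT (partialSymbol a τ ε (k + 1))) x‖ₑ ≤ cauchyAvg (τ * 2⁻¹ ^ k)
        (fun y => K * ‖conv f (invFT (partialSymbol a τ ε (n + L))) y‖ₑ + K * ‖f y‖ₑ) x := by
  obtain ⟨L, hL⟩ := pow_unbounded_of_one_lt (2 * ρ / r) one_lt_two
  set χ : ℝ → ℂ := fun x => lowpass (ρ⁻¹ * x) with hχ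
  have hχs : IsSymbol χ := isSmoothSymbol_lowpass.isSymbol.comp_mul (inv_ne_zero hρ.ne')
  set c : ℕ → ℝ → ℂ := fun l x => a (2⁻¹ ^ (l + 1) * x) * χ x with hc
  have hcs : ∀ l, IsSymbol (c l) := fun l => (ha.comp_mul (by positivity)).mul hχs
  obtain ⟨D, hD⟩ := hχs.exists_isDecaying
  obtain ⟨Dl, hDl⟩ : ∃ Dl : ℕ → ℝ, ∀ l, IsDecaying (Dl l) 1 (invFT (c l)) :=
    ⟨_, fun l => (hcs l).exists_isDecaying.choose_spec⟩
  set K : ℝ≥0 := D.toNNReal + ∑ l ∈ Finset.range L, (Dl l).toNNReal with hK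
  refine ⟨K, L, fun τ hτ ε hε f hf k n hkn x => ?_⟩
  set t := τ * 2⁻¹ ^ k with ht
  have ht0 : 0 < t := by positivity
  have htl : ∀ l ξ, τ * 2⁻¹ ^ (k + 1 + l) * ξ = 2⁻¹ ^ (l + 1) * (t * ξ) := fun l ξ => by
    rw [ht]; ring
  obtain ⟨d, hd⟩ : ∃ d, n + L = k + 1 + L + d := ⟨n - (k + 1), by omega⟩
  -- only the terms up to `k + L` meet the support of the low-pass multiplier
  have hsym : (fun ξ => partialSymbol a τ ε (n + L) ξ * χ (t * ξ)) = fun ξ =>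
      partialSymbol a τ ε (k + 1) ξ + ∑ l ∈ Finset.range L, ε (k + 1 + l) * c l (t * ξ) := by
    funext ξ
    have h1 : partialSymbol a τ ε (n + L) ξ = partialSymbol a τ ε (k + 1) ξ +
        (∑ l ∈ Finset.range L, ε (k + 1 + l) * a (τ * 2⁻¹ ^ (k + 1 + l) * ξ)) +
        ∑ l ∈ Finset.range d, ε (k + 1 + L + l) * a (τ * 2⁻¹ ^ (k + 1 + L + l) * ξ) := by
      rw [hd]; simp only [partialSymbol]; rw [sum_range_add, sum_range_add]
    have h2 : (∑ l ∈ Finset.range d, ε (k + 1 + L + l) * a (τ * 2⁻¹ ^ (k + 1 + L + l) * ξ)) *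
        χ (t * ξ) = 0 := by
      rw [sum_mul]
      refine Finset.sum_eq_zero fun l _ => ?_
      by_cases h : a (τ * 2⁻¹ ^ (k + 1 + L + l) * ξ) = 0
      · rw [h]; ring
      have h3 := har _ h
      rw [add_assoc, htl, abs_mul, abs_of_pos (by positivity)] at h3
      have h4 : (2 : ℝ)⁻¹ ^ (L + l + 1) ≤ 2⁻¹ ^ L :=
        pow_le_pow_of_le_one (by norm_num) (by norm_num) (by omega)
      have h5 : r ≤ 2⁻¹ ^ L * |t * ξ| := h3.trans (mul_le_mul_of_nonneg_right h4 (abs_nonneg _))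
      rw [inv_pow, ← div_eq_inv_mul, le_div_iff₀ (by positivity)] at h5
      rw [div_lt_iff₀ hr] at hL
      rw [hχ]
      beta_reduce
      rw [lowpass_eq_zero, mul_zero]
      rw [abs_mul, abs_of_pos (inv_pos.2 hρ), ← div_eq_inv_mul, le_div_iff₀ hρ]
      nlinarith
    rw [h1, add_mul, add_mul, h2, add_zero, hχ]
    beta_reduce
    rw [partialSymbol_mul_lowpass hρ haρ hτ, sum_mul]
    congr 1
    exact sum_congr rfl fun l _ => by rw [htl, hc, mul_assoc]
  have hmain : conv f (invFT (partialSymbol a τ ε (k + 1))) x =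
      conv (conv f (invFT (partialSymbol a τ ε (n + L)))) (invFT fun ξ => χ (t * ξ)) x -
      ∑ l ∈ Finset.range L, ε (k + 1 + l) * conv f (invFT fun ξ => c l (t * ξ)) x := by
    have hI : ∀ l ∈ Finset.range L, IsSymbol fun ξ => ε (k + 1 + l) * c l (t * ξ) :=
      fun l _ => ((hcs l).comp_mul ht0.ne').const_mul _
    rw [conv_conv_invFT hf (isSymbol_partialSymbol ha hτ ε _) (hχs.comp_mul ht0.ne'), hsym,
      eq_sub_iff_add_eq]
    obtain ⟨D', hD'⟩ := (isSymbol_partialSymbol ha hτ ε (k + 1)).exists_isDecaying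
    have e : invFT (fun ξ => partialSymbol a τ ε (k + 1) ξ +
        ∑ l ∈ Finset.range L, ε (k + 1 + l) * c l (t * ξ)) = fun y =>
        invFT (partialSymbol a τ ε (k + 1)) y +
          ∑ l ∈ Finset.range L, ε (k + 1 + l) * invFT (fun ξ => c l (t * ξ)) y := funext fun y => by
      simp only [← invFT_const_mul]
      rw [← invFT_sum _ fun l hl => (hI l hl).integrable]
      have := invFT_sub (isSymbol_partialSymbol ha hτ ε (k + 1)).integrable
        ((IsSymbol.sum _ hI).const_mul (-1)).integrable y
      rw [invFT_const_mul] at this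
      simpa using this
    have hint : ∀ l, Integrable fun y => ε (k + 1 + l) *
        (f y * invFT (fun ξ => c l (t * ξ)) (x - y)) := fun l =>
      (((hDl l).invFT_comp_mul ht0.ne').integrable hf x).const_mul _
    simp only [conv_apply, e, mul_add, mul_sum]
    simp only [← integral_const_mul, mul_left_comm (f _)]
    rw [integral_add (hD'.integrable hf x) (integrable_finsetSum _ fun l _ => hint l),
      integral_finsetSum _ fun l _ => hint l]
  have hsplit : cauchyAvg t (fun y => K * ‖conv f (invFT (partialSymbol a τ ε (n + L))) y‖ₑ +
      K * ‖f y‖ₑ) x = K * cauchyAvg t (fun y =>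
        ‖conv f (invFT (partialSymbol a τ ε (n + L))) y‖ₑ) x + K * cauchyAvg t (‖f ·‖ₑ) x := by
    obtain ⟨D', hD'⟩ := (isSymbol_partialSymbol ha hτ ε (n + L)).exists_isDecaying
    simp only [cauchyAvg]
    rw [← lintegral_const_mul' _ _ coe_ne_top, ← lintegral_const_mul' _ _
      coe_ne_top, ← lintegral_add_left']
    · exact lintegral_congr fun y => by ring
    · exact (((measurable_cauchyKernel t).comp (measurable_const.prodMk
        measurable_id)).aemeasurable.mul
          (aestronglyMeasurable_conv hf.1 hD'.continuous).enorm).const_mul _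
  rw [hmain, hsplit]
  have hDK : ofReal D ≤ K := ENNReal.coe_le_coe.2 le_self_add
  have hDlK : ∑ l ∈ Finset.range L, ofReal (Dl l) ≤ K := by
    rw [hK, coe_add, ENNReal.ofNNReal_finsetSum]
    exact le_add_self
  refine enorm_sub_le.trans (add_le_add ?_ ?_)
  · have := (hD.invFT_comp_mul ht0.ne').enorm_conv_le
      (conv f (invFT (partialSymbol a τ ε (n + L)))) x
    rw [abs_of_pos ht0] at this
    exact this.trans (mul_le_mul_left hDK _)
  · refine (enorm_sum_le _ _).trans (le_trans (sum_le_sum fun l _ => ?_)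
      ((sum_mul _ _ _).symm.le.trans (mul_le_mul_left hDlK _)))
    rw [enorm_mul]
    have h1 := ((hDl l).invFT_comp_mul ht0.ne').enorm_conv_le f x
    rw [abs_of_pos ht0] at h1
    have h2 : ‖ε (k + 1 + l)‖ₑ ≤ 1 := by
      rw [← ofReal_norm]; exact ENNReal.ofReal_le_one.2 (hε _)
    exact (mul_le_mul' h2 h1).trans_eq (one_mul _)

/-! ### A paraproduct estimate -/

variable {p p' : ℝ} {B : ℝ≥0∞} {f g h : ℝ → ℂ} {a b : ℝ → ℂ}

lemma enorm_integral_le_eLpNorm' (hpp' : p.HolderConjugate p') (hF : IsAdmissible p p' B f g h) :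
    ‖∫ x, g x * f x * h x‖ₑ ≤ B * eLpNorm' f p volume * eLpNorm' h p' volume := by
  have := sum_enorm_integral_le hpp' hF.gB hF.B_ne_top {0} (u := fun _ => f) (v := fun _ => h)
    (fun _ => hF.fm) fun _ => hF.hm
  simp only [Finset.sum_singleton, sq_rpow_half] at this
  rwa [← mul_assoc] at this

lemma sum_mul_eq_mul_sub_sum (x u : ℕ → ℂ) (n : ℕ) : ∑ k ∈ Finset.range n, x k * u k =
    (∑ k ∈ Finset.range n, x k) * u n -
      ∑ l ∈ Finset.range n, (∑ k ∈ Finset.range (l + 1), x k) * (u (l + 1) - u l) := by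
  induction n with
  | zero => simp
  | succ n ih => rw [Finset.sum_range_succ, ih, Finset.sum_range_succ (fun l => _ * _),
      Finset.sum_range_succ x]; ring

lemma isScale_pow {τ : ℝ} (hτ : 0 < τ) : IsScale fun k => τ * 2⁻¹ ^ k := fun k => by
  refine ⟨by positivity, le_of_eq ?_⟩
  rw [abs_of_pos (by positivity), abs_of_pos (by positivity)]
  ring

lemma exists_eLpNorm'_partialSymbol_le (ha : IsSymbol a) (ha0 : a 0 = 0) {q : ℝ} (hq : 1 < q) :
    ∃ C : ℝ≥0, ∀ τ : ℝ, 0 < τ → ∀ ε : ℕ → ℂ, (∀ j, ‖ε j‖ ≤ 1) → ∀ f : ℝ → ℂ,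
      AEStronglyMeasurable f → ∫⁻ x, ‖f x‖ₑ ^ q < ∞ → ∀ n,
      eLpNorm' (conv f (invFT (partialSymbol a τ ε n))) q volume ≤ C * eLpNorm' f q volume := by
  obtain ⟨C, hC⟩ := ha.exists_lintegral_conv_sum_rpow_le ha0 hq
  obtain ⟨C', hC'⟩ := exists_rpow_one_div_le (by linarith : 0 < q) C
  exact ⟨C', fun τ hτ ε hε f hf hfq n => hC' _ _
    (hC (Finset.range n) _ ε ((isScale_pow hτ).isLacunary _) hε f hf hfq)⟩

lemma exists_moment_band_le : ∃ C : ℝ≥0, ∀ σ : ℕ → ℝ, IsScale σ → ∀ k,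
    ∫⁻ v, ofReal |v| * ‖invFT (band σ 2 k) v‖ₑ ≤ C * ofReal |σ k| := by
  obtain ⟨C, hC⟩ := isSmoothSymbol_lowpass.exists_moment_le
  refine ⟨C * 3, fun σ hσ k => ?_⟩
  have h0 : (2 : ℝ)⁻¹ * σ (k + 1) ≠ 0 := mul_ne_zero (by norm_num) (hσ _).1
  have h1 : 2 * σ k ≠ 0 := mul_ne_zero two_ne_zero (hσ k).1
  have hc : Continuous (invFT fun ξ => lowpass (2⁻¹ * σ (k + 1) * ξ)) :=
    continuous_invFT (isSmoothSymbol_lowpass.isSymbol.comp_mul h0).integrable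
  calc _ ≤ ∫⁻ v, (ofReal |v| * ‖invFT (fun ξ => lowpass (2⁻¹ * σ (k + 1) * ξ)) v‖ₑ +
        ofReal |v| * ‖invFT (fun ξ => lowpass (2 * σ k * ξ)) v‖ₑ) :=
        lintegral_mono fun v => by
          rw [invFT_band hσ two_ne_zero, ← mul_add]
          exact mul_le_mul_right enorm_sub_le _
    _ ≤ C * ofReal |σ k| + C * ofReal (2 * |σ k|) := by
        refine (lintegral_add_left (by have := hc.measurable; fun_prop) _).trans_le ?_
        refine add_le_add ((hC _ h0).trans (mul_le_mul_right (ofReal_le_ofReal ?_) _))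
          ((hC _ h1).trans_eq (by rw [abs_mul, abs_two]))
        rw [abs_mul, abs_of_pos (by norm_num : (0 : ℝ) < 2⁻¹)]
        linarith [hσ.le_of_le (Nat.le_succ k), abs_nonneg (σ (k + 1))]
    _ = _ := by
        rw [ofReal_mul zero_le_two, coe_mul]; simp; ring

/-- The commutator estimate behind the replacement of `g` by its band pieces: the function `A`
lives at the scale `t`, and the band `k` at scales at most `|σ_k|`. -/
lemma exists_band_commutator_le (ha : IsSymbol a) (hpp' : p.HolderConjugate p') : ∃ C : ℝ≥0,
    ∀ σ : ℕ → ℝ, IsScale σ → ∀ (k : ℕ) (t : ℝ), 0 < t → ∀ (B : ℝ≥0∞) (A g h : ℝ → ℂ),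
    IsAdmissible p p' B A g h → (∀ x, conv A (invFT fun ξ => a (t * ξ)) x = A x) →
    ‖(∫ x, g x * A x * conv h (invFT (band σ 1 k)) x) - ∫ x, 1 *
      (A x * conv g (invFT (band σ 2 k)) x) * conv h (invFT (band σ 1 k)) x‖ₑ ≤
      C * ofReal (|σ k| / t) * (B * eLpNorm' A p volume * eLpNorm' h p' volume) := by
  obtain ⟨D₁, h₁⟩ := ha.exists_isBump
  obtain ⟨C₁, hC₁⟩ := h₁.exists_eLpNorm'_sub_translate_le hpp'.lt
  obtain ⟨C₂, hC₂⟩ := exists_moment_band_le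
  obtain ⟨C₃, hC₃⟩ := exists_lintegral_band_squareFn_le hpp'.symm.lt
  obtain ⟨C₄, hC₄⟩ := exists_rpow_one_div_le hpp'.symm.pos C₃
  refine ⟨C₁ * C₂ * C₄, fun σ hσ k t ht B A g h hF hA => ?_⟩
  have hb := isSymbol_band hσ one_ne_zero k
  have hb2 := isSymbol_band hσ two_ne_zero k
  obtain ⟨D₂, h₂⟩ := hb2.exists_isDecaying
  have h₃ := hb.conv_mem hpp'.symm.lt hF.hm hF.hp'
  have hA' : conv A (invFT fun ξ => a (t * ξ)) = A := funext hA
  -- the wider band function is even, and equal to one where the narrower one does not vanish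
  have hrep : ∀ x, conv (conv h (invFT (band σ 1 k))) (fun y => invFT (band σ 2 k) (-y)) x =
      conv h (invFT (band σ 1 k)) x := fun x => by
    have e : (fun y => invFT (band σ 2 k) (-y)) = invFT (band σ 2 k) := funext fun y => by
      rw [← invFT_neg]
      congr 1
      funext η
      simp only [band, mul_neg, lowpass_neg]
    rw [e, conv_conv_invFT (tame_of_lintegral_rpow hF.hm hpp'.symm.lt.le hF.hp') hb hb2]
    congr 2
    funext ξ
    by_cases h0 : band σ 1 k ξ = 0
    · rw [h0, zero_mul]
    obtain ⟨h4, h5⟩ := abs_of_band_ne_zero hσ le_rfl h0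
    simp only [abs_mul] at h4 h5
    have h6 : band σ 2 k ξ = 1 := by
      rw [band, lowpass_eq_one, lowpass_eq_zero, sub_zero]
      · rw [abs_mul, abs_mul, abs_two]; linarith
      · rw [abs_mul, abs_mul, abs_of_pos (by norm_num : (0 : ℝ) < 2⁻¹)]; linarith
    rw [h6, mul_one]
  have hN : eLpNorm' (conv h (invFT (band σ 1 k))) p' volume ≤ C₄ * eLpNorm' h p' volume := by
    simpa only [eLpNorm', Finset.sum_singleton, sq_rpow_half] using
      hC₄ _ _ (hC₃ σ hσ 1 le_rfl one_le_two {k} h hF.hm hF.hp')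
  have key := enorm_commutator_le hpp' hF.fm hF.fp hF.gm hF.B_ne_top hF.gB
    h₃.1 h₃.2 h₂
    (by simpa only [hA'] using hC₁ t ht A hF.fm hF.fp) (hC₂ σ hσ k)
  simp only [hrep] at key
  simp only [one_mul]
  rw [enorm_sub_rev]
  refine key.trans ((mul_le_mul_right hN _).trans_eq ?_)
  rw [div_eq_mul_inv, ofReal_mul (abs_nonneg _), coe_mul, coe_mul]
  ring

/-- The paraproduct estimate for `∑ ε_k ∫ g P_k f U_k h`, where `P_k f` has frequencies comparable
to `1/t_k` and `U_k` is a low-pass operator at the much higher frequency `1/σ_k`. Summation by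
parts leaves the differences of the `U_k`; these see only the band pieces of `g`, up to a
commutator, and the Carleson embedding applies. -/
lemma exists_enorm_sum_lowpass_le (ha : IsSymbol a) {r ρ : ℝ} (hr : 0 < r) (hρ : 0 < ρ)
    (har : ∀ x, a x ≠ 0 → r ≤ |x|) (haρ : ∀ x, a x ≠ 0 → |x| ≤ ρ) (hp : 2 ≤ p)
    (hpp' : p.HolderConjugate p') (M : ℝ) : ∃ C : ℝ≥0, ∀ τ : ℝ, 0 < τ → ∀ σ : ℕ → ℝ, IsScale σ →
    (∀ k, |σ k| ≤ τ * 2⁻¹ ^ k) → ∀ n, ∑ k ∈ Finset.range n, |σ k| / (τ * 2⁻¹ ^ k) ≤ M →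
    ∀ ε : ℕ → ℂ, (∀ j, ‖ε j‖ ≤ 1) → ∀ (B : ℝ≥0∞) (f g h : ℝ → ℂ), IsAdmissible p p' B f g h →
    ‖∑ k ∈ Finset.range n, ε k * ∫ x, g x * conv f (invFT fun ξ => a (τ * 2⁻¹ ^ k * ξ)) x *
      conv h (invFT fun ξ => lowpass (σ k * ξ)) x‖ₑ ≤
      C * (B * eLpNorm' f p volume * eLpNorm' h p' volume) := by
  have ha0 : a 0 = 0 := by
    by_contra h0
    have := har 0 h0
    rw [abs_zero] at this
    linarith
  have hχ : IsSymbol fun x => lowpass (ρ⁻¹ * x) :=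
    isSmoothSymbol_lowpass.isSymbol.comp_mul (inv_ne_zero hρ.ne')
  have hp1 := hpp'.lt
  have hp1' := hpp'.symm.lt
  have hp0 := hpp'.pos
  obtain ⟨C₁, hC₁⟩ := exists_eLpNorm'_partialSymbol_le ha ha0 hp1
  obtain ⟨C₂, hC₂⟩ := isSmoothSymbol_lowpass.isSymbol.exists_eLpNorm'_conv_le hp1'
  obtain ⟨C₃, hC₃⟩ := exists_band_commutator_le hχ hpp'
  obtain ⟨K, L, hKL⟩ := exists_enorm_conv_partialSymbol_le ha hr hρ har haρ
  obtain ⟨C₄, hC₄⟩ := exists_lintegral_sum_sq_band_rpow_le hp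
  obtain ⟨C₅', hC₅'⟩ := exists_lintegral_band_squareFn_le hp1'
  obtain ⟨C₅, hC₅⟩ := exists_rpow_one_div_le hpp'.symm.pos C₅'
  refine ⟨C₁ * C₂ + C₃ * C₁ * M.toNNReal + C₄ * (K * C₁ + K) * C₅,
    fun τ hτ σ hσ hστ n hM ε hε B f g h hF => ?_⟩
  have ht0 : ∀ k, 0 < τ * 2⁻¹ ^ k := fun k => by positivity
  have hft := tame_of_lintegral_rpow hF.fm hp1.le hF.fp
  have hht := tame_of_lintegral_rpow hF.hm hp1'.le hF.hp'
  set P : ℕ → ℝ → ℂ := fun k => conv f (invFT fun ξ => a (τ * 2⁻¹ ^ k * ξ)) with hP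
  set U : ℕ → ℝ → ℂ := fun k => conv h (invFT fun ξ => lowpass (σ k * ξ)) with hU
  set A : ℕ → ℝ → ℂ := fun k => conv f (invFT (partialSymbol a τ ε k)) with hA
  set Δ : ℕ → ℝ → ℂ := fun k => conv h (invFT (band σ 1 k)) with hΔ
  set W : ℕ → ℝ → ℂ := fun k => conv g (invFT (band σ 2 k)) with hW
  set Nf := eLpNorm' f p volume with hNf
  set Nh := eLpNorm' h p' volume with hNh
  have hAm : ∀ k, AEStronglyMeasurable (A k) ∧ ∫⁻ x, ‖A k x‖ₑ ^ p < ∞ := fun k =>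
    (isSymbol_partialSymbol ha hτ ε k).conv_mem hp1 hF.fm hF.fp
  have hPm : ∀ k, AEStronglyMeasurable (P k) ∧ ∫⁻ x, ‖P k x‖ₑ ^ p < ∞ := fun k =>
    (ha.comp_mul (ht0 k).ne').conv_mem hp1 hF.fm hF.fp
  have hUm : ∀ k, AEStronglyMeasurable (U k) ∧ ∫⁻ x, ‖U k x‖ₑ ^ p' < ∞ := fun k =>
    (isSmoothSymbol_lowpass.isSymbol.comp_mul (hσ k).1).conv_mem hp1' hF.hm hF.hp'
  have hΔm : ∀ k, AEStronglyMeasurable (Δ k) ∧ ∫⁻ x, ‖Δ k x‖ₑ ^ p' < ∞ := fun k =>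
    (isSymbol_band hσ one_ne_zero k).conv_mem hp1' hF.hm hF.hp'
  have hWm : ∀ k, AEStronglyMeasurable (W k) := fun k =>
    (isSymbol_band hσ two_ne_zero k).aestronglyMeasurable_conv hF.gm
  have hΔU : ∀ k x, Δ k x = U (k + 1) x - U k x := fun k x => by
    obtain ⟨D', hD'⟩ := exists_isDecaying_band
    obtain ⟨h1, h2⟩ := hD' σ hσ 1 le_rfl k
    have e : invFT (band σ 1 k) = fun y => _ := funext (invFT_band hσ one_ne_zero k)
    simp only [hΔ, hU]
    rw [e, conv_sub_kernel hht h1 h2]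
    simp only [inv_one, one_mul]
  -- summation by parts
  have habel : ∑ k ∈ Finset.range n, ε k * ∫ x, g x * P k x * U k x =
      (∫ x, g x * A n x * U n x) - ∑ l ∈ Finset.range n, ∫ x, g x * A (l + 1) x * Δ l x := by
    have hI : ∀ k, Integrable fun x => ε k * (g x * P k x * U k x) := fun k =>
      (integrable_mul_mul hpp' (hF.congr (hPm k) (hUm k))).const_mul _
    have hJ : ∀ l, Integrable fun x => g x * A (l + 1) x * Δ l x := fun l =>
      integrable_mul_mul hpp' (hF.congr (hAm _) (hΔm l))
    simp only [← integral_const_mul]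
    rw [← integral_finsetSum _ fun k _ => hI k, ← integral_finsetSum _ fun l _ => hJ l,
      ← integral_sub (integrable_mul_mul hpp' (hF.congr (hAm n) (hUm n)))
        (integrable_finsetSum _ fun l _ => hJ l)]
    refine integral_congr_ae (ae_of_all _ fun x => ?_)
    have := sum_mul_eq_mul_sub_sum (fun k => ε k * P k x) (fun k => U k x) n
    simp only [hA, conv_partialSymbol ha hτ ε _ hft, hΔU]
    calc _ = g x * ∑ k ∈ Finset.range n, ε k * P k x * U k x := by
          rw [mul_sum]
          exact sum_congr rfl fun k _ => by ring
      _ = _ := by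
          rw [this, mul_sub, mul_sum, mul_assoc]
          congr 1
          exact sum_congr rfl fun k _ => by ring
  have hAN : ∀ k, eLpNorm' (A k) p volume ≤ C₁ * Nf := hC₁ τ hτ ε hε f hF.fm hF.fp
  have hT1 : ‖∫ x, g x * A n x * U n x‖ₑ ≤ C₁ * C₂ * (B * Nf * Nh) :=
    (enorm_integral_le_eLpNorm' hpp' (hF.congr (hAm n) (hUm n))).trans ((mul_le_mul'
      (mul_le_mul_right (hAN n) _) (hC₂ _ (hσ n).1 h hF.hm)).trans_eq (by ring))
  have hT2 : ∑ l ∈ Finset.range n, ‖(∫ x, g x * A (l + 1) x * Δ l x) -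
      ∫ x, 1 * (A (l + 1) x * W l x) * Δ l x‖ₑ ≤ C₃ * C₁ * M.toNNReal * (B * Nf * Nh) := by
    refine (sum_le_sum fun l _ => (hC₃ σ hσ l _ (ht0 l) B (A (l + 1)) g h
      (hF.congr (hAm _) ⟨hF.hm, hF.hp'⟩) fun x => ?_).trans (mul_le_mul_right (mul_le_mul_left
        (mul_le_mul_right (hAN _) _) _) _)).trans ?_
    · simp only [hA]
      rw [conv_conv_invFT hft (isSymbol_partialSymbol ha hτ ε _) (hχ.comp_mul (ht0 l).ne')]
      simp only [partialSymbol_mul_lowpass hρ haρ hτ]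
    · rw [← sum_mul, ← mul_sum, ← ofReal_sum_of_nonneg fun l _ =>
        div_nonneg (abs_nonneg _) (ht0 l).le]
      refine (mul_le_mul_left (mul_le_mul_right (ofReal_le_ofReal hM) _) _).trans_eq ?_
      rw [ofReal]; ring
  have hT3 : ∑ l ∈ Finset.range n, ‖∫ x, 1 * (A (l + 1) x * W l x) * Δ l x‖ₑ ≤
      C₄ * (K * C₁ + K) * C₅ * (B * Nf * Nh) := by
    refine (sum_enorm_integral_le (g := fun _ => 1) (B := 1) hpp' (by simp) ENNReal.one_ne_top _
      (fun l => (hAm _).1.mul (hWm l)) fun l => (hΔm l).1).trans ?_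
    rw [one_mul]
    set F : ℝ → ℝ≥0∞ := fun y => K * ‖A (n + L) y‖ₑ + K * ‖f y‖ₑ with hFdef
    have hFm : AEMeasurable F :=
      ((hAm _).1.enorm.const_mul _).add (hF.fm.enorm.const_mul _)
    have hKp : ∀ u : ℝ → ℂ, (∫⁻ x, (K * ‖u x‖ₑ) ^ p) ^ (1 / p) = K * eLpNorm' u p volume :=
      fun u => by
      simp only [mul_rpow_of_nonneg _ _ hp0.le]
      rw [lintegral_const_mul' _ _ (rpow_ne_top_of_nonneg hp0.le coe_ne_top),
        mul_rpow_of_nonneg _ _ (by positivity), ← rpow_mul,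
        mul_one_div_cancel hp0.ne', rpow_one, eLpNorm'_eq_lintegral_enorm]
    have hFN : (∫⁻ x, F x ^ p) ^ (1 / p) ≤ (K * C₁ + K) * Nf := by
      refine (ENNReal.lintegral_Lp_add_le ((hAm (n + L)).1.enorm.const_mul K)
        (hF.fm.enorm.const_mul K) hp1.le).trans ?_
      rw [hKp, hKp, add_mul, mul_assoc]
      exact add_le_add_left (mul_le_mul_right (hAN _) _) _
    have hfin : ∫⁻ x, F x ^ p < ∞ := by
      have h1 : Nf ≠ ∞ := rpow_ne_top_of_nonneg (by positivity) hF.fp.ne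
      by_contra h2
      rw [not_lt, top_le_iff] at h2
      rw [h2, ENNReal.top_rpow_of_pos (by positivity), top_le_iff] at hFN
      exact absurd hFN (by finiteness)
    have h4 := hC₄ σ hσ (Finset.range n) _ hστ g hF.gm B hF.B_ne_zero hF.B_ne_top hF.gB F hFm hfin
      (fun k x => ‖A (k + 1) x‖ₑ) (fun k => (hAm _).1.enorm)
      fun k hk x => hKL τ hτ ε hε f hft k n (Finset.mem_range.1 hk) x
    simp only [Pi.mul_apply, enorm_mul]
    refine (mul_le_mul' (h4.trans (mul_le_mul_right hFN _))
      (hC₅ _ _ (hC₅' σ hσ 1 le_rfl one_le_two _ h hF.hm hF.hp'))).trans_eq ?_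
    rw [hNh, eLpNorm'_eq_lintegral_enorm]; ring
  rw [habel]
  refine enorm_sub_le.trans ?_
  have hsum : ‖∑ l ∈ Finset.range n, ∫ x, g x * A (l + 1) x * Δ l x‖ₑ ≤
      C₃ * C₁ * M.toNNReal * (B * Nf * Nh) + C₄ * (K * C₁ + K) * C₅ * (B * Nf * Nh) := by
    refine (enorm_sum_le _ _).trans (le_trans ?_ (add_le_add hT2 hT3))
    rw [← sum_add_distrib]
    refine sum_le_sum fun l _ => ?_
    exact (congrArg enorm (sub_add_cancel _ _).symm).le.trans (enorm_add_le _ _)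
  refine (add_le_add hT1 hsum).trans_eq ?_
  push_cast
  ring

/-! ### The trilinear form at separated scales -/

variable {p p' : ℝ} {B : ℝ≥0∞} {f g h : ℝ → ℂ} {a b : ℝ → ℂ}

lemma sum_enorm_le_of_forall_phase {S : Finset ℕ} {z : ℕ → ℂ} {X : ℝ≥0∞}
    (hX : ∀ ε : ℕ → ℂ, (∀ j, ‖ε j‖ ≤ 1) → ‖∑ k ∈ S, ε k * z k‖ₑ ≤ X) : ∑ k ∈ S, ‖z k‖ₑ ≤ X := by
  refine le_trans (le_of_eq ?_) (hX (fun k => conj (z k) / ‖z k‖) fun j => ?_)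
  · have : ∀ k, conj (z k) / ‖z k‖ * z k = ((‖z k‖ : ℝ) : ℂ) := fun k => by
      by_cases h : z k = 0
      · simp [h]
      have h' : (‖z k‖ : ℂ) ≠ 0 := by exact_mod_cast norm_ne_zero_iff.2 h
      rw [div_mul_eq_mul_div, mul_comm, mul_conj, Complex.normSq_eq_norm_sq]
      push_cast
      field_simp
    simp only [this]
    rw [← Complex.ofReal_sum, ← ofReal_norm (E := ℂ), norm_real,
      norm_of_nonneg (sum_nonneg fun k _ => norm_nonneg (z k)),
      ofReal_sum_of_nonneg fun k _ => norm_nonneg (z k)]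
    exact sum_congr rfl fun k _ => (ofReal_norm (z k)).symm
  · rw [norm_div, RCLike.norm_conj, norm_real, norm_norm]
    exact div_self_le_one _

/-- A convolution of each of the three factors with a kernel at a single scale. -/
lemma IsAdmissible.conv {D₁ D₂ D₃ s₁ s₂ s₃ : ℝ} {k₁ k₂ k₃ : ℝ → ℂ}
    (hF : IsAdmissible p p' B f g h) (hpp' : p.HolderConjugate p') (h₁ : IsDecaying D₁ s₁ k₁)
    (h₂ : IsDecaying D₂ s₂ k₂) (h₃ : IsDecaying D₃ s₃ k₃) :
    IsAdmissible p p' ((ofReal D₂ * ofReal π + 1) * B)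
      (conv f k₁) (conv g k₂) (conv h k₃) where
  fm := aestronglyMeasurable_conv hF.fm h₁.continuous
  fp := h₁.lintegral_conv_lt_top hF.fm hpp'.lt hF.fp
  gm := aestronglyMeasurable_conv hF.gm h₂.continuous
  B_ne_zero := mul_ne_zero (by simp) hF.B_ne_zero
  B_ne_top := by have := hF.B_ne_top; finiteness
  gB := Eventually.of_forall fun x => (h₂.enorm_conv_le g x).trans ((mul_le_mul_right
    (cauchyAvg_le_of_ae_le h₂.pos hF.gB x) _).trans (by rw [← mul_assoc, add_mul]; exact le_self_add))
  hm := aestronglyMeasurable_conv hF.hm h₃.continuous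
  hp' := h₃.lintegral_conv_lt_top hF.hm hpp'.symm.lt hF.hp'

lemma exists_enorm_integral_conv_le (ha : IsSymbol a) (hb : IsSymbol b)
    (hpp' : p.HolderConjugate p') : ∃ C : ℝ≥0, ∀ t s : ℝ, t ≠ 0 → s ≠ 0 → ∀ (B : ℝ≥0∞)
    (f g h : ℝ → ℂ), IsAdmissible p p' B f g h →
    ‖∫ x, conv f (invFT fun ξ => a (t * ξ)) x * conv g (invFT fun η => b (s * η)) x *
      conv h (invFT fun η => b (s * η)) x‖ₑ ≤
      C * (B * eLpNorm' f p volume * eLpNorm' h p' volume) := by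
  obtain ⟨D₁, h₁⟩ := ha.exists_isDecaying
  obtain ⟨D₂, h₂⟩ := hb.exists_isDecaying
  obtain ⟨C₁, hC₁⟩ := ha.exists_eLpNorm'_conv_le hpp'.lt
  obtain ⟨C₂, hC₂⟩ := hb.exists_eLpNorm'_conv_le hpp'.symm.lt
  have hA : ofReal D₂ * ofReal π + 1 ≠ ∞ := by finiteness
  refine ⟨(ofReal D₂ * ofReal π + 1).toNNReal * C₁ * C₂,
    fun t s ht hs B f g h hF => ?_⟩
  simp only [mul_comm (CurvedBHT.conv f _ _)]
  refine (enorm_integral_le_eLpNorm' hpp' (hF.conv hpp' (h₁.invFT_comp_mul ht)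
    (h₂.invFT_comp_mul hs) (h₂.invFT_comp_mul hs))).trans ((mul_le_mul' (mul_le_mul_right
    (hC₁ t ht f hF.fm) _) (hC₂ s hs h hF.hm)).trans_eq ?_)
  rw [coe_mul, coe_mul, coe_toNNReal hA]
  ring

/-- The trilinear form at separated scales. The convolution on `g` is moved to `h`, where it turns
the symbol `b` into the even product `b(u) b(-u)`; this is a multiple of the low-pass function,
which leads to a paraproduct, plus a symbol vanishing at the origin, for which the square functions
of `f` and `h` suffice. -/
theorem exists_sum_enorm_separated_le (ha : IsSymbol a) {r ρ : ℝ} (hr : 0 < r) (hρ : 0 < ρ)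
    (har : ∀ x, a x ≠ 0 → r ≤ |x|) (haρ : ∀ x, a x ≠ 0 → |x| ≤ ρ) (hb : IsSmoothSymbol b)
    (hp : 2 ≤ p) (hpp' : p.HolderConjugate p') (M : ℝ) : ∃ C : ℝ≥0, ∀ τ : ℝ, 0 < τ →
    ∀ σ : ℕ → ℝ, IsScale σ → (∀ k, |σ k| ≤ τ * 2⁻¹ ^ k) →
    ∀ n, ∑ k ∈ Finset.range n, |σ k| / (τ * 2⁻¹ ^ k) ≤ M →
    ∀ (B : ℝ≥0∞) (f g h : ℝ → ℂ), IsAdmissible p p' B f g h →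
    ∑ k ∈ Finset.range n, ‖∫ x, conv f (invFT fun ξ => a (τ * 2⁻¹ ^ k * ξ)) x *
      conv g (invFT fun η => b (σ k * η)) x * conv h (invFT fun η => b (σ k * η)) x‖ₑ ≤
      C * (B * eLpNorm' f p volume * eLpNorm' h p' volume) := by
  have ha0 : a 0 = 0 := by
    by_contra h0
    have := har 0 h0
    rw [abs_zero] at this
    linarith
  have hbs := hb.isSymbol
  have hbn : IsSymbol fun u => b (-u) := by simpa using hbs.comp_mul (s := -1) (by norm_num)
  have hl := isSmoothSymbol_lowpass.isSymbol
  set c₀ : ℂ := b 0 * b (-0) with hc₀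
  set E : ℝ → ℂ := fun u => b u * b (-u) - c₀ * lowpass u with hE
  have hEs : IsSymbol E := (hbs.mul hbn).sub (hl.const_mul c₀)
  have hE0 : E 0 = 0 := by simp only [hE]; rw [lowpass_eq_one (by simp), mul_one, sub_self]
  have hp1 := hpp'.lt
  have hp1' := hpp'.symm.lt
  obtain ⟨C₁, hC₁⟩ := ha.exists_commutator_le hb hpp'
  obtain ⟨C₂, hC₂⟩ := hbs.exists_eLpNorm'_conv_le hp1'
  obtain ⟨C₃', hC₃'⟩ := ha.exists_lintegral_squareFn_rpow_le ha0 hp1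
  obtain ⟨C₃, hC₃⟩ := exists_rpow_one_div_le hpp'.pos C₃'
  obtain ⟨C₄', hC₄'⟩ := hEs.exists_lintegral_squareFn_rpow_le hE0 hp1'
  obtain ⟨C₄, hC₄⟩ := exists_rpow_one_div_le hpp'.symm.pos C₄'
  obtain ⟨C₅, hC₅⟩ := exists_enorm_sum_lowpass_le ha hr hρ har haρ hp hpp' M
  refine ⟨C₁ * C₂ * M.toNNReal + (‖c₀‖₊ * C₅ + C₃ * C₄),
    fun τ hτ σ hσ hστ n hM B f g h hF => ?_⟩
  have ht0 : ∀ k, 0 < τ * 2⁻¹ ^ k := fun k => by positivity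
  have hht := tame_of_lintegral_rpow hF.hm hp1'.le hF.hp'
  set P : ℕ → ℝ → ℂ := fun k => conv f (invFT fun ξ => a (τ * 2⁻¹ ^ k * ξ)) with hP
  set U : ℕ → ℝ → ℂ := fun k => conv h (invFT fun ξ => lowpass (σ k * ξ)) with hU
  set V : ℕ → ℝ → ℂ := fun k => conv h (invFT fun ξ => E (σ k * ξ)) with hV
  set Sh : ℕ → ℝ → ℂ := fun k => conv h (invFT fun ξ => b (σ k * ξ)) with hSh
  set N := B * eLpNorm' f p volume * eLpNorm' h p' volume with hN
  have hPm : ∀ k, AEStronglyMeasurable (P k) ∧ ∫⁻ x, ‖P k x‖ₑ ^ p < ∞ := fun k =>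
    (ha.comp_mul (ht0 k).ne').conv_mem hp1 hF.fm hF.fp
  have hm : ∀ {c : ℝ → ℂ}, IsSymbol c → ∀ k,
      AEStronglyMeasurable (conv h (invFT fun ξ => c (σ k * ξ))) volume ∧
      ∫⁻ x, ‖conv h (invFT fun ξ => c (σ k * ξ)) x‖ₑ ^ p' < ∞ := fun hc k =>
    (hc.comp_mul (hσ k).1).conv_mem hp1' hF.hm hF.hp'
  have hconv : ∀ k x, conv (Sh k) (fun y => invFT (fun η => b (σ k * η)) (-y)) x =
      c₀ * U k x + V k x := fun k x => by
    have hs := (hσ k).1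
    have e : (fun y => invFT (fun η => b (σ k * η)) (-y)) =
        invFT fun η => b (-(σ k * η)) := funext fun y => by
      rw [← invFT_neg]; simp only [mul_neg]
    have e2 : invFT (fun ξ => E (σ k * ξ)) = fun y => invFT (fun ξ => b (σ k * ξ) * b (-(σ k * ξ))) y -
        invFT (fun ξ => c₀ * lowpass (σ k * ξ)) y := funext fun y => invFT_sub
      ((hbs.mul hbn).comp_mul hs).integrable ((hl.const_mul c₀).comp_mul hs).integrable y
    obtain ⟨D₁, h₁⟩ := ((hbs.mul hbn).comp_mul hs).exists_isDecaying
    obtain ⟨D₂, h₂⟩ := ((hl.const_mul c₀).comp_mul hs).exists_isDecaying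
    have e3 : conv h (invFT fun ξ => c₀ * lowpass (σ k * ξ)) x = c₀ * U k x := by
      simp only [hU, conv_apply, invFT_const_mul, mul_left_comm _ c₀]
      rw [integral_const_mul]
    rw [e, conv_conv_invFT hht (hbs.comp_mul hs) (hbn.comp_mul hs)]
    simp only [hV]
    rw [e2, conv_sub_kernel hht h₁ h₂, e3]
    ring
  -- first the commutators
  set X : ℕ → ℂ := fun k => ∫ x, P k x * conv g (invFT fun η => b (σ k * η)) x * Sh k x with hX
  set Y : ℕ → ℂ := fun k => ∫ x, g x * P k x * (c₀ * U k x + V k x) with hY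
  have hT1 : ∑ k ∈ Finset.range n, ‖X k - Y k‖ₑ ≤ C₁ * C₂ * M.toNNReal * N := by
    refine (sum_le_sum fun k _ => ?_).trans (b := ∑ k ∈ Finset.range n,
      C₁ * ofReal (|σ k| / (τ * 2⁻¹ ^ k)) * (C₂ * N)) ?_
    · have := hC₁ _ _ (ht0 k) (hσ k).1 B f g (Sh k) (hF.congr ⟨hF.fm, hF.fp⟩ (hm hbs k))
      simp only [hconv] at this
      refine this.trans (mul_le_mul_right ((mul_le_mul_right (hC₂ _ (hσ k).1 h hF.hm) _).trans_eq ?_) _)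
      rw [hN]; ring
    · rw [← sum_mul, ← mul_sum, ← ofReal_sum_of_nonneg fun k _ =>
        div_nonneg (abs_nonneg _) (ht0 k).le]
      refine (mul_le_mul_left (mul_le_mul_right (ofReal_le_ofReal hM) _) _).trans_eq ?_
      rw [ofReal]; ring
  have hT2 : ∑ k ∈ Finset.range n, ‖∫ x, g x * P k x * V k x‖ₑ ≤ C₃ * C₄ * N := by
    refine (sum_enorm_integral_le hpp' hF.gB hF.B_ne_top _ (fun k => (hPm k).1)
      fun k => (hm hEs k).1).trans ((mul_le_mul_right (mul_le_mul' (hC₃ _ _ (hC₃' _ _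
        ((isScale_pow hτ).isLacunary _) f hF.fm hF.fp)) (hC₄ _ _ (hC₄' _ _ (hσ.isLacunary _)
        h hF.hm hF.hp'))) _).trans_eq ?_)
    rw [hN, eLpNorm'_eq_lintegral_enorm, eLpNorm'_eq_lintegral_enorm]; ring
  refine sum_enorm_le_of_forall_phase fun ε hε => ?_
  have hsplit : ∑ k ∈ Finset.range n, ε k * X k = (∑ k ∈ Finset.range n, ε k * (X k - Y k)) +
      (c₀ * (∑ k ∈ Finset.range n, ε k * ∫ x, g x * P k x * U k x) +
        ∑ k ∈ Finset.range n, ε k * ∫ x, g x * P k x * V k x) := by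
    rw [mul_sum, ← sum_add_distrib, ← sum_add_distrib]
    refine sum_congr rfl fun k _ => ?_
    have : Y k = c₀ * (∫ x, g x * P k x * U k x) + ∫ x, g x * P k x * V k x := by
      rw [← integral_const_mul, ← integral_add
        ((integrable_mul_mul hpp' (hF.congr (hPm k) (hm hl k))).const_mul _)
        (integrable_mul_mul hpp' (hF.congr (hPm k) (hm hEs k)))]
      exact integral_congr_ae (ae_of_all _ fun x => by ring)
    rw [this]; ring
  have hε' : ∀ (z : ℕ → ℂ), ‖∑ k ∈ Finset.range n, ε k * z k‖ₑ ≤ ∑ k ∈ Finset.range n, ‖z k‖ₑ :=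
    fun z => (enorm_sum_le _ _).trans (sum_le_sum fun k _ => by
      rw [enorm_mul]
      have : ‖ε k‖ₑ ≤ 1 := by rw [← ofReal_norm]; exact ENNReal.ofReal_le_one.2 (hε _)
      exact (mul_le_mul_left this _).trans_eq (one_mul _))
  rw [hsplit]
  refine (enorm_add_le _ _).trans ((add_le_add ((hε' _).trans hT1) ((enorm_add_le _ _).trans
    (add_le_add ((enorm_mul _ _).le.trans (mul_le_mul_right
      (hC₅ τ hτ σ hσ hστ n hM ε hε B f g h hF) _)) ((hε' _).trans hT2)))).trans_eq ?_)
  push_cast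
  rw [enorm_eq_nnnorm]
  ring

/-! ### Uniform bounds for the trilinear forms -/

variable {p p' : ℝ} {B : ℝ≥0∞} {f g h : ℝ → ℂ} {R : ℝ → ℝ} {φ : ℝ → ℂ} {K : ℝ}

/-- Past some index, the dilations that act on `g` and `h` form a scale, and they are summably
small compared with the dilations that act on `f`. -/
lemma NonFlatNearZero.exists_isScale_dilation {N : ℕ} {γ Q r : ℝ → ℝ} (hγ : NonFlatNearZero N γ Q r)
    (hN : 2 ≤ N) (hγ0 : Tendsto (deriv γ) (𝓝[≠] 0) (𝓝 0)) : ∃ (j₀ : ℕ) (M : ℝ),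
    IsScale (fun k => dilation γ (j₀ + k)) ∧
    (∀ k, |dilation γ (j₀ + k)| ≤ 2⁻¹ ^ j₀ * 2⁻¹ ^ k) ∧
    ∀ n, ∑ k ∈ Finset.range n, |dilation γ (j₀ + k)| / (2⁻¹ ^ j₀ * 2⁻¹ ^ k) ≤ M := by
  obtain ⟨θ, L, hθ0, hθ1, -, hev⟩ := hγ.exists_slope_le hN hγ0
  have hlim : Tendsto (slope γ) atTop (𝓝 0) := hγ0.comp (tendsto_nhdsWithin_iff.2
    ⟨tendsto_pow_atTop_nhds_zero_of_lt_one (by norm_num) (by norm_num),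
      Eventually.of_forall fun j => by simp⟩)
  obtain ⟨j₀, hj₀⟩ := eventually_atTop.1 (hev.and
    (hlim.abs.eventually (gt_mem_nhds (by simp : |(0 : ℝ)| < 1))))
  have hge : ∀ k, |slope γ (j₀ + k)| ≤ θ ^ k := fun k => by
    induction k with
    | zero => simpa using (hj₀ j₀ le_rfl).2.le
    | succ k ih =>
      rw [pow_succ']
      exact ((hj₀ (j₀ + k) (Nat.le_add_right _ _)).1.2.1).trans (mul_le_mul_of_nonneg_left ih hθ0)
  have habs : ∀ j, |dilation γ j| = |slope γ j| * 2⁻¹ ^ j := fun j => by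
    rw [dilation, abs_div, abs_of_pos (by positivity : (0 : ℝ) < 2 ^ j), inv_pow, div_eq_mul_inv]
  have hs : ∀ k, |dilation γ (j₀ + k)| = |slope γ (j₀ + k)| * (2⁻¹ ^ j₀ * 2⁻¹ ^ k) := fun k => by
    rw [habs, pow_add]
  refine ⟨j₀, (1 - θ)⁻¹, fun k => ⟨?_, ?_⟩, fun k => ?_, fun n => ?_⟩
  · exact div_ne_zero (hj₀ _ (Nat.le_add_right _ _)).1.1 (by positivity)
  · rw [hs, hs, ← add_assoc]
    have h1 := (hj₀ (j₀ + k) (Nat.le_add_right _ _)).1.2.1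
    have h2 : |slope γ (j₀ + k + 1)| ≤ |slope γ (j₀ + k)| :=
      h1.trans (mul_le_of_le_one_left (abs_nonneg _) hθ1.le)
    rw [pow_succ]
    nlinarith [mul_le_mul_of_nonneg_right h2 (by positivity : (0 : ℝ) ≤ 2⁻¹ ^ j₀ * 2⁻¹ ^ k)]
  · rw [hs]
    exact mul_le_of_le_one_left (by positivity) ((hge k).trans (pow_le_one₀ hθ0 hθ1.le))
  · refine (sum_le_sum fun k _ => ?_).trans (((summable_geometric_of_lt_one
      hθ0 hθ1).sum_le_tsum _ fun k _ => by positivity).trans_eq (tsum_geometric_of_lt_one hθ0 hθ1))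
    rw [hs, mul_div_assoc, div_self (by positivity), mul_one]
    exact hge k

/-- The symbol acting on `f`, at the scale `j = 0`. -/
noncomputable def packet (R : ℝ → ℝ) (φ : ℝ → ℂ) (m p₀ : ℕ) (ξ : ℝ) : ℂ :=
  φ (2⁻¹ ^ m * ξ) * psi R φ m p₀ 0 ξ

lemma integrand_eq (γ : ℝ → ℝ) {m p₀ : ℕ} (hφ : IsSymbol φ) (hψ : IsSymbol (psi R φ m p₀ 0))
    (hf : Tame f) (j : ℕ) (x : ℝ) : integrand γ R φ j m p₀ f g h x =
      conv f (invFT fun ξ => packet R φ m p₀ (2⁻¹ ^ j * ξ)) x *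
      conv g (invFT fun η => φ (dilation γ j * η - p₀)) x *
      conv h (invFT fun η => φ (dilation γ j * η - p₀)) x := by
  rw [integrand, phiLoc_eq, phiScale_eq, psi_eq_comp_mul, conv_conv_invFT hf
    (hφ.comp_mul (by positivity)) (hψ.comp_mul (by positivity))]
  simp only [packet, pow_add, mul_assoc]

/-- The terms with a vanishing dilation are zero, since the inverse Fourier integral of a constant
takes the value zero. -/
lemma integrand_eq_zero {γ : ℝ → ℝ} {j : ℕ} (hj : dilation γ j = 0) (m p₀ : ℕ) :
    integrand γ R φ j m p₀ f g h = 0 := by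
  have : invFT (phiLoc γ φ j p₀) = 0 := funext fun x => by
    rw [phiLoc_eq, invFT]
    simp only [hj, zero_mul, Pi.zero_apply]
    by_cases hc : φ (0 - p₀) = 0
    · simp only [hc, zero_mul, integral_zero, mul_zero]
    rw [integral_undef, mul_zero]
    intro hI
    have := hI.norm
    simp only [norm_mul, norm_exp_I_mul, mul_one] at this
    rcases integrable_const_iff.1 this with h0 | h0
    · exact hc (norm_eq_zero.1 h0)
    · exact absurd h0.measure_univ_lt_top (by simp)
  funext x
  simp [integrand, this, conv_apply]

lemma IsAlmostOrthogonal.integrable_integrand (hpp' : p.HolderConjugate p') (hφ : IsSymbol φ)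
    {m p₀ : ℕ} (hK : IsAlmostOrthogonal K (Finset.Icc (2 ^ m) (2 ^ (m + 1))) fun p => psi R φ m p 0)
    (hp₀ : p₀ ∈ Finset.Icc (2 ^ m) (2 ^ (m + 1))) (hF : IsAdmissible p p' B f g h) (γ : ℝ → ℝ)
    (j : ℕ) : Integrable (integrand γ R φ j m p₀ f g h) := by
  by_cases hj : dilation γ j = 0
  · rw [integrand_eq_zero hj]; exact integrable_zero _ _ _
  have hψ := hK.isSymbol p₀ hp₀
  obtain ⟨D₁, h₁⟩ := ((hφ.comp_mul (s := 2⁻¹ ^ m) (by positivity)).mul hψ).exists_isDecaying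
  obtain ⟨D₂, h₂⟩ := (hφ.comp_sub p₀).exists_isDecaying
  have h₂ := h₂.invFT_comp_mul hj
  refine (integrable_mul_mul hpp' (hF.conv hpp' (h₁.invFT_comp_mul (s := 2⁻¹ ^ j) (by positivity))
    h₂ h₂)).congr (ae_of_all _ fun x => ?_)
  rw [integrand_eq γ hφ hψ (tame_of_lintegral_rpow hF.fm hpp'.lt.le hF.fp)]
  simp only [packet]
  ring

lemma lambdaPiece_eq_zero_of_ae_eq_zero (γ : ℝ → ℝ) (hg : g =ᵐ[volume] 0) (j m : ℕ) :
    lambdaPiece γ R φ j m f g h = 0 := by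
  have : ∀ k, conv g k = 0 := fun k => funext fun x =>
    integral_eq_zero_of_ae (hg.mono fun t ht => by simp [ht])
  simp [lambdaPiece, integrand, this]

/-- The estimate for large `m`, at lacunary scales. -/
lemma exists_sum_enorm_lambdaPiece_le_of_large (hφ : ContDiff ℝ (⊤ : ℕ∞) φ)
    (hφc : HasCompactSupport φ) (hφ0 : φ 0 = 0) (hφ10 : ∀ x, φ x ≠ 0 → |x| ≤ 10)
    (hK : ∀ m : ℕ, IsAlmostOrthogonal K (Finset.Icc (2 ^ m) (2 ^ (m + 1)))
      fun p => psi R φ m p 0) (hp : 2 ≤ p) (hpp' : p.HolderConjugate p') (γ : ℝ → ℝ) :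
    ∃ C : ℝ≥0, ∀ m : ℕ, 32 ≤ 2 ^ m → ∀ T : Finset ℕ, IsLacunary T (fun j => |dilation γ j|) →
      ∀ (B : ℝ≥0∞) (f g h : ℝ → ℂ), IsAdmissible p p' B f g h →
      ∑ j ∈ T, ‖lambdaPiece γ R φ j m f g h‖ₑ ≤
        C * (B * eLpNorm' f p volume * eLpNorm' h p' volume) := by
  obtain ⟨C, hC⟩ := exists_lintegral_trilinear_le hφ hφc hφ0 hφ10 hK hp hpp'
  refine ⟨C, fun m hm T hT B f g h hF => ?_⟩
  have hm' : ∀ j, ∀ p₀ ∈ Finset.Icc (2 ^ m) (2 ^ (m + 1)),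
      AEMeasurable (fun x => ‖integrand γ R φ j m p₀ f g h x‖ₑ) := fun j p₀ hp₀ =>
    ((hK m).integrable_integrand hpp' (IsSmoothSymbol.isSymbol ⟨hφ, hφc⟩) hp₀ hF γ
      j).aestronglyMeasurable.enorm
  calc _ ≤ ∑ j ∈ T, ∑ p₀ ∈ Finset.Icc (2 ^ m) (2 ^ (m + 1)),
        ∫⁻ x, ‖integrand γ R φ j m p₀ f g h x‖ₑ :=
        sum_le_sum fun j _ => (enorm_sum_le _ _).trans
          (sum_le_sum fun p₀ _ => enorm_integral_le_lintegral_enorm _)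
    _ = ∫⁻ x, ∑ j ∈ T, ∑ p₀ ∈ Finset.Icc (2 ^ m) (2 ^ (m + 1)),
        ‖integrand γ R φ j m p₀ f g h x‖ₑ := by
        rw [lintegral_finsetSum' _ fun j _ => aemeasurable_fun_sum _ (hm' j)]
        exact sum_congr rfl fun j _ => (lintegral_finsetSum' _ (hm' j)).symm
    _ ≤ C * (∫⁻ x, ‖f x‖ₑ ^ p) ^ (1 / p) * B * (∫⁻ x, ‖h x‖ₑ ^ p') ^ (1 / p') := by
        refine le_trans (le_of_eq (lintegral_congr fun x => ?_))
          (hC m hm T _ hT f g h hF.fm hF.gm hF.hm hF.fp hF.hp' B hF.gB)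
        simp only [integrand, phiLoc_eq, enorm_mul]
    _ = _ := by rw [eLpNorm'_eq_lintegral_enorm, eLpNorm'_eq_lintegral_enorm]; ring

/-- The estimate for a single `m`, with a constant that may depend on `m`. -/
lemma exists_sum_enorm_lambdaPiece_le (hφ : ContDiff ℝ (⊤ : ℕ∞) φ)
    (hφc : HasCompactSupport φ) (hφ1 : ∀ x, φ x ≠ 0 → 1 / 10 ≤ |x|)
    (hφ10 : ∀ x, φ x ≠ 0 → |x| ≤ 10) {m : ℕ}
    (hK : IsAlmostOrthogonal K (Finset.Icc (2 ^ m) (2 ^ (m + 1))) fun p => psi R φ m p 0)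
    (hp : 2 ≤ p) (hpp' : p.HolderConjugate p') {γ : ℝ → ℝ} {j₀ : ℕ} {M : ℝ}
    (hσ : IsScale (fun k => dilation γ (j₀ + k)))
    (hσ1 : ∀ k, |dilation γ (j₀ + k)| ≤ 2⁻¹ ^ j₀ * 2⁻¹ ^ k)
    (hσM : ∀ n, ∑ k ∈ Finset.range n, |dilation γ (j₀ + k)| / (2⁻¹ ^ j₀ * 2⁻¹ ^ k) ≤ M) :
    ∃ C : ℝ≥0, ∀ (B : ℝ≥0∞) (f g h : ℝ → ℂ), IsAdmissible p p' B f g h → ∀ n,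
      ∑ j ∈ Finset.range (j₀ + n), ‖lambdaPiece γ R φ j m f g h‖ₑ ≤
        C * (B * eLpNorm' f p volume * eLpNorm' h p' volume) := by
  have hφs : IsSymbol φ := IsSmoothSymbol.isSymbol ⟨hφ, hφc⟩
  have hone : ∀ p₀ ∈ Finset.Icc (2 ^ m) (2 ^ (m + 1)), ∃ C : ℝ≥0, ∀ (B : ℝ≥0∞)
      (f g h : ℝ → ℂ), IsAdmissible p p' B f g h → ∀ n,
      ∑ j ∈ Finset.range (j₀ + n), ‖∫ x, integrand γ R φ j m p₀ f g h x‖ₑ ≤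
        C * (B * eLpNorm' f p volume * eLpNorm' h p' volume) := by
    intro p₀ hp₀
    have ha : IsSymbol (packet R φ m p₀) := (hφs.comp_mul (by positivity)).mul (hK.isSymbol p₀ hp₀)
    have hb : IsSmoothSymbol fun u => φ (u - p₀) := ⟨hφ.comp (contDiff_id.sub contDiff_const),
      hφc.comp_homeomorph (Homeomorph.subRight (p₀ : ℝ))⟩
    have hne : ∀ x, packet R φ m p₀ x ≠ 0 → φ (2⁻¹ ^ m * x) ≠ 0 := fun x hx => left_ne_zero_of_mul hx
    have habs : ∀ x : ℝ, |2⁻¹ ^ m * x| = |x| / 2 ^ m := fun x => by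
      rw [abs_mul, abs_of_pos (by positivity : (0 : ℝ) < 2⁻¹ ^ m), inv_pow, inv_mul_eq_div]
    obtain ⟨C₁, hC₁⟩ := exists_sum_enorm_separated_le ha (r := 1 / 10 * 2 ^ m) (ρ := 10 * 2 ^ m)
      (by positivity) (by positivity)
      (fun x hx => by
        have := hφ1 _ (hne x hx)
        rwa [habs, le_div_iff₀ (by positivity)] at this)
      (fun x hx => by
        have := hφ10 _ (hne x hx)
        rwa [habs, div_le_iff₀ (by positivity)] at this) hb hp hpp' M
    obtain ⟨C₂, hC₂⟩ := exists_enorm_integral_conv_le ha hb.isSymbol hpp'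
    refine ⟨j₀ * C₂ + C₁, fun B f g h hF n => ?_⟩
    have hft := tame_of_lintegral_rpow hF.fm hpp'.lt.le hF.fp
    set N := B * eLpNorm' f p volume * eLpNorm' h p' volume with hN
    have h1 : ∀ j ∈ Finset.range j₀, ‖∫ x, integrand γ R φ j m p₀ f g h x‖ₑ ≤ C₂ * N := by
      intro j _
      by_cases hj : dilation γ j = 0
      · simp [integrand_eq_zero hj]
      simp only [integrand_eq γ hφs (hK.isSymbol p₀ hp₀) hft]
      exact hC₂ _ _ (by positivity) hj B f g h hF
    have h2 := hC₁ (2⁻¹ ^ j₀) (by positivity) _ hσ hσ1 n (hσM n) B f g h hF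
    rw [sum_range_add]
    have h3 := sum_le_card_nsmul _ _ _ h1
    rw [Finset.card_range, nsmul_eq_mul] at h3
    refine (add_le_add h3 (le_of_eq_of_le (sum_congr rfl fun k _ => ?_) h2)).trans_eq ?_
    · simp only [integrand_eq γ hφs (hK.isSymbol p₀ hp₀) hft, pow_add]
    · push_cast; ring
  choose! C hC using hone
  refine ⟨∑ p₀ ∈ Finset.Icc (2 ^ m) (2 ^ (m + 1)), C p₀, fun B f g h hF n => ?_⟩
  rw [ENNReal.ofNNReal_finsetSum, sum_mul]
  refine (sum_le_sum fun j _ => enorm_sum_le _ _).trans ?_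
  rw [Finset.sum_comm]
  exact sum_le_sum fun p₀ hp₀ => hC p₀ hp₀ B f g h hF n

/-- The estimate with a constant that does not depend on `m`. Finitely many indices `j` below `j₀`
are treated one at a time when `m` is large, and finitely many `m` are treated one at a time. -/
theorem exists_sum_enorm_lambdaPiece_le_uniform (hφ : ContDiff ℝ (⊤ : ℕ∞) φ)
    (hφc : HasCompactSupport φ) (hφ1 : ∀ x, φ x ≠ 0 → 1 / 10 ≤ |x|)
    (hφ10 : ∀ x, φ x ≠ 0 → |x| ≤ 10) (hK : ∀ m : ℕ, IsAlmostOrthogonal K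
      (Finset.Icc (2 ^ m) (2 ^ (m + 1))) fun p => psi R φ m p 0)
    (hp : 2 ≤ p) (hpp' : p.HolderConjugate p') {γ : ℝ → ℝ} {j₀ : ℕ} {M : ℝ}
    (hσ : IsScale (fun k => dilation γ (j₀ + k)))
    (hσ1 : ∀ k, |dilation γ (j₀ + k)| ≤ 2⁻¹ ^ j₀ * 2⁻¹ ^ k)
    (hσM : ∀ n, ∑ k ∈ Finset.range n, |dilation γ (j₀ + k)| / (2⁻¹ ^ j₀ * 2⁻¹ ^ k) ≤ M) :
    ∃ C : ℝ≥0, ∀ (m : ℕ) (B : ℝ≥0∞) (f g h : ℝ → ℂ), IsAdmissible p p' B f g h → ∀ n,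
      ∑ j ∈ Finset.range n, ‖lambdaPiece γ R φ j m f g h‖ₑ ≤
        C * (B * eLpNorm' f p volume * eLpNorm' h p' volume) := by
  have hφ0 : φ 0 = 0 := by
    by_contra h0
    have := hφ1 0 h0
    norm_num at this
  choose C hC using fun m => exists_sum_enorm_lambdaPiece_le hφ hφc hφ1 hφ10 (hK m) hp hpp' hσ hσ1 hσM
  obtain ⟨C', hC'⟩ := exists_sum_enorm_lambdaPiece_le_of_large hφ hφc hφ0 hφ10 hK hp hpp' γ
  refine ⟨∑ m ∈ Finset.range 5, C m + (j₀ + 1) * C', fun m B f g h hF n => ?_⟩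
  have hmono : ∑ j ∈ Finset.range n, ‖lambdaPiece γ R φ j m f g h‖ₑ ≤
      ∑ j ∈ Finset.range (j₀ + n), ‖lambdaPiece γ R φ j m f g h‖ₑ :=
    Finset.sum_le_sum_of_subset (Finset.range_mono (Nat.le_add_left n j₀))
  refine hmono.trans ?_
  by_cases hm : m < 5
  · refine (hC m B f g h hF n).trans (mul_le_mul_left (ENNReal.coe_le_coe.2 ?_) _)
    exact (single_le_sum (f := C) (fun _ _ => zero_le) (Finset.mem_range.2 hm)).trans
      le_self_add
  have hm32 : 32 ≤ 2 ^ m := (by norm_num : 32 ≤ 2 ^ 5).trans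
    (Nat.pow_le_pow_right two_pos (not_lt.1 hm))
  set N := B * eLpNorm' f p volume * eLpNorm' h p' volume with hN
  have h1 : ∀ j ∈ Finset.range j₀, ‖lambdaPiece γ R φ j m f g h‖ₑ ≤ C' * N := by
    intro j _
    by_cases hj : dilation γ j = 0
    · simp [lambdaPiece, integrand_eq_zero hj]
    have := hC' m hm32 {j} (fun i hi => ?_) B f g h hF
    · rwa [Finset.sum_singleton] at this
    · rw [Finset.mem_singleton] at hi
      subst hi
      exact ⟨abs_pos.2 hj, fun l hl hne => absurd (Finset.mem_singleton.1 hl).symm hne⟩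
  have h2 : ∑ k ∈ Finset.range n, ‖lambdaPiece γ R φ (j₀ + k) m f g h‖ₑ ≤ C' * N := by
    have := hC' m hm32 ((Finset.range n).map (addLeftEmbedding j₀)) (fun i hi => ?_) B f g h hF
    · simpa only [Finset.sum_map, addLeftEmbedding_apply] using this
    · obtain ⟨k, hk, rfl⟩ := Finset.mem_map.1 hi
      obtain ⟨h3, h4⟩ := hσ.isLacunary (Finset.range n) k hk
      refine ⟨h3, fun l hl hne => ?_⟩
      obtain ⟨k', hk', rfl⟩ := Finset.mem_map.1 hl
      exact h4 k' hk' fun e => hne (by rw [e])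
  have h3 := sum_le_card_nsmul _ _ _ h1
  rw [Finset.card_range, nsmul_eq_mul] at h3
  rw [sum_range_add]
  refine (add_le_add h3 h2).trans ((le_of_eq ?_).trans (mul_le_mul_left
    (ENNReal.coe_le_coe.2 (le_add_self (a := (j₀ + 1) * C'))) _))
  push_cast
  ring

end CurvedBHT

theorem mainTheorem7
    (N : ℕ) (hN : 4 ≤ N) (γ Q r : ℝ → ℝ)
    (hγ : CurvedBHT.NonFlatNearZero N γ Q r)
    (hγ0 : Tendsto (deriv γ) (𝓝[≠] 0) (𝓝 0))
    (D : Set ℝ) (hDc : IsCompact D) (hJD : CurvedBHT.imageJ Q ⊆ D)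
    (hD : CurvedBHT.DualAsymptotics N γ D r)
    (φ : ℝ → ℂ) (hφ : ContDiff ℝ (⊤ : ℕ∞) φ)
    (hφsupp : tsupport φ ⊆ {x : ℝ | 1 / 10 < |x| ∧ |x| < 10})
    (hφD : ∀ u ∈ tsupport φ, ∀ q ∈ Icc (1 : ℝ) 2, u / q ∈ D)
    (p p' : ℝ) (hp : 2 ≤ p) (hpp' : p.HolderConjugate p') :
    ∃ C : ℝ, ∀ m : ℕ, 1 ≤ m → ∀ f g h : ℝ → ℂ,
      MemLp f (ENNReal.ofReal p) volume → MemLp g ⊤ volume →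
      MemLp h (ENNReal.ofReal p') volume →
      (∀ j : ℕ+, ∀ p₀ ∈ Finset.Icc (2 ^ m) (2 ^ (m + 1)),
        Integrable
          (CurvedBHT.integrand γ (CurvedBHT.dualPhase D r) φ j m p₀ f g h) volume) ∧
      Summable (fun j : ℕ+ =>
        CurvedBHT.lambdaPiece γ (CurvedBHT.dualPhase D r) φ j m f g h) ∧
      ‖CurvedBHT.lambdaPlus γ (CurvedBHT.dualPhase D r) φ m f g h‖ ≤
        C * (m : ℝ) ^ (2 / p' - 1) * (eLpNorm f (ENNReal.ofReal p) volume).toReal *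
          (eLpNorm g ⊤ volume).toReal * (eLpNorm h (ENNReal.ofReal p') volume).toReal := by
  have hφ1 : ∀ x, φ x ≠ 0 → 1 / 10 ≤ |x| := fun x hx =>
    (hφsupp (subset_tsupport φ (Function.mem_support.2 hx))).1.le
  have hφ10 : ∀ x, φ x ≠ 0 → |x| ≤ 10 := fun x hx =>
    (hφsupp (subset_tsupport φ (Function.mem_support.2 hx))).2.le
  have hφc : HasCompactSupport φ := (Metric.isCompact_of_isClosed_isBounded (isClosed_tsupport φ)
    ((Metric.isBounded_Icc (-10) 10).subset fun x hx => abs_le.1 (hφsupp hx).2.le))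
  have hφne : ∀ u ∈ tsupport φ, u ≠ 0 := fun u hu h0 => by
    have := (hφsupp hu).1
    rw [h0, abs_zero] at this
    linarith
  obtain ⟨ρ, M, c, hM, hc, hphase⟩ := CurvedBHT.exists_isPhase hN hγ hγ0 hDc hD hφc hφne hφD
  obtain ⟨K, hK⟩ := hphase.exists_isAlmostOrthogonal hM hc hφ hφsupp
  obtain ⟨j₀, M', hσ, hσ1, hσM⟩ := hγ.exists_isScale_dilation (by omega) hγ0
  obtain ⟨C, hC⟩ := CurvedBHT.exists_sum_enorm_lambdaPiece_le_uniform hφ hφc hφ1 hφ10 hK hp hpp'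
    hσ hσ1 hσM
  refine ⟨C, fun m hm f g h hf hg hh => ?_⟩
  have hp0 := hpp'.pos
  have hp0' := hpp'.symm.pos
  have ef : eLpNorm f (ENNReal.ofReal p) volume = eLpNorm' f p volume := by
    rw [eLpNorm_eq_eLpNorm' (by simpa using hp0) ENNReal.ofReal_ne_top, ENNReal.toReal_ofReal hp0.le]
  have eh : eLpNorm h (ENNReal.ofReal p') volume = eLpNorm' h p' volume := by
    rw [eLpNorm_eq_eLpNorm' (by simpa using hp0') ENNReal.ofReal_ne_top,
      ENNReal.toReal_ofReal hp0'.le]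
  have hNf : eLpNorm' f p volume < ⊤ := ef ▸ hf.2
  have hNh : eLpNorm' h p' volume < ⊤ := eh ▸ hh.2
  have adm : ∀ B : ENNReal, B ≠ 0 → B ≠ ⊤ → eLpNorm g ⊤ volume ≤ B →
      CurvedBHT.IsAdmissible p p' B f g h := fun B hB0 hB hgB =>
    ⟨hf.1, lintegral_rpow_enorm_lt_top_of_eLpNorm'_lt_top hp0 hNf, hg.1, hB0, hB,
      (ae_le_eLpNormEssSup (f := g) (μ := volume)).mono fun x hx =>
        hx.trans (eLpNorm_exponent_top (f := g) (μ := volume) ▸ hgB),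
      hh.1, lintegral_rpow_enorm_lt_top_of_eLpNorm'_lt_top hp0' hNh⟩
  set X : ℕ → ℂ := fun j => CurvedBHT.lambdaPiece γ (CurvedBHT.dualPhase D r) φ j m f g h with hX
  set N : ℝ := C * (eLpNorm f (ENNReal.ofReal p) volume).toReal *
    (eLpNorm g ⊤ volume).toReal * (eLpNorm h (ENNReal.ofReal p') volume).toReal with hN'
  have hN0 : 0 ≤ N := by positivity
  -- the bound of `g` in an admissible triple is nonzero, so `g = 0` is treated separately
  have hsum : ∀ n, ∑ j ∈ Finset.range n, ‖X j‖ ≤ N := fun n => by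
    by_cases hB : eLpNorm g ⊤ volume = 0
    · have h0 : ∀ j, X j = 0 := fun j => CurvedBHT.lambdaPiece_eq_zero_of_ae_eq_zero γ
        ((eLpNorm_eq_zero_iff hg.1 ENNReal.top_ne_zero).1 hB) j m
      simpa [h0] using hN0
    have h1 := hC m _ f g h (adm _ hB hg.2.ne le_rfl) n
    have h2 : ∑ j ∈ Finset.range n, ‖X j‖ₑ = ENNReal.ofReal (∑ j ∈ Finset.range n, ‖X j‖) := by
      rw [ENNReal.ofReal_sum_of_nonneg fun j _ => norm_nonneg (X j)]
      exact Finset.sum_congr rfl fun j _ => (ofReal_norm (X j)).symm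
    have hg' := hg.2
    rw [h2, ENNReal.ofReal_le_iff_le_toReal (by finiteness)] at h1
    refine h1.trans_eq ?_
    simp only [ENNReal.toReal_mul, ENNReal.coe_toReal, hN', ef, eh]
    ring
  have hnorm : Summable fun j => ‖X j‖ := summable_of_sum_range_le (fun j => norm_nonneg _) hsum
  have hle : ∑' j : ℕ+, ‖X j‖ ≤ N := (tsum_comp_le_tsum_of_inj hnorm (fun j => norm_nonneg _)
    PNat.coe_injective).trans (Real.tsum_le_of_sum_range_le (fun j => norm_nonneg _) hsum)
  have hnorm' : Summable fun j : ℕ+ => ‖X j‖ := hnorm.comp_injective PNat.coe_injective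
  refine ⟨fun j p₀ hp₀ => (hK m).integrable_integrand hpp' (CurvedBHT.IsSmoothSymbol.isSymbol
    ⟨hφ, hφc⟩) hp₀ (adm (eLpNorm g ⊤ volume + 1) (by simp)
      (ENNReal.add_ne_top.2 ⟨hg.2.ne, ENNReal.one_ne_top⟩) le_self_add) γ j, hnorm'.of_norm, ?_⟩
  -- the power of `m` is at least one, since `p' ≤ 2`
  have hpow : 1 ≤ (m : ℝ) ^ (2 / p' - 1) := by
    refine Real.one_le_rpow (by exact_mod_cast hm) ?_
    have h1 : p⁻¹ ≤ 2⁻¹ := inv_anti₀ two_pos hp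
    have h2 := hpp'.inv_add_inv_eq_one
    rw [div_eq_mul_inv]
    linarith
  refine (norm_tsum_le_tsum_norm hnorm').trans (hle.trans ?_)
  calc N ≤ (m : ℝ) ^ (2 / p' - 1) * N := le_mul_of_one_le_left hN0 hpow
    _ = _ := by rw [hN']; ring
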